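/- **Setting.** Let $m,\mu>0$ be constants and $a(r)=1-2\mu/r$. On $r>2\mu$, $0<\theta<\pi$ consider, in the coordinates $y=(y^0,\dots,y^3)=(t,r,\theta,\varphi)$, the Schwarzschild metric $g=\mathrm{diag}(-a,\,a^{-1},\,r^2,\,r^2\sin^2\theta)$ with Christoffel symbols $\Gamma^\alpha_{\mu\nu}$ and curvature $R^\mu{}_{\nu\alpha\beta}$ given by $[\nabla_\alpha,\nabla_\beta]A^\mu=R^\mu{}_{\nu\alpha\beta}A^\nu$, the orthonormal tetrad $e_0=a^{-1/2}\partial_t$, $e_1=a^{1/2}\partial_r$, $e_2=r^{-1}\partial_\theta$, $e_3=(r\sin\theta)^{-1}\partial_\varphi$, and $\omega_{\alpha AB}=g_{\mu\nu}e_A{}^\mu\nabla_\alpha e_B{}^\nu$. The phase space has the coordinates $\vec L,\vec M\in\mathbb R^3$, $P_\alpha$, $y^\alpha$ ($\alpha=0,\dots,3$) and the bracket whose nonzero values are $$\{L_i,L_j\}=\hat L_{ij},\quad \{L_i,M_j\}=\hat M_{ij},\quad \{M_i,M_j\}=-\hat L_{ij},\quad \{y^\alpha,P_\beta\}=\delta^\alpha_\beta,\qquad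 \hat v=\begin{pmatrix}0&v_3&-v_2\\-v_3&0&v_1\\v_2&-v_1&0\end{pmatrix}.$$ Let $S^{AB}$ be the skew matrix with $S^{0i}=M_i$, $S^{ij}=\hat L_{ij}$, and put $S^{\alpha\beta}=S^{AB}e_A{}^\alpha e_B{}^\beta$, $p_\alpha=P_\alpha+\frac12\omega_{\alpha AB}S^{AB}$, $f^\alpha=S^{\alpha\beta}p_\beta$, $\mathcal D^\alpha{}_\beta=S^{\alpha\gamma}R_{\gamma\beta\mu\nu}S^{\mu\nu}$, $d=-\frac12R_{\alpha\beta\mu\nu}S^{\alpha\beta}S^{\mu\nu}$, $C_\star=(\vec L,\vec M)$, $C_\circ=(\vec L,\vec L)-(\vec M,\vec M)$, $\rho=\sqrt{L_2^2+L_3^2}$, and $$H=\frac{p_\alpha p^\alpha}{2m}-\frac{\mathcal D^{\alpha\beta}p_\alpha p_\beta}{m(d+2p_\alpha p^\alpha)}\qquad\text{where } d+2p_\alpha p^\alpha\neq0 .$$ **A (the full system).** The bracket is a Poisson bracket with Casimir functions $C_\star,C_\circ$ and has rank $12$ where $C_\circ>0$ (six degrees of freedom). $H$ is smooth, and the Hamiltonian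 equations are $\dot{\vec L}=\partial_{\vec L}H\times\vec L+\partial_{\vec M}H\times\vec M$, $\dot{\vec M}=\partial_{\vec L}H\times\vec M-\partial_{\vec M}H\times\vec L$, $\dot P_\alpha=-\partial_{y^\alpha}H$, $\dot y^\alpha=\partial_{P_\alpha}H$. The functions $S^{\alpha\beta},p_\alpha,y^\alpha$ satisfy the Souriau–Künzle relations, with all other brackets zero: $$\{S^{\alpha\beta},S^{\mu\nu}\}=g^{\alpha\mu}S^{\beta\nu}-g^{\alpha\nu}S^{\beta\mu}+g^{\beta\nu}S^{\alpha\mu}-g^{\beta\mu}S^{\alpha\nu},\quad \{S^{\alpha\beta},p_\mu\}=-\Gamma^\alpha_{\lambda\mu}S^{\lambda\beta}-\Gamma^\beta_{\lambda\mu}S^{\alpha\lambda},$$ $$\{y^\alpha,p_\beta\}=\delta^\alpha_\beta,\qquad \{p_\alpha,p_\beta\}=-\tfrac12R_{\alpha\beta\mu\nu}S^{\mu\nu}.$$ At points with $f=0$ the trajectories satisfy, with $u^\alpha=\dot y^\alpha$, the Mathisson–Papapetrou equations $\frac{Dp^\alpha}{d\tau}=-\frac12R^\alpha{}_{\lambda\mu\nu}u^\lambda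 S^{\mu\nu}$, $\frac{DS^{\alpha\beta}}{d\tau}=p^\alpha u^\beta-u^\alpha p^\beta$, and $-p_\alpha u^\alpha=-p_\alpha p^\alpha/m$. If $f=0$ and $p_\alpha p^\alpha<0$ at one time, then $f=0$ at all times and $p_\alpha p^\alpha$ is constant. **B (first integrals).** The system has the four first integrals $\mathcal E=-P_t$ and $\vec Q=(Q_1,Q_2,P_\varphi)$, $$Q_1=\frac{\cos\varphi}{\sin\theta}(L_1-P_\varphi\cos\theta)-P_\theta\sin\varphi,\qquad Q_2=\frac{\sin\varphi}{\sin\theta}(L_1-P_\varphi\cos\theta)+P_\theta\cos\varphi ;$$ their differentials are linearly independent everywhere, $\{\mathcal E,Q_i\}=0$ and $\{Q_i,Q_j\}=\hat Q_{ij}$ (the algebra $so(3)$). **C (reduction by three degrees of freedom, $\vec Q\ne0$).** Where $\rho>0$ let $$X=\frac{L_1\cos\theta-P_\varphi}{\sin\theta},\quad \vec E=\Big(L_1,\frac{L_3P_\theta+L_2X}{\rho},\frac{-L_2P_\theta+L_3X}{\rho}\Big),\quad \vec Z=\Big(-\frac{M_1|\vec L|}{\rho},\,|\vec L|,\,\frac{M_2L_3-M_3L_2}{\rho}\Big).$$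 The eight functions $(\vec E,\vec Z,r,P_r)$ are smooth and in involution with $\mathcal E,Q_1,Q_2,Q_3$. On $C_\star=0$ they close under the bracket of $so(3)\oplus so(2,1)\oplus$ canonical pair, $$\{E_1,E_2\}=E_3,\ \{E_1,E_3\}=-E_2,\ \{E_2,E_3\}=E_1,\quad \{Z_1,Z_2\}=Z_3,\ \{Z_1,Z_3\}=Z_2,\ \{Z_2,Z_3\}=Z_1,\quad \{r,P_r\}=1,$$ all other brackets being zero; they fill the set $r>2\mu$, $|E_1|<Z_2$ (for each value of $\mathcal E$). This is a Poisson bracket, of rank $6$ where $\vec E\neq0$, $\vec Z\ne0$ (three degrees of freedom), with the Casimir functions $-Z_1^2+Z_2^2-Z_3^2$ and $F=E_1^2+E_2^2+E_3^2$, which on $C_\star=0$ equal $C_\circ$ and $(\vec Q,\vec Q)$. Put $W=\sqrt{Z_2^2-E_1^2}$, $\Gamma=\sqrt{a(r)(Z_2^2-E_1^2)}-E_2$, $\Theta=\frac{Z_1}{Z_2}W$, $$\mathsf m^2=-aP_r^2+\frac{(\mu\Theta-\mathcal Er^2)^2}{r^3(r-2\mu)}-\frac{E_3^2+\Gamma^2}{r^2},\qquad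 V=\frac{\mathsf m^2}{\mu}r^3-2Z_1^2-Z_2^2+Z_3^2+3E_1^2\Big(1+\frac{Z_1^2}{Z_2^2}\Big).$$ On $C_\star=0$, $\rho>0$ one has $-p_\alpha p^\alpha=\mathsf m^2$, $d+2p_\alpha p^\alpha=-2\mu r^{-3}V$, and where $V\ne0$ the Hamiltonian equals the function $$\begin{aligned} \mathsf H_{\mathcal E}={}&\frac am\Big[\frac12+\frac{2\Theta^2+Z_2^2-E_1^2}{V}\Big]P_r^2+\frac{\Gamma+E_2}{mrV}\Big[E_1E_3\Big(\frac{Z_1^2}{Z_2^2}-1\Big)-Z_3E_2\frac{Z_1}{Z_2}\Big]P_r+\frac{Z_2^2-E_1^2}{mr^3V}\big[r\Gamma^2+\mu Z_1^2\big]\\ &-\frac{(\mu\Theta-r^2\mathcal E)^2}{mr^3(r-2\mu)}\Big[\frac12-\frac{Z_1^2+Z_3^2-3\Theta^2}{V}\Big]+\frac{W}{mrV}\big[Z_3(\Theta-2r\mathcal E)P_r-Z_1Z_2\mathcal E\big]+\frac{E_3^2+\Gamma^2}{mr^2}\Big[\frac12-\frac{2E_1^2}{V}\Big]\\ &-\frac{\mu\Theta-r^2\mathcal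 E}{mr^2V\sqrt{r(r-2\mu)}}\big[E_1E_3Z_3+Z_1Z_2E_2\big]-\frac1{mr^2V}\Big[\frac{Z_1}{Z_2}E_1E_3+Z_3\Gamma\Big]^2 \end{aligned}$$ of the reduced variables, which is smooth where $V\neq 0$. Every trajectory of the full system on an open interval on which $\rho>0$, with $C_\star=0$ and $\vec Q\neq0$, projects to a solution of $$\dot{\vec E}=\frac{\partial\mathsf H_{\mathcal E}}{\partial\vec E}\times\vec E,\quad \dot{\vec Z}=\frac{\partial\mathsf H_{\mathcal E}}{\partial\vec Z}\times(\mathbf J\vec Z),\quad \dot P_r=-\frac{\partial\mathsf H_{\mathcal E}}{\partial r},\quad \dot r=\frac{\partial\mathsf H_{\mathcal E}}{\partial P_r},\qquad \mathbf J=\mathrm{diag}(1,-1,1),\tag{$*$}$$ on the leaf $-Z_1^2+Z_2^2-Z_3^2=C_\circ$, $F=(\vec Q,\vec Q)$, and $\dot t=-\partial\mathsf H_{\mathcal E}/\partial\mathcal E$. Conversely, let $P_\varphi\neq0$ be a constant and let $(\vec E,\vec Z,r,P_r)$ be a solution of $(*)$ on an open interval with $r>2\mu$, $|E_1|<Z_2$,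 $V\ne0$, $F=P_\varphi^2$, $E_2^2+E_3^2>0$; if $t$ and $\varphi$ satisfy $\dot t=-\partial\mathsf H_{\mathcal E}/\partial\mathcal E$ and $\dot\varphi=\frac{P_\varphi}{E_2^2+E_3^2}\big(E_2\frac{\partial\mathsf H_{\mathcal E}}{\partial E_2}+E_3\frac{\partial\mathsf H_{\mathcal E}}{\partial E_3}\big)$, then there is a trajectory of the full system with these reduced variables and these $t,\varphi$, with $\cos\theta=E_1/P_\varphi$, $P_\theta=0$, $C_\star=0$, energy $\mathcal E$ and $\vec Q=(0,0,P_\varphi)$. On $C_\star=0$, $\rho>0$ the components $f^t$, $f^r$ and $f^N=(L_2\,r\sin\theta\, f^\varphi-L_3\,rf^\theta)/\rho$ of the Tulczyjew vector are $$f^t=-\Theta P_r-\frac{WZ_3}{r}+\frac{E_2Z_2Z_3-E_1Z_1E_3}{Z_2\sqrt{r(r-2\mu)}},\qquad f^r=-\mathcal E\Theta+\frac{\mu\Theta^2}{r^2}-\frac{(\Gamma+E_2)\Gamma}{r},$$ $$f^N=\frac{Z_3}{\sqrt{a}}\Big(\frac{\mu\Theta}{r^2}-\mathcal E\Big)+\sqrt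 a\,WP_r+\frac{E_1E_3}{r},$$ and $f=0$ if and only if $f^t=f^r=f^N=0$. Where $Z_1\ne0$ the equation $f^N=0$ follows from $f^t=f^r=0$. The set $\{f^t=f^r=f^N=0\}$ is invariant under $(*)$ and $\mathsf m^2$ is constant on its trajectories (for solutions with $r>2\mu$, $|E_1|<Z_2$, $V\ne0$ which lie on it with $\mathsf m^2>0$ at one time). **D (reduction by four degrees of freedom, $\vec Q=0$).** $\vec Q=0$ is equivalent to $P_\theta=L_1=P_\varphi=0$. If $\vec Q=0$, $C_\star=0$, $C_\circ>0$, then $\rho>0$, $\vec E=0$, the functions $(\vec Z,r,P_r)$ are in involution with $\mathcal E$ and $\vec Q$ and have among themselves the brackets given in C. These define a Poisson bracket on the space of $(\vec Z,r,P_r)$, which has the Casimir function $C_\circ=-Z_1^2+Z_2^2-Z_3^2$ and rank $4$ where $\vec Z\ne0$ (two degrees of freedom). All values with $r>2\mu$, $Z_2>0$, $C_\circ>0$ occur. The Hamiltonian equals $\mathsf H_{\mathcal E}|_{\vec E=0}$, and every trajectory of the full system with $\vec Q=0$, $C_\star=0$, $C_\circ>0$ projects to a solution of the last three equations of $(*)$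 with this Hamiltonian, with $\dot t=-\partial \mathsf H_{\mathcal E}|_{\vec E=0}/\partial\mathcal E$. Conversely, each solution of these equations with $r>2\mu$, $Z_2>0$, $V\ne0$, $C_\circ>0$ comes from a trajectory of the full system with $\vec Q=0$, $C_\star=0$, energy $\mathcal E$ and $\theta=\pi/2$, for any $t$ and $\varphi$ with $\dot t=-\partial \mathsf H_{\mathcal E}|_{\vec E=0}/\partial\mathcal E$ and $\dot\varphi=\partial\mathsf H_{\mathcal E}/\partial E_2|_{\vec E=0}$. Here $f=0$ if and only if $$Z_1P_r+\frac{Z_2Z_3}{r}=0,\qquad -\mathcal EZ_1+\frac{\mu Z_1^2}{r^2}-\frac{a(r)}{r}Z_2^2=0,$$ and this set is invariant under the reduced system (for solutions with $r>2\mu$, $Z_2>0$, $V\ne0$ which lie on it with $\mathsf m^2>0$ at one time). -/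

import Mathlib

noncomputable section

namespace SpinningBody

open Matrix
open scoped ContDiff

/-! ## Poisson tensors and Hamiltonian systems in coordinates -/

section Poisson

variable {ι : Type} [Fintype ι] [DecidableEq ι]

/-- The partial derivative of `F` with respect to the coordinate `i`. -/
def pd (F : (ι → ℝ) → ℝ) (i : ι) (x : ι → ℝ) : ℝ :=
  fderiv ℝ F x (Pi.single i 1)

/-- The Poisson bracket `{F, G} = π^{ij} ∂_i F ∂_j G`. -/
def bracket (π : (ι → ℝ) → Matrix ι ι ℝ) (F G : (ι → ℝ) → ℝ) (x : ι → ℝ) : ℝ :=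
  ∑ i, ∑ j, π x i j * pd F i x * pd G j x

/-- The tensor `π` is skew-symmetric and satisfies the Jacobi identity. -/
def IsPoissonTensor (π : (ι → ℝ) → Matrix ι ι ℝ) : Prop :=
  (∀ i j, ContDiff ℝ ∞ fun x => π x i j) ∧
  (∀ x i j, π x i j = -π x j i) ∧
  ∀ x i j k, ∑ l, (π x i l * pd (fun z => π z j k) l x
    + π x j l * pd (fun z => π z k i) l x + π x k l * pd (fun z => π z i j) l x) = 0

/-- `C` is a Casimir function: it is smooth and in involution with every coordinate. -/
def IsCasimir (π : (ι → ℝ) → Matrix ι ι ℝ) (C : (ι → ℝ) → ℝ) : Prop :=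
  ContDiff ℝ ∞ C ∧ ∀ x j, ∑ i, pd C i x * π x i j = 0

/-- The Hamiltonian vector field `ẋ^i = {x^i, H} = π^{ij} ∂_j H`. -/
def hamField (π : (ι → ℝ) → Matrix ι ι ℝ) (H : (ι → ℝ) → ℝ) (x : ι → ℝ) : ι → ℝ :=
  fun i => ∑ j, π x i j * pd H j x

/-- `γ` is a solution, on the set of times `I`, of the Hamiltonian system given by `π` and `H`. -/
def IsTrajectory (π : (ι → ℝ) → Matrix ι ι ℝ) (H : (ι → ℝ) → ℝ) (I : Set ℝ)
    (γ : ℝ → ι → ℝ) : Prop :=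
  ∀ τ ∈ I, HasDerivAt γ (hamField π H (γ τ)) τ

/-- The set `I` is an open interval (possibly unbounded). -/
def IsOpenInterval (I : Set ℝ) : Prop := IsOpen I ∧ I.OrdConnected

end Poisson

/-! ## Levi-Civita connection and curvature in a chart -/

section Geometry

/-- Christoffel symbols `Γ^α_{βν}` of the metric `g`. -/
def christoffel (g : (Fin 4 → ℝ) → Matrix (Fin 4) (Fin 4) ℝ) (α β ν : Fin 4)
    (y : Fin 4 → ℝ) : ℝ :=
  (1 / 2) * ∑ l, (g y)⁻¹ α l *
    (pd (fun z => g z l ν) β y + pd (fun z => g z l β) ν y - pd (fun z => g z β ν) l y)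

/-- The curvature tensor `R^κ_{ναβ}`, with `[∇_α, ∇_β] A^κ = R^κ_{ναβ} A^ν`. -/
def riemann (g : (Fin 4 → ℝ) → Matrix (Fin 4) (Fin 4) ℝ) (κ ν α β : Fin 4)
    (y : Fin 4 → ℝ) : ℝ :=
  pd (christoffel g κ β ν) α y - pd (christoffel g κ α ν) β y
    + ∑ l, (christoffel g κ α l y * christoffel g l β ν y
      - christoffel g κ β l y * christoffel g l α ν y)

/-- The curvature tensor with all indices lowered, `R_{κναβ}`. -/
def riemannDown (g : (Fin 4 → ℝ) → Matrix (Fin 4) (Fin 4) ℝ) (κ ν α β : Fin 4)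
    (y : Fin 4 → ℝ) : ℝ :=
  ∑ l, g y κ l * riemann g l ν α β y

/-- Ricci rotation coefficients `ω_{αAB} = g_{κν} e_A^κ ∇_α e_B^ν` of the tetrad `e`, where
`e y A κ` is the component `e_A^κ` at `y`. -/
def rotationCoeff (g e : (Fin 4 → ℝ) → Matrix (Fin 4) (Fin 4) ℝ) (α A B : Fin 4)
    (y : Fin 4 → ℝ) : ℝ :=
  ∑ κ, ∑ ν, g y κ ν * e y A κ *
    (pd (fun z => e z B ν) α y + ∑ l, christoffel g ν α l y * e y B l)

/-- The function `a(r) = 1 - 2μ/r`. -/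
def lapse (μ r : ℝ) : ℝ := 1 - 2 * μ / r

/-- The Schwarzschild metric in the coordinates `y = (t, r, θ, φ)`. -/
def schw (μ : ℝ) (y : Fin 4 → ℝ) : Matrix (Fin 4) (Fin 4) ℝ :=
  diagonal ![-lapse μ (y 1), 1 / lapse μ (y 1), y 1 ^ 2, y 1 ^ 2 * Real.sin (y 2) ^ 2]

/-- The orthonormal tetrad obtained by normalizing the coordinate basis. -/
def tetrad (μ : ℝ) (y : Fin 4 → ℝ) : Matrix (Fin 4) (Fin 4) ℝ :=
  diagonal ![1 / √(lapse μ (y 1)), √(lapse μ (y 1)), 1 / y 1, 1 / (y 1 * Real.sin (y 2))]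

end Geometry

/-! ## The full system -/

section Full

/-- Labels of the fourteen coordinates `L_i`, `M_i`, `P_α`, `y^α`. -/
abbrev FullIdx : Type := (Fin 3 ⊕ Fin 3) ⊕ (Fin 4 ⊕ Fin 4)

/-- The phase space of the full system. -/
abbrev Full : Type := FullIdx → ℝ

def vecL (x : Full) : Fin 3 → ℝ := fun i => x (.inl (.inl i))
def vecM (x : Full) : Fin 3 → ℝ := fun i => x (.inl (.inr i))
def vecP (x : Full) : Fin 4 → ℝ := fun α => x (.inr (.inl α))
def pos (x : Full) : Fin 4 → ℝ := fun α => x (.inr (.inr α))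

/-- The skew-symmetric matrix `v̂`. -/
def hat (v : Fin 3 → ℝ) : Matrix (Fin 3) (Fin 3) ℝ :=
  !![0, v 2, -v 1; -v 2, 0, v 0; v 1, -v 0, 0]

/-- The bracket `{L_i, L_j} = L̂_{ij}`, `{L_i, M_j} = M̂_{ij}`, `{M_i, M_j} = -L̂_{ij}`,
`{y^α, P_β} = δ^α_β`. -/
def fullTensor (x : Full) : Matrix FullIdx FullIdx ℝ :=
  fromBlocks (fromBlocks (hat (vecL x)) (hat (vecM x)) (hat (vecM x)) (-hat (vecL x))) 0 0
    (fromBlocks 0 (-1) 1 0)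

/-- The right-hand side of the equations of motion in vector form. -/
def fullEqs (H : Full → ℝ) (x : Full) : Full :=
  let HL : Fin 3 → ℝ := fun i => pd H (.inl (.inl i)) x
  let HM : Fin 3 → ℝ := fun i => pd H (.inl (.inr i)) x
  Sum.elim
    (Sum.elim (crossProduct HL (vecL x) + crossProduct HM (vecM x))
      (crossProduct HL (vecM x) - crossProduct HM (vecL x)))
    (Sum.elim (fun α => -pd H (.inr (.inr α)) x) (fun α => pd H (.inr (.inl α)) x))

/-- The Casimir function `C⋆ = (L, M)`. -/
def casStar (x : Full) : ℝ := ∑ i, vecL x i * vecM x i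

/-- The Casimir function `C∘ = (L, L) - (M, M)`. -/
def casCirc (x : Full) : ℝ := ∑ i, vecL x i ^ 2 - ∑ i, vecM x i ^ 2

/-- The tetrad components `S^{AB}` of the spin tensor. -/
def spinFrame (x : Full) : Matrix (Fin 4) (Fin 4) ℝ :=
  !![0, vecM x 0, vecM x 1, vecM x 2;
    -vecM x 0, 0, vecL x 2, -vecL x 1;
    -vecM x 1, -vecL x 2, 0, vecL x 0;
    -vecM x 2, vecL x 1, -vecL x 0, 0]

/-- The spin tensor `S^{αβ} = S^{AB} e_A^α e_B^β`. -/
def spin (μ : ℝ) (α β : Fin 4) (x : Full) : ℝ :=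
  ∑ A, ∑ B, spinFrame x A B * tetrad μ (pos x) A α * tetrad μ (pos x) B β

/-- The linear momentum `p_α = P_α + ½ ω_{αAB} S^{AB}`. -/
def mom (μ : ℝ) (α : Fin 4) (x : Full) : ℝ :=
  vecP x α + (1 / 2) * ∑ A, ∑ B, rotationCoeff (schw μ) (tetrad μ) α A B (pos x) * spinFrame x A B

/-- The linear momentum with upper index, `p^α`. -/
def momUp (μ : ℝ) (α : Fin 4) (x : Full) : ℝ :=
  ∑ β, (schw μ (pos x))⁻¹ α β * mom μ β x

/-- The square `p_α p^α`. -/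
def momSq (μ : ℝ) (x : Full) : ℝ := ∑ α, mom μ α x * momUp μ α x

/-- The Tulczyjew vector `f^α = S^{αβ} p_β`. -/
def tulczyjew (μ : ℝ) (α : Fin 4) (x : Full) : ℝ := ∑ β, spin μ α β x * mom μ β x

/-- The matrix `𝒟^α_β = S^{αγ} R_{γβκν} S^{κν}`. -/
def curvSpin (μ : ℝ) (α β : Fin 4) (x : Full) : ℝ :=
  ∑ c, ∑ κ, ∑ ν, spin μ α c x * riemannDown (schw μ) c β κ ν (pos x) * spin μ κ ν x

/-- The scalar `d = -½ R_{αβκν} S^{αβ} S^{κν}`. -/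
def curvScalar (μ : ℝ) (x : Full) : ℝ :=
  -(1 / 2) * ∑ α, ∑ β, ∑ κ, ∑ ν,
    riemannDown (schw μ) α β κ ν (pos x) * spin μ α β x * spin μ κ ν x

/-- The Hamiltonian `H = p²/(2m) - 𝒟^{αβ} p_α p_β / (m (d + 2 p²))`; here `m` is a constant. -/
def ham (m μ : ℝ) (x : Full) : ℝ :=
  momSq μ x / (2 * m)
    - (∑ α, ∑ β, curvSpin μ α β x * mom μ α x * momUp μ β x)
      / (m * (curvScalar μ x + 2 * momSq μ x))

/-- The part of the phase space outside the event horizon, in the domain of the spherical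
coordinates. -/
def exterior (μ : ℝ) : Set Full :=
  {x | 2 * μ < pos x 1 ∧ 0 < pos x 2 ∧ pos x 2 < Real.pi}

/-- The part of the exterior on which the Hamiltonian has no singularity. -/
def regular (μ : ℝ) : Set Full :=
  {x | x ∈ exterior μ ∧ curvScalar μ x + 2 * momSq μ x ≠ 0}

/-- The energy `ℰ = -P_t`. -/
def energy (x : Full) : ℝ := -vecP x 0

/-- The vector of integrals `Q = (Q₁, Q₂, P_φ)`. -/
def vecQ (x : Full) : Fin 3 → ℝ :=
  let θ := pos x 2
  let φ := pos x 3
  ![Real.cos φ / Real.sin θ * (vecL x 0 - vecP x 3 * Real.cos θ) - vecP x 2 * Real.sin φ,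
    Real.sin φ / Real.sin θ * (vecL x 0 - vecP x 3 * Real.cos θ) + vecP x 2 * Real.cos φ,
    vecP x 3]

/-- `√(L₂² + L₃²)`. -/
def perpL (x : Full) : ℝ := √(vecL x 1 ^ 2 + vecL x 2 ^ 2)

end Full

/-! ## The reduced system for `Q ≠ 0` -/

section Reduced

/-- Labels of the eight coordinates `E_i`, `Z_i`, `r`, `P_r`. -/
abbrev RedIdx : Type := (Fin 3 ⊕ Fin 3) ⊕ Fin 2

/-- The space of the reduced variables `(E, Z, r, P_r)`. -/
abbrev Red : Type := RedIdx → ℝ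

def vecE (z : Red) : Fin 3 → ℝ := fun i => z (.inl (.inl i))
def vecZ (z : Red) : Fin 3 → ℝ := fun i => z (.inl (.inr i))
def radius (z : Red) : ℝ := z (.inr 0)
def radMom (z : Red) : ℝ := z (.inr 1)

/-- The reduced variables `(E, Z, r, P_r)` as functions on the full phase space. -/
def redMap (x : Full) : Red :=
  let X := (vecL x 0 * Real.cos (pos x 2) - vecP x 3) / Real.sin (pos x 2)
  Sum.elim
    (Sum.elim
      ![vecL x 0,
        vecL x 2 * vecP x 2 / perpL x + vecL x 1 * X / perpL x,
        -(vecL x 1 * vecP x 2) / perpL x + vecL x 2 * X / perpL x]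
      ![-(vecM x 0 * √(∑ i, vecL x i ^ 2)) / perpL x,
        √(∑ i, vecL x i ^ 2),
        (vecM x 1 * vecL x 2 - vecM x 2 * vecL x 1) / perpL x])
    ![pos x 1, vecP x 1]

/-- The matrix of the `so(2,1)` bracket `{Z₁, Z₂} = Z₃`, `{Z₁, Z₃} = Z₂`, `{Z₂, Z₃} = Z₁`. -/
def hatJ (v : Fin 3 → ℝ) : Matrix (Fin 3) (Fin 3) ℝ :=
  !![0, v 2, v 1; -v 2, 0, v 0; -v 1, -v 0, 0]

/-- The bracket of `so(3) ⊕ so(2,1)` and the canonical pair `{r, P_r} = 1`. -/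
def redTensor (z : Red) : Matrix RedIdx RedIdx ℝ :=
  fromBlocks (fromBlocks (hat (vecE z)) 0 0 (hatJ (vecZ z))) 0 0 !![0, 1; -1, 0]

/-- The diagonal matrix `J = diag(1, -1, 1)` applied to a vector. -/
def applyJ (v : Fin 3 → ℝ) : Fin 3 → ℝ := ![v 0, -v 1, v 2]

/-- The right-hand side of the reduced equations in vector form. -/
def redEqs (H : Red → ℝ) (z : Red) : Red :=
  Sum.elim
    (Sum.elim (crossProduct (fun i => pd H (.inl (.inl i)) z) (vecE z))
      (crossProduct (fun i => pd H (.inl (.inr i)) z) (applyJ (vecZ z))))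
    ![pd H (.inr 1) z, -pd H (.inr 0) z]

/-- The Casimir function `C∘ = -Z₁² + Z₂² - Z₃²`. -/
def redCirc (z : Red) : ℝ := -vecZ z 0 ^ 2 + vecZ z 1 ^ 2 - vecZ z 2 ^ 2

/-- The Casimir function `F = E₁² + E₂² + E₃²`. -/
def redF (z : Red) : ℝ := vecE z 0 ^ 2 + vecE z 1 ^ 2 + vecE z 2 ^ 2

/-- `√(Z₂² - E₁²)`. -/
def redW (z : Red) : ℝ := √(vecZ z 1 ^ 2 - vecE z 0 ^ 2)

/-- `Γ = √(a(r) (Z₂² - E₁²)) - E₂`. -/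
def redGamma (μ : ℝ) (z : Red) : ℝ :=
  √(lapse μ (radius z) * (vecZ z 1 ^ 2 - vecE z 0 ^ 2)) - vecE z 1

/-- `Θ = (Z₁ / Z₂) √(Z₂² - E₁²)`. -/
def redTheta (z : Red) : ℝ := vecZ z 0 / vecZ z 1 * redW z

/-- The function which expresses the squared mass `-p_α p^α` in the reduced variables. -/
def redMassSq (μ ℰ : ℝ) (z : Red) : ℝ :=
  -lapse μ (radius z) * radMom z ^ 2
    + (μ * redTheta z - ℰ * radius z ^ 2) ^ 2 / (radius z ^ 3 * (radius z - 2 * μ))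
    - (vecE z 2 ^ 2 + redGamma μ z ^ 2) / radius z ^ 2

/-- The function `V`, with the squared mass replaced by its expression `redMassSq`. -/
def redV (μ ℰ : ℝ) (z : Red) : ℝ :=
  redMassSq μ ℰ z / μ * radius z ^ 3 - 2 * vecZ z 0 ^ 2 - vecZ z 1 ^ 2 + vecZ z 2 ^ 2
    + 3 * vecE z 0 ^ 2 * (1 + vecZ z 0 ^ 2 / vecZ z 1 ^ 2)

/-- The reduced Hamiltonian; `m` and `ℰ` are constants. -/
def redHam (m μ ℰ : ℝ) (z : Red) : ℝ :=
  let r := radius z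
  let Pr := radMom z
  let a := lapse μ r
  let E1 := vecE z 0
  let E2 := vecE z 1
  let E3 := vecE z 2
  let Z1 := vecZ z 0
  let Z2 := vecZ z 1
  let Z3 := vecZ z 2
  let Θ := redTheta z
  let Γ := redGamma μ z
  let V := redV μ ℰ z
  a / m * (1 / 2 + (2 * Θ ^ 2 + Z2 ^ 2 - E1 ^ 2) / V) * Pr ^ 2
  + (Γ + E2) / (m * r * V) * (E1 * E3 * (Z1 ^ 2 / Z2 ^ 2 - 1) - Z3 * E2 * (Z1 / Z2)) * Pr
  + (Z2 ^ 2 - E1 ^ 2) / (m * r ^ 3 * V) * (r * Γ ^ 2 + μ * Z1 ^ 2)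
  - (μ * Θ - r ^ 2 * ℰ) ^ 2 / (m * r ^ 3 * (r - 2 * μ))
      * (1 / 2 - (Z1 ^ 2 + Z3 ^ 2 - 3 * Θ ^ 2) / V)
  + √(Z2 ^ 2 - E1 ^ 2) / (m * r * V) * (Z3 * (Θ - 2 * r * ℰ) * Pr - Z1 * Z2 * ℰ)
  + (E3 ^ 2 + Γ ^ 2) / (m * r ^ 2) * (1 / 2 - 2 * E1 ^ 2 / V)
  - (μ * Θ - r ^ 2 * ℰ) / (m * r ^ 2 * V * √(r * (r - 2 * μ))) * (E1 * E3 * Z3 + Z1 * Z2 * E2)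
  - 1 / (m * r ^ 2 * V) * (Z1 / Z2 * E1 * E3 + Z3 * Γ) ^ 2

/-- The range of the reduced variables: outside the horizon and `|E₁| < Z₂`. -/
def redDomain (μ : ℝ) : Set Red :=
  {z | 2 * μ < radius z ∧ |vecE z 0| < vecZ z 1}

/-- The component `f^t` of the Tulczyjew vector in the reduced variables. -/
def redTulT (μ : ℝ) (z : Red) : ℝ :=
  -redTheta z * radMom z - redW z * (vecZ z 2 / radius z)
    + (vecE z 1 * vecZ z 1 * vecZ z 2 - vecE z 0 * vecZ z 0 * vecE z 2)
      / (vecZ z 1 * √(radius z * (radius z - 2 * μ)))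

/-- The component `f^r` of the Tulczyjew vector in the reduced variables. -/
def redTulR (μ ℰ : ℝ) (z : Red) : ℝ :=
  -ℰ * redTheta z + μ * redTheta z ^ 2 / radius z ^ 2
    - (redGamma μ z + vecE z 1) * redGamma μ z / radius z

/-- The component of the Tulczyjew vector along the unit vector orthogonal to `(L₂, L₃)` in the
plane of the last two vectors of the tetrad, in the reduced variables. -/
def redTulN (μ ℰ : ℝ) (z : Red) : ℝ :=
  vecZ z 2 * (μ * redTheta z / radius z ^ 2 - ℰ) / √(lapse μ (radius z))
    + redW z * √(lapse μ (radius z)) * radMom z + vecE z 0 * vecE z 2 / radius z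

/-- The Tulczyjew manifold in the space of the reduced variables. -/
def redTulczyjew (μ ℰ : ℝ) : Set Red :=
  {z | redTulT μ z = 0 ∧ redTulR μ ℰ z = 0 ∧ redTulN μ ℰ z = 0}

end Reduced

/-! ## The reduced system for `Q = 0` -/

section ReducedZero

/-- Labels of the five coordinates `Z_i`, `r`, `P_r`. -/
abbrev RedIdx₀ : Type := Fin 3 ⊕ Fin 2

/-- The space of the reduced variables `(Z, r, P_r)`. -/
abbrev Red₀ : Type := RedIdx₀ → ℝ

/-- The inclusion of the reduced space for `Q = 0` as the subspace `E = 0`. -/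
def incl₀ (w : Red₀) : Red :=
  Sum.elim (Sum.elim 0 fun i => w (.inl i)) fun i => w (.inr i)

/-- The reduced variables `(Z, r, P_r)` as functions on the full phase space. -/
def redMap₀ (x : Full) : Red₀ :=
  Sum.elim (fun i => redMap x (.inl (.inr i))) fun i => redMap x (.inr i)

/-- The bracket of `so(2,1)` and the canonical pair `{r, P_r} = 1`. -/
def redTensor₀ (w : Red₀) : Matrix RedIdx₀ RedIdx₀ ℝ :=
  fromBlocks (hatJ fun i => w (.inl i)) 0 0 !![0, 1; -1, 0]

/-- The reduced Hamiltonian for `Q = 0`, which is the reduced Hamiltonian at `E = 0`. -/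
def redHam₀ (m μ ℰ : ℝ) (w : Red₀) : ℝ := redHam m μ ℰ (incl₀ w)

/-- The right-hand side of the reduced equations for `Q = 0` in vector form. -/
def redEqs₀ (H : Red₀ → ℝ) (w : Red₀) : Red₀ :=
  Sum.elim (crossProduct (fun i => pd H (.inl i) w) (applyJ fun i => w (.inl i)))
    ![pd H (.inr 1) w, -pd H (.inr 0) w]

/-- The Casimir function `C∘ = -Z₁² + Z₂² - Z₃²`. -/
def redCirc₀ (w : Red₀) : ℝ := redCirc (incl₀ w)

/-- The range of the reduced variables for `Q = 0`. -/
def redDomain₀ (μ : ℝ) : Set Red₀ := {w | 2 * μ < w (.inr 0) ∧ 0 < w (.inl 1)}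

/-- The Tulczyjew manifold in the space of the reduced variables for `Q = 0`. -/
def redTulczyjew₀ (μ ℰ : ℝ) : Set Red₀ :=
  {w | w (.inl 0) * w (.inr 1) + w (.inl 1) * w (.inl 2) / w (.inr 0) = 0 ∧
    -ℰ * w (.inl 0) + μ * w (.inl 0) ^ 2 / w (.inr 0) ^ 2
      - lapse μ (w (.inr 0)) / w (.inr 0) * w (.inl 1) ^ 2 = 0}

end ReducedZero

end SpinningBody

end

open SpinningBody
open scoped ContDiff

open SpinningBody
open scoped ContDiff

namespace SpinningBody

open Matrix Filter Topology

set_option linter.unusedSectionVars false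
set_option linter.unusedSimpArgs false
set_option linter.unreachableTactic false
set_option linter.unusedTactic false

noncomputable section

/-! ### Differentials as plain functions, brackets, linear differential equations -/

section Linearization

variable {ι κ : Type} [Fintype ι] [DecidableEq ι] [Fintype κ] [DecidableEq κ]

/-! The full system. The bracket is the Lie-Poisson bracket of so(3,1) together with four canonical
pairs. Passing from the tetrad components of the spin and from the canonical momenta to `spin` and
`mom` turns it into the covariant Souriau bracket: the rotation coefficients supply the Christoffel
terms, and the only curvature components that enter are the sectional ones (`riemannDown_schw`). By
`ham_eq` the Hamiltonian is p²/(2m) + λ_γ f^γ, where λ_γ = R_{γβκν} p^β S^{κν} / (m (d + 2p²)). At f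
= 0 the multipliers behave like constants (`bracket_ham`), and the Mathisson-Papapetrou equations
come out with the velocity u^α = p^α/m + λ_γ S^{γα}.

The Tulczyjew manifold is invariant because of an algebraic identity, `spin_spinCurv_spin`: when the
Pfaffian C⋆ of the spin tensor vanishes, the spin tensor composed with R_{αβκν} S^{κν} and with
itself again is a multiple of itself, with the factor given by d. The denominator d + 2p² is exactly
what makes the inhomogeneous terms of {f, H} cancel (`mainBracket_tulczyjew`). Along a trajectory f
therefore solves a homogeneous linear equation with continuous coefficients, and
`linear_ode_eq_zero` applies. The condition C⋆ = 0 comes for free: a timelike p in the kernel of the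
spin tensor makes the Pfaffian vanish, and C⋆ is a Casimir function. Conservation of p² on f = 0
reduces to the skew-symmetry of S.

The integrals. In tetrad components H depends only on r, the spin and the momentum, and rotating the
last two legs of the tetrad does not change it (`fderiv_ham_eq_zero`). The Q_i generate the
rotations of the sphere, which act on those components through such rotations of the legs; the
energy generates time translations.

The reduction. Let (u, v) be the unit vector along (L₂, L₃). The reduced variables are, in essence,
the components with respect to a tetrad whose last two legs are adapted to (u, v), so they commute
with the Q_i. On C⋆ = 0 the vector M is a function of Z, E₁ and (u, v); this closes the brackets
(`bracket_redMap_redMap`) and turns p², the denominator and the pairing of f with the tidal covector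
into functions of the reduced variables and the energy (`ham_redMap`). The two Hamiltonians agree
only on the level C⋆ = 0, but a function vanishing on a level of a Casimir function is there in
involution with everything (`bracket_eq_zero_of_casStar`), so the chain rule gives the projected
equations.

The converse. The energy, Q, the reduced variables, C⋆, t and φ have differentials which determine a
tangent vector wherever (L₁ cos θ - P_φ)/sin θ ≠ 0 (`eq_zero_of_reduced`). Hence an explicit lift on
which these functions evolve correctly is a trajectory. For Q = 0 that quantity vanishes; two
further conditions, on θ and on the direction of (L₂, L₃), take its place, and they hold because the
reduced Hamiltonian is even in (E₁, E₃) (`pd_redHam_incl₀`).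

Invariance of the reduced Tulczyjew set needs no lifted solution: at each time the derivative of a
reduced function equals a bracket of the full system at any chosen point above
(`hasDerivAt_of_redMap`). -/

/-- `F` is differentiable at `x`, with differential `v ↦ ℓ v`. -/
def HasDiff (F : (ι → ℝ) → ℝ) (ℓ : (ι → ℝ) → ℝ) (x : ι → ℝ) : Prop :=
  ∃ F' : (ι → ℝ) →L[ℝ] ℝ, HasFDerivAt F F' x ∧ ∀ v, F' v = ℓ v

namespace HasDiff

variable {F G : (ι → ℝ) → ℝ} {ℓ k : (ι → ℝ) → ℝ} {x : ι → ℝ}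

theorem congr (h : HasDiff F ℓ x) (e : ∀ v, ℓ v = k v) : HasDiff F k x := by
  obtain ⟨F', h1, h2⟩ := h
  exact ⟨F', h1, fun v => (h2 v).trans (e v)⟩

theorem congr_fun (h : HasDiff F ℓ x) (e : G =ᶠ[𝓝 x] F) : HasDiff G ℓ x := by
  obtain ⟨F', h1, h2⟩ := h
  exact ⟨F', h1.congr_of_eventuallyEq e, h2⟩

theorem differentiableAt (h : HasDiff F ℓ x) : DifferentiableAt ℝ F x := by
  obtain ⟨F', h1, -⟩ := h
  exact h1.differentiableAt

theorem of_differentiableAt (h : DifferentiableAt ℝ F x) : HasDiff F (fderiv ℝ F x) x :=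
  ⟨_, h.hasFDerivAt, fun _ => rfl⟩

theorem fderiv_eq (h : HasDiff F ℓ x) (v : ι → ℝ) : fderiv ℝ F x v = ℓ v := by
  obtain ⟨F', h1, h2⟩ := h
  rw [h1.fderiv, h2]

theorem pd_eq (h : HasDiff F ℓ x) (i : ι) : pd F i x = ℓ (Pi.single i 1) := h.fderiv_eq _

theorem unique (h : HasDiff F ℓ x) (h' : HasDiff F k x) (v : ι → ℝ) : ℓ v = k v := by
  rw [← h.fderiv_eq, h'.fderiv_eq]

theorem coord (i : ι) : HasDiff (fun z => z i) (fun v => v i) x :=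
  ⟨ContinuousLinearMap.proj i, hasFDerivAt_apply i x, fun _ => rfl⟩

theorem const (c : ℝ) : HasDiff (fun _ => c) (fun _ => 0) x :=
  ⟨0, hasFDerivAt_const c x, fun _ => rfl⟩

theorem add (h : HasDiff F ℓ x) (h' : HasDiff G k x) :
    HasDiff (fun z => F z + G z) (fun v => ℓ v + k v) x := by
  obtain ⟨F', h1, h2⟩ := h
  obtain ⟨G', h3, h4⟩ := h'
  exact ⟨_, h1.add h3, fun v => by simp [h2, h4]⟩

theorem neg (h : HasDiff F ℓ x) : HasDiff (fun z => -F z) (fun v => -ℓ v) x := by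
  obtain ⟨F', h1, h2⟩ := h
  exact ⟨_, h1.neg, fun v => by simp [h2]⟩

theorem sub (h : HasDiff F ℓ x) (h' : HasDiff G k x) :
    HasDiff (fun z => F z - G z) (fun v => ℓ v - k v) x := by
  obtain ⟨F', h1, h2⟩ := h
  obtain ⟨G', h3, h4⟩ := h'
  exact ⟨_, h1.sub h3, fun v => by simp [h2, h4]⟩

theorem mul (h : HasDiff F ℓ x) (h' : HasDiff G k x) :
    HasDiff (fun z => F z * G z) (fun v => ℓ v * G x + F x * k v) x := by
  obtain ⟨F', h1, h2⟩ := h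
  obtain ⟨G', h3, h4⟩ := h'
  exact ⟨_, h1.mul h3, fun v => by simp [h2, h4]; ring⟩

/-- The chain rule for a function of one real variable. -/
theorem scomp {f : ℝ → ℝ} {f' : ℝ} (hf : HasDerivAt f f' (F x)) (h : HasDiff F ℓ x) :
    HasDiff (fun z => f (F z)) (fun v => f' * ℓ v) x := by
  obtain ⟨F', h1, h2⟩ := h
  exact ⟨_, hf.comp_hasFDerivAt x h1, fun v => by simp [h2]⟩

theorem inv (h : HasDiff F ℓ x) (h0 : F x ≠ 0) :
    HasDiff (fun z => (F z)⁻¹) (fun v => -ℓ v / F x ^ 2) x :=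
  (scomp (hasDerivAt_inv h0) h).congr fun v => by ring

theorem div (h : HasDiff F ℓ x) (h' : HasDiff G k x) (h0 : G x ≠ 0) :
    HasDiff (fun z => F z / G z) (fun v => (ℓ v * G x - F x * k v) / G x ^ 2) x := by
  simp only [div_eq_mul_inv]
  exact (h.mul (h'.inv h0)).congr fun v => by field_simp; ring

theorem pow (h : HasDiff F ℓ x) (n : ℕ) :
    HasDiff (fun z => F z ^ n) (fun v => n * F x ^ (n - 1) * ℓ v) x :=
  scomp (hasDerivAt_pow n (F x)) h

theorem sq (h : HasDiff F ℓ x) :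
    HasDiff (fun z => F z ^ 2) (fun v => 2 * F x * ℓ v) x :=
  (h.pow 2).congr fun v => by norm_num

theorem sqrt (h : HasDiff F ℓ x) (h0 : F x ≠ 0) :
    HasDiff (fun z => √(F z)) (fun v => ℓ v / (2 * √(F x))) x :=
  (scomp (Real.hasDerivAt_sqrt h0) h).congr fun v => by ring

theorem sin (h : HasDiff F ℓ x) :
    HasDiff (fun z => Real.sin (F z)) (fun v => Real.cos (F x) * ℓ v) x :=
  scomp (Real.hasDerivAt_sin _) h

theorem cos (h : HasDiff F ℓ x) :
    HasDiff (fun z => Real.cos (F z)) (fun v => -Real.sin (F x) * ℓ v) x :=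
  scomp (Real.hasDerivAt_cos _) h

theorem sum {α : Type} (s : Finset α) {F ℓ : α → (ι → ℝ) → ℝ} (h : ∀ a ∈ s, HasDiff (F a) (ℓ a) x) :
    HasDiff (fun z => ∑ a ∈ s, F a z) (fun v => ∑ a ∈ s, ℓ a v) x := by
  classical
  induction s using Finset.induction_on with
  | empty => simpa using const 0
  | insert a s ha ih =>
    simp only [Finset.sum_insert ha]
    exact (h a (Finset.mem_insert_self a s)).add
      (ih fun b hb => h b (Finset.mem_insert_of_mem hb))

/-- The chain rule for a function of several variables. -/
theorem comp {H : (κ → ℝ) → ℝ} {m : (κ → ℝ) → ℝ} {Φ : (ι → ℝ) → κ → ℝ} {d : κ → (ι → ℝ) → ℝ}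
    (hΦ : ∀ a, HasDiff (fun z => Φ z a) (d a) x) (hH : HasDiff H m (Φ x)) :
    HasDiff (fun z => H (Φ z)) (fun v => m fun a => d a v) x := by
  choose Φ' h1 h2 using hΦ
  obtain ⟨H', h3, h4⟩ := hH
  refine ⟨_, h3.comp x (hasFDerivAt_pi.2 h1), fun v => ?_⟩
  simp only [ContinuousLinearMap.comp_apply, h4]
  congr 1
  ext a
  simp [h2]

theorem hasDerivAt (h : HasDiff F ℓ x) {γ : ℝ → ι → ℝ} {v : ι → ℝ} {τ : ℝ}
    (hγ : HasDerivAt γ v τ) (hx : γ τ = x) : HasDerivAt (fun s => F (γ s)) (ℓ v) τ := by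
  subst hx
  obtain ⟨F', h1, h2⟩ := h
  rw [← h2]
  exact h1.comp_hasDerivAt τ hγ

theorem apply_eq_sum (h : HasDiff F ℓ x) (v : ι → ℝ) : ℓ v = ∑ i, v i * pd F i x := by
  obtain ⟨F', h1, h2⟩ := h
  rw [← h2]
  conv_lhs => rw [pi_eq_sum_univ' v, map_sum]
  refine Finset.sum_congr rfl fun i _ => ?_
  rw [pd, h1.fderiv, map_smul, smul_eq_mul]

/-- The bracket {F, G} is the differential of F evaluated on the Hamiltonian field of G. Nearly
every bracket below is computed this way, from one explicit differential and one explicit vector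
field; G need not be differentiable. -/
theorem bracket_eq (h : HasDiff F ℓ x) (π : (ι → ℝ) → Matrix ι ι ℝ) (G : (ι → ℝ) → ℝ) :
    bracket π F G x = ℓ (hamField π G x) := by
  rw [h.apply_eq_sum]
  unfold bracket hamField
  refine Finset.sum_congr rfl fun i _ => ?_
  rw [Finset.sum_mul]
  exact Finset.sum_congr rfl fun j _ => by ring

end HasDiff

theorem hasDiff_pd {F : (ι → ℝ) → ℝ} {x : ι → ℝ} (h : DifferentiableAt ℝ F x) :
    HasDiff F (fun v => ∑ i, v i * pd F i x) x :=
  (HasDiff.of_differentiableAt h).congr (HasDiff.of_differentiableAt h).apply_eq_sum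

theorem bracket_antisymm {π : (ι → ℝ) → Matrix ι ι ℝ} {x : ι → ℝ} (hπ : ∀ i j, π x i j = -π x j i)
    (F G : (ι → ℝ) → ℝ) : bracket π F G x = -bracket π G F x := by
  unfold bracket
  rw [Finset.sum_comm, ← Finset.sum_neg_distrib]
  refine Finset.sum_congr rfl fun i _ => ?_
  rw [← Finset.sum_neg_distrib]
  exact Finset.sum_congr rfl fun j _ => by rw [hπ]; ring

theorem IsTrajectory.hasDerivAt_comp {π : (ι → ℝ) → Matrix ι ι ℝ} {H : (ι → ℝ) → ℝ} {I : Set ℝ}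
    {γ : ℝ → ι → ℝ} (hγ : IsTrajectory π H I γ) {τ : ℝ} (hτ : τ ∈ I) {F : (ι → ℝ) → ℝ}
    (hF : DifferentiableAt ℝ F (γ τ)) :
    HasDerivAt (fun s => F (γ s)) (bracket π F H (γ τ)) τ := by
  have h := HasDiff.of_differentiableAt hF
  rw [h.bracket_eq]
  exact h.hasDerivAt (hγ τ hτ) rfl

theorem eq_of_hasDerivAt_zero {I : Set ℝ} (hI : IsOpenInterval I) {f : ℝ → ℝ}
    (hf : ∀ τ ∈ I, HasDerivAt f 0 τ) {s t : ℝ} (hs : s ∈ I) (ht : t ∈ I) : f s = f t := by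
  have hc : Convex ℝ I := hI.2.convex
  refine hc.is_const_of_fderivWithin_eq_zero (𝕜 := ℝ) (f := f)
    (fun τ hτ => (hf τ hτ).differentiableAt.differentiableWithinAt) (fun τ hτ => ?_) hs ht
  rw [fderivWithin_of_isOpen hI.1 hτ]
  ext
  simp [(hf τ hτ).deriv]

/-- A solution of a linear system of differential equations which vanishes at one time
vanishes on the whole interval. -/
theorem linear_ode_eq_zero {I : Set ℝ} (hI : IsOpenInterval I) {A : ℝ → Matrix ι ι ℝ}
    (hA : ∀ i j, ContinuousOn (fun τ => A τ i j) I) {y : ℝ → ι → ℝ}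
    (hy : ∀ τ ∈ I, HasDerivAt y (A τ *ᵥ y τ) τ) {τ₀ : ℝ} (h₀ : τ₀ ∈ I) (hy₀ : y τ₀ = 0)
    {τ : ℝ} (hτ : τ ∈ I) : y τ = 0 := by
  -- On a compact subinterval the sum of the absolute values of all entries is bounded, and it
  -- dominates the operator norm for the sup norm.
  have lip : ∀ s t, s ∈ I → t ∈ I → ∃ K : NNReal, ∀ r ∈ Set.Icc s t,
      LipschitzOnWith K (fun w => A r *ᵥ w) Set.univ := by
    intro s t hs ht
    have hsub : Set.Icc s t ⊆ I := hI.2.out hs ht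
    have hc : ContinuousOn (fun r => ∑ i, ∑ j, |A r i j|) (Set.Icc s t) :=
      continuousOn_finsetSum _ fun i _ => continuousOn_finsetSum _ fun j _ =>
        ((hA i j).mono hsub).abs
    obtain ⟨K, hK⟩ := (isCompact_Icc.image_of_continuousOn hc).bddAbove
    refine ⟨Real.toNNReal K, fun r hr => ?_⟩
    have hr' : ∑ i, ∑ j, |A r i j| ≤ K := hK ⟨r, hr, rfl⟩
    refine LipschitzOnWith.of_dist_le_mul fun v _ w _ => ?_
    rw [dist_eq_norm, dist_eq_norm, ← Matrix.mulVec_sub]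
    refine (pi_norm_le_iff_of_nonneg (by positivity)).2 fun i => ?_
    rw [Real.norm_eq_abs, Matrix.mulVec, dotProduct]
    calc |∑ j, A r i j * (v - w) j| ≤ ∑ j, |A r i j| * ‖v - w‖ := by
          refine (Finset.abs_sum_le_sum_abs _ _).trans (Finset.sum_le_sum fun j _ => ?_)
          rw [abs_mul]
          exact mul_le_mul_of_nonneg_left (norm_le_pi_norm (v - w) j) (abs_nonneg _)
      _ = (∑ j, |A r i j|) * ‖v - w‖ := by rw [Finset.sum_mul]
      _ ≤ (Real.toNNReal K : ℝ) * ‖v - w‖ := by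
          refine mul_le_mul_of_nonneg_right (le_trans ?_ (Real.le_coe_toNNReal K)) (norm_nonneg _)
          refine le_trans ?_ hr'
          exact Finset.single_le_sum (f := fun i => ∑ j, |A r i j|)
            (fun i _ => Finset.sum_nonneg fun j _ => abs_nonneg _) (Finset.mem_univ i)
  have hz : ∀ t : ℝ, HasDerivAt (fun _ => (0 : ι → ℝ)) (A t *ᵥ (0 : ι → ℝ)) t := fun t => by
    rw [Matrix.mulVec_zero]
    exact hasDerivAt_const t 0
  -- Uniqueness forward and backward in time, each time against the zero solution.
  rcases le_total τ₀ τ with h | h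
  · obtain ⟨K, hK⟩ := lip τ₀ τ h₀ hτ
    have hsub : Set.Icc τ₀ τ ⊆ I := hI.2.out h₀ hτ
    exact ODE_solution_unique_of_mem_Icc_right (g := fun _ => 0) (s := fun _ => Set.univ)
      (fun t ht => hK t (Set.Ico_subset_Icc_self ht))
      (HasDerivAt.continuousOn fun t ht => hy t (hsub ht))
      (fun t ht => (hy t (hsub (Set.Ico_subset_Icc_self ht))).hasDerivWithinAt)
      (fun _ _ => trivial) continuousOn_const (fun t _ => (hz t).hasDerivWithinAt)
      (fun _ _ => trivial) hy₀ ⟨h, le_rfl⟩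
  · obtain ⟨K, hK⟩ := lip τ τ₀ hτ h₀
    have hsub : Set.Icc τ τ₀ ⊆ I := hI.2.out hτ h₀
    exact ODE_solution_unique_of_mem_Icc_left (g := fun _ => 0) (s := fun _ => Set.univ)
      (fun t ht => hK t (Set.Ioc_subset_Icc_self ht))
      (HasDerivAt.continuousOn fun t ht => hy t (hsub ht))
      (fun t ht => (hy t (hsub (Set.Ioc_subset_Icc_self ht))).hasDerivWithinAt)
      (fun _ _ => trivial) continuousOn_const (fun t _ => (hz t).hasDerivWithinAt)
      (fun _ _ => trivial) hy₀ ⟨le_rfl, h⟩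

end Linearization

/-! ### Affine Poisson tensors, Hamiltonian fields in vector form, Casimir functions -/

section Tensors

variable {ι : Type} [Fintype ι] [DecidableEq ι]

/-- For a tensor with affine coefficients the partial derivatives are the structure constants `c
(Pi.single l 1)`, so the Jacobi identity becomes finite algebra. -/
theorem isPoissonTensor_of_linear {π : (ι → ℝ) → Matrix ι ι ℝ} (k : Matrix ι ι ℝ)
    {c : (ι → ℝ) → Matrix ι ι ℝ} (hπ : ∀ z, π z = c z + k) (hc : ∀ z w, c (z + w) = c z + c w)
    (hs : ∀ (a : ℝ) z, c (a • z) = a • c z) (hskew : ∀ x i j, π x i j = -π x j i)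
    (hjac : ∀ x i j k, ∑ l, (π x i l * c (Pi.single l 1) j k
      + π x j l * c (Pi.single l 1) k i + π x k l * c (Pi.single l 1) i j) = 0) :
    IsPoissonTensor π := by
  have hlin : ∀ i j, ∃ f : (ι → ℝ) →L[ℝ] ℝ, ∀ z, f z = c z i j := fun i j =>
    ⟨LinearMap.toContinuousLinearMap
      { toFun := fun z => c z i j
        map_add' := fun z w => by rw [hc]; rfl
        map_smul' := fun a z => by rw [hs]; rfl }, fun z => rfl⟩
  choose f hf using hlin
  have hfun : ∀ i j, (fun z => π z i j) = fun z => f i j z + k i j := fun i j => by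
    ext z
    rw [hπ, hf]
    rfl
  refine ⟨fun i j => ?_, hskew, fun x i j k' => ?_⟩
  · rw [hfun]
    exact (f i j).contDiff.add contDiff_const
  · have hp : ∀ i j l, pd (fun z => π z i j) l x = c (Pi.single l 1) i j := fun i j l => by
      rw [hfun, pd, ((f i j).hasFDerivAt.add_const (k i j)).fderiv, hf]
    simp only [hp]
    exact hjac x i j k'

theorem isCasimir_of_hasDiff {π : (ι → ℝ) → Matrix ι ι ℝ} {C : (ι → ℝ) → ℝ}
    {ℓ : (ι → ℝ) → (ι → ℝ) → ℝ} (hC : ContDiff ℝ ∞ C) (hℓ : ∀ x, HasDiff C (ℓ x) x)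
    (h : ∀ x j, ℓ x (fun i => π x i j) = 0) : IsCasimir π C := by
  refine ⟨hC, fun x j => ?_⟩
  have := (hℓ x).apply_eq_sum (fun i => π x i j)
  rw [h] at this
  rw [this]
  exact Finset.sum_congr rfl fun i _ => mul_comm _ _

end Tensors

theorem hat_add (v w : Fin 3 → ℝ) : hat (v + w) = hat v + hat w := by
  ext i j; fin_cases i <;> fin_cases j <;> simp [hat] <;> ring

theorem hat_smul (a : ℝ) (v : Fin 3 → ℝ) : hat (a • v) = a • hat v := by
  ext i j; fin_cases i <;> fin_cases j <;> simp [hat]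

theorem hatJ_add (v w : Fin 3 → ℝ) : hatJ (v + w) = hatJ v + hatJ w := by
  ext i j; fin_cases i <;> fin_cases j <;> simp [hatJ] <;> ring

theorem hatJ_smul (a : ℝ) (v : Fin 3 → ℝ) : hatJ (a • v) = a • hatJ v := by
  ext i j; fin_cases i <;> fin_cases j <;> simp [hatJ]

theorem hat_zero : hat 0 = 0 := by
  ext i j; fin_cases i <;> fin_cases j <;> simp [hat]

theorem hatJ_zero : hatJ 0 = 0 := by
  ext i j; fin_cases i <;> fin_cases j <;> simp [hatJ]

theorem hatJ_zero' : (hatJ fun _ => 0) = 0 := hatJ_zero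

section Single

variable (i : Fin 3) (j : Fin 2) (k : Fin 4)

theorem vecE_single_E : vecE (Pi.single (.inl (.inl i)) 1) = Pi.single i 1 := by
  ext l; simp [vecE, Pi.single_apply]

theorem vecE_single_Z : vecE (Pi.single (.inl (.inr i)) 1) = 0 := by
  ext l; simp [vecE, Pi.single_apply]

theorem vecE_single_r : vecE (Pi.single (.inr j) 1) = 0 := by
  ext l; simp [vecE, Pi.single_apply]

theorem vecZ_single_E : vecZ (Pi.single (.inl (.inl i)) 1) = 0 := by
  ext l; simp [vecZ, Pi.single_apply]

theorem vecZ_single_Z : vecZ (Pi.single (.inl (.inr i)) 1) = Pi.single i 1 := by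
  ext l; simp [vecZ, Pi.single_apply]

theorem vecZ_single_r : vecZ (Pi.single (.inr j) 1) = 0 := by
  ext l; simp [vecZ, Pi.single_apply]

theorem vecL_single_L : vecL (Pi.single (.inl (.inl i)) 1) = Pi.single i 1 := by
  ext l; simp [vecL, Pi.single_apply]

theorem vecL_single_M : vecL (Pi.single (.inl (.inr i)) 1) = 0 := by
  ext l; simp [vecL, Pi.single_apply]

theorem vecL_single_P : vecL (Pi.single (.inr (.inl k)) 1) = 0 := by
  ext l; simp [vecL, Pi.single_apply]

theorem vecL_single_y : vecL (Pi.single (.inr (.inr k)) 1) = 0 := by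
  ext l; simp [vecL, Pi.single_apply]

theorem vecM_single_L : vecM (Pi.single (.inl (.inl i)) 1) = 0 := by
  ext l; simp [vecM, Pi.single_apply]

theorem vecM_single_M : vecM (Pi.single (.inl (.inr i)) 1) = Pi.single i 1 := by
  ext l; simp [vecM, Pi.single_apply]

theorem vecM_single_P : vecM (Pi.single (.inr (.inl k)) 1) = 0 := by
  ext l; simp [vecM, Pi.single_apply]

theorem vecM_single_y : vecM (Pi.single (.inr (.inr k)) 1) = 0 := by
  ext l; simp [vecM, Pi.single_apply]

theorem vecZ₀_single_Z :
    (fun l : Fin 3 => (Pi.single (.inl i) 1 : Red₀) (.inl l)) = Pi.single i 1 := by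
  ext l; simp [Pi.single_apply]

end Single

theorem hat_jacobi (v : Fin 3 → ℝ) (i j k : Fin 3) :
    ∑ l, (hat v i l * hat (Pi.single l 1) j k + hat v j l * hat (Pi.single l 1) k i
      + hat v k l * hat (Pi.single l 1) i j) = 0 := by
  fin_cases i <;> fin_cases j <;> fin_cases k <;> simp [Fin.sum_univ_succ, hat]

theorem hat_transpose (v : Fin 3 → ℝ) : (hat v)ᵀ = -hat v := by
  ext i j; fin_cases i <;> fin_cases j <;> simp [hat]

theorem hatJ_transpose (v : Fin 3 → ℝ) : (hatJ v)ᵀ = -hatJ v := by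
  ext i j; fin_cases i <;> fin_cases j <;> simp [hatJ]

theorem canonical_transpose : (!![0, 1; -1, 0] : Matrix (Fin 2) (Fin 2) ℝ)ᵀ = -!![0, 1; -1, 0] := by
  ext i j; fin_cases i <;> fin_cases j <;> simp

theorem skew_of_transpose {ι : Type} {A : Matrix ι ι ℝ} (h : Aᵀ = -A) (i j : ι) :
    A i j = -A j i :=
  congr_fun (congr_fun h j) i

theorem fullTensor_skew (x : Full) (i j : FullIdx) : fullTensor x i j = -fullTensor x j i := by
  refine skew_of_transpose ?_ i j
  simp [fullTensor, fromBlocks_transpose, fromBlocks_neg, hat_transpose]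

theorem redTensor_skew (x : Red) (i j : RedIdx) : redTensor x i j = -redTensor x j i := by
  refine skew_of_transpose ?_ i j
  simp only [redTensor, fromBlocks_transpose, fromBlocks_neg, hat_transpose, hatJ_transpose,
    canonical_transpose, transpose_zero, neg_zero]

theorem redTensor₀_skew (x : Red₀) (i j : RedIdx₀) : redTensor₀ x i j = -redTensor₀ x j i := by
  refine skew_of_transpose ?_ i j
  simp only [redTensor₀, fromBlocks_transpose, fromBlocks_neg, hatJ_transpose,
    canonical_transpose, transpose_zero, neg_zero]

theorem isPoissonTensor_redTensor : IsPoissonTensor redTensor := by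
  refine isPoissonTensor_of_linear
    (fromBlocks 0 0 0 !![0, 1; -1, 0])
    (c := fun z => fromBlocks (fromBlocks (hat (vecE z)) 0 0 (hatJ (vecZ z))) 0 0 0)
    (fun z => ?_) (fun z w => ?_) (fun a z => ?_) redTensor_skew fun x i j k => ?_
  · simp [redTensor, fromBlocks_add]
  · simp [fromBlocks_add, ← hat_add, ← hatJ_add]; exact ⟨rfl, rfl⟩
  · simp [fromBlocks_smul, ← hat_smul, ← hatJ_smul]; exact ⟨rfl, rfl⟩
  · rcases i with (i | i) | i <;> rcases j with (j | j) | j <;> rcases k with (k | k) | k <;>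
      simp [redTensor, Fintype.sum_sum_type, vecE_single_E, vecE_single_Z, vecE_single_r,
        vecZ_single_E, vecZ_single_Z, vecZ_single_r, hat_zero, hatJ_zero]
    · fin_cases i <;> fin_cases j <;> fin_cases k <;>
        simp [Fin.sum_univ_succ, hat, vecE]
    · fin_cases i <;> fin_cases j <;> fin_cases k <;>
        simp [Fin.sum_univ_succ, hatJ, vecZ]

theorem isPoissonTensor_redTensor₀ : IsPoissonTensor redTensor₀ := by
  refine isPoissonTensor_of_linear
    (fromBlocks 0 0 0 !![0, 1; -1, 0])
    (c := fun z => fromBlocks (hatJ fun i => z (.inl i)) 0 0 0)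
    (fun z => ?_) (fun z w => ?_) (fun a z => ?_) redTensor₀_skew fun x i j k => ?_
  · simp [redTensor₀, fromBlocks_add]
  · simp [fromBlocks_add, ← hatJ_add]; rfl
  · simp [fromBlocks_smul, ← hatJ_smul]; rfl
  · rcases i with i | i <;> rcases j with j | j <;> rcases k with k | k <;>
      simp [redTensor₀, Fintype.sum_sum_type, vecZ₀_single_Z, hatJ_zero']
    · fin_cases i <;> fin_cases j <;> fin_cases k <;>
        simp [Fin.sum_univ_succ, hatJ]

theorem isPoissonTensor_fullTensor : IsPoissonTensor fullTensor := by
  refine isPoissonTensor_of_linear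
    (fromBlocks 0 0 0 (fromBlocks 0 (-1) 1 0))
    (c := fun z => fromBlocks
      (fromBlocks (hat (vecL z)) (hat (vecM z)) (hat (vecM z)) (-hat (vecL z))) 0 0 0)
    (fun z => ?_) (fun z w => ?_) (fun a z => ?_) fullTensor_skew fun x i j k => ?_
  · simp [fullTensor, fromBlocks_add]
  · have hL : vecL (z + w) = vecL z + vecL w := rfl
    have hM : vecM (z + w) = vecM z + vecM w := rfl
    simp only [fromBlocks_add, hL, hM, hat_add, neg_add, add_zero]
  · have hL : vecL (a • z) = a • vecL z := rfl
    have hM : vecM (a • z) = a • vecM z := rfl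
    simp only [fromBlocks_smul, hL, hM, hat_smul, smul_neg, smul_zero]
  · rcases i with (i | i) | (i | i) <;> rcases j with (j | j) | (j | j) <;>
      rcases k with (k | k) | (k | k) <;>
      simp [fullTensor, Fintype.sum_sum_type, vecL_single_L, vecL_single_M, vecL_single_P,
        vecL_single_y, vecM_single_L, vecM_single_M, vecM_single_P, vecM_single_y, hat_zero]
    -- The nontrivial blocks left over are all instances of the so(3) Jacobi identity, taken at L or
    -- at M: L + iM carries the bracket of complexified so(3).
    all_goals
      have hL := hat_jacobi (vecL x) i j k
      have hM := hat_jacobi (vecM x) i j k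
      simp only [Finset.sum_add_distrib, Finset.sum_neg_distrib] at hL hM ⊢
      linarith

theorem hamField_fullTensor (H : Full → ℝ) (x : Full) : hamField fullTensor H x = fullEqs H x := by
  ext i
  rcases i with (i | i) | (i | i)
  · fin_cases i <;>
      simp [hamField, fullTensor, fullEqs, Fintype.sum_sum_type, hat, Fin.sum_univ_succ,
        crossProduct] <;> ring
  · fin_cases i <;>
      simp [hamField, fullTensor, fullEqs, Fintype.sum_sum_type, hat, Fin.sum_univ_succ,
        crossProduct] <;> ring
  · simp [hamField, fullTensor, fullEqs, Fintype.sum_sum_type, Matrix.one_apply]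
  · simp [hamField, fullTensor, fullEqs, Fintype.sum_sum_type, Matrix.one_apply]

theorem hamField_redTensor (H : Red → ℝ) (z : Red) : hamField redTensor H z = redEqs H z := by
  ext i
  rcases i with (i | i) | i <;> fin_cases i <;>
      simp [hamField, redTensor, redEqs, Fintype.sum_sum_type, hat, hatJ, Fin.sum_univ_succ,
        crossProduct, applyJ] <;> ring

theorem hamField_redTensor₀ (H : Red₀ → ℝ) (w : Red₀) :
    hamField redTensor₀ H w = redEqs₀ H w := by
  ext i
  rcases i with i | i <;> fin_cases i <;>
      simp [hamField, redTensor₀, redEqs₀, Fintype.sum_sum_type, hat, hatJ, Fin.sum_univ_succ,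
        crossProduct, applyJ] <;> ring

theorem isCasimir_casStar : IsCasimir fullTensor casStar := by
  refine isCasimir_of_hasDiff (ℓ := fun x v => ∑ i, (vecL v i * vecM x i + vecL x i * vecM v i))
    (by unfold casStar vecL vecM; fun_prop)
    (fun x => HasDiff.sum _ fun i _ => (HasDiff.coord _).mul (HasDiff.coord _)) fun x j => ?_
  rcases j with (j | j) | (j | j)
  · fin_cases j <;> simp [fullTensor, hat, vecL, vecM, Fin.sum_univ_succ] <;> ring
  · fin_cases j <;> simp [fullTensor, hat, vecL, vecM, Fin.sum_univ_succ] <;> ring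
  · simp [fullTensor, vecL, vecM]
  · simp [fullTensor, vecL, vecM]

theorem isCasimir_casCirc : IsCasimir fullTensor casCirc := by
  refine isCasimir_of_hasDiff
    (ℓ := fun x v => ∑ i, 2 * vecL x i * vecL v i - ∑ i, 2 * vecM x i * vecM v i)
    (by unfold casCirc vecL vecM; fun_prop)
    (fun x => (HasDiff.sum _ fun i _ => (HasDiff.coord _).sq).sub
      (HasDiff.sum _ fun i _ => (HasDiff.coord _).sq)) fun x j => ?_
  rcases j with (j | j) | (j | j)
  · fin_cases j <;> simp [fullTensor, hat, vecL, vecM, Fin.sum_univ_succ] <;> ring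
  · fin_cases j <;> simp [fullTensor, hat, vecL, vecM, Fin.sum_univ_succ] <;> ring
  · simp [fullTensor, vecL, vecM]
  · simp [fullTensor, vecL, vecM]

theorem isCasimir_redCirc : IsCasimir redTensor redCirc := by
  refine isCasimir_of_hasDiff
    (ℓ := fun x v => -(2 * vecZ x 0 * vecZ v 0) + 2 * vecZ x 1 * vecZ v 1 - 2 * vecZ x 2 * vecZ v 2)
    (by unfold redCirc vecZ; fun_prop)
    (fun x => ((HasDiff.coord _).sq.neg.add (HasDiff.coord _).sq).sub (HasDiff.coord _).sq)
    fun x j => ?_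
  rcases j with (j | j) | j <;> fin_cases j <;> simp [redTensor, hatJ, vecZ] <;> ring

theorem isCasimir_redF : IsCasimir redTensor redF := by
  refine isCasimir_of_hasDiff
    (ℓ := fun x v => 2 * vecE x 0 * vecE v 0 + 2 * vecE x 1 * vecE v 1 + 2 * vecE x 2 * vecE v 2)
    (by unfold redF vecE; fun_prop)
    (fun x => ((HasDiff.coord _).sq.add (HasDiff.coord _).sq).add (HasDiff.coord _).sq)
    fun x j => ?_
  rcases j with (j | j) | j <;> fin_cases j <;> simp [redTensor, hat, vecE] <;> ring

theorem isCasimir_redCirc₀ : IsCasimir redTensor₀ redCirc₀ := by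
  refine isCasimir_of_hasDiff
    (ℓ := fun x v => -(2 * x (.inl 0) * v (.inl 0)) + 2 * x (.inl 1) * v (.inl 1)
      - 2 * x (.inl 2) * v (.inl 2))
    (by unfold redCirc₀ redCirc vecZ incl₀; simp only [Sum.elim_inl, Sum.elim_inr]; fun_prop)
    (fun x => ((HasDiff.coord _).sq.neg.add (HasDiff.coord _).sq).sub (HasDiff.coord _).sq)
    fun x j => ?_
  rcases j with j | j <;> fin_cases j <;> simp [redTensor₀, hatJ] <;> ring

/-! ### Ranks of the three Poisson tensors -/

/-- Rank-nullity with an explicit basis of the kernel. In the applications the basis consists of the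
gradients of the Casimir functions, up to constant factors. -/
theorem rank_add_eq_card {ι : Type} [Fintype ι] [DecidableEq ι] {k : ℕ} {A : Matrix ι ι ℝ}
    {b : Fin k → ι → ℝ} (hb : LinearIndependent ℝ b) (hA : ∀ i, A *ᵥ b i = 0)
    (h : ∀ v, A *ᵥ v = 0 → ∃ c : Fin k → ℝ, v = ∑ i, c i • b i) :
    A.rank + k = Fintype.card ι := by
  have hker : LinearMap.ker A.mulVecLin = Submodule.span ℝ (Set.range b) := by
    refine le_antisymm (fun v hv => ?_) (Submodule.span_le.2 ?_)
    · obtain ⟨c, rfl⟩ := h v (by simpa using hv)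
      exact Submodule.sum_mem _ fun i _ =>
        Submodule.smul_mem _ _ (Submodule.subset_span ⟨i, rfl⟩)
    · rintro _ ⟨i, rfl⟩
      simpa using hA i
  have h1 := A.mulVecLin.finrank_range_add_finrank_ker
  rw [hker, finrank_span_eq_card hb, Fintype.card_fin, Module.finrank_fintype_fun_eq_card] at h1
  exact h1

theorem exists_smul_of_cross_eq_zero {a v : Fin 3 → ℝ} (hv : v ≠ 0)
    (h0 : a 1 * v 2 = a 2 * v 1) (h1 : a 2 * v 0 = a 0 * v 2) (h2 : a 0 * v 1 = a 1 * v 0) :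
    ∃ c : ℝ, ∀ i, a i = c * v i := by
  obtain ⟨k, hk⟩ := Function.ne_iff.1 hv
  refine ⟨a k / v k, fun i => ?_⟩
  simp only [Pi.zero_apply] at hk
  rw [div_mul_eq_mul_div, eq_div_iff hk]
  fin_cases k <;> fin_cases i <;> simp <;> linarith

/-- A covector is in the kernel when its E-part is parallel to E, its Z-part parallel to JZ, and its
last two entries vanish. Both directions exist because E and Z are nonzero. -/
theorem rank_redTensor (z : Red) (hE : vecE z ≠ 0) (hZ : vecZ z ≠ 0) :
    (redTensor z).rank = 2 * (6 - 3) := by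
  have hcard : Fintype.card RedIdx = 8 := rfl
  have h := rank_add_eq_card (A := redTensor z)
    (b := ![Sum.elim (Sum.elim (vecE z) 0) 0, Sum.elim (Sum.elim 0 (applyJ (vecZ z))) 0])
    ?_ ?_ ?_
  · omega
  · rw [LinearIndependent.pair_iff]
    intro s t h
    obtain ⟨i, hi⟩ := Function.ne_iff.1 hE
    obtain ⟨j, hj⟩ := Function.ne_iff.1 hZ
    have h1 := congr_fun h (.inl (.inl i))
    have h2 := congr_fun h (.inl (.inr j))
    constructor
    · exact (by simpa using h1 : s = 0 ∨ vecE z i = 0).resolve_right hi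
    · fin_cases j <;> simp_all [applyJ]
  · intro i
    ext j
    fin_cases i <;> rcases j with (j | j) | j <;> fin_cases j <;>
      simp [redTensor, mulVec, dotProduct, hat, hatJ, applyJ, Fin.sum_univ_succ] <;> ring
  · intro v hv
    have e : ∀ j, (redTensor z *ᵥ v) j = 0 := fun j => congr_fun hv j
    have e0 := e (.inl (.inl 0))
    have e1 := e (.inl (.inl 1))
    have e2 := e (.inl (.inl 2))
    have e3 := e (.inl (.inr 0))
    have e4 := e (.inl (.inr 1))
    have e5 := e (.inl (.inr 2))
    have e6 := e (.inr 0)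
    have e7 := e (.inr 1)
    simp [redTensor, mulVec, dotProduct, hat, hatJ, Fin.sum_univ_succ] at e0 e1 e2 e3 e4 e5 e6 e7
    obtain ⟨c, hc⟩ := exists_smul_of_cross_eq_zero (a := vecE v) hE
      (by simp only [vecE] at *; linarith) (by simp only [vecE] at *; linarith)
      (by simp only [vecE] at *; linarith)
    obtain ⟨d, hd⟩ := exists_smul_of_cross_eq_zero (a := applyJ (vecZ v)) hZ
      (by simp [vecZ, applyJ] at *; linarith) (by simp [vecZ, applyJ] at *; linarith)
      (by simp [vecZ, applyJ] at *; linarith)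
    refine ⟨![c, d], funext fun j => ?_⟩
    have hd0 := hd 0
    have hd1 := hd 1
    have hd2 := hd 2
    simp [applyJ] at hd0 hd1 hd2
    rcases j with (j | j) | j
    · simpa [vecE] using hc j
    · fin_cases j <;> simp [applyJ] <;> simp only [vecZ] at * <;> linarith
    · fin_cases j <;> simp [e6, e7]

theorem rank_redTensor₀ (w : Red₀) (hZ : (fun i => w (.inl i)) ≠ 0) :
    (redTensor₀ w).rank = 2 * (6 - 4) := by
  have hcard : Fintype.card RedIdx₀ = 5 := rfl
  have h := rank_add_eq_card (A := redTensor₀ w)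
    (b := ![Sum.elim (applyJ fun i => w (.inl i)) 0]) ?_ ?_ ?_
  · omega
  · refine LinearIndependent.of_subsingleton 0 fun h => hZ (funext fun i => ?_)
    have h0 := congr_fun h (.inl 0)
    have h1 := congr_fun h (.inl 1)
    have h2 := congr_fun h (.inl 2)
    simp [applyJ] at h0 h1 h2
    fin_cases i
    exacts [h0, h1, h2]
  · intro i
    ext j
    fin_cases i
    rcases j with j | j <;> fin_cases j <;>
      simp [redTensor₀, mulVec, dotProduct, hatJ, applyJ, Fin.sum_univ_succ] <;> ring
  · intro v hv
    have e : ∀ j, (redTensor₀ w *ᵥ v) j = 0 := fun j => congr_fun hv j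
    have e3 := e (.inl 0)
    have e4 := e (.inl 1)
    have e5 := e (.inl 2)
    have e6 := e (.inr 0)
    have e7 := e (.inr 1)
    simp [redTensor₀, mulVec, dotProduct, hatJ, Fin.sum_univ_succ] at e3 e4 e5 e6 e7
    obtain ⟨d, hd⟩ := exists_smul_of_cross_eq_zero (a := applyJ fun i => v (.inl i)) hZ
      (by simp [applyJ] at *; linarith) (by simp [applyJ] at *; linarith)
      (by simp [applyJ] at *; linarith)
    refine ⟨![d], funext fun j => ?_⟩
    have hd0 := hd 0
    have hd1 := hd 1
    have hd2 := hd 2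
    simp [applyJ] at hd0 hd1 hd2
    rcases j with j | j
    · fin_cases j <;> simp [applyJ] <;> linarith
    · fin_cases j <;> simp [e6, e7]

/-- Complexify: with w = v_L - i v_M and ℓ = L + iM the kernel condition on the spin part is w × ℓ =
0 over the complex numbers, so w is a complex multiple of ℓ. This gives two real dimensions.
Positivity of C∘ is used only to have ℓ ≠ 0. -/
theorem rank_fullTensor (x : Full) (hx : 0 < casCirc x) : (fullTensor x).rank = 2 * 6 := by
  have hcard : Fintype.card FullIdx = 14 := rfl
  obtain ⟨k, hk⟩ : ∃ k, vecL x k ≠ 0 := by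
    by_contra! h0
    have : 0 ≤ ∑ i, vecM x i ^ 2 := Finset.sum_nonneg fun i _ => sq_nonneg _
    simp [casCirc, h0] at hx
    linarith
  have hn : vecL x k ^ 2 + vecM x k ^ 2 ≠ 0 := by positivity
  have h := rank_add_eq_card (A := fullTensor x)
    (b := ![Sum.elim (Sum.elim (vecL x) (-vecM x)) 0, Sum.elim (Sum.elim (vecM x) (vecL x)) 0])
    ?_ ?_ ?_
  · omega
  · rw [LinearIndependent.pair_iff]
    intro s t h
    have h1 := congr_fun h (.inl (.inl k))
    have h2 := congr_fun h (.inl (.inr k))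
    simp at h1 h2
    constructor
    · refine (mul_eq_zero.1 (?_ : s * (vecL x k ^ 2 + vecM x k ^ 2) = 0)).resolve_right hn
      linear_combination vecL x k * h1 - vecM x k * h2
    · refine (mul_eq_zero.1 (?_ : t * (vecL x k ^ 2 + vecM x k ^ 2) = 0)).resolve_right hn
      linear_combination vecM x k * h1 + vecL x k * h2
  · intro i
    ext j
    fin_cases i <;> rcases j with (j | j) | (j | j)
    all_goals
      first
      | (simp [fullTensor, mulVec, dotProduct]; done)
      | (fin_cases j <;>
          simp [fullTensor, mulVec, dotProduct, hat, Fin.sum_univ_succ] <;> ring)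
  · intro v hv
    have e : ∀ j, (fullTensor x *ᵥ v) j = 0 := fun j => congr_fun hv j
    have e0 := e (.inl (.inl 0))
    have e1 := e (.inl (.inl 1))
    have e2 := e (.inl (.inl 2))
    have e3 := e (.inl (.inr 0))
    have e4 := e (.inl (.inr 1))
    have e5 := e (.inl (.inr 2))
    have e6 := fun j => e (.inr (.inl j))
    have e7 := fun j => e (.inr (.inr j))
    simp [fullTensor, mulVec, dotProduct, hat, Fin.sum_univ_succ] at e0 e1 e2 e3 e4 e5
    simp [fullTensor, mulVec, dotProduct, Matrix.one_apply] at e6 e7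
    -- The real part of w × ℓ = 0; the imaginary part follows.
    have hR : ∀ i j, vecL v i * vecL x j + vecM v i * vecM x j
        = vecL v j * vecL x i + vecM v j * vecM x i := by
      intro i j
      fin_cases i <;> fin_cases j <;> simp [vecL, vecM] at * <;> linarith
    have hI : ∀ i j, vecL v i * vecM x j - vecM v i * vecL x j
        = vecL v j * vecM x i - vecM v j * vecL x i := by
      intro i j
      fin_cases i <;> fin_cases j <;> simp [vecL, vecM] at * <;> linarith
    -- The two coefficients are the real part, and minus the imaginary part, of the quotient w_k /
    -- ℓ_k.
    refine ⟨![(vecL v k * vecL x k - vecM v k * vecM x k) / (vecL x k ^ 2 + vecM x k ^ 2),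
      (vecL v k * vecM x k + vecM v k * vecL x k) / (vecL x k ^ 2 + vecM x k ^ 2)],
      funext fun j => ?_⟩
    rcases j with (j | j) | (j | j)
    · simp
      field_simp
      change vecL v j * _ = _
      linear_combination vecL x k * hR j k + vecM x k * hI j k
    · simp
      field_simp
      change vecM v j * _ = _
      linear_combination vecM x k * hR j k - vecL x k * hI j k
    · simp [e7]
    · simp [e6]

/-! ### Connection, curvature and rotation coefficients of the Schwarzschild metric -/

section Schwarzschild

/-- The domain of the coordinates: outside the horizon, away from the axis. -/
def chartDomain (μ : ℝ) : Set (Fin 4 → ℝ) := {y | 2 * μ < y 1 ∧ 0 < y 2 ∧ y 2 < Real.pi}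

theorem isOpen_chartDomain (μ : ℝ) : IsOpen (chartDomain μ) :=
  (isOpen_lt continuous_const (continuous_apply 1)).inter
    ((isOpen_lt continuous_const (continuous_apply 2)).inter
      (isOpen_lt (continuous_apply 2) continuous_const))

/-- The Christoffel symbols of the Schwarzschild metric. -/
def schwChristoffel (μ : ℝ) (y : Fin 4 → ℝ) : Fin 4 → Matrix (Fin 4) (Fin 4) ℝ :=
  ![!![0, μ / (y 1 * (y 1 - 2 * μ)), 0, 0; μ / (y 1 * (y 1 - 2 * μ)), 0, 0, 0;
      0, 0, 0, 0; 0, 0, 0, 0],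
    !![μ * (y 1 - 2 * μ) / y 1 ^ 3, 0, 0, 0; 0, -(μ / (y 1 * (y 1 - 2 * μ))), 0, 0;
      0, 0, -(y 1 - 2 * μ), 0; 0, 0, 0, -((y 1 - 2 * μ) * Real.sin (y 2) ^ 2)],
    !![0, 0, 0, 0; 0, 0, 1 / y 1, 0; 0, 1 / y 1, 0, 0;
      0, 0, 0, -(Real.sin (y 2) * Real.cos (y 2))],
    !![0, 0, 0, 0; 0, 0, 0, 1 / y 1; 0, 0, 0, Real.cos (y 2) / Real.sin (y 2);
      0, 1 / y 1, Real.cos (y 2) / Real.sin (y 2), 0]]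

/-- The differentials of the Christoffel symbols of the Schwarzschild metric. -/
def schwChristoffelDiff (μ : ℝ) (y v : Fin 4 → ℝ) : Fin 4 → Matrix (Fin 4) (Fin 4) ℝ :=
  ![!![0, -(μ * (2 * y 1 - 2 * μ) / (y 1 * (y 1 - 2 * μ)) ^ 2 * v 1), 0, 0;
      -(μ * (2 * y 1 - 2 * μ) / (y 1 * (y 1 - 2 * μ)) ^ 2 * v 1), 0, 0, 0;
      0, 0, 0, 0; 0, 0, 0, 0],
    !![μ * (6 * μ - 2 * y 1) / y 1 ^ 4 * v 1, 0, 0, 0;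
      0, μ * (2 * y 1 - 2 * μ) / (y 1 * (y 1 - 2 * μ)) ^ 2 * v 1, 0, 0;
      0, 0, -v 1, 0;
      0, 0, 0, -(v 1 * Real.sin (y 2) ^ 2)
        - (y 1 - 2 * μ) * (2 * Real.sin (y 2) * Real.cos (y 2)) * v 2],
    !![0, 0, 0, 0; 0, 0, -(v 1 / y 1 ^ 2), 0; 0, -(v 1 / y 1 ^ 2), 0, 0;
      0, 0, 0, (Real.sin (y 2) ^ 2 - Real.cos (y 2) ^ 2) * v 2],
    !![0, 0, 0, 0; 0, 0, 0, -(v 1 / y 1 ^ 2); 0, 0, 0, -(v 2 / Real.sin (y 2) ^ 2);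
      0, -(v 1 / y 1 ^ 2), -(v 2 / Real.sin (y 2) ^ 2), 0]]

/-- The sectional components `R_{κνκν}` of the curvature tensor of the Schwarzschild metric. -/
def schwSectional (μ : ℝ) (y : Fin 4 → ℝ) : Matrix (Fin 4) (Fin 4) ℝ :=
  let r := y 1
  let s := Real.sin (y 2)
  !![0, -(2 * μ / r ^ 3), μ * (r - 2 * μ) / r ^ 2, μ * (r - 2 * μ) / r ^ 2 * s ^ 2;
    -(2 * μ / r ^ 3), 0, -(μ / (r - 2 * μ)), -(μ / (r - 2 * μ) * s ^ 2);
    μ * (r - 2 * μ) / r ^ 2, -(μ / (r - 2 * μ)), 0, 2 * μ * r * s ^ 2;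
    μ * (r - 2 * μ) / r ^ 2 * s ^ 2, -(μ / (r - 2 * μ) * s ^ 2), 2 * μ * r * s ^ 2, 0]

variable {μ : ℝ} {y : Fin 4 → ℝ}

theorem lapse_eq (hr : y 1 ≠ 0) : lapse μ (y 1) = (y 1 - 2 * μ) / y 1 := by
  unfold lapse
  field_simp

section Nonzero

variable (hμ : 0 < μ) (hy : y ∈ chartDomain μ)
include hμ hy

theorem radius_pos : 0 < y 1 := by
  have := hy.1
  linarith

theorem radius_ne : y 1 ≠ 0 := (radius_pos hμ hy).ne'

theorem radius_sub_pos : 0 < y 1 - 2 * μ := by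
  have := hy.1
  linarith

theorem radius_sub_ne : y 1 - 2 * μ ≠ 0 := (radius_sub_pos hμ hy).ne'

theorem sin_pos : 0 < Real.sin (y 2) := Real.sin_pos_of_pos_of_lt_pi hy.2.1 hy.2.2

theorem sin_ne : Real.sin (y 2) ≠ 0 := (sin_pos hμ hy).ne'

theorem lapse_pos : 0 < lapse μ (y 1) := by
  rw [lapse_eq (radius_ne hμ hy)]
  exact div_pos (radius_sub_pos hμ hy) (radius_pos hμ hy)

end Nonzero

theorem schw_inv (hμ : 0 < μ) (hy : y ∈ chartDomain μ) :
    (schw μ y)⁻¹ = diagonal ![-(y 1 / (y 1 - 2 * μ)), (y 1 - 2 * μ) / y 1, 1 / y 1 ^ 2,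
      1 / (y 1 ^ 2 * Real.sin (y 2) ^ 2)] := by
  have h1 := radius_ne hμ hy
  have h2 := radius_sub_ne hμ hy
  have h3 := sin_ne hμ hy
  refine Matrix.inv_eq_right_inv ?_
  rw [schw, diagonal_mul_diagonal, lapse_eq h1, ← diagonal_one]
  congr 1
  ext i
  fin_cases i <;> simp <;> field_simp

/-- The differential of the components of the Schwarzschild metric. -/
theorem hasDiff_schw (hμ : 0 < μ) (hy : y ∈ chartDomain μ) (i j : Fin 4) :
    HasDiff (fun z => schw μ z i j) (fun v => (diagonal ![-(2 * μ / y 1 ^ 2 * v 1),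
      -(2 * μ / (y 1 - 2 * μ) ^ 2 * v 1), 2 * y 1 * v 1,
      2 * y 1 * Real.sin (y 2) ^ 2 * v 1
        + y 1 ^ 2 * (2 * Real.sin (y 2) * Real.cos (y 2)) * v 2] : Matrix (Fin 4) (Fin 4) ℝ) i j)
      y := by
  have h1 := radius_ne hμ hy
  have h2 := radius_sub_ne hμ hy
  have ha : lapse μ (y 1) ≠ 0 := (lapse_pos hμ hy).ne'
  have hl : HasDiff (fun z : Fin 4 → ℝ => lapse μ (z 1)) (fun v => 2 * μ / y 1 ^ 2 * v 1) y :=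
    ((HasDiff.const 1).sub ((HasDiff.const (2 * μ)).div (HasDiff.coord 1) h1)).congr
      fun v => by ring
  by_cases hij : i = j
  · subst hij
    simp only [schw, diagonal_apply_eq]
    fin_cases i
    · exact hl.neg
    · refine ((HasDiff.const 1).div hl ha).congr fun v => ?_
      rw [lapse_eq h1]
      simp
      field_simp
    · exact (HasDiff.coord 1).sq
    · refine ((HasDiff.coord 1).sq.mul (HasDiff.coord 2).sin.sq).congr fun v => ?_
      simp
      ring
  · simp only [schw, diagonal_apply_ne _ hij]
    exact HasDiff.const 0

theorem christoffel_schw (hμ : 0 < μ) (hy : y ∈ chartDomain μ) (α β ν : Fin 4) :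
    christoffel (schw μ) α β ν y = schwChristoffel μ y α β ν := by
  have h1 := radius_ne hμ hy
  have h2 := radius_sub_ne hμ hy
  have h3 := sin_ne hμ hy
  simp only [christoffel, schw_inv hμ hy, (hasDiff_schw hμ hy _ _).pd_eq]
  fin_cases α <;> fin_cases β <;> fin_cases ν <;>
    simp [schwChristoffel, Fin.sum_univ_succ, diagonal] <;> (field_simp; try ring1)

theorem hasDiff_christoffel (hμ : 0 < μ) (hy : y ∈ chartDomain μ) (α β ν : Fin 4) :
    HasDiff (christoffel (schw μ) α β ν) (fun v => schwChristoffelDiff μ y v α β ν) y := by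
  have h1 := radius_ne hμ hy
  have h2 := radius_sub_ne hμ hy
  have h3 := sin_ne hμ hy
  -- The closed form holds on the whole open chart domain, hence near the point, and may therefore
  -- be differentiated.
  have he : christoffel (schw μ) α β ν =ᶠ[𝓝 y] fun z => schwChristoffel μ z α β ν :=
    Filter.eventuallyEq_of_mem ((isOpen_chartDomain μ).mem_nhds hy)
      fun z hz => christoffel_schw hμ hz α β ν
  refine HasDiff.congr_fun ?_ he
  have hsub : HasDiff (fun z : Fin 4 → ℝ => z 1 - 2 * μ) (fun v => v 1) y :=
    ((HasDiff.coord 1).sub (HasDiff.const _)).congr fun v => by ring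
  have hA : HasDiff (fun z : Fin 4 → ℝ => μ / (z 1 * (z 1 - 2 * μ)))
      (fun v => -(μ * (2 * y 1 - 2 * μ) / (y 1 * (y 1 - 2 * μ)) ^ 2 * v 1)) y :=
    ((HasDiff.const μ).div ((HasDiff.coord 1).mul hsub) (mul_ne_zero h1 h2)).congr fun v => by
      ring
  have hR : HasDiff (fun z : Fin 4 → ℝ => 1 / z 1) (fun v => -(v 1 / y 1 ^ 2)) y :=
    ((HasDiff.const 1).div (HasDiff.coord 1) h1).congr fun v => by ring
  have hC : HasDiff (fun z : Fin 4 → ℝ => Real.cos (z 2) / Real.sin (z 2))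
      (fun v => -(v 2 / Real.sin (y 2) ^ 2)) y :=
    ((HasDiff.coord 2).cos.div (HasDiff.coord 2).sin h3).congr fun v => by
      field_simp
      linear_combination -v 2 * Real.sin_sq_add_cos_sq (y 2)
  have hT : HasDiff (fun z : Fin 4 → ℝ => μ * (z 1 - 2 * μ) / z 1 ^ 3)
      (fun v => μ * (6 * μ - 2 * y 1) / y 1 ^ 4 * v 1) y :=
    (((HasDiff.const μ).mul hsub).div ((HasDiff.coord 1).pow 3) (pow_ne_zero 3 h1)).congr
      fun v => by
        field_simp
        ring
  have hP : HasDiff (fun z : Fin 4 → ℝ => -((z 1 - 2 * μ) * Real.sin (z 2) ^ 2))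
      (fun v => -(v 1 * Real.sin (y 2) ^ 2)
        - (y 1 - 2 * μ) * (2 * Real.sin (y 2) * Real.cos (y 2)) * v 2) y :=
    (hsub.mul (HasDiff.coord 2).sin.sq).neg.congr fun v => by ring
  have hS : HasDiff (fun z : Fin 4 → ℝ => -(Real.sin (z 2) * Real.cos (z 2)))
      (fun v => (Real.sin (y 2) ^ 2 - Real.cos (y 2) ^ 2) * v 2) y :=
    ((HasDiff.coord 2).sin.mul (HasDiff.coord 2).cos).neg.congr fun v => by ring
  fin_cases α <;> fin_cases β <;> fin_cases ν <;>
    first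
    | exact HasDiff.const 0
    | exact hA
    | exact hA.neg.congr fun v => neg_neg _
    | exact hR
    | exact hC
    | exact hsub.neg
    | exact hT
    | exact hP
    | exact hS

/-- All derivatives are replaced by the closed forms, and the metric factor is a single diagonal
entry. What remains is an algebraic expression for each choice of indices. -/
theorem riemannDown_eq (hμ : 0 < μ) (hy : y ∈ chartDomain μ) (κ ν α β : Fin 4) :
    riemannDown (schw μ) κ ν α β y =
      ![-((y 1 - 2 * μ) / y 1), y 1 / (y 1 - 2 * μ), y 1 ^ 2,
        y 1 ^ 2 * Real.sin (y 2) ^ 2] κ *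
      (schwChristoffelDiff μ y (Pi.single α 1) κ β ν - schwChristoffelDiff μ y (Pi.single β 1) κ α ν
        + ∑ l, (schwChristoffel μ y κ α l * schwChristoffel μ y l β ν
          - schwChristoffel μ y κ β l * schwChristoffel μ y l α ν)) := by
  have hg : schw μ y = diagonal ![-((y 1 - 2 * μ) / y 1), y 1 / (y 1 - 2 * μ), y 1 ^ 2,
      y 1 ^ 2 * Real.sin (y 2) ^ 2] := by
    simp only [schw, lapse_eq (radius_ne hμ hy), one_div_div]
  simp only [riemannDown, riemann, hg, (hasDiff_christoffel hμ hy _ _ _).pd_eq,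
    christoffel_schw hμ hy, diagonal_apply, ite_mul, zero_mul, Finset.sum_ite_eq, Finset.mem_univ,
    if_true]

theorem riemannDown_schw_swap (hμ : 0 < μ) (hy : y ∈ chartDomain μ) (κ ν α β : Fin 4) :
    riemannDown (schw μ) κ ν α β y = -riemannDown (schw μ) κ ν β α y := by
  simp only [riemannDown_eq hμ hy, Fin.sum_univ_four]
  ring

/-- Reduces the check of sixteen index pairs to six; used for the curvature and for the brackets of
the spin tensor. -/
theorem eq_of_skew {p q : Fin 4 → Fin 4 → ℝ} (hp : ∀ i j, p i j = -p j i)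
    (hq : ∀ i j, q i j = -q j i) (h01 : p 0 1 = q 0 1) (h02 : p 0 2 = q 0 2)
    (h03 : p 0 3 = q 0 3) (h12 : p 1 2 = q 1 2) (h13 : p 1 3 = q 1 3) (h23 : p 2 3 = q 2 3)
    (i j : Fin 4) : p i j = q i j := by
  have hd : ∀ i, p i i = q i i := fun i => by linarith [hp i i, hq i i]
  have hs : ∀ i j, p i j = q i j → p j i = q j i := fun i j h => by rw [hp, hq, h]
  fin_cases i <;> fin_cases j
  exacts [hd 0, h01, h02, h03, hs _ _ h01, hd 1, h12, h13, hs _ _ h02, hs _ _ h12, hd 2, h23,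
    hs _ _ h03, hs _ _ h13, hs _ _ h23, hd 3]

-- By spherical symmetry and staticity the curvature is diagonal on bivectors in these coordinates.
-- This is what later reduces the contraction with the spin tensor to one term.
set_option maxHeartbeats 1000000 in
theorem riemannDown_schw (hμ : 0 < μ) (hy : y ∈ chartDomain μ) (κ ν α β : Fin 4) :
    riemannDown (schw μ) κ ν α β y = schwSectional μ y κ ν *
      ((if κ = α then 1 else 0) * (if ν = β then 1 else 0)
        - (if κ = β then 1 else 0) * (if ν = α then 1 else 0)) := by
  have h1 := radius_ne hμ hy
  have h2 := radius_sub_ne hμ hy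
  have h3 := sin_ne hμ hy
  have hs : Real.cos (y 2) ^ 2 = 1 - Real.sin (y 2) ^ 2 := by
    linarith [Real.sin_sq_add_cos_sq (y 2)]
  refine eq_of_skew (p := fun α β => riemannDown (schw μ) κ ν α β y)
    (q := fun α β => schwSectional μ y κ ν * ((if κ = α then 1 else 0) * (if ν = β then 1 else 0)
      - (if κ = β then 1 else 0) * (if ν = α then 1 else 0)))
    (riemannDown_schw_swap hμ hy κ ν) (fun α β => by ring) ?_ ?_ ?_ ?_ ?_ ?_ α β
  all_goals
    simp only [riemannDown_eq hμ hy]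
    fin_cases κ <;> fin_cases ν <;>
      simp [schwChristoffel, schwChristoffelDiff, schwSectional, Fin.sum_univ_succ, -mul_eq_zero,
        -mul_eq_mul_left_iff] <;>
      field_simp <;> (try rw [hs]) <;> ring1

theorem sqrt_lapse_pos (hμ : 0 < μ) (hy : y ∈ chartDomain μ) : 0 < √(lapse μ (y 1)) :=
  Real.sqrt_pos.2 (lapse_pos hμ hy)

theorem sqrt_lapse_sq (hμ : 0 < μ) (hy : y ∈ chartDomain μ) :
    √(lapse μ (y 1)) ^ 2 * y 1 = y 1 - 2 * μ := by
  rw [Real.sq_sqrt (lapse_pos hμ hy).le, lapse_eq (radius_ne hμ hy)]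
  have := radius_ne hμ hy
  field_simp

theorem hasDiff_sqrt_lapse (hμ : 0 < μ) (hy : y ∈ chartDomain μ) :
    HasDiff (fun z : Fin 4 → ℝ => √(lapse μ (z 1)))
      (fun v => μ / (y 1 ^ 2 * √(lapse μ (y 1))) * v 1) y := by
  have h1 := radius_ne hμ hy
  have hs := (sqrt_lapse_pos hμ hy).ne'
  have hl : HasDiff (fun z : Fin 4 → ℝ => lapse μ (z 1)) (fun v => 2 * μ / y 1 ^ 2 * v 1) y :=
    ((HasDiff.const 1).sub ((HasDiff.const (2 * μ)).div (HasDiff.coord 1) h1)).congr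
      fun v => by ring
  refine (hl.sqrt (lapse_pos hμ hy).ne').congr fun v => ?_
  field_simp

/-- The differential of the components of the tetrad. -/
theorem hasDiff_tetrad (hμ : 0 < μ) (hy : y ∈ chartDomain μ) (i j : Fin 4) :
    HasDiff (fun z => tetrad μ z i j) (fun v => (diagonal
      ![-(μ / (y 1 ^ 2 * √(lapse μ (y 1)) ^ 3) * v 1), μ / (y 1 ^ 2 * √(lapse μ (y 1))) * v 1,
        -(v 1 / y 1 ^ 2), -((v 1 * Real.sin (y 2) + y 1 * (Real.cos (y 2) * v 2))
          / (y 1 * Real.sin (y 2)) ^ 2)] : Matrix (Fin 4) (Fin 4) ℝ) i j)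
      y := by
  have h1 := radius_ne hμ hy
  have h3 := sin_ne hμ hy
  have hs := (sqrt_lapse_pos hμ hy).ne'
  by_cases hij : i = j
  · subst hij
    simp only [tetrad, diagonal_apply_eq]
    fin_cases i
    · refine ((HasDiff.const 1).div (hasDiff_sqrt_lapse hμ hy) hs).congr fun v => ?_
      simp
      field_simp
    · exact hasDiff_sqrt_lapse hμ hy
    · exact ((HasDiff.const 1).div (HasDiff.coord 1) h1).congr fun v => by simp; ring
    · refine ((HasDiff.const 1).div ((HasDiff.coord 1).mul (HasDiff.coord 2).sin)
        (mul_ne_zero h1 h3)).congr fun v => by simp; ring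
  · simp only [tetrad, diagonal_apply_ne _ hij]
    exact HasDiff.const 0

/-- The Ricci rotation coefficients of the tetrad. -/
def schwRotation (μ : ℝ) (y : Fin 4 → ℝ) : Fin 4 → Matrix (Fin 4) (Fin 4) ℝ :=
  ![!![0, -(μ / y 1 ^ 2), 0, 0; μ / y 1 ^ 2, 0, 0, 0; 0, 0, 0, 0; 0, 0, 0, 0],
    0,
    !![0, 0, 0, 0; 0, 0, -√(lapse μ (y 1)), 0; 0, √(lapse μ (y 1)), 0, 0; 0, 0, 0, 0],
    !![0, 0, 0, 0; 0, 0, 0, -(√(lapse μ (y 1)) * Real.sin (y 2)); 0, 0, 0, -Real.cos (y 2);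
      0, √(lapse μ (y 1)) * Real.sin (y 2), Real.cos (y 2), 0]]

theorem rotationCoeff_schw (hμ : 0 < μ) (hy : y ∈ chartDomain μ) (α A B : Fin 4) :
    rotationCoeff (schw μ) (tetrad μ) α A B y = schwRotation μ y α A B := by
  have h1 := radius_ne hμ hy
  have h3 := sin_ne hμ hy
  have hs := (sqrt_lapse_pos hμ hy).ne'
  have hsq := sqrt_lapse_sq hμ hy
  have hr : y 1 - 2 * μ = √(lapse μ (y 1)) ^ 2 * y 1 := hsq.symm
  have hl : lapse μ (y 1) = √(lapse μ (y 1)) ^ 2 := (Real.sq_sqrt (lapse_pos hμ hy).le).symm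
  -- With s = √a one has μ = r (1 - s²) / 2. In the variables r and s the claims become rational and
  -- need no rule for square roots; the same substitution is used in the bracket computations below.
  have hm : μ = (y 1 - √(lapse μ (y 1)) ^ 2 * y 1) / 2 := by linarith
  simp only [rotationCoeff, (hasDiff_tetrad hμ hy _ _).pd_eq, christoffel_schw hμ hy]
  simp only [schw, tetrad, schwChristoffel, schwRotation, hr]
  generalize √(lapse μ (y 1)) = s at *
  simp only [hl]
  fin_cases α <;> fin_cases A <;> fin_cases B <;>
    simp [Fin.sum_univ_succ, diagonal, -mul_eq_zero, -mul_eq_mul_left_iff] <;>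
    field_simp <;> try ring1

end Schwarzschild

/-! ### Differentials and Hamiltonian fields of spin and momentum -/

section FullSystem

theorem contDiff_pos : ContDiff ℝ ∞ pos := by
  unfold pos
  fun_prop

theorem isOpen_exterior (μ : ℝ) : IsOpen (exterior μ) :=
  (isOpen_chartDomain μ).preimage contDiff_pos.continuous

/-- The vector field `π^{ij} G_j` of a covector with the given components. -/
def hamVec (x : Full) (gL gM : Fin 3 → ℝ) (gP gy : Fin 4 → ℝ) : Full :=
  Sum.elim
    (Sum.elim (crossProduct gL (vecL x) + crossProduct gM (vecM x))
      (crossProduct gL (vecM x) - crossProduct gM (vecL x)))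
    (Sum.elim (-gy) gP)

section HamVec

variable (x : Full) (gL gM : Fin 3 → ℝ) (gP gy : Fin 4 → ℝ)

theorem vecL_hamVec : vecL (hamVec x gL gM gP gy)
    = crossProduct gL (vecL x) + crossProduct gM (vecM x) := rfl

theorem vecM_hamVec : vecM (hamVec x gL gM gP gy)
    = crossProduct gL (vecM x) - crossProduct gM (vecL x) := rfl

theorem vecP_hamVec : vecP (hamVec x gL gM gP gy) = -gy := rfl

theorem pos_hamVec : pos (hamVec x gL gM gP gy) = gP := rfl

end HamVec

/-- Converts a differential, once its coefficients are read off, into the Hamiltonian field in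
vector form. The coefficients are the partial derivatives by uniqueness of the differential. -/
theorem hamField_of_hasDiff {G : Full → ℝ} {ℓ : Full → ℝ} {x : Full} (h : HasDiff G ℓ x)
    (gL gM : Fin 3 → ℝ) (gP gy : Fin 4 → ℝ)
    (e : ∀ v, ℓ v = ∑ i, gL i * vecL v i + ∑ i, gM i * vecM v i + ∑ i, gP i * vecP v i
      + ∑ i, gy i * pos v i) :
    hamField fullTensor G x = hamVec x gL gM gP gy := by
  have hL : (fun i => pd G (.inl (.inl i)) x) = gL := by
    ext i
    rw [h.pd_eq, e]
    simp [vecL, vecM, vecP, pos, Pi.single_apply]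
  have hM : (fun i => pd G (.inl (.inr i)) x) = gM := by
    ext i
    rw [h.pd_eq, e]
    simp [vecL, vecM, vecP, pos, Pi.single_apply]
  have hP : (fun i => pd G (.inr (.inl i)) x) = gP := by
    ext i
    rw [h.pd_eq, e]
    simp [vecL, vecM, vecP, pos, Pi.single_apply]
  have hy : (fun i => -pd G (.inr (.inr i)) x) = -gy := by
    ext i
    rw [h.pd_eq, e]
    simp [vecL, vecM, vecP, pos, Pi.single_apply]
  rw [hamField_fullTensor, fullEqs, hL, hM, hP, hy]
  rfl

variable {x : Full} {μ : ℝ}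

theorem hasDiff_vecL (i : Fin 3) : HasDiff (fun z => vecL z i) (fun v => vecL v i) x :=
  HasDiff.coord _

theorem hasDiff_vecM (i : Fin 3) : HasDiff (fun z => vecM z i) (fun v => vecM v i) x :=
  HasDiff.coord _

theorem hasDiff_vecP (α : Fin 4) : HasDiff (fun z => vecP z α) (fun v => vecP v α) x :=
  HasDiff.coord _

theorem hasDiff_pos (α : Fin 4) : HasDiff (fun z => pos z α) (fun v => pos v α) x :=
  HasDiff.coord _

theorem HasDiff.comp_pos {f : (Fin 4 → ℝ) → ℝ} {ℓ : (Fin 4 → ℝ) → ℝ} (h : HasDiff f ℓ (pos x)) :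
    HasDiff (fun z => f (pos z)) (fun v => ℓ (pos v)) x :=
  HasDiff.comp (fun a => hasDiff_pos a) h

theorem hasDiff_spinFrame (A B : Fin 4) :
    HasDiff (fun z => spinFrame z A B) (fun v => spinFrame v A B) x := by
  fin_cases A <;> fin_cases B <;>
    first
    | exact HasDiff.const 0
    | exact hasDiff_vecL _
    | exact hasDiff_vecM _
    | exact (hasDiff_vecL _).neg
    | exact (hasDiff_vecM _).neg

theorem spinFrame_skew (x : Full) (A B : Fin 4) : spinFrame x A B = -spinFrame x B A := by
  fin_cases A <;> fin_cases B <;> simp [spinFrame]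

/-- The diagonal entries of the tetrad. -/
def tetradDiag (μ : ℝ) (y : Fin 4 → ℝ) : Fin 4 → ℝ :=
  ![1 / √(lapse μ (y 1)), √(lapse μ (y 1)), 1 / y 1, 1 / (y 1 * Real.sin (y 2))]

/-- The differentials of the diagonal entries of the tetrad. -/
def tetradDiff (μ : ℝ) (y v : Fin 4 → ℝ) : Fin 4 → ℝ :=
  ![-(μ / (y 1 ^ 2 * √(lapse μ (y 1)) ^ 3) * v 1), μ / (y 1 ^ 2 * √(lapse μ (y 1))) * v 1,
    -(v 1 / y 1 ^ 2), -((v 1 * Real.sin (y 2) + y 1 * (Real.cos (y 2) * v 2))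
      / (y 1 * Real.sin (y 2)) ^ 2)]

theorem hasDiff_tetradDiag {y : Fin 4 → ℝ} (hμ : 0 < μ) (hy : y ∈ chartDomain μ) (i : Fin 4) :
    HasDiff (fun z => tetradDiag μ z i) (fun v => tetradDiff μ y v i) y := by
  have := hasDiff_tetrad hμ hy i i
  simp only [tetrad, diagonal_apply_eq] at this
  exact this

theorem tetradDiag_pos {y : Fin 4 → ℝ} (hμ : 0 < μ) (hy : y ∈ chartDomain μ) (i : Fin 4) :
    0 < tetradDiag μ y i := by
  have h1 := radius_pos hμ hy
  have h2 := sqrt_lapse_pos hμ hy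
  have h3 := sin_pos hμ hy
  fin_cases i
  · exact one_div_pos.2 h2
  · exact h2
  · exact one_div_pos.2 h1
  · exact one_div_pos.2 (mul_pos h1 h3)

/-- The tetrad is diagonal, so each component of the spin tensor is one frame component times two
scale factors. -/
theorem spin_eq (μ : ℝ) (α β : Fin 4) (x : Full) :
    spin μ α β x = spinFrame x α β * tetradDiag μ (pos x) α * tetradDiag μ (pos x) β := by
  change ∑ A, ∑ B, spinFrame x A B * diagonal (tetradDiag μ (pos x)) A α
    * diagonal (tetradDiag μ (pos x)) B β = _
  simp [diagonal_apply]

theorem spin_skew (μ : ℝ) (α β : Fin 4) (x : Full) : spin μ α β x = -spin μ β α x := by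
  rw [spin_eq, spin_eq, spinFrame_skew]
  ring

theorem hasDiff_spin (hμ : 0 < μ) (hx : x ∈ exterior μ) (α β : Fin 4) :
    HasDiff (spin μ α β) (fun v =>
      spinFrame v α β * tetradDiag μ (pos x) α * tetradDiag μ (pos x) β
      + spinFrame x α β * (tetradDiff μ (pos x) (pos v) α * tetradDiag μ (pos x) β
        + tetradDiag μ (pos x) α * tetradDiff μ (pos x) (pos v) β)) x := by
  have he : spin μ α β = fun z => spinFrame z α β * tetradDiag μ (pos z) α
    * tetradDiag μ (pos z) β := funext fun z => spin_eq μ α β z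
  rw [he]
  exact (((hasDiff_spinFrame α β).mul (hasDiff_tetradDiag hμ hx α).comp_pos).mul
    (hasDiff_tetradDiag hμ hx β).comp_pos).congr fun v => by ring

/-- The linear momentum in explicit form. -/
theorem mom_eq (hμ : 0 < μ) (hx : x ∈ exterior μ) (α : Fin 4) :
    mom μ α x = ![vecP x 0 - μ / pos x 1 ^ 2 * vecM x 0, vecP x 1,
      vecP x 2 - √(lapse μ (pos x 1)) * vecL x 2,
      vecP x 3 + √(lapse μ (pos x 1)) * Real.sin (pos x 2) * vecL x 1
        - Real.cos (pos x 2) * vecL x 0] α := by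
  simp only [mom, rotationCoeff_schw hμ hx]
  fin_cases α <;> simp [schwRotation, spinFrame, Fin.sum_univ_succ] <;> ring

theorem hasDiff_mom (hμ : 0 < μ) (hx : x ∈ exterior μ) (α : Fin 4) :
    HasDiff (mom μ α) (fun v => ![vecP v 0 - μ / pos x 1 ^ 2 * vecM v 0
        + 2 * μ / pos x 1 ^ 3 * vecM x 0 * pos v 1,
      vecP v 1,
      vecP v 2 - √(lapse μ (pos x 1)) * vecL v 2
        - μ / (pos x 1 ^ 2 * √(lapse μ (pos x 1))) * vecL x 2 * pos v 1,
      vecP v 3 + √(lapse μ (pos x 1)) * Real.sin (pos x 2) * vecL v 1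
        - Real.cos (pos x 2) * vecL v 0
        + μ / (pos x 1 ^ 2 * √(lapse μ (pos x 1))) * Real.sin (pos x 2) * vecL x 1 * pos v 1
        + (√(lapse μ (pos x 1)) * Real.cos (pos x 2) * vecL x 1
          + Real.sin (pos x 2) * vecL x 0) * pos v 2] α) x := by
  have he : mom μ α =ᶠ[𝓝 x] fun x => ![vecP x 0 - μ / pos x 1 ^ 2 * vecM x 0, vecP x 1,
      vecP x 2 - √(lapse μ (pos x 1)) * vecL x 2,
      vecP x 3 + √(lapse μ (pos x 1)) * Real.sin (pos x 2) * vecL x 1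
        - Real.cos (pos x 2) * vecL x 0] α :=
    Filter.eventuallyEq_of_mem ((isOpen_exterior μ).mem_nhds hx) fun z hz => mom_eq hμ hz α
  have h1 : pos x 1 ≠ 0 := radius_ne hμ hx
  have hs := (hasDiff_sqrt_lapse hμ hx).comp_pos
  refine HasDiff.congr_fun ?_ he
  fin_cases α
  · refine ((hasDiff_vecP 0).sub (((HasDiff.const μ).div (hasDiff_pos 1).sq
      (pow_ne_zero 2 h1)).mul (hasDiff_vecM 0))).congr fun v => ?_
    simp
    field_simp
    ring
  · exact hasDiff_vecP 1
  · exact ((hasDiff_vecP 2).sub (hs.mul (hasDiff_vecL 2))).congr fun v => by simp; ring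
  · exact (((hasDiff_vecP 3).add ((hs.mul (hasDiff_pos 2).sin).mul (hasDiff_vecL 1))).sub
      ((hasDiff_pos 2).cos.mul (hasDiff_vecL 0))).congr fun v => by simp; ring

/-- The Hamiltonian vector fields of the linear momenta. -/
theorem hamField_mom (hμ : 0 < μ) (hx : x ∈ exterior μ) (α : Fin 4) :
    hamField fullTensor (mom μ α) x = hamVec x
      (![0, 0, ![0, 0, -√(lapse μ (pos x 1))],
        ![-Real.cos (pos x 2), √(lapse μ (pos x 1)) * Real.sin (pos x 2), 0]] α)
      (![![-(μ / pos x 1 ^ 2), 0, 0], 0, 0, 0] α) (Pi.single α 1)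
      (![![0, 2 * μ / pos x 1 ^ 3 * vecM x 0, 0, 0], 0,
        ![0, -(μ / (pos x 1 ^ 2 * √(lapse μ (pos x 1))) * vecL x 2), 0, 0],
        ![0, μ / (pos x 1 ^ 2 * √(lapse μ (pos x 1))) * Real.sin (pos x 2) * vecL x 1,
          √(lapse μ (pos x 1)) * Real.cos (pos x 2) * vecL x 1
          + Real.sin (pos x 2) * vecL x 0, 0]] α) := by
  refine hamField_of_hasDiff (hasDiff_mom hμ hx α) _ _ _ _ fun v => ?_
  fin_cases α <;> simp [Fin.sum_univ_succ] <;> ring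

/-- The Minkowski metric. -/
def minkowski : Matrix (Fin 4) (Fin 4) ℝ := diagonal ![-1, 1, 1, 1]

theorem hamField_spinFrame (x : Full) (A B : Fin 4) :
    hamField fullTensor (fun z => spinFrame z A B) x = hamVec x
      (!![0, 0, 0, 0; 0, 0, Pi.single 2 1, -Pi.single 1 1; 0, -Pi.single 2 1, 0, Pi.single 0 1;
        0, Pi.single 1 1, -Pi.single 0 1, 0] A B)
      (!![0, Pi.single 0 1, Pi.single 1 1, Pi.single 2 1; -Pi.single 0 1, 0, 0, 0;
        -Pi.single 1 1, 0, 0, 0; -Pi.single 2 1, 0, 0, 0] A B) 0 0 := by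
  refine hamField_of_hasDiff (hasDiff_spinFrame A B) _ _ _ _ fun v => ?_
  fin_cases A <;> fin_cases B <;> simp [Fin.sum_univ_succ, spinFrame]

theorem bracket_spinFrame_swap (x : Full) (F : Full → ℝ) (A B : Fin 4) :
    bracket fullTensor (fun z => spinFrame z A B) F x
      = -bracket fullTensor (fun z => spinFrame z B A) F x := by
  rw [(hasDiff_spinFrame A B).bracket_eq, (hasDiff_spinFrame B A).bracket_eq, spinFrame_skew]

/-- These are the commutation relations of the Lorentz algebra. Skew-symmetry in each index pair,
and of the bracket, leaves only the ordered pairs to check. -/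
theorem bracket_spinFrame (x : Full) (A B C D : Fin 4) :
    bracket fullTensor (fun z => spinFrame z A B) (fun z => spinFrame z C D) x
      = minkowski A C * spinFrame x B D - minkowski A D * spinFrame x B C
        + minkowski B D * spinFrame x A C - minkowski B C * spinFrame x A D := by
  refine eq_of_skew
    (p := fun A B => bracket fullTensor (fun z => spinFrame z A B) (fun z => spinFrame z C D) x)
    (q := fun A B => minkowski A C * spinFrame x B D - minkowski A D * spinFrame x B C
      + minkowski B D * spinFrame x A C - minkowski B C * spinFrame x A D)
    (bracket_spinFrame_swap x _) (fun A B => by ring) ?_ ?_ ?_ ?_ ?_ ?_ A B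
  all_goals
    refine eq_of_skew (p := fun C D => bracket fullTensor _ (fun z => spinFrame z C D) x)
      (q := fun C D => minkowski _ C * spinFrame x _ D - minkowski _ D * spinFrame x _ C
        + minkowski _ D * spinFrame x _ C - minkowski _ C * spinFrame x _ D)
      (fun C D => ?_) (fun C D => by ring) ?_ ?_ ?_ ?_ ?_ ?_ C D
    · rw [bracket_antisymm (fullTensor_skew x), bracket_spinFrame_swap,
        bracket_antisymm (fullTensor_skew x) (fun z => spinFrame z D C), neg_neg]
  all_goals
    simp only [(hasDiff_spinFrame _ _).bracket_eq, hamField_spinFrame]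
    simp [spinFrame, vecL_hamVec, vecM_hamVec, crossProduct, minkowski, diagonal]

end FullSystem

/-! ### The Souriau-Künzle relations -/

section Souriau

variable {x : Full} {μ : ℝ}

theorem schw_inv_apply {y : Fin 4 → ℝ} (hμ : 0 < μ) (hy : y ∈ chartDomain μ) (α β : Fin 4) :
    (schw μ y)⁻¹ α β = minkowski α β * tetradDiag μ y α * tetradDiag μ y β := by
  have h1 := radius_ne hμ hy
  have h3 := sin_ne hμ hy
  have hs := (sqrt_lapse_pos hμ hy).ne'
  have hr : y 1 - 2 * μ = √(lapse μ (y 1)) ^ 2 * y 1 := (sqrt_lapse_sq hμ hy).symm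
  rw [schw_inv hμ hy, hr]
  by_cases h : α = β
  · subst h
    fin_cases α <;> simp [minkowski, tetradDiag] <;> field_simp
  · simp [minkowski, diagonal_apply_ne _ h]

/-- The spin tensor does not involve P, so its Hamiltonian flow leaves the coordinates fixed. -/
theorem hamField_pos_eq_zero_of (hμ : 0 < μ) (hx : x ∈ exterior μ) (κ ν : Fin 4) :
    pos (hamField fullTensor (spin μ κ ν) x) = 0 := by
  ext α
  change hamField fullTensor (spin μ κ ν) x (.inr (.inr α)) = 0
  rw [hamField_fullTensor]
  change pd (spin μ κ ν) (.inr (.inl α)) x = 0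
  rw [(hasDiff_spin hμ hx κ ν).pd_eq]
  have h1 : pos (Pi.single (.inr (.inl α)) 1 : Full) = 0 := by
    ext β
    simp [pos]
  have h2 : spinFrame (Pi.single (.inr (.inl α)) 1 : Full) κ ν = 0 := by
    fin_cases κ <;> fin_cases ν <;> simp [spinFrame, vecL, vecM]
  have h3 : ∀ i, tetradDiff μ (pos x) 0 i = 0 := fun i => by
    fin_cases i <;> simp [tetradDiff]
  rw [h1, h2, h3, h3]
  ring

theorem bracket_pos_spin (hμ : 0 < μ) (hx : x ∈ exterior μ) (α κ ν : Fin 4) :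
    bracket fullTensor (fun z => pos z α) (spin μ κ ν) x = 0 := by
  rw [(hasDiff_pos α).bracket_eq]
  exact congr_fun (hamField_pos_eq_zero_of hμ hx κ ν) α

theorem tetradDiff_zero (y : Fin 4 → ℝ) (i : Fin 4) : tetradDiff μ y 0 i = 0 := by
  fin_cases i <;> simp [tetradDiff]

/-- The scale factors of the tetrad depend on the position only and commute with the frame
components of the spin. -/
theorem bracket_spinFrame_spin (hμ : 0 < μ) (hx : x ∈ exterior μ) (A B κ ν : Fin 4) :
    bracket fullTensor (fun z => spinFrame z A B) (spin μ κ ν) x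
      = bracket fullTensor (fun z => spinFrame z A B) (fun z => spinFrame z κ ν) x
        * tetradDiag μ (pos x) κ * tetradDiag μ (pos x) ν := by
  have hp : pos (hamField fullTensor (fun z => spinFrame z A B) x) = 0 := by
    rw [hamField_spinFrame, pos_hamVec]
  rw [bracket_antisymm (fullTensor_skew x), (hasDiff_spin hμ hx κ ν).bracket_eq, hp,
    tetradDiff_zero, tetradDiff_zero,
    bracket_antisymm (fullTensor_skew x) (fun z => spinFrame z A B),
    (hasDiff_spinFrame κ ν).bracket_eq]
  ring

/-- The Lorentz relations, multiplied by four scale factors: by `schw_inv_apply` these turn the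
Minkowski metric into the inverse metric. -/
theorem bracket_spin_spin (hμ : 0 < μ) (hx : x ∈ exterior μ) (α β κ ν : Fin 4) :
    bracket fullTensor (spin μ α β) (spin μ κ ν) x
      = (schw μ (pos x))⁻¹ α κ * spin μ β ν x - (schw μ (pos x))⁻¹ α ν * spin μ β κ x
        + (schw μ (pos x))⁻¹ β ν * spin μ α κ x - (schw μ (pos x))⁻¹ β κ * spin μ α ν x := by
  have h := bracket_spinFrame_spin hμ hx α β κ ν
  rw [(hasDiff_spinFrame α β).bracket_eq, bracket_spinFrame] at h
  rw [(hasDiff_spin hμ hx α β).bracket_eq, hamField_pos_eq_zero_of hμ hx, h, tetradDiff_zero,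
    tetradDiff_zero]
  simp only [schw_inv_apply hμ hx, spin_eq]
  ring

theorem bracket_pos_mom (hμ : 0 < μ) (hx : x ∈ exterior μ) (α β : Fin 4) :
    bracket fullTensor (fun z => pos z α) (mom μ β) x = if α = β then 1 else 0 := by
  rw [(hasDiff_pos α).bracket_eq, hamField_mom hμ hx, pos_hamVec, Pi.single_apply]

theorem bracket_pos_pos (x : Full) (α β : Fin 4) :
    bracket fullTensor (fun z => pos z α) (fun z => pos z β) x = 0 := by
  rw [(hasDiff_pos α).bracket_eq, hamField_of_hasDiff (hasDiff_pos β) 0 0 0 (Pi.single β 1)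
    fun v => by simp [Pi.single_apply], pos_hamVec, Pi.zero_apply]

/-- Contraction with a curvature-type tensor that is diagonal on bivectors picks out one
antisymmetrized entry. -/
theorem sum_curvature_mul (k : ℝ) (f : Fin 4 → Fin 4 → ℝ) (α β : Fin 4) :
    ∑ c, ∑ l, k * ((if α = c then 1 else 0) * (if β = l then 1 else 0)
      - (if α = l then 1 else 0) * (if β = c then 1 else 0)) * f c l
      = k * (f α β - f β α) := by
  fin_cases α <;> fin_cases β <;> simp [Fin.sum_univ_four] <;> ring

-- The bracket of two momenta is, as for a charge in a gauge field, the curvature of the connection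
-- contracted with the internal charge, here the spin.
set_option maxHeartbeats 1000000 in
theorem bracket_mom_mom (hμ : 0 < μ) (hx : x ∈ exterior μ) (α β : Fin 4) :
    bracket fullTensor (mom μ α) (mom μ β) x
      = -(1 / 2) * ∑ c, ∑ l, riemannDown (schw μ) α β c l (pos x) * spin μ c l x := by
  have h1 : pos x 1 ≠ 0 := radius_ne hμ hx
  have h3 : Real.sin (pos x 2) ≠ 0 := sin_ne hμ hx
  have hs := (sqrt_lapse_pos hμ hx).ne'
  have hr : pos x 1 - 2 * μ = √(lapse μ (pos x 1)) ^ 2 * pos x 1 := (sqrt_lapse_sq hμ hx).symm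
  have hm : μ = (pos x 1 - √(lapse μ (pos x 1)) ^ 2 * pos x 1) / 2 := by linarith
  have hc : Real.cos (pos x 2) ^ 2 = 1 - Real.sin (pos x 2) ^ 2 := by
    linarith [Real.sin_sq_add_cos_sq (pos x 2)]
  have hR : ∑ c, ∑ l, riemannDown (schw μ) α β c l (pos x) * spin μ c l x
      = 2 * schwSectional μ (pos x) α β * spin μ α β x := by
    simp only [riemannDown_schw hμ hx]
    rw [sum_curvature_mul, spin_skew μ β α]
    ring
  rw [hR, (hasDiff_mom hμ hx α).bracket_eq, hamField_mom hμ hx, spin_eq]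
  simp only [vecL_hamVec, vecM_hamVec, vecP_hamVec, pos_hamVec, schwSectional, hr, tetradDiag]
  generalize √(lapse μ (pos x 1)) = s at *
  generalize pos x 1 = r at *
  subst hm
  fin_cases α <;> fin_cases β <;>
    simp [crossProduct, spinFrame, -mul_eq_zero] <;> field_simp <;> (try rw [hc]) <;> try ring1

-- The momentum acts on the spin as parallel transport: a frame rotation by the rotation
-- coefficients and the derivative of the scale factors add up to the Christoffel terms.
set_option maxHeartbeats 2000000 in
theorem bracket_spin_mom (hμ : 0 < μ) (hx : x ∈ exterior μ) (α β κ : Fin 4) :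
    bracket fullTensor (spin μ α β) (mom μ κ) x
      = -(∑ l, christoffel (schw μ) α l κ (pos x) * spin μ l β x)
        - ∑ l, christoffel (schw μ) β l κ (pos x) * spin μ α l x := by
  have h1 : pos x 1 ≠ 0 := radius_ne hμ hx
  have h3 : Real.sin (pos x 2) ≠ 0 := sin_ne hμ hx
  have hs := (sqrt_lapse_pos hμ hx).ne'
  have hr : pos x 1 - 2 * μ = √(lapse μ (pos x 1)) ^ 2 * pos x 1 := (sqrt_lapse_sq hμ hx).symm
  have hm : μ = (pos x 1 - √(lapse μ (pos x 1)) ^ 2 * pos x 1) / 2 := by linarith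
  have hc : Real.cos (pos x 2) ^ 2 = 1 - Real.sin (pos x 2) ^ 2 := by
    linarith [Real.sin_sq_add_cos_sq (pos x 2)]
  refine eq_of_skew (p := fun α β => bracket fullTensor (spin μ α β) (mom μ κ) x)
    (q := fun α β => -(∑ l, christoffel (schw μ) α l κ (pos x) * spin μ l β x)
      - ∑ l, christoffel (schw μ) β l κ (pos x) * spin μ α l x)
    (fun α β => ?_) (fun α β => ?_) ?_ ?_ ?_ ?_ ?_ ?_ α β
  · rw [(hasDiff_spin hμ hx α β).bracket_eq, (hasDiff_spin hμ hx β α).bracket_eq,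
      spinFrame_skew _ α β, spinFrame_skew x α β]
    ring
  · have h := fun l => spin_skew μ l β x
    have h' := fun l => spin_skew μ α l x
    simp only [h, h', mul_neg, Finset.sum_neg_distrib]
    ring
  all_goals
    simp only [(hasDiff_spin hμ hx _ _).bracket_eq, hamField_mom hμ hx]
    simp only [christoffel_schw hμ hx, spin_eq, pos_hamVec, schwChristoffel, tetradDiff, tetradDiag,
      hr, Fin.sum_univ_four]
    clear hx
    generalize √(lapse μ (pos x 1)) = s at *
    generalize pos x 1 = r at *
    subst hm
    fin_cases κ <;>
      simp [crossProduct, spinFrame, vecL_hamVec, vecM_hamVec, -mul_eq_zero] <;> field_simp <;>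
      try ring1

end Souriau

/-! ### Leibniz rules for brackets -/

section Brackets

variable {ι : Type} [Fintype ι] [DecidableEq ι] {π : (ι → ℝ) → Matrix ι ι ℝ}
  {F G K : (ι → ℝ) → ℝ} {x : ι → ℝ}

/-- The mirror image of `HasDiff.bracket_eq`, with the explicit differential taken of the second
argument. -/
theorem bracket_eq_apply (hπ : ∀ i j, π x i j = -π x j i) (F : (ι → ℝ) → ℝ)
    {ℓ : (ι → ℝ) → ℝ} (hG : HasDiff G ℓ x) :
    bracket π F G x = ℓ (-hamField π F x) := by
  have h := hG.bracket_eq π F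
  obtain ⟨G', h1, h2⟩ := hG
  rw [bracket_antisymm hπ, h, ← h2, ← h2, map_neg]

theorem bracket_mul_right (hG : DifferentiableAt ℝ G x) (hK : DifferentiableAt ℝ K x) :
    bracket π F (fun z => G z * K z) x = bracket π F G x * K x + G x * bracket π F K x := by
  have h : ∀ j, pd (fun z => G z * K z) j x = pd G j x * K x + G x * pd K j x := fun j =>
    ((HasDiff.of_differentiableAt hG).mul (HasDiff.of_differentiableAt hK)).pd_eq j
  simp only [bracket, h, Finset.sum_mul, Finset.mul_sum, ← Finset.sum_add_distrib]
  exact Finset.sum_congr rfl fun i _ => Finset.sum_congr rfl fun j _ => by ring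

theorem bracket_add_right (hG : DifferentiableAt ℝ G x) (hK : DifferentiableAt ℝ K x) :
    bracket π F (fun z => G z + K z) x = bracket π F G x + bracket π F K x := by
  have h : ∀ j, pd (fun z => G z + K z) j x = pd G j x + pd K j x := fun j =>
    ((HasDiff.of_differentiableAt hG).add (HasDiff.of_differentiableAt hK)).pd_eq j
  simp only [bracket, h, ← Finset.sum_add_distrib]
  exact Finset.sum_congr rfl fun i _ => Finset.sum_congr rfl fun j _ => by ring

theorem bracket_sum_right {α : Type} (s : Finset α) {G : α → (ι → ℝ) → ℝ}
    (hG : ∀ a ∈ s, DifferentiableAt ℝ (G a) x) :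
    bracket π F (fun z => ∑ a ∈ s, G a z) x = ∑ a ∈ s, bracket π F (G a) x := by
  have h : ∀ j, pd (fun z => ∑ a ∈ s, G a z) j x = ∑ a ∈ s, pd (G a) j x := fun j =>
    (HasDiff.sum s fun a ha => HasDiff.of_differentiableAt (hG a ha)).pd_eq j
  simp only [bracket, h, Finset.mul_sum]
  rw [Finset.sum_congr rfl fun i _ => Finset.sum_comm, Finset.sum_comm]

theorem bracket_const_mul_right (c : ℝ) (hG : DifferentiableAt ℝ G x) :
    bracket π F (fun z => c * G z) x = c * bracket π F G x := by
  have h : ∀ j, pd (fun z => c * G z) j x = c * pd G j x := fun j =>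
    (((HasDiff.const c).mul (HasDiff.of_differentiableAt hG)).congr
      (k := fun v => c * fderiv ℝ G x v) fun v => by ring).pd_eq j
  simp only [bracket, h, Finset.mul_sum]
  exact Finset.sum_congr rfl fun i _ => Finset.sum_congr rfl fun j _ => by ring

end Brackets

/-! ### The Hamiltonian as a constrained system with multipliers -/

section Hamiltonian

variable {x : Full} {m μ : ℝ}

/-- The contraction `R_{αβκν} S^{κν}`. -/
def spinCurv (μ : ℝ) (α β : Fin 4) (x : Full) : ℝ :=
  ∑ κ, ∑ ν, riemannDown (schw μ) α β κ ν (pos x) * spin μ κ ν x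

/-- The covector `R_{αβκν} p^β S^{κν}`. -/
def tidal (μ : ℝ) (α : Fin 4) (x : Full) : ℝ := ∑ β, spinCurv μ α β x * momUp μ β x

/-- The denominator `d + 2 p²` of the Hamiltonian. -/
def denom (μ : ℝ) (x : Full) : ℝ := curvScalar μ x + 2 * momSq μ x

theorem spinCurv_eq (hμ : 0 < μ) (hx : x ∈ exterior μ) (α β : Fin 4) :
    spinCurv μ α β x = 2 * schwSectional μ (pos x) α β * spin μ α β x := by
  simp only [spinCurv, riemannDown_schw hμ hx]
  rw [sum_curvature_mul, spin_skew μ β α]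
  ring

theorem bracket_mom_mom' (hμ : 0 < μ) (hx : x ∈ exterior μ) (α β : Fin 4) :
    bracket fullTensor (mom μ α) (mom μ β) x = -(1 / 2) * spinCurv μ α β x :=
  bracket_mom_mom hμ hx α β

/-- Since S^{αγ} p_α = -f^γ, the quotient in the Hamiltonian is linear in f up to its coefficients.
The coefficients are the multipliers `mult`. -/
theorem ham_eq (m μ : ℝ) (x : Full) :
    ham m μ x = 1 / (2 * m) * momSq μ x
      + ∑ γ, tulczyjew μ γ x * (tidal μ γ x / (m * denom μ x)) := by
  have h : ∑ α, ∑ β, curvSpin μ α β x * mom μ α x * momUp μ β x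
      = -∑ γ, tulczyjew μ γ x * tidal μ γ x := by
    have h1 : ∀ α β, curvSpin μ α β x = ∑ c, spin μ α c x * spinCurv μ c β x := fun α β => by
      simp only [curvSpin, spinCurv, Finset.mul_sum, mul_assoc]
    have h2 : ∀ γ, tulczyjew μ γ x = -∑ β, spin μ β γ x * mom μ β x := fun γ => by
      simp only [tulczyjew, spin_skew μ γ, neg_mul, Finset.sum_neg_distrib]
    simp only [h1, h2, tidal, Fin.sum_univ_four]
    ring
  rw [ham, h, denom, neg_div]
  simp only [← mul_div_assoc, ← Finset.sum_div]
  ring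

/-- The Christoffel symbols are symmetric. -/
theorem schwChristoffel_symm (μ : ℝ) (y : Fin 4 → ℝ) (α β ν : Fin 4) :
    schwChristoffel μ y α β ν = schwChristoffel μ y α ν β := by
  fin_cases α <;> fin_cases β <;> fin_cases ν <;> simp [schwChristoffel]

theorem christoffel_symm (hμ : 0 < μ) (hx : x ∈ exterior μ) (α β ν : Fin 4) :
    christoffel (schw μ) α β ν (pos x) = christoffel (schw μ) α ν β (pos x) := by
  rw [christoffel_schw hμ hx, christoffel_schw hμ hx, schwChristoffel_symm]

/-- The inverse metric is covariantly constant. -/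
theorem hasDiff_schw_inv {y : Fin 4 → ℝ} (hμ : 0 < μ) (hy : y ∈ chartDomain μ) (α β : Fin 4) :
    HasDiff (fun z => (schw μ z)⁻¹ α β) (fun v =>
      -(∑ κ, ∑ l, christoffel (schw μ) α κ l y * (schw μ y)⁻¹ l β * v κ)
      - ∑ κ, ∑ l, christoffel (schw μ) β κ l y * (schw μ y)⁻¹ α l * v κ) y := by
  have h1 := radius_ne hμ hy
  have h2 := radius_sub_ne hμ hy
  have h3 := sin_ne hμ hy
  have he : (fun z => (schw μ z)⁻¹ α β) =ᶠ[𝓝 y] fun z => (diagonal ![-(z 1 / (z 1 - 2 * μ)),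
      (z 1 - 2 * μ) / z 1, 1 / z 1 ^ 2, 1 / (z 1 ^ 2 * Real.sin (z 2) ^ 2)] :
        Matrix (Fin 4) (Fin 4) ℝ) α β :=
    Filter.eventuallyEq_of_mem ((isOpen_chartDomain μ).mem_nhds hy)
      fun z hz => by
        change (schw μ z)⁻¹ α β = _
        rw [schw_inv hμ hz]
  have hsub : HasDiff (fun z : Fin 4 → ℝ => z 1 - 2 * μ) (fun v => v 1) y :=
    ((HasDiff.coord 1).sub (HasDiff.const _)).congr fun v => by ring
  refine HasDiff.congr_fun ?_ he
  simp only [christoffel_schw hμ hy, schw_inv hμ hy]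
  by_cases h : α = β
  · subst h
    simp only [diagonal_apply_eq]
    fin_cases α
    · refine ((HasDiff.coord 1).div hsub h2).neg.congr fun v => ?_
      simp [schwChristoffel, Fin.sum_univ_succ]
      field_simp
      ring
    · refine (hsub.div (HasDiff.coord 1) h1).congr fun v => ?_
      simp [schwChristoffel, Fin.sum_univ_succ]
      field_simp
      ring
    · refine ((HasDiff.const 1).div (HasDiff.coord 1).sq (pow_ne_zero 2 h1)).congr fun v => ?_
      simp [schwChristoffel, Fin.sum_univ_succ]
      field_simp
      ring
    · refine ((HasDiff.const 1).div ((HasDiff.coord 1).sq.mul (HasDiff.coord 2).sin.sq)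
        (mul_ne_zero (pow_ne_zero 2 h1) (pow_ne_zero 2 h3))).congr fun v => ?_
      simp [schwChristoffel, Fin.sum_univ_succ]
      field_simp
      ring
  · simp only [diagonal_apply_ne _ h]
    refine (HasDiff.const 0).congr fun v => ?_
    fin_cases α <;> fin_cases β <;> simp at h <;>
      simp [schwChristoffel, Fin.sum_univ_succ] <;> (field_simp; try ring1)

theorem hasDiff_momUp (hμ : 0 < μ) (hx : x ∈ exterior μ) (α : Fin 4) :
    HasDiff (momUp μ α) (fun v => ∑ β, ((schw μ (pos x))⁻¹ α β * fderiv ℝ (mom μ β) x v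
      - (∑ κ, ∑ l, christoffel (schw μ) α κ l (pos x) * (schw μ (pos x))⁻¹ l β * pos v κ)
        * mom μ β x
      - (∑ κ, ∑ l, christoffel (schw μ) β κ l (pos x) * (schw μ (pos x))⁻¹ α l * pos v κ)
        * mom μ β x)) x := by
  refine (HasDiff.sum Finset.univ fun β _ => (hasDiff_schw_inv hμ hx α β).comp_pos.mul
    (HasDiff.of_differentiableAt (hasDiff_mom hμ hx β).differentiableAt)).congr fun v => ?_
  exact Finset.sum_congr rfl fun β _ => by ring

theorem differentiableAt_spin (hμ : 0 < μ) (hx : x ∈ exterior μ) (α β : Fin 4) :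
    DifferentiableAt ℝ (spin μ α β) x := (hasDiff_spin hμ hx α β).differentiableAt

theorem differentiableAt_mom (hμ : 0 < μ) (hx : x ∈ exterior μ) (α : Fin 4) :
    DifferentiableAt ℝ (mom μ α) x := (hasDiff_mom hμ hx α).differentiableAt

theorem differentiableAt_momUp (hμ : 0 < μ) (hx : x ∈ exterior μ) (α : Fin 4) :
    DifferentiableAt ℝ (momUp μ α) x := (hasDiff_momUp hμ hx α).differentiableAt

theorem differentiableAt_tulczyjew (hμ : 0 < μ) (hx : x ∈ exterior μ) (α : Fin 4) :
    DifferentiableAt ℝ (tulczyjew μ α) x :=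
  (HasDiff.sum Finset.univ fun β _ =>
    (HasDiff.of_differentiableAt (differentiableAt_spin hμ hx α β)).mul
      (HasDiff.of_differentiableAt (differentiableAt_mom hμ hx β))).differentiableAt

section General

variable (F : Full → ℝ)

/-- The inverse metric is covariantly constant; its derivative therefore appears as one Christoffel
correction on the lower index and one on the upper. -/
theorem bracket_momUp (hμ : 0 < μ) (hx : x ∈ exterior μ) (α : Fin 4) :
    bracket fullTensor F (momUp μ α) x
      = ∑ β, (schw μ (pos x))⁻¹ α β * (bracket fullTensor F (mom μ β) x
        - ∑ κ, ∑ l, christoffel (schw μ) l κ β (pos x) * mom μ l x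
          * bracket fullTensor F (fun z => pos z κ) x)
        - ∑ κ, ∑ l, christoffel (schw μ) α κ l (pos x) * momUp μ l x
          * bracket fullTensor F (fun z => pos z κ) x := by
  have hp : ∀ κ, pos (-hamField fullTensor F x) κ = bracket fullTensor F (fun z => pos z κ) x :=
    fun κ => (bracket_eq_apply (fullTensor_skew x) F (hasDiff_pos κ)).symm
  have hm : ∀ β, fderiv ℝ (mom μ β) x (-hamField fullTensor F x)
      = bracket fullTensor F (mom μ β) x := fun β =>
    (bracket_eq_apply (fullTensor_skew x) F
      (HasDiff.of_differentiableAt (differentiableAt_mom hμ hx β))).symm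
  rw [bracket_eq_apply (fullTensor_skew x) F (hasDiff_momUp hμ hx α)]
  simp only [hp, hm, momUp, Fin.sum_univ_four]
  ring

/-- Metric compatibility: in p² the Christoffel terms of the raised index combine with the plain
brackets, so that only the covariant derivative of p_β is left, and both factors contribute equally.
-/
theorem bracket_momSq (hμ : 0 < μ) (hx : x ∈ exterior μ) :
    bracket fullTensor F (momSq μ) x
      = 2 * ∑ β, momUp μ β x * (bracket fullTensor F (mom μ β) x
        - ∑ κ, ∑ l, christoffel (schw μ) l κ β (pos x) * mom μ l x
          * bracket fullTensor F (fun z => pos z κ) x) := by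
  have hs : ∀ α β, (schw μ (pos x))⁻¹ α β = (schw μ (pos x))⁻¹ β α := fun α β => by
    rw [schw_inv hμ hx, diagonal_apply, diagonal_apply]
    by_cases h : α = β
    · rw [h]
    · simp [h, Ne.symm h]
  change bracket fullTensor F (fun z => ∑ α, mom μ α z * momUp μ α z) x = _
  have hd : ∀ α ∈ Finset.univ, DifferentiableAt ℝ (fun z => mom μ α z * momUp μ α z) x :=
    fun α _ => (differentiableAt_mom hμ hx α).mul (differentiableAt_momUp hμ hx α)
  rw [bracket_sum_right _ hd]
  simp only [bracket_mul_right (differentiableAt_mom hμ hx _) (differentiableAt_momUp hμ hx _),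
    bracket_momUp F hμ hx]
  generalize hA : (fun β => bracket fullTensor F (mom μ β) x
        - ∑ κ, ∑ l, christoffel (schw μ) l κ β (pos x) * mom μ l x
          * bracket fullTensor F (fun z => pos z κ) x) = A
  have hA' : ∀ β, bracket fullTensor F (mom μ β) x
        - ∑ κ, ∑ l, christoffel (schw μ) l κ β (pos x) * mom μ l x
          * bracket fullTensor F (fun z => pos z κ) x = A β := fun β => congr_fun hA β
  have hB : ∀ β, bracket fullTensor F (mom μ β) x
      = A β + ∑ κ, ∑ l, christoffel (schw μ) l κ β (pos x) * mom μ l x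
          * bracket fullTensor F (fun z => pos z κ) x := fun β => by
    rw [← hA']
    ring
  -- The inverse metric is symmetric, so the index may be raised on either factor.
  have hC : ∑ α, mom μ α x * ∑ β, (schw μ (pos x))⁻¹ α β * A β = ∑ β, momUp μ β x * A β := by
    simp only [momUp, Finset.mul_sum, Finset.sum_mul]
    rw [Finset.sum_comm]
    exact Finset.sum_congr rfl fun β _ => Finset.sum_congr rfl fun α _ => by rw [hs α β]; ring
  simp only [hA', mul_sub, Finset.sum_add_distrib, Finset.sum_sub_distrib, hC]
  simp only [hB, Fin.sum_univ_four]
  ring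

theorem bracket_tulczyjew (hμ : 0 < μ) (hx : x ∈ exterior μ) (γ : Fin 4) :
    bracket fullTensor F (tulczyjew μ γ) x
      = ∑ β, (bracket fullTensor F (spin μ γ β) x * mom μ β x
        + spin μ γ β x * bracket fullTensor F (mom μ β) x) := by
  change bracket fullTensor F (fun z => ∑ β, spin μ γ β z * mom μ β z) x = _
  have hd : ∀ β ∈ Finset.univ, DifferentiableAt ℝ (fun z => spin μ γ β z * mom μ β z) x :=
    fun β _ => (differentiableAt_spin hμ hx γ β).mul (differentiableAt_mom hμ hx β)
  rw [bracket_sum_right _ hd]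
  simp only [bracket_mul_right (differentiableAt_spin hμ hx _ _) (differentiableAt_mom hμ hx _)]

end General

/-- The multipliers of the components of the Tulczyjew vector in the Hamiltonian. -/
def mult (m μ : ℝ) (γ : Fin 4) (x : Full) : ℝ := tidal μ γ x / (m * denom μ x)

/-- The velocity on the Tulczyjew manifold. -/
def velocity (m μ : ℝ) (α : Fin 4) (x : Full) : ℝ :=
  momUp μ α x / m + ∑ γ, mult m μ γ x * spin μ γ α x

/-- The bracket with the Hamiltonian for constant multipliers. -/
def mainBracket (m μ : ℝ) (F : Full → ℝ) (x : Full) : ℝ :=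
  1 / (2 * m) * bracket fullTensor F (momSq μ) x
    + ∑ γ, mult m μ γ x * bracket fullTensor F (tulczyjew μ γ) x

theorem bracket_pos_momSq (hμ : 0 < μ) (hx : x ∈ exterior μ) (κ : Fin 4) :
    bracket fullTensor (fun z => pos z κ) (momSq μ) x = 2 * momUp μ κ x := by
  rw [bracket_momSq _ hμ hx]
  simp [bracket_pos_mom hμ hx, bracket_pos_pos]

theorem bracket_pos_tulczyjew (hμ : 0 < μ) (hx : x ∈ exterior μ) (κ γ : Fin 4) :
    bracket fullTensor (fun z => pos z κ) (tulczyjew μ γ) x = spin μ γ κ x := by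
  rw [bracket_tulczyjew _ hμ hx]
  simp [bracket_pos_mom hμ hx, bracket_pos_spin hμ hx]

/-- {y, p²} = 2p and {y^κ, f^γ} = S^{γκ}; this identifies `velocity` as the time derivative of the
position when f = 0. -/
theorem mainBracket_pos (hm : m ≠ 0) (hμ : 0 < μ) (hx : x ∈ exterior μ) (κ : Fin 4) :
    mainBracket m μ (fun z => pos z κ) x = velocity m μ κ x := by
  simp only [mainBracket, bracket_pos_momSq hμ hx, bracket_pos_tulczyjew hμ hx, velocity]
  field_simp

theorem bracket_mom_pos (hμ : 0 < μ) (hx : x ∈ exterior μ) (α β : Fin 4) :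
    bracket fullTensor (mom μ α) (fun z => pos z β) x = if α = β then -1 else 0 := by
  rw [bracket_antisymm (fullTensor_skew x), bracket_pos_mom hμ hx]
  by_cases h : α = β
  · simp [h]
  · simp [h, Ne.symm h]

theorem bracket_mom_momSq (hμ : 0 < μ) (hx : x ∈ exterior μ) (κ : Fin 4) :
    bracket fullTensor (mom μ κ) (momSq μ) x
      = -tidal μ κ x
        + 2 * ∑ β, ∑ l, christoffel (schw μ) l κ β (pos x) * momUp μ β x * mom μ l x := by
  rw [bracket_momSq _ hμ hx]
  have h : ∀ β : Fin 4, ∑ k : Fin 4, ∑ l, christoffel (schw μ) l k β (pos x) * mom μ l x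
      * (if κ = k then -1 else 0)
      = -∑ l, christoffel (schw μ) l κ β (pos x) * mom μ l x := fun β => by
    fin_cases κ <;> simp [Fin.sum_univ_four] <;> ring
  simp only [bracket_mom_mom' hμ hx, bracket_mom_pos hμ hx, h, tidal]
  simp only [Fin.sum_univ_four]
  ring

theorem bracket_mom_tulczyjew (hμ : 0 < μ) (hx : x ∈ exterior μ) (κ γ : Fin 4) :
    bracket fullTensor (mom μ κ) (tulczyjew μ γ) x
      = ∑ l, christoffel (schw μ) γ l κ (pos x) * tulczyjew μ l x
        + ∑ β, (spin μ γ β x * ∑ l, christoffel (schw μ) l β κ (pos x) * mom μ l x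
          - 1 / 2 * spin μ γ β x * spinCurv μ κ β x) := by
  rw [bracket_tulczyjew _ hμ hx]
  simp only [bracket_mom_mom' hμ hx, bracket_antisymm (fullTensor_skew x) (mom μ κ) (spin μ _ _),
    bracket_spin_mom hμ hx, tulczyjew, Fin.sum_univ_four]
  ring

/-- The curvature and Christoffel contributions of p² and of f enter with the coefficients p/m and
λS, which are the two summands of the velocity. The last sum is what is left over away from f = 0.
-/
theorem mainBracket_mom (hm : m ≠ 0) (hμ : 0 < μ) (hx : x ∈ exterior μ) (κ : Fin 4) :
    mainBracket m μ (mom μ κ) x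
      = ∑ δ, velocity m μ δ x * (∑ l, christoffel (schw μ) l κ δ (pos x) * mom μ l x
          - 1 / 2 * spinCurv μ κ δ x)
        + ∑ γ, ∑ l, mult m μ γ x * christoffel (schw μ) γ l κ (pos x) * tulczyjew μ l x := by
  have hs : ∀ l β, christoffel (schw μ) l β κ (pos x) = christoffel (schw μ) l κ β (pos x) :=
    fun l β => christoffel_symm hμ hx l β κ
  simp only [mainBracket, bracket_mom_momSq hμ hx, bracket_mom_tulczyjew hμ hx, velocity, tidal,
    hs, Fin.sum_univ_four]
  field_simp
  ring

theorem bracket_spin_pos (hμ : 0 < μ) (hx : x ∈ exterior μ) (α β κ : Fin 4) :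
    bracket fullTensor (spin μ α β) (fun z => pos z κ) x = 0 := by
  rw [bracket_antisymm (fullTensor_skew x), bracket_pos_spin hμ hx, neg_zero]

theorem bracket_spin_momSq (hμ : 0 < μ) (hx : x ∈ exterior μ) (α β : Fin 4) :
    bracket fullTensor (spin μ α β) (momSq μ) x
      = -2 * ∑ δ, ∑ l, momUp μ δ x * (christoffel (schw μ) α l δ (pos x) * spin μ l β x
        + christoffel (schw μ) β l δ (pos x) * spin μ α l x) := by
  rw [bracket_momSq _ hμ hx]
  simp only [bracket_spin_mom hμ hx, bracket_spin_pos hμ hx, Fin.sum_univ_four]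
  ring

theorem bracket_spin_tulczyjew (hμ : 0 < μ) (hx : x ∈ exterior μ) (α β γ : Fin 4) :
    bracket fullTensor (spin μ α β) (tulczyjew μ γ) x
      = (schw μ (pos x))⁻¹ α γ * tulczyjew μ β x - momUp μ α x * spin μ β γ x
        + momUp μ β x * spin μ α γ x - (schw μ (pos x))⁻¹ β γ * tulczyjew μ α x
        - ∑ δ, ∑ l, spin μ γ δ x * (christoffel (schw μ) α l δ (pos x) * spin μ l β x
          + christoffel (schw μ) β l δ (pos x) * spin μ α l x) := by
  rw [bracket_tulczyjew _ hμ hx]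
  simp only [bracket_spin_mom hμ hx, bracket_spin_spin hμ hx, tulczyjew, momUp, Fin.sum_univ_four]
  ring

/-- The Christoffel terms again assemble to transport along the velocity. The remaining sum comes
from the Lorentz brackets of S with f = Sp; at f = 0 it becomes p ∧ u. -/
theorem mainBracket_spin (hm : m ≠ 0) (hμ : 0 < μ) (hx : x ∈ exterior μ) (α β : Fin 4) :
    mainBracket m μ (spin μ α β) x
      = -∑ δ, ∑ l, velocity m μ δ x * (christoffel (schw μ) α l δ (pos x) * spin μ l β x
          + christoffel (schw μ) β l δ (pos x) * spin μ α l x)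
        + ∑ γ, mult m μ γ x * ((schw μ (pos x))⁻¹ α γ * tulczyjew μ β x
          - momUp μ α x * spin μ β γ x + momUp μ β x * spin μ α γ x
          - (schw μ (pos x))⁻¹ β γ * tulczyjew μ α x) := by
  simp only [mainBracket, bracket_spin_momSq hμ hx, bracket_spin_tulczyjew hμ hx, velocity,
    Fin.sum_univ_four]
  field_simp
  ring

end Hamiltonian

/-! ### Smoothness in the full phase space -/

section Smoothness

variable {x : Full} {m μ : ℝ}

theorem contDiffAt_coord {ι : Type} [Fintype ι] {z : ι → ℝ} (i : ι) :
    ContDiffAt ℝ ∞ (fun z : ι → ℝ => z i) z := contDiffAt_apply ℝ ℝ i z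

theorem contDiffAt_sqrt_lapse (hμ : 0 < μ) (hx : x ∈ exterior μ) :
    ContDiffAt ℝ ∞ (fun z : Full => √(lapse μ (pos z 1))) x := by
  have h1 : pos x 1 ≠ 0 := radius_ne hμ hx
  refine ContDiffAt.sqrt ?_ (lapse_pos hμ hx).ne'
  exact contDiffAt_const.sub (contDiffAt_const.div (contDiffAt_coord _) h1)

theorem contDiffAt_spinFrame (A B : Fin 4) : ContDiffAt ℝ ∞ (fun z => spinFrame z A B) x := by
  fin_cases A <;> fin_cases B <;>
    first
    | exact contDiffAt_const
    | exact contDiffAt_coord _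
    | exact (contDiffAt_coord _).neg

theorem contDiffAt_tetradDiag (hμ : 0 < μ) (hx : x ∈ exterior μ) (i : Fin 4) :
    ContDiffAt ℝ ∞ (fun z => tetradDiag μ (pos z) i) x := by
  have h1 : pos x 1 ≠ 0 := radius_ne hμ hx
  have h3 : Real.sin (pos x 2) ≠ 0 := sin_ne hμ hx
  fin_cases i
  · exact contDiffAt_const.div (contDiffAt_sqrt_lapse hμ hx) (sqrt_lapse_pos hμ hx).ne'
  · exact contDiffAt_sqrt_lapse hμ hx
  · exact contDiffAt_const.div (contDiffAt_coord _) h1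
  · exact contDiffAt_const.div ((contDiffAt_coord _).mul
      (Real.contDiff_sin.contDiffAt.comp x (contDiffAt_coord _))) (mul_ne_zero h1 h3)

theorem contDiffAt_spin (hμ : 0 < μ) (hx : x ∈ exterior μ) (α β : Fin 4) :
    ContDiffAt ℝ ∞ (spin μ α β) x := by
  have he : spin μ α β = fun z => spinFrame z α β * tetradDiag μ (pos z) α
    * tetradDiag μ (pos z) β := funext fun z => spin_eq μ α β z
  rw [he]
  exact ((contDiffAt_spinFrame α β).mul (contDiffAt_tetradDiag hμ hx α)).mul
    (contDiffAt_tetradDiag hμ hx β)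

theorem eventuallyEq_of_exterior {F G : Full → ℝ} (hx : x ∈ exterior μ)
    (h : ∀ z ∈ exterior μ, F z = G z) : F =ᶠ[𝓝 x] G :=
  Filter.eventuallyEq_of_mem ((isOpen_exterior μ).mem_nhds hx) h

theorem contDiffAt_mom (hμ : 0 < μ) (hx : x ∈ exterior μ) (α : Fin 4) :
    ContDiffAt ℝ ∞ (mom μ α) x := by
  have h1 : pos x 1 ≠ 0 := radius_ne hμ hx
  have hs := contDiffAt_sqrt_lapse hμ hx
  refine ContDiffAt.congr_of_eventuallyEq ?_
    (eventuallyEq_of_exterior hx fun z hz => mom_eq hμ hz α)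
  fin_cases α
  · have hr : ContDiffAt ℝ ∞ (fun z : Full => pos z 1) x := contDiffAt_coord _
    have hq : ContDiffAt ℝ ∞ (fun z : Full => μ / pos z 1 ^ 2) x :=
      contDiffAt_const.div (hr.pow 2) (pow_ne_zero 2 h1)
    exact (contDiffAt_coord _).sub (hq.mul (contDiffAt_coord _))
  · exact contDiffAt_coord _
  · exact (contDiffAt_coord _).sub (hs.mul (contDiffAt_coord _))
  · exact ((contDiffAt_coord _).add ((hs.mul (Real.contDiff_sin.contDiffAt.comp x
      (contDiffAt_coord _))).mul (contDiffAt_coord _))).sub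
      ((Real.contDiff_cos.contDiffAt.comp x (contDiffAt_coord _)).mul (contDiffAt_coord _))

theorem contDiffAt_momUp (hμ : 0 < μ) (hx : x ∈ exterior μ) (α : Fin 4) :
    ContDiffAt ℝ ∞ (momUp μ α) x := by
  refine ContDiffAt.congr_of_eventuallyEq (f := fun z => ∑ β, minkowski α β
    * tetradDiag μ (pos z) α * tetradDiag μ (pos z) β * mom μ β z) ?_
    (eventuallyEq_of_exterior hx fun z hz => ?_)
  · exact ContDiffAt.sum fun β _ => ((contDiffAt_const.mul (contDiffAt_tetradDiag hμ hx α)).mul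
      (contDiffAt_tetradDiag hμ hx β)).mul (contDiffAt_mom hμ hx β)
  · simp only [momUp, schw_inv_apply hμ hz]

theorem contDiffAt_momSq (hμ : 0 < μ) (hx : x ∈ exterior μ) : ContDiffAt ℝ ∞ (momSq μ) x :=
  ContDiffAt.sum fun α _ => (contDiffAt_mom hμ hx α).mul (contDiffAt_momUp hμ hx α)

theorem contDiffAt_tulczyjew (hμ : 0 < μ) (hx : x ∈ exterior μ) (α : Fin 4) :
    ContDiffAt ℝ ∞ (tulczyjew μ α) x :=
  ContDiffAt.sum fun β _ => (contDiffAt_spin hμ hx α β).mul (contDiffAt_mom hμ hx β)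

/-- The sectional components of the curvature in the tetrad, up to the factor `μ / r³`. -/
def tidalMatrix : Matrix (Fin 4) (Fin 4) ℝ :=
  !![0, -2, 1, 1; -2, 0, -1, -1; 1, -1, 0, 2; 1, -1, 2, 0]

/-- In the orthonormal tetrad the tidal eigenvalues are constant multiples of μ/r³. All curvature
identities below are checked in this form. -/
theorem schwSectional_mul {y : Fin 4 → ℝ} (hμ : 0 < μ) (hy : y ∈ chartDomain μ) (β δ : Fin 4) :
    schwSectional μ y β δ * tetradDiag μ y β ^ 2 * tetradDiag μ y δ ^ 2
      = μ / y 1 ^ 3 * tidalMatrix β δ := by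
  have h1 := radius_ne hμ hy
  have h3 := sin_ne hμ hy
  have hs := (sqrt_lapse_pos hμ hy).ne'
  have hr : y 1 - 2 * μ = √(lapse μ (y 1)) ^ 2 * y 1 := (sqrt_lapse_sq hμ hy).symm
  simp only [schwSectional, tetradDiag, hr, tidalMatrix]
  fin_cases β <;> fin_cases δ <;> simp <;> field_simp

/-- By `schwSectional_mul` every entry is μ/r³ times a constant, divided by scale factors which do
not vanish; this treats all entries at once. -/
theorem contDiffAt_schwSectional (hμ : 0 < μ) (hx : x ∈ exterior μ) (α β : Fin 4) :
    ContDiffAt ℝ ∞ (fun z => schwSectional μ (pos z) α β) x := by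
  have h1 : pos x 1 ≠ 0 := radius_ne hμ hx
  have hr : ContDiffAt ℝ ∞ (fun z : Full => pos z 1) x := contDiffAt_coord _
  have hq : ContDiffAt ℝ ∞ (fun z : Full => μ / pos z 1 ^ 3) x :=
    contDiffAt_const.div (hr.pow 3) (pow_ne_zero 3 h1)
  have hn : ∀ z ∈ exterior μ, tetradDiag μ (pos z) α ^ 2 * tetradDiag μ (pos z) β ^ 2 ≠ 0 :=
    fun z hz => mul_ne_zero (pow_ne_zero 2 (tetradDiag_pos hμ hz α).ne')
      (pow_ne_zero 2 (tetradDiag_pos hμ hz β).ne')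
  have hA : ∀ β, ContDiffAt ℝ ∞ (fun z : Full => tetradDiag μ (pos z) β ^ 2) x :=
    fun β => (contDiffAt_tetradDiag hμ hx β).pow 2
  have hD : ContDiffAt ℝ ∞ (fun z : Full => tetradDiag μ (pos z) α ^ 2
      * tetradDiag μ (pos z) β ^ 2) x := (hA α).mul (hA β)
  have hN : ContDiffAt ℝ ∞ (fun z : Full => μ / pos z 1 ^ 3 * tidalMatrix α β) x :=
    hq.mul contDiffAt_const
  have hf : ContDiffAt ℝ ∞ (fun z : Full => μ / pos z 1 ^ 3 * tidalMatrix α β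
      / (tetradDiag μ (pos z) α ^ 2 * tetradDiag μ (pos z) β ^ 2)) x := by
    have hc : tetradDiag μ (pos x) α ^ 2 * tetradDiag μ (pos x) β ^ 2 ≠ 0 := hn x hx
    generalize tidalMatrix α β = c at hN ⊢
    exact hN.fun_div hD hc
  refine hf.congr_of_eventuallyEq (eventuallyEq_of_exterior hx fun z hz => ?_)
  rw [← schwSectional_mul hμ hz, eq_div_iff (hn z hz)]
  ring

theorem contDiffAt_spinCurv (hμ : 0 < μ) (hx : x ∈ exterior μ) (α β : Fin 4) :
    ContDiffAt ℝ ∞ (spinCurv μ α β) x :=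
  ((contDiffAt_const.mul (contDiffAt_schwSectional hμ hx α β)).mul
    (contDiffAt_spin hμ hx α β)).congr_of_eventuallyEq
    (eventuallyEq_of_exterior hx fun _ hz => spinCurv_eq hμ hz α β)

theorem contDiffAt_tidal (hμ : 0 < μ) (hx : x ∈ exterior μ) (α : Fin 4) :
    ContDiffAt ℝ ∞ (tidal μ α) x :=
  ContDiffAt.sum fun β _ => (contDiffAt_spinCurv hμ hx α β).mul (contDiffAt_momUp hμ hx β)

theorem curvScalar_eq (μ : ℝ) (x : Full) :
    curvScalar μ x = -(1 / 2) * ∑ α, ∑ β, spinCurv μ α β x * spin μ α β x := by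
  have h : ∀ α β, spinCurv μ α β x * spin μ α β x = ∑ κ, ∑ ν,
      riemannDown (schw μ) α β κ ν (pos x) * spin μ α β x * spin μ κ ν x := fun α β => by
    simp only [spinCurv, Finset.sum_mul, mul_right_comm]
  simp only [curvScalar, h]

theorem contDiffAt_denom (hμ : 0 < μ) (hx : x ∈ exterior μ) : ContDiffAt ℝ ∞ (denom μ) x := by
  have he : denom μ = fun x => -(1 / 2) * ∑ α, ∑ β, spinCurv μ α β x * spin μ α β x
      + 2 * momSq μ x := funext fun z => by rw [denom, curvScalar_eq]
  rw [he]
  exact (contDiffAt_const.mul (ContDiffAt.sum fun α _ => ContDiffAt.sum fun β _ =>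
    (contDiffAt_spinCurv hμ hx α β).mul (contDiffAt_spin hμ hx α β))).add
    (contDiffAt_const.mul (contDiffAt_momSq hμ hx))

theorem contDiffAt_mult (hm : m ≠ 0) (hμ : 0 < μ) (hx : x ∈ regular μ) (γ : Fin 4) :
    ContDiffAt ℝ ∞ (mult m μ γ) x :=
  (contDiffAt_tidal hμ hx.1 γ).div (contDiffAt_const.mul (contDiffAt_denom hμ hx.1))
    (mul_ne_zero hm hx.2)

theorem contDiffAt_ham (hm : m ≠ 0) (hμ : 0 < μ) (hx : x ∈ regular μ) :
    ContDiffAt ℝ ∞ (ham m μ) x := by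
  have he : ham m μ = fun x => 1 / (2 * m) * momSq μ x
      + ∑ γ, tulczyjew μ γ x * mult m μ γ x := funext fun z => ham_eq m μ z
  rw [he]
  exact (contDiffAt_const.mul (contDiffAt_momSq hμ hx.1)).add (ContDiffAt.sum fun γ _ =>
    (contDiffAt_tulczyjew hμ hx.1 γ).mul (contDiffAt_mult hm hμ hx γ))

theorem ContDiffAt.diff {ι : Type} [Fintype ι] {F : (ι → ℝ) → ℝ} {z : ι → ℝ}
    (h : ContDiffAt ℝ ∞ F z) : DifferentiableAt ℝ F z := h.differentiableAt (by simp)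

theorem continuousAt_pd {ι : Type} [Fintype ι] [DecidableEq ι] {F : (ι → ℝ) → ℝ} {z : ι → ℝ}
    (h : ContDiffAt ℝ ∞ F z) (i : ι) : ContinuousAt (pd F i) z :=
  (h.fderiv_right (m := 0) (by simp)).continuousAt.clm_apply continuousAt_const

theorem continuousAt_bracket {ι : Type} [Fintype ι] [DecidableEq ι]
    {π : (ι → ℝ) → Matrix ι ι ℝ} (hπ : IsPoissonTensor π) {F G : (ι → ℝ) → ℝ} {z : ι → ℝ}
    (hF : ContDiffAt ℝ ∞ F z) (hG : ContDiffAt ℝ ∞ G z) : ContinuousAt (bracket π F G) z := by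
  have h1 : ∀ i j, ContinuousAt (fun z => π z i j) z := fun i j =>
    (hπ.1 i j).continuous.continuousAt
  unfold bracket
  exact tendsto_finsetSum _ fun i _ => tendsto_finsetSum _ fun j _ =>
    ((h1 i j).mul (continuousAt_pd hF i)).mul (continuousAt_pd hG j)

end Smoothness

/-! ### The bracket of the Tulczyjew vector with the Hamiltonian -/

section Invariance

variable {x : Full} {m μ : ℝ}

/-- Leibniz rule on λ_γ f^γ. The brackets with the multipliers are themselves multiplied by f, hence
vanish on the Tulczyjew manifold and only change the coefficients of a linear equation elsewhere. -/
theorem bracket_ham (hm : m ≠ 0) (hμ : 0 < μ) (hx : x ∈ regular μ) (F : Full → ℝ) :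
    bracket fullTensor F (ham m μ) x = mainBracket m μ F x
      + ∑ γ, tulczyjew μ γ x * bracket fullTensor F (mult m μ γ) x := by
  have he : ham m μ = fun x => 1 / (2 * m) * momSq μ x
      + ∑ γ, tulczyjew μ γ x * mult m μ γ x := funext fun z => ham_eq m μ z
  have h1 : DifferentiableAt ℝ (momSq μ) x := (contDiffAt_momSq hμ hx.1).diff
  have h2 : ∀ γ, DifferentiableAt ℝ (tulczyjew μ γ) x := differentiableAt_tulczyjew hμ hx.1
  have h3 : ∀ γ, DifferentiableAt ℝ (mult m μ γ) x := fun γ => (contDiffAt_mult hm hμ hx γ).diff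
  have h4 : ∀ γ ∈ Finset.univ, DifferentiableAt ℝ (fun z => tulczyjew μ γ z * mult m μ γ z) x :=
    fun γ _ => (h2 γ).mul (h3 γ)
  rw [he, bracket_add_right (h1.const_mul _) (DifferentiableAt.fun_sum h4),
    bracket_const_mul_right _ h1, bracket_sum_right _ h4, mainBracket]
  simp only [bracket_mul_right (h2 _) (h3 _), Finset.sum_add_distrib]
  rw [add_assoc]
  simp only [mul_comm]

theorem bracket_tulczyjew_left (hμ : 0 < μ) (hx : x ∈ exterior μ) (G : Full → ℝ) (α : Fin 4) :
    bracket fullTensor (tulczyjew μ α) G x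
      = ∑ β, (bracket fullTensor (spin μ α β) G x * mom μ β x
        + spin μ α β x * bracket fullTensor (mom μ β) G x) := by
  rw [bracket_antisymm (fullTensor_skew x), bracket_tulczyjew _ hμ hx, ← Finset.sum_neg_distrib]
  refine Finset.sum_congr rfl fun β _ => ?_
  rw [bracket_antisymm (fullTensor_skew x) G, bracket_antisymm (fullTensor_skew x) G]
  ring

theorem mainBracket_tulczyjew_leibniz (hμ : 0 < μ) (hx : x ∈ exterior μ) (α : Fin 4) :
    mainBracket m μ (tulczyjew μ α) x
      = ∑ β, (mainBracket m μ (spin μ α β) x * mom μ β x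
        + spin μ α β x * mainBracket m μ (mom μ β) x) := by
  simp only [mainBracket, bracket_tulczyjew_left hμ hx, Fin.sum_univ_four]
  ring

/-- If `C⋆ = 0`, the composition of the spin tensor with `R_{αβκν} S^{κν}` and again the spin
tensor is a multiple of the spin tensor. -/
theorem spin_spinCurv_spin (hμ : 0 < μ) (hx : x ∈ exterior μ) (h : casStar x = 0) (α γ : Fin 4) :
    ∑ β, ∑ δ, spin μ α β x * spinCurv μ β δ x * spin μ γ δ x
      = -curvScalar μ x * spin μ α γ x := by
  have hK := schwSectional_mul hμ hx
  have e1 : ∀ β δ, spin μ α β x * spinCurv μ β δ x * spin μ γ δ x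
      = tetradDiag μ (pos x) α * tetradDiag μ (pos x) γ * (2 * μ / pos x 1 ^ 3)
        * (tidalMatrix β δ * spinFrame x α β
          * spinFrame x β δ * spinFrame x γ δ) := fun β δ => by
    rw [spinCurv_eq hμ hx, spin_eq, spin_eq, spin_eq]
    linear_combination 2 * tetradDiag μ (pos x) α * tetradDiag μ (pos x) γ * spinFrame x α β
          * spinFrame x β δ * spinFrame x γ δ * hK β δ
  have e2 : ∀ β δ, spinCurv μ β δ x * spin μ β δ x = 2 * μ / pos x 1 ^ 3
      * (tidalMatrix β δ * spinFrame x β δ ^ 2) :=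
    fun β δ => by
    rw [spinCurv_eq hμ hx, spin_eq]
    linear_combination 2 * spinFrame x β δ ^ 2 * hK β δ
  have h0 : vecL x 0 * vecM x 0 + vecL x 1 * vecM x 1 + vecL x 2 * vecM x 2 = 0 := by
    simpa [casStar, Fin.sum_univ_three] using h
  rw [curvScalar_eq, spin_eq]
  simp only [e1, e2, ← Finset.mul_sum]
  -- In the tetrad the two sides differ, entry by entry, by a multiple of (L, M), the Pfaffian of
  -- the spin matrix.
  have key : ∑ β, ∑ δ, (tidalMatrix β δ
      * spinFrame x α β * spinFrame x β δ * spinFrame x γ δ)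
      = (1 / 2) * (∑ β, ∑ δ, tidalMatrix β δ
        * spinFrame x β δ ^ 2) * spinFrame x α γ := by
    have hc : ∀ c : ℝ, c * (vecL x 0 * vecM x 0 + vecL x 1 * vecM x 1 + vecL x 2 * vecM x 2)
        = 0 := fun c => by rw [h0, mul_zero]
    fin_cases α <;> fin_cases γ <;> simp [Fin.sum_univ_four, spinFrame, tidalMatrix]
    · ring
    · linear_combination hc (-2 * vecL x 0)
    · linear_combination hc (vecL x 1)
    · linear_combination hc (vecL x 2)
    · linear_combination hc (2 * vecL x 0)
    · ring
    · linear_combination hc (-vecM x 2)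
    · linear_combination hc (vecM x 1)
    · linear_combination hc (-vecL x 1)
    · linear_combination hc (vecM x 2)
    · ring
    · linear_combination hc (2 * vecM x 0)
    · linear_combination hc (-vecL x 2)
    · linear_combination hc (-vecM x 1)
    · linear_combination hc (-2 * vecM x 0)
    · ring
  rw [key]
  ring

/-- All terms are proportional to components of f except p² S λ - ½ S (RS) u. The multipliers in the
Hamiltonian are those for which this expression is zero. -/
theorem mainBracket_tulczyjew (hm : m ≠ 0) (hμ : 0 < μ) (hx : x ∈ regular μ) (h : casStar x = 0)
    (α : Fin 4) :
    mainBracket m μ (tulczyjew μ α) x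
      = ∑ l, (-(∑ δ, velocity m μ δ x * christoffel (schw μ) α l δ (pos x))
          + momUp μ α x * mult m μ l x
          + (∑ γ, (schw μ (pos x))⁻¹ α γ * mult m μ γ x) * mom μ l x
          + ∑ β, ∑ γ, spin μ α β x * mult m μ γ x * christoffel (schw μ) γ l β (pos x))
            * tulczyjew μ l x
        - (∑ β, ∑ γ, (schw μ (pos x))⁻¹ β γ * mult m μ γ x * mom μ β x) * tulczyjew μ α x := by
  have hsk : ∀ γ, ∑ β, spin μ β γ x * mom μ β x = -tulczyjew μ γ x := fun γ => by
    rw [tulczyjew, ← Finset.sum_neg_distrib]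
    exact Finset.sum_congr rfl fun β _ => by rw [spin_skew μ β γ]; ring
  have hN : ∀ β, tidal μ β x = m * denom μ x * mult m μ β x := fun β => by
    have : denom μ x ≠ 0 := hx.2
    rw [mult]
    field_simp
  have hS : ∀ γ, ∑ β, ∑ δ, spin μ α β x * spinCurv μ β δ x * spin μ γ δ x
      = -(denom μ x - 2 * momSq μ x) * spin μ α γ x := fun γ => by
    rw [spin_spinCurv_spin hμ hx.1 h, denom]
    ring
  -- Insert u = p/m + λS. The first summand contributes ½ (d + 2p²) Sλ by the definition of the
  -- multipliers, the second -½ d Sλ by `spin_spinCurv_spin`; together they give p² Sλ.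
  have hrem : momSq μ x * ∑ γ, spin μ α γ x * mult m μ γ x
      - 1 / 2 * ∑ β, ∑ δ, spin μ α β x * velocity m μ δ x * spinCurv μ β δ x = 0 := by
    have e : ∑ β, ∑ δ, spin μ α β x * velocity m μ δ x * spinCurv μ β δ x
        = 1 / m * (∑ β, spin μ α β x * tidal μ β x)
          + ∑ γ, mult m μ γ x * ∑ β, ∑ δ, spin μ α β x * spinCurv μ β δ x * spin μ γ δ x := by
      simp only [velocity, tidal, Fin.sum_univ_four]
      field_simp
      ring
    rw [e]
    simp only [hS, hN]
    simp only [Fin.sum_univ_four]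
    field_simp
    ring
  rw [mainBracket_tulczyjew_leibniz hμ hx.1]
  simp only [mainBracket_spin hm hμ hx.1, mainBracket_mom hm hμ hx.1]
  have h0 := hsk 0
  have h1 := hsk 1
  have h2 := hsk 2
  have h3 := hsk 3
  simp only [Fin.sum_univ_four, momSq] at h0 h1 h2 h3 hrem ⊢
  have t0 : ∀ l, tulczyjew μ l x = spin μ l 0 x * mom μ 0 x + spin μ l 1 x * mom μ 1 x
    + spin μ l 2 x * mom μ 2 x + spin μ l 3 x * mom μ 3 x := fun l => by
      rw [tulczyjew, Fin.sum_univ_four]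
  simp only [t0] at h0 h1 h2 h3 ⊢
  linear_combination hrem - momUp μ α x * (mult m μ 0 x * h0 + mult m μ 1 x * h1
    + mult m μ 2 x * h2 + mult m μ 3 x * h3)

end Invariance

/-! ### Mathisson-Papapetrou equations and the invariant Tulczyjew manifold -/

section Worldline

variable {x : Full} {m μ : ℝ}

theorem bracket_ham_of_tulczyjew (hm : m ≠ 0) (hμ : 0 < μ) (hx : x ∈ regular μ)
    (hf : ∀ α, tulczyjew μ α x = 0) (F : Full → ℝ) :
    bracket fullTensor F (ham m μ) x = mainBracket m μ F x := by
  simp [bracket_ham hm hμ hx, hf]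

theorem sum_schw_inv_riemannDown {y : Fin 4 → ℝ} (hμ : 0 < μ) (hy : y ∈ chartDomain μ)
    (α δ κ ν : Fin 4) :
    ∑ β, (schw μ y)⁻¹ α β * riemannDown (schw μ) β δ κ ν y = riemann (schw μ) α δ κ ν y := by
  have h1 := radius_ne hμ hy
  have h2 := radius_sub_ne hμ hy
  have h3 := sin_ne hμ hy
  have hg : schw μ y = diagonal ![-((y 1 - 2 * μ) / y 1), y 1 / (y 1 - 2 * μ), y 1 ^ 2,
      y 1 ^ 2 * Real.sin (y 2) ^ 2] := by
    simp only [schw, lapse_eq h1, one_div_div]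
  simp only [riemannDown, schw_inv hμ hy]
  simp only [hg, diagonal_apply, ite_mul, zero_mul, Finset.sum_ite_eq, Finset.mem_univ, if_true]
  fin_cases α <;> simp <;> field_simp

/-- At f = 0 the leftover sum in `mainBracket_mom` drops out. Raising the index cancels one set of
Christoffel terms by metric compatibility and leaves the one for the upper index. -/
theorem bracket_momUp_ham (hm : m ≠ 0) (hμ : 0 < μ) (hx : x ∈ regular μ)
    (hf : ∀ α, tulczyjew μ α x = 0) (α : Fin 4) :
    bracket fullTensor (momUp μ α) (ham m μ) x
      = -(∑ κ, ∑ ν, christoffel (schw μ) α κ ν (pos x) * momUp μ κ x * velocity m μ ν x)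
        - (1 / 2) * ∑ l, ∑ κ, ∑ ν,
          riemann (schw μ) α l κ ν (pos x) * velocity m μ l x * spin μ κ ν x := by
  have hP : ∀ κ, bracket fullTensor (ham m μ) (fun z => pos z κ) x = -velocity m μ κ x :=
    fun κ => by
    rw [bracket_antisymm (fullTensor_skew x), bracket_ham_of_tulczyjew hm hμ hx hf,
      mainBracket_pos hm hμ hx.1]
  have hM : ∀ β, bracket fullTensor (ham m μ) (mom μ β) x
      = -∑ δ, velocity m μ δ x * (∑ l, christoffel (schw μ) l β δ (pos x) * mom μ l x
          - 1 / 2 * spinCurv μ β δ x) := fun β => by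
    rw [bracket_antisymm (fullTensor_skew x), bracket_ham_of_tulczyjew hm hμ hx hf,
      mainBracket_mom hm hμ hx.1]
    simp [hf]
  have hR : ∑ l, ∑ κ, ∑ ν, riemann (schw μ) α l κ ν (pos x) * velocity m μ l x * spin μ κ ν x
      = ∑ β, ∑ δ, (schw μ (pos x))⁻¹ α β * velocity m μ δ x * spinCurv μ β δ x := by
    have e : ∀ l κ ν, riemann (schw μ) α l κ ν (pos x) = ∑ β, (schw μ (pos x))⁻¹ α β
        * riemannDown (schw μ) β l κ ν (pos x) :=
      fun l κ ν => (sum_schw_inv_riemannDown hμ hx.1 α l κ ν).symm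
    simp only [e, spinCurv, Finset.sum_mul, Finset.mul_sum]
    rw [Finset.sum_congr rfl fun l _ => Finset.sum_congr rfl fun κ _ => Finset.sum_comm]
    rw [Finset.sum_congr rfl fun l _ => Finset.sum_comm]
    rw [Finset.sum_comm]
    refine Finset.sum_congr rfl fun β _ => Finset.sum_congr rfl fun δ _ =>
      Finset.sum_congr rfl fun κ _ => Finset.sum_congr rfl fun ν _ => ?_
    ring
  have hS : ∀ l κ, christoffel (schw μ) α l κ (pos x) = christoffel (schw μ) α κ l (pos x) :=
    fun l κ => christoffel_symm hμ hx.1 α l κ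
  have hC : ∀ l β κ, christoffel (schw μ) l β κ (pos x) = christoffel (schw μ) l κ β (pos x) :=
    fun l β κ => christoffel_symm hμ hx.1 l β κ
  rw [bracket_antisymm (fullTensor_skew x), bracket_momUp _ hμ hx.1, hR]
  have hD : ∀ β, bracket fullTensor (ham m μ) (mom μ β) x - ∑ κ, ∑ l,
      christoffel (schw μ) l κ β (pos x) * mom μ l x * bracket fullTensor (ham m μ)
        (fun z => pos z κ) x = 1 / 2 * ∑ δ, velocity m μ δ x * spinCurv μ β δ x := fun β => by
    rw [hM]
    simp only [hP, hC _ β, Fin.sum_univ_four]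
    ring
  simp only [hD]
  simp only [hP]
  simp only [Fin.sum_univ_four]
  rw [hS 1 0, hS 2 0, hS 3 0, hS 2 1, hS 3 1, hS 3 2]
  ring

theorem bracket_spin_ham (hm : m ≠ 0) (hμ : 0 < μ) (hx : x ∈ regular μ)
    (hf : ∀ α, tulczyjew μ α x = 0) (α β : Fin 4) :
    bracket fullTensor (spin μ α β) (ham m μ) x
      = -(∑ κ, ∑ ν, christoffel (schw μ) α κ ν (pos x) * spin μ κ β x * velocity m μ ν x)
        - (∑ κ, ∑ ν, christoffel (schw μ) β κ ν (pos x) * spin μ α κ x * velocity m μ ν x)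
        + (momUp μ α x * velocity m μ β x - velocity m μ α x * momUp μ β x) := by
  rw [bracket_ham_of_tulczyjew hm hμ hx hf, mainBracket_spin hm hμ hx.1]
  have e : ∑ γ, mult m μ γ x * ((schw μ (pos x))⁻¹ α γ * tulczyjew μ β x
          - momUp μ α x * spin μ β γ x + momUp μ β x * spin μ α γ x
          - (schw μ (pos x))⁻¹ β γ * tulczyjew μ α x)
      = momUp μ α x * velocity m μ β x - velocity m μ α x * momUp μ β x := by
    simp only [velocity, hf, spin_skew μ α, spin_skew μ β, Fin.sum_univ_four]
    ring
  rw [e]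
  congr 1
  generalize velocity m μ = u
  simp only [Fin.sum_univ_four]
  ring

/-- The component of the velocity along p is p²/m, because the correction λS contracted with p is
λ_γ f^γ. -/
theorem sum_mom_velocity (x : Full) (hf : ∀ α, tulczyjew μ α x = 0) :
    ∑ α, mom μ α x * velocity m μ α x = momSq μ x / m := by
  have e : ∑ α, mom μ α x * velocity m μ α x
      = momSq μ x / m + ∑ γ, mult m μ γ x * tulczyjew μ γ x := by
    simp only [velocity, momSq, tulczyjew, Fin.sum_univ_four]
    ring
  rw [e]
  simp [hf]

/-- The components of the linear momentum with respect to the tetrad. -/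
def frameMom (μ : ℝ) (A : Fin 4) (x : Full) : ℝ := tetradDiag μ (pos x) A * mom μ A x

theorem momSq_eq (hμ : 0 < μ) (hx : x ∈ exterior μ) :
    momSq μ x = -frameMom μ 0 x ^ 2 + frameMom μ 1 x ^ 2 + frameMom μ 2 x ^ 2
      + frameMom μ 3 x ^ 2 := by
  simp [momSq, momUp, schw_inv_apply hμ hx, minkowski, diagonal_apply, frameMom,
    Fin.sum_univ_four]
  ring

theorem tulczyjew_eq (μ : ℝ) (x : Full) (α : Fin 4) :
    tulczyjew μ α x = tetradDiag μ (pos x) α * ∑ B, spinFrame x α B * frameMom μ B x := by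
  simp only [tulczyjew, spin_eq, frameMom, Fin.sum_univ_four]
  ring

theorem sum_spinFrame_frameMom (hμ : 0 < μ) (hx : x ∈ exterior μ) (α : Fin 4)
    (hf : tulczyjew μ α x = 0) : ∑ B, spinFrame x α B * frameMom μ B x = 0 := by
  rw [tulczyjew_eq] at hf
  exact (mul_eq_zero.1 hf).resolve_left (tetradDiag_pos hμ hx α).ne'

/-- The spin matrix kills a nonzero vector, so its Pfaffian (L, M) vanishes. Concretely, the scalar
product of L with the spatial equations gives p_0 (L, M) = 0 in the tetrad. -/
theorem casStar_eq_zero_of_tulczyjew (hμ : 0 < μ) (hx : x ∈ exterior μ) (hp : momSq μ x < 0)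
    (hf : ∀ α, tulczyjew μ α x = 0) : casStar x = 0 := by
  have h := fun α => sum_spinFrame_frameMom hμ hx α (hf α)
  have h1 := h 1
  have h2 := h 2
  have h3 := h 3
  simp [spinFrame, Fin.sum_univ_four] at h1 h2 h3
  -- A timelike covector has a nonzero time component.
  have hq : frameMom μ 0 x ≠ 0 := fun h0 => by
    rw [momSq_eq hμ hx, h0] at hp
    nlinarith [sq_nonneg (frameMom μ 1 x), sq_nonneg (frameMom μ 2 x), sq_nonneg (frameMom μ 3 x)]
  refine (mul_eq_zero.1 (?_ : frameMom μ 0 x * casStar x = 0)).resolve_left hq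
  rw [casStar, Fin.sum_univ_three]
  linear_combination -vecL x 0 * h1 - vecL x 1 * h2 - vecL x 2 * h3

/-- The coefficients of the linear differential equation satisfied by the Tulczyjew vector. -/
def tulczyjewCoeff (m μ : ℝ) (x : Full) : Matrix (Fin 4) (Fin 4) ℝ := fun α l =>
  -(∑ δ, velocity m μ δ x * christoffel (schw μ) α l δ (pos x))
    + momUp μ α x * mult m μ l x
    + (∑ γ, (schw μ (pos x))⁻¹ α γ * mult m μ γ x) * mom μ l x
    + (∑ β, ∑ γ, spin μ α β x * mult m μ γ x * christoffel (schw μ) γ l β (pos x))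
    + bracket fullTensor (tulczyjew μ α) (mult m μ l) x
    - if α = l then ∑ β, ∑ γ, (schw μ (pos x))⁻¹ β γ * mult m μ γ x * mom μ β x else 0

/-- The linear equation for f holds on the whole level C⋆ = 0, not only where f = 0; this is needed
to propagate the zero. -/
theorem bracket_tulczyjew_ham (hm : m ≠ 0) (hμ : 0 < μ) (hx : x ∈ regular μ)
    (h : casStar x = 0) (α : Fin 4) :
    bracket fullTensor (tulczyjew μ α) (ham m μ) x
      = ∑ l, tulczyjewCoeff m μ x α l * tulczyjew μ l x := by
  rw [bracket_ham hm hμ hx, mainBracket_tulczyjew hm hμ hx h]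
  simp only [tulczyjewCoeff, sub_mul, add_mul, ite_mul, zero_mul, Finset.sum_sub_distrib,
    Finset.sum_add_distrib, Finset.sum_ite_eq, Finset.mem_univ, if_true]
  simp only [mul_comm (tulczyjew μ _ x)]
  ring

theorem continuousAt_tulczyjewCoeff (hm : m ≠ 0) (hμ : 0 < μ) (hx : x ∈ regular μ)
    (α l : Fin 4) : ContinuousAt (fun z => tulczyjewCoeff m μ z α l) x := by
  have hc : ∀ α β ν, ContinuousAt (fun z => christoffel (schw μ) α β ν (pos z)) x := fun α β ν =>
    ((hasDiff_christoffel hμ hx.1 α β ν).comp_pos (x := x)).differentiableAt.continuousAt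
  have hg : ∀ α β, ContinuousAt (fun z => (schw μ (pos z))⁻¹ α β) x := fun α β =>
    ((hasDiff_schw_inv hμ hx.1 α β).comp_pos (x := x)).differentiableAt.continuousAt
  have hp : ∀ α, ContinuousAt (mom μ α) x := fun α => (contDiffAt_mom hμ hx.1 α).continuousAt
  have hu : ∀ α, ContinuousAt (momUp μ α) x := fun α => (contDiffAt_momUp hμ hx.1 α).continuousAt
  have hs : ∀ α β, ContinuousAt (spin μ α β) x := fun α β =>
    (contDiffAt_spin hμ hx.1 α β).continuousAt
  have hk : ∀ α, ContinuousAt (mult m μ α) x := fun α => (contDiffAt_mult hm hμ hx α).continuousAt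
  have hb : ContinuousAt (bracket fullTensor (tulczyjew μ α) (mult m μ l)) x :=
    continuousAt_bracket isPoissonTensor_fullTensor (contDiffAt_tulczyjew hμ hx.1 α)
      (contDiffAt_mult hm hμ hx l)
  have hv : ∀ α, ContinuousAt (velocity m μ α) x := fun α =>
    ((hu α).div_const m).add (tendsto_finsetSum _ fun γ _ => (hk γ).mul (hs γ α))
  refine ContinuousAt.sub ?_ ?_
  · refine ContinuousAt.add (ContinuousAt.add (ContinuousAt.add (ContinuousAt.add ?_ ?_) ?_) ?_) hb
    · exact (tendsto_finsetSum _ fun δ _ => (hv δ).mul (hc _ _ _)).neg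
    · exact (hu α).mul (hk l)
    · exact ContinuousAt.mul (tendsto_finsetSum _ fun γ _ => (hg α γ).mul (hk γ)) (hp l)
    · exact tendsto_finsetSum _ fun β _ => tendsto_finsetSum _ fun γ _ =>
        ((hs α β).mul (hk γ)).mul (hc γ l β)
  · split_ifs
    · exact tendsto_finsetSum _ fun β _ => tendsto_finsetSum _ fun γ _ =>
        ((hg β γ).mul (hk γ)).mul (hp β)
    · exact continuousAt_const

/-- At f = 0 one has {p², f^γ} = S^{γβ} times the tidal covector, which is proportional to λ_β. So
the bracket with H is a multiple of λSλ, zero by skew-symmetry. -/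
theorem bracket_momSq_ham (hm : m ≠ 0) (hμ : 0 < μ) (hx : x ∈ regular μ)
    (hf : ∀ α, tulczyjew μ α x = 0) : bracket fullTensor (momSq μ) (ham m μ) x = 0 := by
  have h1 : bracket fullTensor (momSq μ) (momSq μ) x = 0 := by
    have := bracket_antisymm (fullTensor_skew x) (momSq μ) (momSq μ)
    linarith
  have hN : ∀ β, tidal μ β x = m * denom μ x * mult m μ β x := fun β => by
    have : denom μ x ≠ 0 := hx.2
    rw [mult]
    field_simp
  have h2 : ∀ γ, bracket fullTensor (momSq μ) (tulczyjew μ γ) x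
      = m * denom μ x * ∑ β, spin μ γ β x * mult m μ β x := fun γ => by
    have e : bracket fullTensor (momSq μ) (tulczyjew μ γ) x = ∑ β, spin μ γ β x * tidal μ β x
        + 2 * ∑ δ, ∑ l, momUp μ δ x * christoffel (schw μ) γ l δ (pos x) * tulczyjew μ l x := by
      rw [bracket_antisymm (fullTensor_skew x), bracket_tulczyjew_left hμ hx.1]
      simp only [bracket_spin_momSq hμ hx.1, bracket_mom_momSq hμ hx.1]
      have hS : ∀ l δ β, christoffel (schw μ) l δ β (pos x) = christoffel (schw μ) l β δ (pos x) :=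
        fun l δ β => christoffel_symm hμ hx.1 l δ β
      generalize tidal μ = N
      simp only [tulczyjew, Fin.sum_univ_four]
      simp only [hS _ 1 0, hS _ 2 0, hS _ 3 0, hS _ 2 1, hS _ 3 1, hS _ 3 2]
      ring
    rw [e]
    simp only [hN, hf, mul_zero, Finset.sum_const_zero, add_zero]
    rw [Finset.mul_sum]
    exact Finset.sum_congr rfl fun β _ => by ring
  rw [bracket_ham_of_tulczyjew hm hμ hx hf, mainBracket, h1]
  simp only [h2]
  have hs : ∀ i, spin μ i i x = 0 := fun i => by linarith [spin_skew μ i i x]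
  simp only [Fin.sum_univ_four, hs, spin_skew μ 1 0, spin_skew μ 2 0, spin_skew μ 3 0,
    spin_skew μ 2 1, spin_skew μ 3 1, spin_skew μ 3 2]
  ring

section Trajectories

variable {I : Set ℝ} {γ : ℝ → Full}

theorem IsCasimir.bracket_eq_zero {ι : Type} [Fintype ι] [DecidableEq ι]
    {π : (ι → ℝ) → Matrix ι ι ℝ} {K : (ι → ℝ) → ℝ} (hK : IsCasimir π K) (G : (ι → ℝ) → ℝ)
    (z : ι → ℝ) : bracket π K G z = 0 := by
  have h : bracket π K G z = ∑ j, (∑ i, pd K i z * π z i j) * pd G j z := by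
    rw [bracket, Finset.sum_comm]
    refine Finset.sum_congr rfl fun j _ => ?_
    rw [Finset.sum_mul]
    exact Finset.sum_congr rfl fun i _ => by ring
  rw [h]
  simp [hK.2]

theorem IsTrajectory.casimir_eq {ι : Type} [Fintype ι] [DecidableEq ι]
    {π : (ι → ℝ) → Matrix ι ι ℝ} {K H : (ι → ℝ) → ℝ} (hK : IsCasimir π K) (hI : IsOpenInterval I)
    {γ : ℝ → ι → ℝ} (hγ : IsTrajectory π H I γ) {s t : ℝ} (hs : s ∈ I) (ht : t ∈ I) :
    K (γ s) = K (γ t) := by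
  refine eq_of_hasDerivAt_zero hI (f := fun τ => K (γ τ)) (fun τ hτ => ?_) hs ht
  rw [← hK.bracket_eq_zero H (γ τ)]
  exact hγ.hasDerivAt_comp hτ (hK.1.differentiable (by simp) _)

/-- The given velocity u equals `velocity` because derivatives are unique; the equations are then
the brackets with H at f = 0. -/
theorem mathisson_papapetrou (hm : m ≠ 0) (hμ : 0 < μ) {u : ℝ → Fin 4 → ℝ}
    (hγ : IsTrajectory fullTensor (ham m μ) I γ)
    (hu : ∀ τ ∈ I, ∀ α, HasDerivAt (fun s => pos (γ s) α) (u τ α) τ) {τ : ℝ} (hτ : τ ∈ I)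
    (hx : γ τ ∈ regular μ) (hf : ∀ α, tulczyjew μ α (γ τ) = 0) :
    (∀ α, HasDerivAt (fun s => momUp μ α (γ s))
      (-(∑ κ, ∑ ν, christoffel (schw μ) α κ ν (pos (γ τ)) * momUp μ κ (γ τ) * u τ ν)
        - (1 / 2) * ∑ l, ∑ κ, ∑ ν,
          riemann (schw μ) α l κ ν (pos (γ τ)) * u τ l * spin μ κ ν (γ τ)) τ) ∧
    (∀ α β, HasDerivAt (fun s => spin μ α β (γ s))
      (-(∑ κ, ∑ ν, christoffel (schw μ) α κ ν (pos (γ τ)) * spin μ κ β (γ τ) * u τ ν)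
        - (∑ κ, ∑ ν, christoffel (schw μ) β κ ν (pos (γ τ)) * spin μ α κ (γ τ) * u τ ν)
        + (momUp μ α (γ τ) * u τ β - u τ α * momUp μ β (γ τ))) τ) ∧
    -(∑ α, mom μ α (γ τ) * u τ α) = -momSq μ (γ τ) / m := by
  have hv : ∀ α, u τ α = velocity m μ α (γ τ) := fun α => by
    rw [← mainBracket_pos hm hμ hx.1, ← bracket_ham_of_tulczyjew hm hμ hx hf]
    exact (hu τ hτ α).unique (hγ.hasDerivAt_comp hτ (hasDiff_pos α).differentiableAt)
  simp only [hv]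
  refine ⟨fun α => ?_, fun α β => ?_, ?_⟩
  · rw [← bracket_momUp_ham hm hμ hx hf]
    exact hγ.hasDerivAt_comp hτ (differentiableAt_momUp hμ hx.1 α)
  · rw [← bracket_spin_ham hm hμ hx hf]
    exact hγ.hasDerivAt_comp hτ (differentiableAt_spin hμ hx.1 α β)
  · rw [sum_mom_velocity _ hf, neg_div]

theorem tulczyjew_invariant (hm : m ≠ 0) (hμ : 0 < μ) (hI : IsOpenInterval I)
    (hγ : IsTrajectory fullTensor (ham m μ) I γ) (hr : ∀ τ ∈ I, γ τ ∈ regular μ) {τ₀ : ℝ}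
    (hτ₀ : τ₀ ∈ I) (hp : momSq μ (γ τ₀) < 0) (hf : ∀ α, tulczyjew μ α (γ τ₀) = 0) {τ : ℝ}
    (hτ : τ ∈ I) : (∀ α, tulczyjew μ α (γ τ) = 0) ∧ momSq μ (γ τ) = momSq μ (γ τ₀) := by
  -- C⋆ vanishes at the initial time by the degeneracy of S, and at all times as a Casimir function.
  have hC : ∀ τ ∈ I, casStar (γ τ) = 0 := fun τ hτ => by
    rw [hγ.casimir_eq isCasimir_casStar hI hτ hτ₀,
      casStar_eq_zero_of_tulczyjew hμ (hr τ₀ hτ₀).1 hp hf]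
  have hz : ∀ τ ∈ I, ∀ α, tulczyjew μ α (γ τ) = 0 := fun τ hτ α => by
    refine congr_fun (linear_ode_eq_zero hI (A := fun τ => tulczyjewCoeff m μ (γ τ))
      (y := fun τ α => tulczyjew μ α (γ τ)) (fun i j τ hτ => ?_) (fun τ hτ => ?_) hτ₀
      (funext hf) hτ) α
    · exact (ContinuousAt.comp (continuousAt_tulczyjewCoeff hm hμ (hr τ hτ) i j)
        (hγ τ hτ).continuousAt).continuousWithinAt
    · refine hasDerivAt_pi.2 fun α => ?_
      have h := hγ.hasDerivAt_comp hτ (differentiableAt_tulczyjew hμ (hr τ hτ).1 α)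
      rw [bracket_tulczyjew_ham hm hμ (hr τ hτ) (hC τ hτ)] at h
      exact h
  refine ⟨hz τ hτ, eq_of_hasDerivAt_zero hI (f := fun τ => momSq μ (γ τ)) (fun τ hτ => ?_) hτ hτ₀⟩
  rw [← bracket_momSq_ham hm hμ (hr τ hτ) (hz τ hτ)]
  exact hγ.hasDerivAt_comp hτ (contDiffAt_momSq hμ (hr τ hτ).1).diff

end Trajectories

end Worldline

/-! ### Tetrad form of the Hamiltonian and its rotational symmetry -/

section FrameForm

variable {x : Full} {m μ : ℝ}

/-- The components of the Tulczyjew vector with respect to the tetrad. -/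
def frameTul (μ : ℝ) (A : Fin 4) (x : Full) : ℝ := ∑ B, spinFrame x A B * frameMom μ B x

/-- The tidal covector with respect to the tetrad, up to the factor `2 μ / r³`. -/
def frameTidal (μ : ℝ) (A : Fin 4) (x : Full) : ℝ :=
  ∑ B, tidalMatrix A B * minkowski B B * (spinFrame x A B * frameMom μ B x)

/-- The denominator of the Hamiltonian, up to the factor `-2 μ / r³`. -/
def frameDenom (μ : ℝ) (x : Full) : ℝ :=
  1 / 2 * (∑ A, ∑ B, tidalMatrix A B * spinFrame x A B ^ 2) - momSq μ x / μ * pos x 1 ^ 3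

theorem denom_eq (hμ : 0 < μ) (hx : x ∈ exterior μ) :
    curvScalar μ x + 2 * momSq μ x = -2 * μ / pos x 1 ^ 3 * frameDenom μ x := by
  have h1 : pos x 1 ≠ 0 := radius_ne hμ hx
  have h : ∀ α β, spinCurv μ α β x * spin μ α β x
      = 2 * (μ / pos x 1 ^ 3) * (tidalMatrix α β * spinFrame x α β ^ 2) := fun α β => by
    rw [spinCurv_eq hμ hx, spin_eq]
    linear_combination 2 * spinFrame x α β ^ 2 * schwSectional_mul hμ hx α β
  rw [curvScalar_eq, frameDenom]
  simp only [h, ← Finset.mul_sum]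
  field_simp
  ring

theorem tidal_mul (hμ : 0 < μ) (hx : x ∈ exterior μ) (α : Fin 4) :
    tetradDiag μ (pos x) α * tidal μ α x = 2 * μ / pos x 1 ^ 3 * frameTidal μ α x := by
  have h : ∀ β, momUp μ β x = minkowski β β * tetradDiag μ (pos x) β * frameMom μ β x := fun β => by
    simp only [momUp, schw_inv_apply hμ hx, frameMom]
    rw [Finset.sum_eq_single β (fun γ _ hγ => by
      simp [minkowski, diagonal_apply_ne _ hγ.symm]) (by simp)]
    ring
  simp only [tidal, frameTidal, Finset.mul_sum]
  refine Finset.sum_congr rfl fun β _ => ?_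
  rw [spinCurv_eq hμ hx, spin_eq, h]
  linear_combination 2 * minkowski β β * spinFrame x α β * frameMom μ β x
    * schwSectional_mul hμ hx α β

/-- The scale factors cancel between f and the tidal covector, and the common factor μ/r³ cancels
between the tidal covector and the denominator. Apart from r itself, H then involves only tetrad
components. -/
theorem ham_frame (hμ : 0 < μ) (hx : x ∈ exterior μ) :
    ham m μ x = momSq μ x / (2 * m)
      - (∑ A, frameTul μ A x * frameTidal μ A x) / (m * frameDenom μ x) := by
  have h1 : pos x 1 ≠ 0 := radius_ne hμ hx
  rw [ham_eq, denom, denom_eq hμ hx]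
  have h : ∀ γ, tulczyjew μ γ x * (tidal μ γ x
      / (m * (-2 * μ / pos x 1 ^ 3 * frameDenom μ x)))
      = -(frameTul μ γ x * frameTidal μ γ x / (m * frameDenom μ x)) := fun γ => by
    rw [tulczyjew_eq]
    have e : ∀ D : ℝ, tetradDiag μ (pos x) γ * (∑ B, spinFrame x γ B * frameMom μ B x)
        * (tidal μ γ x / D)
        = frameTul μ γ x * (tetradDiag μ (pos x) γ * tidal μ γ x / D) := fun D => by
      rw [frameTul]
      ring
    rw [e, tidal_mul hμ hx]
    -- If the denominator vanishes both quotients are zero by the convention for division, so the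
    -- identity holds on the whole exterior.
    by_cases hV : m * frameDenom μ x = 0
    · have h0 : m * (-2 * μ / pos x 1 ^ 3 * frameDenom μ x) = 0 := by
        rw [mul_left_comm, hV, mul_zero]
      rw [h0, hV]
      simp
    · have hm' : m ≠ 0 := left_ne_zero_of_mul hV
      have hV' : frameDenom μ x ≠ 0 := right_ne_zero_of_mul hV
      have hμ' := hμ.ne'
      field_simp
  simp only [h, Finset.sum_neg_distrib, ← Finset.sum_div]
  ring

theorem frameDenom_ne (hμ : 0 < μ) (hx : x ∈ regular μ) : frameDenom μ x ≠ 0 := by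
  have h := hx.2
  rw [denom_eq hμ hx.1] at h
  exact right_ne_zero_of_mul h

theorem frameMom_eq (hμ : 0 < μ) (hx : x ∈ exterior μ) (A : Fin 4) :
    frameMom μ A x = ![(vecP x 0 - μ / pos x 1 ^ 2 * vecM x 0) / √(lapse μ (pos x 1)),
      √(lapse μ (pos x 1)) * vecP x 1,
      (vecP x 2 - √(lapse μ (pos x 1)) * vecL x 2) / pos x 1,
      (√(lapse μ (pos x 1)) * vecL x 1
        - (vecL x 0 * Real.cos (pos x 2) - vecP x 3) / Real.sin (pos x 2)) / pos x 1] A := by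
  have h1 : pos x 1 ≠ 0 := radius_ne hμ hx
  have h3 : Real.sin (pos x 2) ≠ 0 := sin_ne hμ hx
  rw [frameMom, mom_eq hμ hx]
  fin_cases A <;> simp [tetradDiag] <;> field_simp
  ring

theorem vecP_single_y (k : Fin 4) : vecP (Pi.single (.inr (.inr k)) 1) = 0 := by
  ext i
  simp [vecP]

theorem pos_single_y (k : Fin 4) : pos (Pi.single (.inr (.inr k)) 1) = Pi.single k 1 := by
  ext i
  simp [pos, Pi.single_apply]

theorem vecP_single_P (k : Fin 4) : vecP (Pi.single (.inr (.inl k)) 1) = Pi.single k 1 := by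
  ext i
  simp [vecP, Pi.single_apply]

theorem pos_single_P (k : Fin 4) : pos (Pi.single (.inr (.inl k)) 1) = 0 := by
  ext i
  simp [pos]

theorem vecP_single_L (k : Fin 3) : vecP (Pi.single (.inl (.inl k)) 1) = 0 := by
  ext i
  simp [vecP]

theorem pos_single_L (k : Fin 3) : pos (Pi.single (.inl (.inl k)) 1) = 0 := by
  ext i
  simp [pos]

/-- The derivative in r is left unevaluated: the symmetries to which this is applied keep r fixed.
-/
theorem hasDiff_frameMom (hμ : 0 < μ) (hx : x ∈ exterior μ) (A : Fin 4) :
    HasDiff (frameMom μ A) (fun v =>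
      ![(vecP v 0 - μ / pos x 1 ^ 2 * vecM v 0) / √(lapse μ (pos x 1))
          + fderiv ℝ (frameMom μ 0) x (Pi.single (.inr (.inr 1)) 1) * pos v 1,
        √(lapse μ (pos x 1)) * vecP v 1
          + fderiv ℝ (frameMom μ 1) x (Pi.single (.inr (.inr 1)) 1) * pos v 1,
        (vecP v 2 - √(lapse μ (pos x 1)) * vecL v 2) / pos x 1
          + fderiv ℝ (frameMom μ 2) x (Pi.single (.inr (.inr 1)) 1) * pos v 1,
        (√(lapse μ (pos x 1)) * vecL v 1
          - (vecL v 0 * Real.cos (pos x 2) - vecP v 3) / Real.sin (pos x 2)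
          + (vecL x 0 - vecP x 3 * Real.cos (pos x 2)) / Real.sin (pos x 2) ^ 2 * pos v 2) / pos x 1
          + fderiv ℝ (frameMom μ 3) x (Pi.single (.inr (.inr 1)) 1) * pos v 1] A) x := by
  have h1 : pos x 1 ≠ 0 := radius_ne hμ hx
  have h3 : Real.sin (pos x 2) ≠ 0 := sin_ne hμ hx
  have hs0 := (sqrt_lapse_pos hμ hx).ne'
  have hs := (hasDiff_sqrt_lapse hμ hx).comp_pos
  have hcs : Real.cos (pos x 2) ^ 2 = 1 - Real.sin (pos x 2) ^ 2 := Real.cos_sq' _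
  have key : ∀ A, ∃ ℓ, HasDiff (frameMom μ A) ℓ x ∧ ∀ v, ℓ v =
      ![(vecP v 0 - μ / pos x 1 ^ 2 * vecM v 0) / √(lapse μ (pos x 1)),
        √(lapse μ (pos x 1)) * vecP v 1,
        (vecP v 2 - √(lapse μ (pos x 1)) * vecL v 2) / pos x 1,
        (√(lapse μ (pos x 1)) * vecL v 1
          - (vecL v 0 * Real.cos (pos x 2) - vecP v 3) / Real.sin (pos x 2)
          + (vecL x 0 - vecP x 3 * Real.cos (pos x 2)) / Real.sin (pos x 2) ^ 2 * pos v 2)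
            / pos x 1] A + ℓ (Pi.single (.inr (.inr 1)) 1) * pos v 1 := by
    intro A
    refine ⟨_, (hasDiff_tetradDiag hμ hx A).comp_pos.mul (hasDiff_mom hμ hx A), fun v => ?_⟩
    simp only [mom_eq hμ hx]
    fin_cases A <;> simp [tetradDiag, tetradDiff, vecL_single_y, vecM_single_y, vecP_single_y,
      pos_single_y] <;> field_simp <;> ring_nf <;> (try simp only [hcs]) <;> (try ring)
  obtain ⟨ℓ, hℓ, e⟩ := key A
  refine hℓ.congr fun v => ?_
  rw [e v, ← hℓ.fderiv_eq]
  fin_cases A <;> rfl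

/-- The Hamiltonian is invariant under rotations about the radial direction. -/
theorem fderiv_ham_eq_zero (hm : m ≠ 0) (hμ : 0 < μ) (hx : x ∈ regular μ) {v : Full} (κ : ℝ)
    (hr : pos v 1 = 0) (hL : vecL v = ![0, -κ * vecL x 2, κ * vecL x 1])
    (hM : vecM v = ![0, -κ * vecM x 2, κ * vecM x 1])
    (h0 : fderiv ℝ (frameMom μ 0) x v = 0) (h1 : fderiv ℝ (frameMom μ 1) x v = 0)
    (h2 : fderiv ℝ (frameMom μ 2) x v = -κ * frameMom μ 3 x)
    (h3 : fderiv ℝ (frameMom μ 3) x v = κ * frameMom μ 2 x) :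
    fderiv ℝ (ham m μ) x v = 0 := by
  have hq : ∀ A, HasDiff (frameMom μ A) (fun v => fderiv ℝ (frameMom μ A) x v) x := fun A =>
    HasDiff.of_differentiableAt (hasDiff_frameMom hμ hx.1 A).differentiableAt
  -- The momentum square, the denominator and the pairing of f with the tidal covector are each
  -- invariant under the infinitesimal rotation of the last two legs; the quotient H inherits this.
  have hp : ∃ ℓ, HasDiff (momSq μ) ℓ x ∧ ℓ v = 0 :=
    ⟨_, ((((hq 0).sq.neg.add (hq 1).sq).add (hq 2).sq).add (hq 3).sq).congr_fun
      (eventuallyEq_of_exterior hx.1 fun z hz => momSq_eq hμ hz), by rw [h0, h1, h2, h3]; ring⟩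
  obtain ⟨ℓp, hp, ep⟩ := hp
  have hV : ∃ ℓ, HasDiff (frameDenom μ) ℓ x ∧ ℓ v = 0 := by
    refine ⟨_, ((HasDiff.const (1 / 2)).mul (HasDiff.sum Finset.univ fun A _ =>
      HasDiff.sum Finset.univ fun B _ => (HasDiff.const (tidalMatrix A B)).mul
        (hasDiff_spinFrame A B).sq)).sub ((hp.mul (HasDiff.const (1 / μ))).mul
          ((hasDiff_pos 1).pow 3)) |>.congr_fun (Filter.Eventually.of_forall fun z => ?_), ?_⟩
    · rw [frameDenom]
      ring
    · simp [hr, ep, Fin.sum_univ_four, spinFrame, tidalMatrix, hL, hM]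
      ring
  obtain ⟨ℓV, hV, eV⟩ := hV
  have hN : ∃ ℓ, HasDiff (fun z => ∑ A, frameTul μ A z * frameTidal μ A z) ℓ x ∧ ℓ v = 0 := by
    refine ⟨_, HasDiff.sum Finset.univ fun A _ => (HasDiff.sum Finset.univ fun B _ =>
      (hasDiff_spinFrame A B).mul (hq B)).mul (HasDiff.sum Finset.univ fun B _ =>
        (HasDiff.const (tidalMatrix A B * minkowski B B)).mul
          ((hasDiff_spinFrame A B).mul (hq B))), ?_⟩
    simp [frameTul, frameTidal, Fin.sum_univ_four, spinFrame, tidalMatrix, minkowski,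
      diagonal_apply, hL, hM, h0, h1, h2, h3]
    ring
  obtain ⟨ℓN, hN, eN⟩ := hN
  have hH := (hp.mul (HasDiff.const (1 / (2 * m)))).sub
    (hN.div ((HasDiff.const m).mul hV) (mul_ne_zero hm (frameDenom_ne hμ hx)))
  have hH' := hH.congr_fun (G := ham m μ) (eventuallyEq_of_exterior hx.1 fun z hz => by
    rw [ham_frame hμ hz]
    ring)
  rw [hH'.fderiv_eq, ep, eV, eN]
  ring

end FrameForm

/-! ### Energy and angular momentum -/

section Integrals

variable {x : Full} {m μ : ℝ}

theorem hasDiff_energy : HasDiff energy (fun v => -vecP v 0) x := (hasDiff_vecP 0).neg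

/-- The vector field of the energy. -/
theorem hamField_energy (x : Full) :
    hamField fullTensor energy x = hamVec x 0 0 ![-1, 0, 0, 0] 0 :=
  hamField_of_hasDiff hasDiff_energy _ _ _ _ fun v => by simp [Fin.sum_univ_four]

theorem hasDiff_vecQ (hμ : 0 < μ) (hx : x ∈ exterior μ) (i : Fin 3) :
    HasDiff (fun z => vecQ z i) (fun v =>
      ![Real.cos (pos x 3) / Real.sin (pos x 2) * (vecL v 0 - vecP v 3 * Real.cos (pos x 2))
          - Real.sin (pos x 3) * vecP v 2
          - Real.cos (pos x 3) * (vecL x 0 * Real.cos (pos x 2) - vecP x 3)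
            / Real.sin (pos x 2) ^ 2 * pos v 2
          - vecQ x 1 * pos v 3,
        Real.sin (pos x 3) / Real.sin (pos x 2) * (vecL v 0 - vecP v 3 * Real.cos (pos x 2))
          + Real.cos (pos x 3) * vecP v 2
          - Real.sin (pos x 3) * (vecL x 0 * Real.cos (pos x 2) - vecP x 3)
            / Real.sin (pos x 2) ^ 2 * pos v 2
          + vecQ x 0 * pos v 3,
        vecP v 3] i) x := by
  have h3 : Real.sin (pos x 2) ≠ 0 := sin_ne hμ hx
  have hcs : Real.cos (pos x 2) ^ 2 = 1 - Real.sin (pos x 2) ^ 2 := Real.cos_sq' _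
  have hY := (hasDiff_vecL (x := x) 0).sub ((hasDiff_vecP 3).mul (hasDiff_pos 2).cos)
  fin_cases i
  · refine ((((hasDiff_pos 3).cos.div (hasDiff_pos 2).sin h3).mul hY).sub
      ((hasDiff_vecP 2).mul (hasDiff_pos 3).sin)).congr fun v => ?_
    simp [vecQ]
    field_simp
    ring_nf
    simp only [hcs]
    ring
  · refine ((((hasDiff_pos 3).sin.div (hasDiff_pos 2).sin h3).mul hY).add
      ((hasDiff_vecP 2).mul (hasDiff_pos 3).cos)).congr fun v => ?_
    simp [vecQ]
    field_simp
    ring_nf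
    simp only [hcs]
    ring
  · exact hasDiff_vecP 3

theorem hamField_vecQ (hμ : 0 < μ) (hx : x ∈ exterior μ) (i : Fin 3) :
    hamField fullTensor (fun z => vecQ z i) x = hamVec x
      (![![Real.cos (pos x 3) / Real.sin (pos x 2), 0, 0],
        ![Real.sin (pos x 3) / Real.sin (pos x 2), 0, 0], 0] i) 0
      (![![0, 0, -Real.sin (pos x 3),
          -(Real.cos (pos x 3) / Real.sin (pos x 2) * Real.cos (pos x 2))],
        ![0, 0, Real.cos (pos x 3),
          -(Real.sin (pos x 3) / Real.sin (pos x 2) * Real.cos (pos x 2))], ![0, 0, 0, 1]] i)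
      (![![0, 0, -(Real.cos (pos x 3) * (vecL x 0 * Real.cos (pos x 2) - vecP x 3)
            / Real.sin (pos x 2) ^ 2), -vecQ x 1],
        ![0, 0, -(Real.sin (pos x 3) * (vecL x 0 * Real.cos (pos x 2) - vecP x 3)
            / Real.sin (pos x 2) ^ 2), vecQ x 0], 0] i) := by
  refine hamField_of_hasDiff (hasDiff_vecQ hμ hx i) _ _ _ _ fun v => ?_
  fin_cases i <;> simp [Fin.sum_univ_succ] <;> ring

theorem bracket_energy_vecQ (hμ : 0 < μ) (hx : x ∈ exterior μ) (i : Fin 3) :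
    bracket fullTensor energy (fun z => vecQ z i) x = 0 := by
  rw [hasDiff_energy.bracket_eq, hamField_vecQ hμ hx, vecP_hamVec]
  fin_cases i <;> simp

theorem bracket_vecQ_vecQ (hμ : 0 < μ) (hx : x ∈ exterior μ) (i j : Fin 3) :
    bracket fullTensor (fun z => vecQ z i) (fun z => vecQ z j) x = hat (vecQ x) i j := by
  have h3 : Real.sin (pos x 2) ≠ 0 := sin_ne hμ hx
  have hcs : Real.cos (pos x 2) ^ 2 = 1 - Real.sin (pos x 2) ^ 2 := Real.cos_sq' _
  have hcp : Real.cos (pos x 3) ^ 2 = 1 - Real.sin (pos x 3) ^ 2 := Real.cos_sq' _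
  rw [(hasDiff_vecQ hμ hx i).bracket_eq, hamField_vecQ hμ hx, pos_hamVec, vecP_hamVec, vecL_hamVec]
  fin_cases i <;> fin_cases j <;> simp [hat, vecQ, cross_apply] <;> field_simp <;>
    (try simp only [hcs, hcp]) <;> (try ring_nf) <;> (try simp only [hcs, hcp]) <;> (try ring)

/-- The flow of Q_i moves the point on the sphere and hence turns the legs e₂, e₃ by a local angle;
`fderiv_ham_eq_zero` says that H does not notice. -/
theorem bracket_vecQ_ham (hm : m ≠ 0) (hμ : 0 < μ) (hx : x ∈ regular μ) (i : Fin 3) :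
    bracket fullTensor (fun z => vecQ z i) (ham m μ) x = 0 := by
  have h1 : pos x 1 ≠ 0 := radius_ne hμ hx.1
  have h3 : Real.sin (pos x 2) ≠ 0 := sin_ne hμ hx.1
  have hcs : Real.cos (pos x 2) ^ 2 = 1 - Real.sin (pos x 2) ^ 2 := Real.cos_sq' _
  rw [bracket_antisymm (fullTensor_skew x), (HasDiff.of_differentiableAt
    (contDiffAt_ham hm hμ hx).diff).bracket_eq, hamField_vecQ hμ hx.1, neg_eq_zero]
  have hq := fun A v => (hasDiff_frameMom hμ hx.1 A).fderiv_eq v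
  -- The rate κ of the local rotation is the derivative of Q_i in L₁.
  refine fderiv_ham_eq_zero hm hμ hx (![Real.cos (pos x 3) / Real.sin (pos x 2),
    Real.sin (pos x 3) / Real.sin (pos x 2), 0] i) ?_ ?_ ?_ ?_ ?_ ?_ ?_
  · rw [pos_hamVec]
    fin_cases i <;> simp
  · rw [vecL_hamVec]
    fin_cases i <;> ext j <;> fin_cases j <;> simp [cross_apply]
  · rw [vecM_hamVec]
    fin_cases i <;> ext j <;> fin_cases j <;> simp [cross_apply]
  all_goals
    rw [hq]
    try rw [frameMom_eq hμ hx.1]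
    simp only [pos_hamVec, vecL_hamVec, vecM_hamVec, vecP_hamVec]
    fin_cases i <;> simp [cross_apply, vecQ] <;> (try field_simp) <;> (try simp only [hcs]) <;>
      (try ring)

theorem bracket_energy_ham (hm : m ≠ 0) (hμ : 0 < μ) (hx : x ∈ regular μ) :
    bracket fullTensor energy (ham m μ) x = 0 := by
  rw [bracket_antisymm (fullTensor_skew x), (HasDiff.of_differentiableAt
    (contDiffAt_ham hm hμ hx).diff).bracket_eq, hamField_energy, neg_eq_zero]
  have hq := fun A v => (hasDiff_frameMom hμ hx.1 A).fderiv_eq v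
  refine fderiv_ham_eq_zero hm hμ hx 0 ?_ ?_ ?_ ?_ ?_ ?_ ?_
  · simp [pos_hamVec]
  · rw [vecL_hamVec]
    ext j
    fin_cases j <;> simp
  · rw [vecM_hamVec]
    ext j
    fin_cases j <;> simp
  all_goals
    rw [hq]
    simp [pos_hamVec, vecL_hamVec, vecM_hamVec, vecP_hamVec]

/-- The derivatives in P_t, L₁, P_θ, P_φ suffice: for Q₁ and Q₂ the columns of L₁ and P_θ form, up
to the factor 1/sin θ, a rotation by φ, and the system is otherwise triangular. -/
theorem linearIndependent_integrals (hμ : 0 < μ) (hx : x ∈ exterior μ) :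
    LinearIndependent ℝ ![fun i => pd energy i x, fun i => pd (fun z => vecQ z 0) i x,
      fun i => pd (fun z => vecQ z 1) i x, fun i => pd (fun z => vecQ z 2) i x] := by
  have h3 : Real.sin (pos x 2) ≠ 0 := sin_ne hμ hx
  have hq := fun i j => (hasDiff_vecQ hμ hx i).pd_eq j
  have he := fun j => (hasDiff_energy (x := x)).pd_eq j
  rw [Fintype.linearIndependent_iff]
  intro g hg
  have hg' : ∀ j, g 0 * pd energy j x + g 1 * pd (fun z => vecQ z 0) j x
      + g 2 * pd (fun z => vecQ z 1) j x + g 3 * pd (fun z => vecQ z 2) j x = 0 := fun j => by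
    simpa [Fin.sum_univ_four] using congr_fun hg j
  have a0 := hg' (.inr (.inl 0))
  have a1 := hg' (.inl (.inl 0))
  have a2 := hg' (.inr (.inl 2))
  have a3 := hg' (.inr (.inl 3))
  simp only [hq, he] at a0 a1 a2 a3
  simp [vecL_single_L, vecL_single_P, vecP_single_P, vecP_single_L, pos_single_P, pos_single_L]
    at a0 a1 a2 a3
  have hcp := Real.cos_sq_add_sin_sq (pos x 3)
  rw [← mul_div_assoc, ← mul_div_assoc, ← add_div, div_eq_zero_iff, or_iff_left h3] at a1
  have g1 : g 1 = 0 := by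
    linear_combination Real.cos (pos x 3) * a1 - Real.sin (pos x 3) * a2 - g 1 * hcp
  have g2 : g 2 = 0 := by
    linear_combination Real.sin (pos x 3) * a1 + Real.cos (pos x 3) * a2 - g 2 * hcp
  have g3 : g 3 = 0 := by
    simpa [g1, g2] using a3
  intro i
  fin_cases i <;> assumption

theorem integrals_conserved (hm : m ≠ 0) (hμ : 0 < μ) {I : Set ℝ} {γ : ℝ → Full}
    (hI : IsOpenInterval I) (hγ : IsTrajectory fullTensor (ham m μ) I γ)
    (hr : ∀ τ ∈ I, γ τ ∈ regular μ) {s τ : ℝ} (hs : s ∈ I) (hτ : τ ∈ I) :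
    energy (γ τ) = energy (γ s) ∧ vecQ (γ τ) = vecQ (γ s) := by
  refine ⟨eq_of_hasDerivAt_zero hI (f := fun τ => energy (γ τ)) (fun τ hτ => ?_) hτ hs,
    funext fun i => eq_of_hasDerivAt_zero hI (f := fun τ => vecQ (γ τ) i) (fun τ hτ => ?_) hτ hs⟩
  · rw [← bracket_energy_ham hm hμ (hr τ hτ)]
    exact hγ.hasDerivAt_comp hτ hasDiff_energy.differentiableAt
  · rw [← bracket_vecQ_ham hm hμ (hr τ hτ) i]
    exact hγ.hasDerivAt_comp hτ (hasDiff_vecQ hμ (hr τ hτ).1 i).differentiableAt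

end Integrals

/-! ### The reduced variables and their brackets -/

section ReducedVariables

variable {x : Full} {m μ : ℝ}

/-- The norm of `L`. -/
def normL (x : Full) : ℝ := √(∑ i, vecL x i ^ 2)

/-- The direction cosine `L₂ / ρ`. -/
def dirU (x : Full) : ℝ := vecL x 1 / perpL x

/-- The direction cosine `L₃ / ρ`. -/
def dirV (x : Full) : ℝ := vecL x 2 / perpL x

/-- The function `(L₁ cos θ - P_φ) / sin θ`. -/
def angX (x : Full) : ℝ := (vecL x 0 * Real.cos (pos x 2) - vecP x 3) / Real.sin (pos x 2)

/-- The function `(L₁ - P_φ cos θ) / sin θ`. -/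
def angY (x : Full) : ℝ := (vecL x 0 - vecP x 3 * Real.cos (pos x 2)) / Real.sin (pos x 2)

theorem sq_perpL (x : Full) : perpL x ^ 2 = vecL x 1 ^ 2 + vecL x 2 ^ 2 :=
  Real.sq_sqrt (by positivity)

theorem sq_normL (x : Full) : normL x ^ 2 = vecL x 0 ^ 2 + perpL x ^ 2 := by
  rw [normL, Real.sq_sqrt (by positivity), sq_perpL, Fin.sum_univ_three]
  ring

theorem normL_pos (h : 0 < perpL x) : 0 < normL x := by
  refine (Real.sqrt_nonneg _).lt_of_ne' fun h0 => ?_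
  have := sq_normL x
  rw [normL, h0] at this
  nlinarith [sq_nonneg (vecL x 0)]

theorem vecL_one (h : 0 < perpL x) : vecL x 1 = perpL x * dirU x := by
  rw [dirU]
  field_simp

theorem vecL_two (h : 0 < perpL x) : vecL x 2 = perpL x * dirV x := by
  rw [dirV]
  field_simp

theorem sq_dirV (h : 0 < perpL x) : dirV x ^ 2 = 1 - dirU x ^ 2 := by
  have := sq_perpL x
  rw [dirU, dirV]
  field_simp
  linarith

theorem cube_dirV (h : 0 < perpL x) : dirV x ^ 3 = dirV x * (1 - dirU x ^ 2) := by
  rw [pow_succ, sq_dirV h, mul_comm]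

theorem redMap_eq (x : Full) : redMap x = Sum.elim (Sum.elim
    ![vecL x 0, dirV x * vecP x 2 + dirU x * angX x, -(dirU x * vecP x 2) + dirV x * angX x]
    ![-(vecM x 0 * normL x) / perpL x, normL x, dirV x * vecM x 1 - dirU x * vecM x 2])
    ![pos x 1, vecP x 1] := by
  simp only [redMap, dirU, dirV, angX, normL]
  congr 2
  · congr 2
    · ring
    · congr 1
      ring
  · congr 3
    ring

/-- The partial derivatives of the reduced variables with respect to `L`. -/
def redGradL (x : Full) : RedIdx → Fin 3 → ℝ :=
  Sum.elim (Sum.elim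
    ![![1, 0, 0],
      ![dirU x * Real.cos (pos x 2) / Real.sin (pos x 2),
        dirV x * vecE (redMap x) 2 / perpL x, -(dirU x * vecE (redMap x) 2 / perpL x)],
      ![dirV x * Real.cos (pos x 2) / Real.sin (pos x 2),
        -(dirV x * vecE (redMap x) 1 / perpL x), dirU x * vecE (redMap x) 1 / perpL x]]
    ![![-(vecM x 0 * vecL x 0 / (normL x * perpL x)),
        -(vecM x 0 / normL x + vecZ (redMap x) 0 / perpL x) * dirU x,
        -(vecM x 0 / normL x + vecZ (redMap x) 0 / perpL x) * dirV x],
      ![vecL x 0 / normL x, perpL x * dirU x / normL x, perpL x * dirV x / normL x],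
      ![0, -(dirV x * (dirU x * vecM x 1 + dirV x * vecM x 2) / perpL x),
        dirU x * (dirU x * vecM x 1 + dirV x * vecM x 2) / perpL x]])
    ![0, 0]

/-- The partial derivatives of the reduced variables with respect to `M`. -/
def redGradM (x : Full) : RedIdx → Fin 3 → ℝ :=
  Sum.elim (Sum.elim 0 ![![-(normL x / perpL x), 0, 0], 0, ![0, dirV x, -dirU x]]) 0

/-- The partial derivatives of the reduced variables with respect to `P`. -/
def redGradP (x : Full) : RedIdx → Fin 4 → ℝ :=
  Sum.elim (Sum.elim ![0, ![0, 0, dirV x, -(dirU x / Real.sin (pos x 2))],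
    ![0, 0, -dirU x, -(dirV x / Real.sin (pos x 2))]] 0) ![0, ![0, 1, 0, 0]]

/-- The partial derivatives of the reduced variables with respect to the coordinates. -/
def redGradY (x : Full) : RedIdx → Fin 4 → ℝ :=
  Sum.elim (Sum.elim ![0, ![0, 0, -(dirU x * angY x / Real.sin (pos x 2)), 0],
    ![0, 0, -(dirV x * angY x / Real.sin (pos x 2)), 0]] 0) ![![0, 1, 0, 0], 0]

theorem hasDiff_perpL (h : 0 < perpL x) :
    HasDiff perpL (fun v => dirU x * vecL v 1 + dirV x * vecL v 2) x := by
  have h0 : vecL x 1 ^ 2 + vecL x 2 ^ 2 ≠ 0 := (Real.sqrt_pos.1 h).ne'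
  refine (HasDiff.sqrt ((hasDiff_vecL 1).sq.add (hasDiff_vecL 2).sq) h0).congr fun v => ?_
  change _ / (2 * perpL x) = _
  rw [dirU, dirV]
  field_simp

theorem hasDiff_normL (h : 0 < perpL x) :
    HasDiff normL (fun v => (∑ i, vecL x i * vecL v i) / normL x) x := by
  have hn := normL_pos h
  have h0 : ∑ i, vecL x i ^ 2 ≠ 0 := (Real.sqrt_pos.1 hn).ne'
  refine (HasDiff.sqrt (HasDiff.sum Finset.univ fun i _ => (hasDiff_vecL i).sq) h0).congr
    fun v => ?_
  change _ / (2 * normL x) = _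
  simp only [Fin.sum_univ_three]
  field_simp

theorem hasDiff_angX (hμ : 0 < μ) (hx : x ∈ exterior μ) : HasDiff angX (fun v =>
    (vecL v 0 * Real.cos (pos x 2) - vecP v 3 - angY x * pos v 2) / Real.sin (pos x 2)) x := by
  have h3 : Real.sin (pos x 2) ≠ 0 := sin_ne hμ hx
  have hcs : Real.cos (pos x 2) ^ 2 = 1 - Real.sin (pos x 2) ^ 2 := Real.cos_sq' _
  refine ((((hasDiff_vecL 0).mul (hasDiff_pos 2).cos).sub (hasDiff_vecP 3)).div
    (hasDiff_pos 2).sin h3).congr fun v => ?_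
  rw [angY]
  field_simp
  ring_nf
  simp only [hcs]
  ring

theorem hasDiff_redMap (hμ : 0 < μ) (hx : x ∈ exterior μ) (h : 0 < perpL x) (a : RedIdx) :
    HasDiff (fun z => redMap z a) (fun v => ∑ i, redGradL x a i * vecL v i
      + ∑ i, redGradM x a i * vecM v i + ∑ i, redGradP x a i * vecP v i
      + ∑ i, redGradY x a i * pos v i) x := by
  have h3 : Real.sin (pos x 2) ≠ 0 := sin_ne hμ hx
  have hn := (normL_pos h).ne'
  have hρ := h.ne'
  have hV := sq_dirV h
  have h1 := vecL_one h
  have h2 := vecL_two h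
  have hX := hasDiff_angX hμ hx
  -- A unit vector varies perpendicularly to itself. This is why E₂ and E₃ occur in each other's
  -- gradients.
  have hu : HasDiff dirU (fun v => dirV x * (dirV x * vecL v 1 - dirU x * vecL v 2) / perpL x) x := by
    refine ((hasDiff_vecL 1).div (hasDiff_perpL h) hρ).congr fun v => ?_
    rw [h1]
    field_simp
    linear_combination -vecL v 1 * hV
  have hv : HasDiff dirV (fun v => -(dirU x * (dirV x * vecL v 1 - dirU x * vecL v 2) / perpL x)) x := by
    refine ((hasDiff_vecL 2).div (hasDiff_perpL h) hρ).congr fun v => ?_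
    rw [h2]
    field_simp
    linear_combination -vecL v 2 * hV
  simp only [redMap_eq]
  rcases a with (i | i) | i
  · fin_cases i
    · refine (hasDiff_vecL 0).congr fun v => ?_
      simp [redGradL, redGradM, redGradP, redGradY, Fin.sum_univ_succ]
    · refine ((hv.mul (hasDiff_vecP 2)).add (hu.mul hX)).congr fun v => ?_
      simp [redGradL, redGradM, redGradP, redGradY, Fin.sum_univ_succ, redMap_eq, vecE]
      field_simp
      ring
    · refine ((hu.mul (hasDiff_vecP 2)).neg.add (hv.mul hX)).congr fun v => ?_
      simp [redGradL, redGradM, redGradP, redGradY, Fin.sum_univ_succ, redMap_eq, vecE]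
      field_simp
      ring
  · fin_cases i
    · refine (((hasDiff_vecM 0).mul (hasDiff_normL h)).neg.div (hasDiff_perpL h) hρ).congr
        fun v => ?_
      simp [redGradL, redGradM, redGradP, redGradY, Fin.sum_univ_succ, redMap_eq, vecZ, h1, h2]
      field_simp
      ring
    · refine (hasDiff_normL h).congr fun v => ?_
      simp [redGradL, redGradM, redGradP, redGradY, Fin.sum_univ_succ, h1, h2]
      field_simp
    · refine ((hv.mul (hasDiff_vecM 1)).sub (hu.mul (hasDiff_vecM 2))).congr fun v => ?_
      simp [redGradL, redGradM, redGradP, redGradY, Fin.sum_univ_succ]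
      field_simp
      ring
  · fin_cases i
    · refine (hasDiff_pos 1).congr fun v => ?_
      simp [redGradL, redGradM, redGradP, redGradY, Fin.sum_univ_succ]
    · refine (hasDiff_vecP 1).congr fun v => ?_
      simp [redGradL, redGradM, redGradP, redGradY, Fin.sum_univ_succ]

theorem hamField_redMap (hμ : 0 < μ) (hx : x ∈ exterior μ) (h : 0 < perpL x) (a : RedIdx) :
    hamField fullTensor (fun z => redMap z a) x
      = hamVec x (redGradL x a) (redGradM x a) (redGradP x a) (redGradY x a) :=
  hamField_of_hasDiff (hasDiff_redMap hμ hx h a) _ _ _ _ fun _ => rfl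

theorem contDiffAt_redMap (hμ : 0 < μ) (hx : x ∈ exterior μ) (h : 0 < perpL x) :
    ContDiffAt ℝ ∞ redMap x := by
  have h3 : Real.sin (pos x 2) ≠ 0 := sin_ne hμ hx
  have h0 : vecL x 1 ^ 2 + vecL x 2 ^ 2 ≠ 0 := (Real.sqrt_pos.1 h).ne'
  have h0' : ∑ i, vecL x i ^ 2 ≠ 0 := (Real.sqrt_pos.1 (normL_pos h)).ne'
  have hL : ∀ i, ContDiffAt ℝ ∞ (fun z => vecL z i) x := fun i => contDiffAt_coord _
  have hM : ∀ i, ContDiffAt ℝ ∞ (fun z => vecM z i) x := fun i => contDiffAt_coord _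
  have hP : ∀ i, ContDiffAt ℝ ∞ (fun z => vecP z i) x := fun i => contDiffAt_coord _
  have hy : ∀ i, ContDiffAt ℝ ∞ (fun z => pos z i) x := fun i => contDiffAt_coord _
  have hρ : ContDiffAt ℝ ∞ perpL x := ContDiffAt.sqrt (((hL 1).pow 2).add ((hL 2).pow 2)) h0
  have hN : ContDiffAt ℝ ∞ normL x :=
    ContDiffAt.sqrt (ContDiffAt.sum fun i _ => (hL i).pow 2) h0'
  have hX : ContDiffAt ℝ ∞ angX x :=
    (((hL 0).mul (Real.contDiff_cos.contDiffAt.comp x (hy 2))).sub (hP 3)).div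
      (Real.contDiff_sin.contDiffAt.comp x (hy 2)) h3
  have hu : ContDiffAt ℝ ∞ dirU x := (hL 1).div hρ h.ne'
  have hv : ContDiffAt ℝ ∞ dirV x := (hL 2).div hρ h.ne'
  refine contDiffAt_pi.2 fun a => ?_
  simp only [redMap_eq]
  rcases a with (i | i) | i <;> fin_cases i
  · exact hL 0
  · exact (hv.mul (hP 2)).add (hu.mul hX)
  · exact (hu.mul (hP 2)).neg.add (hv.mul hX)
  · exact ((hM 0).mul hN).neg.div hρ h.ne'
  · exact hN
  · exact (hv.mul (hM 1)).sub (hu.mul (hM 2))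
  · exact hy 1
  · exact hP 1

/-- The energy generates translations of t, on which no reduced variable depends. -/
theorem bracket_redMap_energy (hμ : 0 < μ) (hx : x ∈ exterior μ) (h : 0 < perpL x) (a : RedIdx) :
    bracket fullTensor (fun z => redMap z a) energy x = 0 := by
  rw [(hasDiff_redMap hμ hx h a).bracket_eq, hamField_energy, pos_hamVec, vecL_hamVec, vecM_hamVec,
    vecP_hamVec]
  rcases a with (i | i) | i <;> fin_cases i <;> simp [redGradY, Fin.sum_univ_succ]

theorem bracket_redMap_vecQ (hμ : 0 < μ) (hx : x ∈ exterior μ) (h : 0 < perpL x) (a : RedIdx)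
    (i : Fin 3) : bracket fullTensor (fun z => redMap z a) (fun z => vecQ z i) x = 0 := by
  have h3 : Real.sin (pos x 2) ≠ 0 := sin_ne hμ hx
  have hρ := h.ne'
  have hV := sq_dirV h
  have hn := (normL_pos h).ne'
  have hcs : Real.cos (pos x 2) ^ 2 = 1 - Real.sin (pos x 2) ^ 2 := Real.cos_sq' _
  have hV' := cube_dirV h
  rw [(hasDiff_redMap hμ hx h a).bracket_eq, hamField_vecQ hμ hx, pos_hamVec, vecL_hamVec,
    vecM_hamVec, vecP_hamVec]
  rcases a with (j | j) | j <;> fin_cases j <;> fin_cases i <;>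
    simp [redGradL, redGradM, redGradP, redGradY, Fin.sum_univ_succ, cross_apply, redMap_eq, vecE,
      vecZ, vecL_one h, vecL_two h, angX, angY, vecQ, -mul_eq_zero, -mul_eq_mul_left_iff] <;>
    (try field_simp) <;> (try ring_nf) <;> (try simp only [hcs, hV, hV']) <;> (try ring)

theorem vecE_redMap (x : Full) : vecE (redMap x) 0 = vecL x 0 := rfl

theorem vecZ_redMap (x : Full) : vecZ (redMap x) 1 = normL x := rfl

theorem radius_redMap (x : Full) : radius (redMap x) = pos x 1 := rfl

theorem radMom_redMap (x : Full) : radMom (redMap x) = vecP x 1 := rfl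

theorem sq_perpL_eq (x : Full) :
    perpL x ^ 2 = vecZ (redMap x) 1 ^ 2 - vecE (redMap x) 0 ^ 2 := by
  rw [vecE_redMap, vecZ_redMap]
  linarith [sq_normL x]

/-- (E₂, E₃) is obtained from (P_θ, X) by an orthogonal matrix with entries from (u, v). This and
`angX_eq` are its inverse. -/
theorem vecP_two (h : 0 < perpL x) :
    vecP x 2 = dirV x * vecE (redMap x) 1 - dirU x * vecE (redMap x) 2 := by
  have hV := sq_dirV h
  simp only [redMap_eq, vecE]
  simp
  linear_combination -vecP x 2 * hV

theorem angX_eq (h : 0 < perpL x) :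
    angX x = dirU x * vecE (redMap x) 1 + dirV x * vecE (redMap x) 2 := by
  have hV := sq_dirV h
  simp only [redMap_eq, vecE]
  simp
  linear_combination -angX x * hV

theorem angY_eq (hμ : 0 < μ) (hx : x ∈ exterior μ) :
    angY x = vecL x 0 * Real.sin (pos x 2) + Real.cos (pos x 2) * angX x := by
  have h3 : Real.sin (pos x 2) ≠ 0 := sin_ne hμ hx
  have hcs : Real.cos (pos x 2) ^ 2 = 1 - Real.sin (pos x 2) ^ 2 := Real.cos_sq' _
  rw [angY, angX]
  field_simp
  linear_combination -vecL x 0 * hcs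

theorem vecM_zero (h : 0 < perpL x) :
    vecM x 0 = -(vecZ (redMap x) 0 * perpL x / vecZ (redMap x) 1) := by
  have hn := (normL_pos h).ne'
  have hρ := h.ne'
  rw [vecZ_redMap]
  simp only [redMap_eq, vecZ]
  simp
  field_simp

/-- This is the place where C⋆ = 0 enters: it determines the component of M along (L₂, L₃), the only
one that the Z_i do not encode. -/
theorem inner_dir_vecM (h : 0 < perpL x) (hC : casStar x = 0) :
    dirU x * vecM x 1 + dirV x * vecM x 2
      = vecE (redMap x) 0 * vecZ (redMap x) 0 / vecZ (redMap x) 1 := by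
  have hn : vecZ (redMap x) 1 ≠ 0 := (normL_pos h).ne'
  have hρ := h.ne'
  rw [casStar, Fin.sum_univ_three, vecL_one h, vecL_two h, vecM_zero h, ← vecE_redMap] at hC
  field_simp at hC ⊢
  rw [mul_zero, mul_eq_zero, or_iff_right hρ] at hC
  linarith

theorem vecM_one (h : 0 < perpL x) (hC : casStar x = 0) :
    vecM x 1 = dirU x * (vecE (redMap x) 0 * vecZ (redMap x) 0 / vecZ (redMap x) 1)
      + dirV x * vecZ (redMap x) 2 := by
  have hV := sq_dirV h
  have hZ : vecZ (redMap x) 2 = dirV x * vecM x 1 - dirU x * vecM x 2 := by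
    simp [redMap_eq, vecZ]
  rw [← inner_dir_vecM h hC, hZ]
  linear_combination -vecM x 1 * hV

theorem vecM_two (h : 0 < perpL x) (hC : casStar x = 0) :
    vecM x 2 = dirV x * (vecE (redMap x) 0 * vecZ (redMap x) 0 / vecZ (redMap x) 1)
      - dirU x * vecZ (redMap x) 2 := by
  have hV := sq_dirV h
  have hZ : vecZ (redMap x) 2 = dirV x * vecM x 1 - dirU x * vecM x 2 := by
    simp [redMap_eq, vecZ]
  rw [← inner_dir_vecM h hC, hZ]
  linear_combination -vecM x 2 * hV

-- After M is expressed by Z, E₁ and (u, v), each bracket is a rational identity modulo u² + v² = 1,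
-- ρ² = Z₂² - E₁² and sin² + cos² = 1. The direction (u, v) and θ drop out.
set_option maxHeartbeats 2000000 in
theorem bracket_redMap_redMap (hμ : 0 < μ) (hx : x ∈ exterior μ) (h : 0 < perpL x)
    (hC : casStar x = 0) (a b : RedIdx) :
    bracket fullTensor (fun z => redMap z a) (fun z => redMap z b) x
      = redTensor (redMap x) a b := by
  have h3 : Real.sin (pos x 2) ≠ 0 := sin_ne hμ hx
  have hρ := h.ne'
  have hV := sq_dirV h
  have hV' := cube_dirV h
  have hn : vecZ (redMap x) 1 ≠ 0 := (normL_pos h).ne'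
  have hcs : Real.cos (pos x 2) ^ 2 = 1 - Real.sin (pos x 2) ^ 2 := Real.cos_sq' _
  have hρ2 := sq_perpL_eq x
  have hρ4 : perpL x ^ 4 = (vecZ (redMap x) 1 ^ 2 - vecE (redMap x) 0 ^ 2) ^ 2 := by
    rw [← hρ2]
    ring
  rw [(hasDiff_redMap hμ hx h a).bracket_eq, hamField_redMap hμ hx h, pos_hamVec, vecL_hamVec,
    vecM_hamVec, vecP_hamVec]
  simp only [redGradL, redGradM, inner_dir_vecM h hC, redGradY, angY_eq hμ hx, angX_eq h,
    ← vecE_redMap, ← vecZ_redMap]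
  have e1 := vecL_one h
  have e2 := vecL_two h
  have e0 := vecM_zero h
  have e3 := vecM_one h hC
  have e4 := vecM_two h hC
  have e5 := vecE_redMap x
  generalize redMap x = z at *
  rcases a with (i | i) | i <;> fin_cases i <;> rcases b with (j | j) | j <;> fin_cases j <;>
    simp [redGradP, redTensor, hat, hatJ, Fin.sum_univ_succ, cross_apply, e0, e1, e2, e3, e4, ← e5,
      -mul_eq_zero, -mul_eq_mul_left_iff] <;>
    (try field_simp) <;> (try ring_nf) <;> (try simp only [hcs, hV, hV', hρ2, hρ4]) <;> (try ring)

end ReducedVariables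

/-! ### The reduced Hamiltonian in factored form -/

section ReducedHamiltonian

variable {z : Red} {m μ ℰ : ℝ}

theorem redDomain_radius_pos (hμ : 0 < μ) (hz : z ∈ redDomain μ) : 0 < radius z := by
  have := hz.1
  linarith

theorem redDomain_lapse_pos (hμ : 0 < μ) (hz : z ∈ redDomain μ) : 0 < lapse μ (radius z) := by
  have h1 := hz.1
  have h2 := redDomain_radius_pos hμ hz
  rw [lapse, sub_pos, div_lt_one h2]
  exact h1

theorem redDomain_sq_lt (hz : z ∈ redDomain μ) : vecE z 0 ^ 2 < vecZ z 1 ^ 2 :=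
  sq_lt_sq' (by linarith [neg_abs_le (vecE z 0), hz.2]) ((le_abs_self _).trans_lt hz.2)

theorem redDomain_pos (hz : z ∈ redDomain μ) : 0 < vecZ z 1 := (abs_nonneg _).trans_lt hz.2

theorem redW_pos (hz : z ∈ redDomain μ) : 0 < redW z :=
  Real.sqrt_pos.2 (sub_pos.2 (redDomain_sq_lt hz))

theorem sq_redW (hz : z ∈ redDomain μ) : redW z ^ 2 = vecZ z 1 ^ 2 - vecE z 0 ^ 2 :=
  Real.sq_sqrt (sub_pos.2 (redDomain_sq_lt hz)).le

theorem redGamma_eq (hμ : 0 < μ) (hz : z ∈ redDomain μ) :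
    redGamma μ z = √(lapse μ (radius z)) * redW z - vecE z 1 := by
  rw [redGamma, Real.sqrt_mul (redDomain_lapse_pos hμ hz).le, redW]

theorem sq_sqrt_lapse (hμ : 0 < μ) (hz : z ∈ redDomain μ) :
    √(lapse μ (radius z)) ^ 2 = lapse μ (radius z) :=
  Real.sq_sqrt (redDomain_lapse_pos hμ hz).le

theorem sqrt_radius_mul (hμ : 0 < μ) (hz : z ∈ redDomain μ) :
    √(radius z * (radius z - 2 * μ)) = radius z * √(lapse μ (radius z)) := by
  have h := redDomain_radius_pos hμ hz
  have e : radius z * (radius z - 2 * μ) = radius z ^ 2 * lapse μ (radius z) := by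
    rw [lapse]
    field_simp
  rw [e, Real.sqrt_mul (by positivity), Real.sqrt_sq h.le]

theorem mass_eq (hμ : 0 < μ) (hz : z ∈ redDomain μ) :
    μ = radius z * (1 - √(lapse μ (radius z)) ^ 2) / 2 := by
  have h := (redDomain_radius_pos hμ hz).ne'
  rw [sq_sqrt_lapse hμ hz, lapse]
  field_simp
  ring

/-- The time component of the linear momentum with respect to the tetrad, in the reduced
variables. -/
def redQ (μ ℰ : ℝ) (z : Red) : ℝ :=
  (μ * redTheta z / radius z ^ 2 - ℰ) / √(lapse μ (radius z))

/-- The component of `M` along `(L₂, L₃)`, in the reduced variables. -/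
def redA (z : Red) : ℝ := vecE z 0 * vecZ z 0 / vecZ z 1

/-- The components of the Tulczyjew vector with respect to a rotated tetrad, in the reduced
variables. -/
def redTul (μ ℰ : ℝ) (z : Red) : Fin 4 → ℝ :=
  ![-(redTheta z * √(lapse μ (radius z)) * radMom z) - redA z * vecE z 2 / radius z
      - vecZ z 2 * redGamma μ z / radius z,
    redTheta z * redQ μ ℰ z - redW z * redGamma μ z / radius z,
    -(redA z * redQ μ ℰ z) + vecE z 0 * redGamma μ z / radius z,
    -(vecZ z 2 * redQ μ ℰ z) - redW z * √(lapse μ (radius z)) * radMom z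
      - vecE z 0 * vecE z 2 / radius z]

/-- The components of the tidal covector with respect to a rotated tetrad, in the reduced
variables. -/
def redTidal (μ ℰ : ℝ) (z : Red) : Fin 4 → ℝ :=
  ![2 * (redTheta z * √(lapse μ (radius z)) * radMom z) - redA z * vecE z 2 / radius z
      - vecZ z 2 * redGamma μ z / radius z,
    2 * (redTheta z * redQ μ ℰ z) + redW z * redGamma μ z / radius z,
    redA z * redQ μ ℰ z + 2 * (vecE z 0 * redGamma μ z / radius z),
    vecZ z 2 * redQ μ ℰ z + redW z * √(lapse μ (radius z)) * radMom z
      - 2 * (vecE z 0 * vecE z 2 / radius z)]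

theorem redMassSq_eq (hμ : 0 < μ) (hz : z ∈ redDomain μ) : redMassSq μ ℰ z
    = redQ μ ℰ z ^ 2 - lapse μ (radius z) * radMom z ^ 2
      - (vecE z 2 ^ 2 + redGamma μ z ^ 2) / radius z ^ 2 := by
  have h1 := (redDomain_radius_pos hμ hz).ne'
  have h2 := (redDomain_lapse_pos hμ hz).ne'
  have e : radius z - 2 * μ = radius z * lapse μ (radius z) := by
    rw [lapse]
    field_simp
  rw [redMassSq, redQ, e, div_pow, sq_sqrt_lapse hμ hz]
  field_simp
  ring

/-- The long explicit formula is an expansion of the same structure as `ham_frame`: minus half the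
squared mass over m, minus the pairing of f with the tidal covector over mV. Smoothness and the
comparison with the full Hamiltonian are both read off from this form. -/
theorem redHam_eq (hm : m ≠ 0) (hμ : 0 < μ) (hz : z ∈ redDomain μ) (hV : redV μ ℰ z ≠ 0) :
    redHam m μ ℰ z = -redMassSq μ ℰ z / (2 * m)
      - (∑ i, redTul μ ℰ z i * redTidal μ ℰ z i) / (m * redV μ ℰ z) := by
  have hr := (redDomain_radius_pos hμ hz).ne'
  have ha := redDomain_lapse_pos hμ hz
  have hs := (Real.sqrt_pos.2 ha).ne'
  have hZ := (redDomain_pos hz).ne'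
  have hW := sq_redW hz
  have hW3 : redW z ^ 3 = redW z * (vecZ z 1 ^ 2 - vecE z 0 ^ 2) := by rw [← hW]; ring
  have hW4 : redW z ^ 4 = (vecZ z 1 ^ 2 - vecE z 0 ^ 2) ^ 2 := by rw [← hW]; ring
  have hsW : √(vecZ z 1 ^ 2 - vecE z 0 ^ 2) = redW z := rfl
  have hΓ := redGamma_eq hμ hz
  have hM := mass_eq hμ hz
  have e1 : radius z - 2 * μ = radius z * lapse μ (radius z) := by
    rw [lapse]
    field_simp
  have e2 := sqrt_radius_mul hμ hz
  have e3 : lapse μ (radius z) = √(lapse μ (radius z)) ^ 2 := (sq_sqrt_lapse hμ hz).symm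
  rw [redMassSq_eq hμ hz]
  simp only [redHam, hsW, e2]
  simp only [e1]
  simp only [Fin.sum_univ_four, redTul, redTidal]
  simp
  -- V may stay opaque, because the identity holds for each numerator over V separately. The rest is
  -- rational in r, s = √a and W, modulo W² = Z₂² - E₁².
  generalize redV μ ℰ z = V at *
  simp only [redQ, redTheta, redA, hΓ]
  generalize hs' : √(lapse μ (radius z)) = s at *
  simp only [e3]
  generalize radius z = r at *
  generalize redW z = W at *
  subst hM
  field_simp
  ring_nf
  simp only [hW, hW3, hW4]
  ring

end ReducedHamiltonian

/-! ### The full quantities in terms of the reduced variables -/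

section ReductionIdentities

variable {x : Full} {m μ : ℝ}

theorem redMap_mem_redDomain (hx : x ∈ exterior μ) (h : 0 < perpL x) :
    redMap x ∈ redDomain μ := by
  refine ⟨hx.1, abs_lt_of_sq_lt_sq ?_ (normL_pos h).le⟩
  have h1 := sq_perpL_eq x
  have h2 := pow_pos h 2
  linarith

theorem redW_redMap (h : 0 < perpL x) : redW (redMap x) = perpL x := by
  rw [redW, ← sq_perpL_eq, Real.sqrt_sq h.le]

theorem redGamma_redMap (hμ : 0 < μ) (hx : x ∈ exterior μ) (h : 0 < perpL x) :
    redGamma μ (redMap x) = √(lapse μ (pos x 1)) * perpL x - vecE (redMap x) 1 := by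
  rw [redGamma_eq hμ (redMap_mem_redDomain hx h), redW_redMap h, radius_redMap]

theorem vecM_zero_eq (h : 0 < perpL x) : vecM x 0 = -redTheta (redMap x) := by
  rw [vecM_zero h, redTheta, redW_redMap h]
  ring

theorem frameMom_zero (hμ : 0 < μ) (hx : x ∈ exterior μ) (h : 0 < perpL x) :
    frameMom μ 0 x = redQ μ (energy x) (redMap x) := by
  rw [frameMom_eq hμ hx, redQ, radius_redMap]
  simp [vecM_zero_eq h, energy]
  ring

theorem frameMom_one (hμ : 0 < μ) (hx : x ∈ exterior μ) :
    frameMom μ 1 x = √(lapse μ (pos x 1)) * vecP x 1 := frameMom_eq hμ hx 1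

theorem frameMom_two (hμ : 0 < μ) (hx : x ∈ exterior μ) (h : 0 < perpL x) :
    frameMom μ 2 x = -((dirV x * redGamma μ (redMap x) + dirU x * vecE (redMap x) 2) / pos x 1) := by
  rw [frameMom_eq hμ hx, redGamma_redMap hμ hx h]
  simp [vecP_two h, vecL_two h]
  ring

theorem frameMom_three (hμ : 0 < μ) (hx : x ∈ exterior μ) (h : 0 < perpL x) :
    frameMom μ 3 x = (dirU x * redGamma μ (redMap x) - dirV x * vecE (redMap x) 2) / pos x 1 := by
  rw [frameMom_eq hμ hx, redGamma_redMap hμ hx h]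
  change (√(lapse μ (pos x 1)) * vecL x 1 - angX x) / pos x 1 = _
  rw [angX_eq h, vecL_one h]
  ring

theorem redMassSq_redMap (hμ : 0 < μ) (hx : x ∈ exterior μ) (h : 0 < perpL x) :
    redMassSq μ (energy x) (redMap x) = -momSq μ x := by
  have h1 : pos x 1 ≠ 0 := radius_ne hμ hx
  have hV := sq_dirV h
  rw [redMassSq_eq hμ (redMap_mem_redDomain hx h), momSq_eq hμ hx, frameMom_zero hμ hx h,
    frameMom_one hμ hx, frameMom_two hμ hx h, frameMom_three hμ hx h,
    ← sq_sqrt_lapse hμ (redMap_mem_redDomain hx h), radius_redMap, radMom_redMap]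
  field_simp
  ring_nf
  simp only [hV]
  ring

theorem frameDenom_eq (hμ : 0 < μ) (hx : x ∈ exterior μ) (h : 0 < perpL x) (hC : casStar x = 0) :
    frameDenom μ x = redV μ (energy x) (redMap x) := by
  have hn : vecZ (redMap x) 1 ≠ 0 := (normL_pos h).ne'
  have hV := sq_dirV h
  have hρ := sq_perpL_eq x
  rw [frameDenom, redV, redMassSq_redMap hμ hx h]
  simp [Fin.sum_univ_four, spinFrame, tidalMatrix, vecM_zero h, vecM_one h hC, vecM_two h hC,
    vecL_one h, vecL_two h, ← vecE_redMap, radius_redMap]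
  field_simp
  ring_nf
  simp only [hV, hρ]
  ring

theorem denom_redMap (hμ : 0 < μ) (hx : x ∈ exterior μ) (h : 0 < perpL x) (hC : casStar x = 0) :
    curvScalar μ x + 2 * momSq μ x = -2 * μ / pos x 1 ^ 3 * redV μ (energy x) (redMap x) := by
  rw [denom_eq hμ hx, frameDenom_eq hμ hx h hC]

theorem redV_ne (hμ : 0 < μ) (hx : x ∈ regular μ) (h : 0 < perpL x) (hC : casStar x = 0) :
    redV μ (energy x) (redMap x) ≠ 0 := by
  rw [← frameDenom_eq hμ hx.1 h hC]
  exact frameDenom_ne hμ hx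

theorem mem_regular (hμ : 0 < μ) (hx : x ∈ exterior μ) (h : 0 < perpL x) (hC : casStar x = 0)
    (hV : redV μ (energy x) (redMap x) ≠ 0) : x ∈ regular μ := by
  refine ⟨hx, ?_⟩
  rw [denom_redMap hμ hx h hC]
  have h1 : pos x 1 ≠ 0 := radius_ne hμ hx
  exact mul_ne_zero (div_ne_zero (by linarith) (pow_ne_zero 3 h1)) hV

theorem frameTul_zero (hμ : 0 < μ) (hx : x ∈ exterior μ) (h : 0 < perpL x) (hC : casStar x = 0) :
    frameTul μ 0 x = redTul μ (energy x) (redMap x) 0 := by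
  have hV := sq_dirV h
  simp [frameTul, Fin.sum_univ_four, spinFrame, redTul, vecM_zero_eq h, vecM_one h hC,
    vecM_two h hC, frameMom_one hμ hx, frameMom_two hμ hx h, frameMom_three hμ hx h, redA,
    radius_redMap, radMom_redMap]
  ring_nf
  simp only [hV]
  ring

theorem frameTul_one (hμ : 0 < μ) (hx : x ∈ exterior μ) (h : 0 < perpL x) :
    frameTul μ 1 x = redTul μ (energy x) (redMap x) 1 := by
  have hV := sq_dirV h
  simp [frameTul, Fin.sum_univ_four, spinFrame, redTul, vecM_zero_eq h, vecL_one h, vecL_two h,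
    frameMom_zero hμ hx h, frameMom_two hμ hx h, frameMom_three hμ hx h, redW_redMap h,
    radius_redMap]
  ring_nf
  simp only [hV]
  ring

theorem frameTul_parallel (hμ : 0 < μ) (hx : x ∈ exterior μ) (h : 0 < perpL x)
    (hC : casStar x = 0) : dirU x * frameTul μ 2 x + dirV x * frameTul μ 3 x
      = redTul μ (energy x) (redMap x) 2 := by
  have hV := sq_dirV h
  simp [frameTul, Fin.sum_univ_four, spinFrame, redTul, vecM_one h hC,
    vecM_two h hC, vecL_one h, vecL_two h, ← vecE_redMap, frameMom_zero hμ hx h,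
    frameMom_one hμ hx, frameMom_two hμ hx h, frameMom_three hμ hx h, redA, radius_redMap]
  ring_nf
  simp only [hV]
  ring

theorem frameTul_orthogonal (hμ : 0 < μ) (hx : x ∈ exterior μ) (h : 0 < perpL x)
    (hC : casStar x = 0) : dirV x * frameTul μ 2 x - dirU x * frameTul μ 3 x
      = redTul μ (energy x) (redMap x) 3 := by
  have hV := sq_dirV h
  simp [frameTul, Fin.sum_univ_four, spinFrame, redTul, vecM_one h hC,
    vecM_two h hC, vecL_one h, vecL_two h, ← vecE_redMap, frameMom_zero hμ hx h,
    frameMom_one hμ hx, frameMom_two hμ hx h, frameMom_three hμ hx h, redA, radius_redMap,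
    redW_redMap h, radMom_redMap]
  ring_nf
  simp only [hV]
  ring

theorem frameTidal_zero (hμ : 0 < μ) (hx : x ∈ exterior μ) (h : 0 < perpL x) (hC : casStar x = 0) :
    frameTidal μ 0 x = redTidal μ (energy x) (redMap x) 0 := by
  have hV := sq_dirV h
  simp [frameTidal, Fin.sum_univ_four, spinFrame, tidalMatrix, minkowski, redTidal, vecM_zero_eq h,
    vecM_one h hC, vecM_two h hC, frameMom_one hμ hx, frameMom_two hμ hx h,
    frameMom_three hμ hx h, redA, radius_redMap, radMom_redMap]
  ring_nf
  simp only [hV]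
  ring

theorem frameTidal_one (hμ : 0 < μ) (hx : x ∈ exterior μ) (h : 0 < perpL x) :
    frameTidal μ 1 x = redTidal μ (energy x) (redMap x) 1 := by
  have hV := sq_dirV h
  simp [frameTidal, Fin.sum_univ_four, spinFrame, tidalMatrix, minkowski, redTidal, vecM_zero_eq h,
    vecL_one h, vecL_two h, frameMom_zero hμ hx h, frameMom_two hμ hx h, frameMom_three hμ hx h,
    redW_redMap h, radius_redMap]
  ring_nf
  simp only [hV]
  ring

theorem frameTidal_parallel (hμ : 0 < μ) (hx : x ∈ exterior μ) (h : 0 < perpL x)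
    (hC : casStar x = 0) : dirU x * frameTidal μ 2 x + dirV x * frameTidal μ 3 x
      = redTidal μ (energy x) (redMap x) 2 := by
  have hV := sq_dirV h
  simp [frameTidal, Fin.sum_univ_four, spinFrame, tidalMatrix, minkowski, redTidal, vecM_one h hC,
    vecM_two h hC, vecL_one h, vecL_two h, ← vecE_redMap, frameMom_zero hμ hx h,
    frameMom_one hμ hx, frameMom_two hμ hx h, frameMom_three hμ hx h, redA, radius_redMap]
  ring_nf
  simp only [hV]
  ring

theorem frameTidal_orthogonal (hμ : 0 < μ) (hx : x ∈ exterior μ) (h : 0 < perpL x)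
    (hC : casStar x = 0) : dirV x * frameTidal μ 2 x - dirU x * frameTidal μ 3 x
      = redTidal μ (energy x) (redMap x) 3 := by
  have hV := sq_dirV h
  simp [frameTidal, Fin.sum_univ_four, spinFrame, tidalMatrix, minkowski, redTidal, vecM_one h hC,
    vecM_two h hC, vecL_one h, vecL_two h, ← vecE_redMap, frameMom_zero hμ hx h,
    frameMom_one hμ hx, frameMom_two hμ hx h, frameMom_three hμ hx h, redA, radius_redMap,
    redW_redMap h, radMom_redMap]
  ring_nf
  simp only [hV]
  ring

/-- The pairing of f with the tidal covector does not change under an orthogonal change of the last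
two legs; in the legs adapted to (L₂, L₃) all components are functions of the reduced variables. -/
theorem ham_redMap (hm : m ≠ 0) (hμ : 0 < μ) (hx : x ∈ regular μ) (h : 0 < perpL x)
    (hC : casStar x = 0) : ham m μ x = redHam m μ (energy x) (redMap x) := by
  have hV := sq_dirV h
  rw [redHam_eq hm hμ (redMap_mem_redDomain hx.1 h) (redV_ne hμ hx h hC), ham_frame hμ hx.1,
    frameDenom_eq hμ hx.1 h hC, redMassSq_redMap hμ hx.1 h, neg_neg]
  congr 2
  rw [Fin.sum_univ_four, Fin.sum_univ_four, ← frameTul_zero hμ hx.1 h hC,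
    ← frameTul_one hμ hx.1 h, ← frameTul_parallel hμ hx.1 h hC, ← frameTul_orthogonal hμ hx.1 h hC,
    ← frameTidal_zero hμ hx.1 h hC, ← frameTidal_one hμ hx.1 h,
    ← frameTidal_parallel hμ hx.1 h hC, ← frameTidal_orthogonal hμ hx.1 h hC]
  linear_combination (-frameTul μ 2 x * frameTidal μ 2 x
    - frameTul μ 3 x * frameTidal μ 3 x) * hV

theorem redCirc_redMap (h : 0 < perpL x) (hC : casStar x = 0) :
    redCirc (redMap x) = casCirc x := by
  have hn : vecZ (redMap x) 1 ≠ 0 := (normL_pos h).ne'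
  have hV := sq_dirV h
  have hρ := sq_perpL_eq x
  rw [redCirc, casCirc, Fin.sum_univ_three, Fin.sum_univ_three, vecM_zero h, vecM_one h hC,
    vecM_two h hC, vecL_one h, vecL_two h, ← vecE_redMap]
  field_simp
  ring_nf
  simp only [hV, hρ]
  ring

theorem redF_redMap (hμ : 0 < μ) (hx : x ∈ exterior μ) (h : 0 < perpL x) :
    redF (redMap x) = ∑ i, vecQ x i ^ 2 := by
  have h3 : Real.sin (pos x 2) ≠ 0 := sin_ne hμ hx
  have hV := sq_dirV h
  have hcs : Real.cos (pos x 2) ^ 2 = 1 - Real.sin (pos x 2) ^ 2 := Real.cos_sq' _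
  have hcp : Real.cos (pos x 3) ^ 2 = 1 - Real.sin (pos x 3) ^ 2 := Real.cos_sq' _
  simp only [redF, redMap_eq, vecE, Fin.sum_univ_three, vecQ, angX]
  simp
  field_simp
  ring_nf
  simp only [hV, hcs, hcp]
  ring_nf

theorem tulczyjew_frame (μ : ℝ) (x : Full) (α : Fin 4) :
    tulczyjew μ α x = tetradDiag μ (pos x) α * frameTul μ α x := tulczyjew_eq μ x α

section

variable {z : Red} {ℰ : ℝ}

theorem redTulT_eq (hμ : 0 < μ) (hz : z ∈ redDomain μ) :
    redTulT μ z = 1 / √(lapse μ (radius z)) * redTul μ ℰ z 0 := by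
  have hr := (redDomain_radius_pos hμ hz).ne'
  have hs := (Real.sqrt_pos.2 (redDomain_lapse_pos hμ hz)).ne'
  have hZ := (redDomain_pos hz).ne'
  rw [redTulT, sqrt_radius_mul hμ hz]
  simp [redTul, redGamma_eq hμ hz, redA]
  field_simp
  ring

theorem redTulR_eq (hμ : 0 < μ) (hz : z ∈ redDomain μ) :
    redTulR μ ℰ z = √(lapse μ (radius z)) * redTul μ ℰ z 1 := by
  have hr := (redDomain_radius_pos hμ hz).ne'
  have hs := (Real.sqrt_pos.2 (redDomain_lapse_pos hμ hz)).ne'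
  rw [redTulR]
  simp [redTul, redGamma_eq hμ hz, redQ]
  field_simp
  ring

theorem redTulN_eq (hμ : 0 < μ) (hz : z ∈ redDomain μ) :
    redTulN μ ℰ z = -redTul μ ℰ z 3 := by
  have hr := (redDomain_radius_pos hμ hz).ne'
  have hs := (Real.sqrt_pos.2 (redDomain_lapse_pos hμ hz)).ne'
  rw [redTulN]
  simp [redTul, redQ]
  field_simp
  ring

/-- The projection of the spatial part of the Tulczyjew vector to `L` vanishes. -/
theorem redTul_parallel (hμ : 0 < μ) (hz : z ∈ redDomain μ) :
    redW z * redTul μ ℰ z 2 = -vecE z 0 * redTul μ ℰ z 1 := by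
  have hr := (redDomain_radius_pos hμ hz).ne'
  have hZ := (redDomain_pos hz).ne'
  simp [redTul, redA, redTheta]
  field_simp
  ring

/-- When the Pfaffian vanishes, the dual of the spin tensor annihilates the image of the spin
tensor, to which f belongs. This relation and `redTul_parallel` are two components of that fact, so
f has only two independent components in general. -/
theorem redTul_orthogonal (hμ : 0 < μ) (hz : z ∈ redDomain μ) :
    redTheta z * redTul μ ℰ z 3 = redW z * redTul μ ℰ z 0 - vecZ z 2 * redTul μ ℰ z 1 := by
  have hr := (redDomain_radius_pos hμ hz).ne'
  have hZ := (redDomain_pos hz).ne'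
  simp [redTul, redA, redTheta]
  field_simp
  ring

/-- By `redTul_orthogonal`, ΘfN is a combination of f^t and f^r, and Θ vanishes only with Z₁. -/
theorem redTulczyjew_of_redTulT_redTulR (hμ : 0 < μ) (hz : z ∈ redDomain μ) (h0 : vecZ z 0 ≠ 0) :
    z ∈ redTulczyjew μ ℰ ↔ redTulT μ z = 0 ∧ redTulR μ ℰ z = 0 := by
  refine ⟨fun h => ⟨h.1, h.2.1⟩, fun h => ⟨h.1, h.2, ?_⟩⟩
  have hs := (Real.sqrt_pos.2 (redDomain_lapse_pos hμ hz)).ne'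
  have hΘ : redTheta z ≠ 0 := mul_ne_zero (div_ne_zero h0 (redDomain_pos hz).ne') (redW_pos hz).ne'
  obtain ⟨hT, hR⟩ := h
  rw [redTulT_eq (ℰ := ℰ) hμ hz, mul_eq_zero, or_iff_right (one_div_ne_zero hs)] at hT
  rw [redTulR_eq hμ hz, mul_eq_zero, or_iff_right hs] at hR
  have := redTul_orthogonal (ℰ := ℰ) hμ hz
  rw [hT, hR, mul_zero, mul_zero, sub_zero, mul_eq_zero, or_iff_right hΘ] at this
  rw [redTulN_eq hμ hz, this, neg_zero]

/-- The component along (L₂, L₃) is missing in the definition of the set; it follows from f^r = 0 by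
`redTul_parallel`, since W > 0. -/
theorem mem_redTulczyjew_iff (hμ : 0 < μ) (hz : z ∈ redDomain μ) :
    z ∈ redTulczyjew μ ℰ ↔ ∀ i, redTul μ ℰ z i = 0 := by
  have hs := (Real.sqrt_pos.2 (redDomain_lapse_pos hμ hz)).ne'
  have h2 := redTul_parallel (ℰ := ℰ) hμ hz
  change (_ ∧ _ ∧ _) ↔ _
  rw [redTulT_eq (ℰ := ℰ) hμ hz, redTulR_eq hμ hz, redTulN_eq hμ hz, mul_eq_zero,
    or_iff_right (one_div_ne_zero hs), mul_eq_zero, or_iff_right hs, neg_eq_zero]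
  refine ⟨fun h i => ?_, fun h => ⟨h 0, h 1, h 3⟩⟩
  rw [h.2.1, mul_zero, mul_eq_zero, or_iff_right (redW_pos hz).ne'] at h2
  fin_cases i
  exacts [h.1, h.2.1, h2, h.2.2]

end

theorem tulczyjew_redMap (hμ : 0 < μ) (hx : x ∈ exterior μ) (h : 0 < perpL x)
    (hC : casStar x = 0) :
    tulczyjew μ 0 x = redTulT μ (redMap x) ∧
    tulczyjew μ 1 x = redTulR μ (energy x) (redMap x) ∧
    (vecL x 1 * (pos x 1 * Real.sin (pos x 2) * tulczyjew μ 3 x)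
      - vecL x 2 * (pos x 1 * tulczyjew μ 2 x)) / perpL x = redTulN μ (energy x) (redMap x) ∧
    ((∀ α, tulczyjew μ α x = 0) ↔ redMap x ∈ redTulczyjew μ (energy x)) := by
  have hz := redMap_mem_redDomain hx h
  have hρ := h.ne'
  have h1 : pos x 1 ≠ 0 := radius_ne hμ hx
  have h3 : Real.sin (pos x 2) ≠ 0 := sin_ne hμ hx
  have hV := sq_dirV h
  refine ⟨?_, ?_, ?_, ?_⟩
  · rw [tulczyjew_frame, frameTul_zero hμ hx h hC, redTulT_eq hμ hz]
    rfl
  · rw [tulczyjew_frame, frameTul_one hμ hx h, redTulR_eq hμ hz]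
    rfl
  · rw [redTulN_eq hμ hz, ← frameTul_orthogonal hμ hx h hC, tulczyjew_frame, tulczyjew_frame,
      vecL_one h, vecL_two h]
    simp [tetradDiag]
    field_simp
  · rw [mem_redTulczyjew_iff hμ hz]
    have e : (∀ α, tulczyjew μ α x = 0) ↔ ∀ α, frameTul μ α x = 0 := by
      refine forall_congr' fun α => ?_
      rw [tulczyjew_frame, mul_eq_zero, or_iff_right (tetradDiag_pos hμ hx α).ne']
    have t0 := frameTul_zero hμ hx h hC
    have t1 := frameTul_one hμ hx h
    have t2 := frameTul_parallel hμ hx h hC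
    have t3 := frameTul_orthogonal hμ hx h hC
    rw [e]
    constructor
    · intro hf i
      simp only [hf] at t0 t1 t2 t3
      fin_cases i
      · exact t0.symm
      · exact t1.symm
      · simpa using t2.symm
      · simpa using t3.symm
    · intro hf α
      simp only [hf] at t0 t1 t2 t3
      fin_cases α
      · exact t0
      · exact t1
      · change frameTul μ 2 x = 0
        linear_combination dirU x * t2 + dirV x * t3 - frameTul μ 2 x * hV
      · change frameTul μ 3 x = 0
        linear_combination dirV x * t2 - dirU x * t3 - frameTul μ 3 x * hV

end ReductionIdentities

/-! ### Smooth dependence and projection of trajectories -/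

section Projection

variable {x : Full} {m μ : ℝ}

theorem isOpen_redDomain (μ : ℝ) : IsOpen (redDomain μ) := by
  have h1 : Continuous radius := continuous_apply _
  have h2 : Continuous fun z : Red => vecE z 0 := continuous_apply _
  have h3 : Continuous fun z : Red => vecZ z 1 := continuous_apply _
  exact (isOpen_lt continuous_const h1).inter (isOpen_lt h2.abs h3)

section Smooth

variable {E : Type*} [NormedAddCommGroup E] [NormedSpace ℝ E] {f : E → Red} {g : E → ℝ} {y : E}

/-- Composition with arbitrary smooth f and g covers at once smoothness for fixed energy and joint
smoothness in the energy and the reduced variables. The latter is needed for the equation of t. -/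
theorem contDiffAt_redV (hμ : 0 < μ) (hf : ContDiffAt ℝ ∞ f y) (hg : ContDiffAt ℝ ∞ g y)
    (hz : f y ∈ redDomain μ) : ContDiffAt ℝ ∞ (fun w => redW (f w)) y ∧
      ContDiffAt ℝ ∞ (fun w => redGamma μ (f w)) y ∧
      ContDiffAt ℝ ∞ (fun w => redTheta (f w)) y ∧
      ContDiffAt ℝ ∞ (fun w => redMassSq μ (g w) (f w)) y ∧
      ContDiffAt ℝ ∞ (fun w => redV μ (g w) (f w)) y := by
  have h0 := (redDomain_radius_pos hμ hz).ne'
  have h1 : radius (f y) - 2 * μ ≠ 0 := (sub_pos.2 hz.1).ne'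
  have h2 := (redDomain_pos hz).ne'
  have h3 := (sub_pos.2 (redDomain_sq_lt hz)).ne'
  have ha := (redDomain_lapse_pos hμ hz).ne'
  have hE : ∀ i, ContDiffAt ℝ ∞ (fun w => vecE (f w) i) y := fun i => contDiffAt_pi.1 hf _
  have hZ : ∀ i, ContDiffAt ℝ ∞ (fun w => vecZ (f w) i) y := fun i => contDiffAt_pi.1 hf _
  have hr : ContDiffAt ℝ ∞ (fun w => radius (f w)) y := contDiffAt_pi.1 hf _
  have hP : ContDiffAt ℝ ∞ (fun w => radMom (f w)) y := contDiffAt_pi.1 hf _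
  have hl : ContDiffAt ℝ ∞ (fun w => lapse μ (radius (f w))) y :=
    contDiffAt_const.sub (contDiffAt_const.div hr h0)
  have hD : ContDiffAt ℝ ∞ (fun w => vecZ (f w) 1 ^ 2 - vecE (f w) 0 ^ 2) y :=
    ((hZ 1).pow 2).sub ((hE 0).pow 2)
  have hW : ContDiffAt ℝ ∞ (fun w => redW (f w)) y := ContDiffAt.sqrt hD h3
  have hΓ : ContDiffAt ℝ ∞ (fun w => redGamma μ (f w)) y :=
    (ContDiffAt.sqrt (hl.mul hD) (mul_ne_zero ha h3)).sub (hE 1)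
  have hΘ : ContDiffAt ℝ ∞ (fun w => redTheta (f w)) y := ((hZ 0).div (hZ 1) h2).mul hW
  have hr3 : ContDiffAt ℝ ∞ (fun w => radius (f w) ^ 3) y := hr.pow 3
  have hr2 : ContDiffAt ℝ ∞ (fun w => radius (f w) ^ 2) y := hr.pow 2
  have hM : ContDiffAt ℝ ∞ (fun w => redMassSq μ (g w) (f w)) y := by
    refine ContDiffAt.sub (ContDiffAt.add ?_ ?_) ?_
    · exact hl.neg.mul (hP.pow 2)
    · have hn : ContDiffAt ℝ ∞ (fun w => (μ * redTheta (f w) - g w * radius (f w) ^ 2) ^ 2) y :=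
        ((contDiffAt_const.mul hΘ).sub (hg.mul hr2)).pow 2
      have hd : ContDiffAt ℝ ∞ (fun w => radius (f w) ^ 3 * (radius (f w) - 2 * μ)) y :=
        hr3.mul (hr.sub contDiffAt_const)
      exact hn.div hd (mul_ne_zero (pow_ne_zero 3 h0) h1)
    · have hn : ContDiffAt ℝ ∞ (fun w => vecE (f w) 2 ^ 2 + redGamma μ (f w) ^ 2) y :=
        ((hE 2).pow 2).add (hΓ.pow 2)
      exact hn.div hr2 (pow_ne_zero 2 h0)
  refine ⟨hW, hΓ, hΘ, hM, ?_⟩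
  have a1 : ContDiffAt ℝ ∞ (fun w => redMassSq μ (g w) (f w) / μ * radius (f w) ^ 3) y :=
    (hM.div_const μ).mul hr3
  have a2 : ContDiffAt ℝ ∞ (fun w => 2 * vecZ (f w) 0 ^ 2) y := contDiffAt_const.mul ((hZ 0).pow 2)
  have a3 : ContDiffAt ℝ ∞ (fun w => vecZ (f w) 0 ^ 2 / vecZ (f w) 1 ^ 2) y :=
    ((hZ 0).pow 2).div ((hZ 1).pow 2) (pow_ne_zero 2 h2)
  have a4 : ContDiffAt ℝ ∞
      (fun w => 3 * vecE (f w) 0 ^ 2 * (1 + vecZ (f w) 0 ^ 2 / vecZ (f w) 1 ^ 2)) y :=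
    (contDiffAt_const.mul ((hE 0).pow 2)).mul (contDiffAt_const.add a3)
  exact (((a1.sub a2).sub ((hZ 1).pow 2)).add ((hZ 2).pow 2)).add a4

theorem contDiffAt_redTul (hμ : 0 < μ) (hf : ContDiffAt ℝ ∞ f y) (hg : ContDiffAt ℝ ∞ g y)
    (hz : f y ∈ redDomain μ) (i : Fin 4) :
    ContDiffAt ℝ ∞ (fun w => redTul μ (g w) (f w) i) y ∧
      ContDiffAt ℝ ∞ (fun w => redTidal μ (g w) (f w) i) y := by
  have h0 := (redDomain_radius_pos hμ hz).ne'
  have h2 := (redDomain_pos hz).ne'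
  have ha := (redDomain_lapse_pos hμ hz).ne'
  have hs0 := (Real.sqrt_pos.2 (redDomain_lapse_pos hμ hz)).ne'
  have hE : ∀ i, ContDiffAt ℝ ∞ (fun w => vecE (f w) i) y := fun i => contDiffAt_pi.1 hf _
  have hZ : ∀ i, ContDiffAt ℝ ∞ (fun w => vecZ (f w) i) y := fun i => contDiffAt_pi.1 hf _
  have hr : ContDiffAt ℝ ∞ (fun w => radius (f w)) y := contDiffAt_pi.1 hf _
  have hP : ContDiffAt ℝ ∞ (fun w => radMom (f w)) y := contDiffAt_pi.1 hf _
  have hs : ContDiffAt ℝ ∞ (fun w => √(lapse μ (radius (f w)))) y :=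
    ContDiffAt.sqrt (contDiffAt_const.sub (contDiffAt_const.div hr h0)) ha
  obtain ⟨hW, hΓ, hΘ, -, -⟩ := contDiffAt_redV hμ hf hg hz
  have hQ0 : ContDiffAt ℝ ∞ (fun w => μ * redTheta (f w) / radius (f w) ^ 2 - g w) y :=
    ((contDiffAt_const.mul hΘ).div (hr.pow 2) (pow_ne_zero 2 h0)).sub hg
  have hQ : ContDiffAt ℝ ∞ (fun w => redQ μ (g w) (f w)) y := hQ0.div hs hs0
  have hA : ContDiffAt ℝ ∞ (fun w => redA (f w)) y := ((hE 0).mul (hZ 0)).div (hZ 1) h2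
  have hd : ∀ {k : E → ℝ}, ContDiffAt ℝ ∞ k y → ContDiffAt ℝ ∞ (fun w => k w / radius (f w)) y :=
    fun hk => hk.div hr h0
  have hc : ∀ {k : E → ℝ}, ContDiffAt ℝ ∞ k y → ContDiffAt ℝ ∞ (fun w => 2 * k w) y :=
    fun hk => contDiffAt_const.mul hk
  have b1 := (hΘ.mul hs).mul hP
  have b2 := hd (hA.mul (hE 2))
  have b3 := hd ((hZ 2).mul hΓ)
  have b4 := hΘ.mul hQ
  have b5 := hd (hW.mul hΓ)
  have b6 := hA.mul hQ
  have b7 := hd ((hE 0).mul hΓ)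
  have b8 := (hZ 2).mul hQ
  have b9 := (hW.mul hs).mul hP
  have b10 := hd ((hE 0).mul (hE 2))
  fin_cases i
  · exact ⟨(b1.neg.sub b2).sub b3, ((hc b1).sub b2).sub b3⟩
  · exact ⟨b4.sub b5, (hc b4).add b5⟩
  · exact ⟨b6.neg.add b7, b6.add (hc b7)⟩
  · exact ⟨(b8.neg.sub b9).sub b10, (b8.add b9).sub (hc b10)⟩

theorem contDiffAt_redHam (hm : m ≠ 0) (hμ : 0 < μ) (hf : ContDiffAt ℝ ∞ f y)
    (hg : ContDiffAt ℝ ∞ g y) (hz : f y ∈ redDomain μ) (hV : redV μ (g y) (f y) ≠ 0) :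
    ContDiffAt ℝ ∞ (fun w => redHam m μ (g w) (f w)) y := by
  obtain ⟨-, -, -, hM, hV'⟩ := contDiffAt_redV hμ hf hg hz
  have hT := contDiffAt_redTul hμ hf hg hz
  have h1 : ∀ᶠ w in 𝓝 y, f w ∈ redDomain μ :=
    -- The factored form is valid where V ≠ 0 inside the domain, an open condition.
    hf.continuousAt.eventually_mem ((isOpen_redDomain μ).mem_nhds hz)
  have h2 : ∀ᶠ w in 𝓝 y, redV μ (g w) (f w) ≠ 0 := hV'.continuousAt.eventually_ne hV
  have hS : ContDiffAt ℝ ∞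
      (fun w => ∑ i, redTul μ (g w) (f w) i * redTidal μ (g w) (f w) i) y :=
    ContDiffAt.sum fun i _ => (hT i).1.mul (hT i).2
  have hD : ContDiffAt ℝ ∞ (fun w => m * redV μ (g w) (f w)) y := contDiffAt_const.mul hV'
  have hF : ContDiffAt ℝ ∞ (fun w => -redMassSq μ (g w) (f w) / (2 * m)
      - (∑ i, redTul μ (g w) (f w) i * redTidal μ (g w) (f w) i) / (m * redV μ (g w) (f w))) y :=
    (hM.neg.div_const _).sub (hS.div hD (mul_ne_zero hm hV))
  refine hF.congr_of_eventuallyEq ?_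
  filter_upwards [h1, h2] with w hw1 hw2
  exact redHam_eq hm hμ hw1 hw2

end Smooth

/-- The chain rule for a function which depends on a parameter. -/
theorem hasDiff_comp_param {ι κ : Type} [Fintype ι] [Fintype κ] [DecidableEq κ]
    {K : ℝ → (κ → ℝ) → ℝ} {e : (ι → ℝ) → ℝ} {f : (ι → ℝ) → κ → ℝ} {y : ι → ℝ}
    (hK : DifferentiableAt ℝ (fun q : ℝ × (κ → ℝ) => K q.1 q.2) (e y, f y))
    (he : DifferentiableAt ℝ e y) (hf : ∀ a, DifferentiableAt ℝ (fun z => f z a) y) :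
    HasDiff (fun w => K (e w) (f w)) (fun v => deriv (fun s => K s (f y)) (e y) * fderiv ℝ e y v
      + ∑ a, fderiv ℝ (fun z => f z a) y v * pd (K (e y)) a (f y)) y := by
  obtain ⟨A, hA⟩ := hK
  have hr : HasFDerivAt f (ContinuousLinearMap.pi fun a => fderiv ℝ (fun z => f z a) y) y :=
    hasFDerivAt_pi.2 fun a => (hf a).hasFDerivAt
  have h1 : A (1, 0) = deriv (fun s => K s (f y)) (e y) := by
    have h3 := (hA.comp (e y) ((hasFDerivAt_id (e y)).prodMk
      (hasFDerivAt_const (f y) (e y)))).hasDerivAt.deriv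
    change deriv (fun s => K s (f y)) (e y) = _ at h3
    rw [h3]
    simp
  have h2 : ∀ v, A (0, v) = ∑ a, v a * pd (K (e y)) a (f y) := by
    intro v
    have h3 : HasDiff (K (e y)) (fun v => A (0, v)) (f y) :=
      ⟨_, hA.comp (f y) ((hasFDerivAt_const (e y) (f y)).prodMk (hasFDerivAt_id (f y))),
        fun v => by simp⟩
    exact h3.apply_eq_sum v
  have h4 := HasFDerivAt.comp (g := fun q : ℝ × (κ → ℝ) => K q.1 q.2) (f := fun w => (e w, f w))
    y hA (he.hasFDerivAt.prodMk hr)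
  refine ⟨_, h4, fun v => ?_⟩
  have e' : ((fderiv ℝ e y) v, fun a => fderiv ℝ (fun z => f z a) y v)
      = (fderiv ℝ e y v) • ((1 : ℝ), (0 : κ → ℝ))
        + ((0 : ℝ), fun a => fderiv ℝ (fun z => f z a) y v) := by
    ext <;> simp
  change A ((fderiv ℝ e y) v, fun a => fderiv ℝ (fun z => f z a) y v) = _
  rw [e', map_add, map_smul, smul_eq_mul, mul_comm, h1, h2]

theorem differentiableAt_redHam (hm : m ≠ 0) (hμ : 0 < μ) {ℰ : ℝ} {z : Red} (hz : z ∈ redDomain μ)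
    (hV : redV μ ℰ z ≠ 0) :
    DifferentiableAt ℝ (fun q : ℝ × Red => redHam m μ q.1 q.2) (ℰ, z) := by
  have hf : ContDiffAt ℝ ∞ (fun q : ℝ × Red => q.2) (ℰ, z) := contDiffAt_snd
  have hg : ContDiffAt ℝ ∞ (fun q : ℝ × Red => q.1) (ℰ, z) := contDiffAt_fst
  have h := contDiffAt_redHam hm hμ hf hg hz hV
  exact h.differentiableAt (by simp)

theorem hasDiff_redHam_comp (hm : m ≠ 0) (hμ : 0 < μ) (hx : x ∈ exterior μ) (h : 0 < perpL x)
    (hV : redV μ (energy x) (redMap x) ≠ 0) :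
    HasDiff (fun w => redHam m μ (energy w) (redMap w)) (fun v =>
      deriv (fun e => redHam m μ e (redMap x)) (energy x) * fderiv ℝ energy x v
      + ∑ a, fderiv ℝ (fun z => redMap z a) x v * pd (redHam m μ (energy x)) a (redMap x)) x := by
  exact hasDiff_comp_param (K := redHam m μ) (e := energy) (f := redMap)
    (differentiableAt_redHam hm hμ (redMap_mem_redDomain hx h) hV)
    hasDiff_energy.differentiableAt fun a => (hasDiff_redMap hμ hx h a).differentiableAt

/-- The projection to the level `C⋆ = 0` along `L`. -/
def projStar (z : Full) : Full :=
  Sum.elim (Sum.elim (vecL z) (vecM z - (casStar z / normL z ^ 2) • vecL z))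
    (Sum.elim (vecP z) (pos z))

theorem casStar_projStar (h : 0 < perpL x) : casStar (projStar x) = 0 := by
  have hn := (normL_pos h).ne'
  have e : ∑ i, vecL x i * vecL x i = normL x ^ 2 := by
    rw [normL, Real.sq_sqrt (by positivity)]
    exact Finset.sum_congr rfl fun i _ => (sq _).symm
  have e2 : casStar (projStar x) = casStar x - casStar x / normL x ^ 2 * ∑ i, vecL x i * vecL x i := by
    simp only [casStar, projStar, vecL, vecM, Sum.elim_inl, Sum.elim_inr, Pi.sub_apply,
      Pi.smul_apply, smul_eq_mul, Fin.sum_univ_three]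
    ring
  rw [e2, e]
  field_simp
  ring

theorem projStar_of_casStar (hC : casStar x = 0) : projStar x = x := by
  ext ((i | i) | (i | i)) <;> simp [projStar, hC, vecL, vecM, vecP, pos]

theorem hasDiff_projStar (h : 0 < perpL x) (hC : casStar x = 0) (a : FullIdx) :
    HasDiff (fun z => projStar z a) (fun v => (v - (fderiv ℝ casStar x v / normL x ^ 2) •
      (Sum.elim (Sum.elim 0 (vecL x)) 0 : Full)) a) x := by
  have hn := (normL_pos h).ne'
  have hS := HasDiff.of_differentiableAt (isCasimir_casStar.1.differentiable (by simp) x)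
  rcases a with (i | i) | (i | i)
  · exact (HasDiff.coord _).congr fun v => by simp
  · refine ((hasDiff_vecM i).sub ((hS.div (hasDiff_normL h).sq (pow_ne_zero 2 hn)).mul
      (hasDiff_vecL i))).congr fun v => ?_
    simp [hC, vecM]
    field_simp
    simp
  · exact (HasDiff.coord _).congr fun v => by simp
  · exact (HasDiff.coord _).congr fun v => by simp

/-- A function which vanishes on the level `C⋆ = 0` is in involution there with every function. -/
theorem bracket_eq_zero_of_casStar (h : 0 < perpL x) (hC : casStar x = 0) (F : Full → ℝ)
    {G : Full → ℝ} (hG : DifferentiableAt ℝ G x)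
    (h0 : ∀ᶠ z in 𝓝 x, casStar z = 0 → G z = 0) : bracket fullTensor F G x = 0 := by
  have hc : ContinuousAt projStar x := by
    refine continuousAt_pi.2 fun a => (hasDiff_projStar h hC a).differentiableAt.continuousAt
  have hρ : ∀ᶠ z in 𝓝 x, 0 < perpL z :=
    (hasDiff_perpL h).differentiableAt.continuousAt.eventually (lt_mem_nhds h)
  have hp := projStar_of_casStar hC
  have hG' : DifferentiableAt ℝ G (projStar x) := by rwa [hp]
  have h1 : HasDiff (fun z => G (projStar z)) _ x :=
    HasDiff.comp (fun a => hasDiff_projStar h hC a) (HasDiff.of_differentiableAt hG')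
  have h2 : HasDiff (fun z => G (projStar z)) (fun _ => 0) x := by
    refine (HasDiff.const 0).congr_fun ?_
    have h0' : ∀ᶠ z in 𝓝 x, casStar (projStar z) = 0 → G (projStar z) = 0 :=
      hc.eventually (p := fun z => casStar z = 0 → G z = 0) (by rwa [hp])
    filter_upwards [h0', hρ] with z hz1 hz2
    exact hz1 (casStar_projStar hz2)
  have h3 := h1.unique h2 (-hamField fullTensor F x)
  rw [bracket_eq_apply (fullTensor_skew x) F (HasDiff.of_differentiableAt hG)]
  -- Hamiltonian fields are tangent to the level of a Casimir function, so the correction term in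
  -- the differential of the retraction `projStar` disappears, and the derivative of G along the
  -- field is that of a function which vanishes near x.
  have h4 : fderiv ℝ casStar x (-hamField fullTensor F x) = 0 := by
    rw [← bracket_eq_apply (fullTensor_skew x) F (HasDiff.of_differentiableAt
      (isCasimir_casStar.1.differentiable (by simp) x)), bracket_antisymm (fullTensor_skew x),
      isCasimir_casStar.bracket_eq_zero, neg_zero]
  simp only [h4, zero_div, zero_smul, sub_zero, hp] at h3
  exact h3

theorem eventually_mem_regular (hμ : 0 < μ) (hx : x ∈ regular μ) :
    ∀ᶠ z in 𝓝 x, z ∈ regular μ := by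
  have h1 : ∀ᶠ z in 𝓝 x, denom μ z ≠ 0 :=
    (contDiffAt_denom hμ hx.1).continuousAt.eventually_ne hx.2
  filter_upwards [(isOpen_exterior μ).mem_nhds hx.1, h1] with z h2 h3 using ⟨h2, h3⟩

/-- H and the reduced Hamiltonian composed with the energy and `redMap` coincide only on C⋆ = 0; by
`bracket_eq_zero_of_casStar` their difference still has zero brackets there. The rest is the chain
rule. -/
theorem bracket_ham_redHam (hm : m ≠ 0) (hμ : 0 < μ) (hx : x ∈ regular μ) (h : 0 < perpL x)
    (hC : casStar x = 0) (F : Full → ℝ) :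
    bracket fullTensor F (ham m μ) x
      = deriv (fun e => redHam m μ e (redMap x)) (energy x) * bracket fullTensor F energy x
        + ∑ a, bracket fullTensor F (fun z => redMap z a) x
          * pd (redHam m μ (energy x)) a (redMap x) := by
  have hK := hasDiff_redHam_comp hm hμ hx.1 h (redV_ne hμ hx h hC)
  have hH : DifferentiableAt ℝ (ham m μ) x := (contDiffAt_ham hm hμ hx).diff
  have hρ : ∀ᶠ z in 𝓝 x, 0 < perpL z :=
    (hasDiff_perpL h).differentiableAt.continuousAt.eventually (lt_mem_nhds h)
  have h0 : bracket fullTensor F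
      (fun z => ham m μ z + -1 * redHam m μ (energy z) (redMap z)) x = 0 := by
    refine bracket_eq_zero_of_casStar h hC F (hH.add (hK.differentiableAt.const_mul _)) ?_
    filter_upwards [eventually_mem_regular hμ hx, hρ] with z hz1 hz2 hz3
    rw [ham_redMap hm hμ hz1 hz2 hz3]
    ring
  rw [bracket_add_right hH (hK.differentiableAt.const_mul _),
    bracket_const_mul_right _ hK.differentiableAt, bracket_eq_apply (fullTensor_skew x) F hK] at h0
  rw [bracket_eq_apply (fullTensor_skew x) F (HasDiff.of_differentiableAt
    hasDiff_energy.differentiableAt)]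
  simp only [bracket_eq_apply (fullTensor_skew x) F (HasDiff.of_differentiableAt
    (hasDiff_redMap hμ hx.1 h _).differentiableAt)]
  linarith

/-- The energy commutes with the reduced variables, so only the closed brackets of the latter
contribute; this is the reduced Hamiltonian field. -/
theorem bracket_redMap_ham (hm : m ≠ 0) (hμ : 0 < μ) (hx : x ∈ regular μ) (h : 0 < perpL x)
    (hC : casStar x = 0) (a : RedIdx) :
    bracket fullTensor (fun z => redMap z a) (ham m μ) x
      = hamField redTensor (redHam m μ (energy x)) (redMap x) a := by
  rw [bracket_ham_redHam hm hμ hx h hC, bracket_redMap_energy hμ hx.1 h, mul_zero, zero_add]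
  simp only [bracket_redMap_redMap hμ hx.1 h hC]
  rfl

/-- The reduced variables do not involve P_t, so t feels H only through the energy, with {t, ℰ} =
-1. -/
theorem bracket_time_ham (hm : m ≠ 0) (hμ : 0 < μ) (hx : x ∈ regular μ) (h : 0 < perpL x)
    (hC : casStar x = 0) : bracket fullTensor (fun z => pos z 0) (ham m μ) x
      = -deriv (fun e => redHam m μ e (redMap x)) (energy x) := by
  rw [bracket_ham_redHam hm hμ hx h hC]
  have h1 : bracket fullTensor (fun z => pos z 0) energy x = -1 := by
    rw [(hasDiff_pos 0).bracket_eq, hamField_energy, pos_hamVec]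
    rfl
  have h2 : ∀ a, bracket fullTensor (fun z => pos z 0) (fun z => redMap z a) x = 0 := fun a => by
    rw [(hasDiff_pos 0).bracket_eq, hamField_redMap hμ hx.1 h, pos_hamVec]
    rcases a with (i | i) | i <;> fin_cases i <;> simp [redGradP]
  simp [h1, h2]

theorem redMap_trajectory (hm : m ≠ 0) (hμ : 0 < μ) {I : Set ℝ} {γ : ℝ → Full}
    (hI : IsOpenInterval I) (hγ : IsTrajectory fullTensor (ham m μ) I γ)
    (hr : ∀ τ ∈ I, γ τ ∈ regular μ ∧ 0 < perpL (γ τ)) {τ₀ : ℝ} (hτ₀ : τ₀ ∈ I)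
    (hC : casStar (γ τ₀) = 0) :
    IsTrajectory redTensor (redHam m μ (energy (γ τ₀))) I (fun τ => redMap (γ τ)) ∧
      ∀ τ ∈ I, redCirc (redMap (γ τ)) = casCirc (γ τ₀) ∧
        redF (redMap (γ τ)) = ∑ i, vecQ (γ τ₀) i ^ 2 ∧
        HasDerivAt (fun s => pos (γ s) 0)
          (-deriv (fun e => redHam m μ e (redMap (γ τ))) (energy (γ τ₀))) τ := by
  have hC' : ∀ τ ∈ I, casStar (γ τ) = 0 := fun τ hτ => by
    rw [hγ.casimir_eq isCasimir_casStar hI hτ hτ₀, hC]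
  have hQ : ∀ τ ∈ I, energy (γ τ) = energy (γ τ₀) ∧ vecQ (γ τ) = vecQ (γ τ₀) := fun τ hτ =>
    integrals_conserved hm hμ hI hγ (fun τ hτ => (hr τ hτ).1) hτ₀ hτ
  refine ⟨fun τ hτ => hasDerivAt_pi.2 fun a => ?_, fun τ hτ => ⟨?_, ?_, ?_⟩⟩
  · rw [← (hQ τ hτ).1, ← bracket_redMap_ham hm hμ (hr τ hτ).1 (hr τ hτ).2 (hC' τ hτ)]
    exact hγ.hasDerivAt_comp hτ
      (hasDiff_redMap hμ (hr τ hτ).1.1 (hr τ hτ).2 a).differentiableAt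
  · rw [redCirc_redMap (hr τ hτ).2 (hC' τ hτ), hγ.casimir_eq isCasimir_casCirc hI hτ hτ₀]
  · rw [redF_redMap hμ (hr τ hτ).1.1 (hr τ hτ).2, (hQ τ hτ).2]
  · rw [← (hQ τ hτ).1, ← bracket_time_ham hm hμ (hr τ hτ).1 (hr τ hτ).2 (hC' τ hτ)]
    exact hγ.hasDerivAt_comp hτ (hasDiff_pos 0).differentiableAt

end Projection

/-! ### Points of the full phase space above given reduced variables -/

section Lift

variable {m μ ℰ u v t θ φ : ℝ} {z : Red}

/-- A point of the full phase space with given reduced variables, energy, coordinates `t`, `θ`,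
`φ`, and direction `(u, v)` of `(L₂, L₃)`. -/
def redLift (ℰ u v t θ φ : ℝ) (z : Red) : Full :=
  Sum.elim (Sum.elim ![vecE z 0, redW z * u, redW z * v]
      ![-redTheta z, u * redA z + v * vecZ z 2, v * redA z - u * vecZ z 2])
    (Sum.elim ![-ℰ, radMom z, v * vecE z 1 - u * vecE z 2,
        vecE z 0 * Real.cos θ - Real.sin θ * (u * vecE z 1 + v * vecE z 2)]
      ![t, radius z, θ, φ])

theorem energy_redLift : energy (redLift ℰ u v t θ φ z) = ℰ := neg_neg ℰ

theorem perpL_redLift (hz : z ∈ redDomain μ) (huv : u ^ 2 + v ^ 2 = 1) :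
    perpL (redLift ℰ u v t θ φ z) = redW z := by
  have e : (redW z * u) ^ 2 + (redW z * v) ^ 2 = redW z ^ 2 := by
    linear_combination redW z ^ 2 * huv
  change √((redW z * u) ^ 2 + (redW z * v) ^ 2) = _
  rw [e, Real.sqrt_sq (redW_pos hz).le]

theorem dirU_redLift (hz : z ∈ redDomain μ) (huv : u ^ 2 + v ^ 2 = 1) :
    dirU (redLift ℰ u v t θ φ z) = u := by
  rw [dirU, perpL_redLift hz huv]
  change redW z * u / redW z = u
  have := (redW_pos hz).ne'
  field_simp

theorem dirV_redLift (hz : z ∈ redDomain μ) (huv : u ^ 2 + v ^ 2 = 1) :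
    dirV (redLift ℰ u v t θ φ z) = v := by
  rw [dirV, perpL_redLift hz huv]
  change redW z * v / redW z = v
  have := (redW_pos hz).ne'
  field_simp

theorem normL_redLift (hz : z ∈ redDomain μ) (huv : u ^ 2 + v ^ 2 = 1) :
    normL (redLift ℰ u v t θ φ z) = vecZ z 1 := by
  have e : normL (redLift ℰ u v t θ φ z) ^ 2 = vecZ z 1 ^ 2 := by
    rw [sq_normL, perpL_redLift hz huv, sq_redW hz]
    change vecE z 0 ^ 2 + _ = _
    ring
  exact (sq_eq_sq₀ (Real.sqrt_nonneg _) (redDomain_pos hz).le).1 e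

theorem casStar_redLift (hz : z ∈ redDomain μ) (huv : u ^ 2 + v ^ 2 = 1) :
    casStar (redLift ℰ u v t θ φ z) = 0 := by
  have hZ := (redDomain_pos hz).ne'
  rw [casStar, Fin.sum_univ_three]
  change vecE z 0 * -redTheta z + redW z * u * (u * redA z + v * vecZ z 2)
    + redW z * v * (v * redA z - u * vecZ z 2) = 0
  rw [redTheta, redA]
  field_simp
  linear_combination vecE z 0 * redW z * vecZ z 0 * huv

/-- In `redLift`, P_φ is chosen so that (L₁ cos θ - P_φ)/sin θ equals uE₂ + vE₃, and P_θ, M by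
inverting the formulas of the reduced variables on C⋆ = 0. -/
theorem redMap_redLift (hz : z ∈ redDomain μ) (huv : u ^ 2 + v ^ 2 = 1) (hθ : Real.sin θ ≠ 0) :
    redMap (redLift ℰ u v t θ φ z) = z := by
  have hZ := (redDomain_pos hz).ne'
  have hW := (redW_pos hz).ne'
  have hX : angX (redLift ℰ u v t θ φ z) = u * vecE z 1 + v * vecE z 2 := by
    change (vecE z 0 * Real.cos θ - (vecE z 0 * Real.cos θ
      - Real.sin θ * (u * vecE z 1 + v * vecE z 2))) / Real.sin θ = _
    field_simp
    ring
  rw [redMap_eq, dirU_redLift hz huv, dirV_redLift hz huv, normL_redLift hz huv,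
    perpL_redLift hz huv, hX]
  ext a
  rcases a with (i | i) | i <;> fin_cases i
  · rfl
  · change v * (v * vecE z 1 - u * vecE z 2) + u * (u * vecE z 1 + v * vecE z 2) = vecE z 1
    linear_combination vecE z 1 * huv
  · change -(u * (v * vecE z 1 - u * vecE z 2)) + v * (u * vecE z 1 + v * vecE z 2) = vecE z 2
    linear_combination vecE z 2 * huv
  · change -(-redTheta z * vecZ z 1) / redW z = vecZ z 0
    rw [redTheta]
    field_simp
  · rfl
  · change v * (u * redA z + v * vecZ z 2) - u * (v * redA z - u * vecZ z 2) = vecZ z 2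
    linear_combination vecZ z 2 * huv
  · rfl
  · rfl

theorem redLift_mem_exterior (hz : z ∈ redDomain μ) (h0 : 0 < θ) (h1 : θ < Real.pi) :
    redLift ℰ u v t θ φ z ∈ exterior μ := ⟨hz.1, h0, h1⟩

/-- The lift to the equatorial plane, with `L₃ = 0`. -/
def redSection (ℰ : ℝ) (z : Red) : Full := redLift ℰ 1 0 0 (Real.pi / 2) 0 z

section Section

variable (ℰ)

theorem redSection_mem_exterior (hz : z ∈ redDomain μ) : redSection ℰ z ∈ exterior μ :=
  redLift_mem_exterior hz (by positivity) (by linarith [Real.pi_pos])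

theorem perpL_redSection (hz : z ∈ redDomain μ) : 0 < perpL (redSection ℰ z) := by
  rw [redSection, perpL_redLift hz (by norm_num)]
  exact redW_pos hz

theorem casStar_redSection (hz : z ∈ redDomain μ) : casStar (redSection ℰ z) = 0 :=
  casStar_redLift hz (by norm_num)

theorem energy_redSection : energy (redSection ℰ z) = ℰ := energy_redLift

theorem redMap_redSection (hz : z ∈ redDomain μ) : redMap (redSection ℰ z) = z :=
  redMap_redLift hz (by norm_num) (by simp)

theorem redSection_mem_regular (hμ : 0 < μ) (hz : z ∈ redDomain μ) (hV : redV μ ℰ z ≠ 0) :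
    redSection ℰ z ∈ regular μ := by
  refine mem_regular hμ (redSection_mem_exterior ℰ hz) (perpL_redSection ℰ hz)
    (casStar_redSection ℰ hz) ?_
  rwa [energy_redSection, redMap_redSection ℰ hz]

/-- Makes the coefficients of the linear equation for f continuous in time when they are evaluated
along the section. -/
theorem continuousAt_redSection (hμ : 0 < μ) (hz : z ∈ redDomain μ) :
    ContinuousAt (redSection ℰ) z := by
  have hf : ContDiffAt ℝ ∞ (fun w : Red => w) z := contDiffAt_id
  have hg : ContDiffAt ℝ ∞ (fun _ : Red => ℰ) z := contDiffAt_const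
  obtain ⟨hW, -, hΘ, -, -⟩ := contDiffAt_redV hμ hf hg hz
  have hE : ∀ i, ContinuousAt (fun w => vecE w i) z := fun i => continuousAt_apply _ _
  have hZ : ∀ i, ContinuousAt (fun w => vecZ w i) z := fun i => continuousAt_apply _ _
  have hA : ContinuousAt redA z := ((hE 0).mul (hZ 0)).div (hZ 1) (redDomain_pos hz).ne'
  refine continuousAt_pi.2 fun a => ?_
  rcases a with (i | i) | (i | i) <;> fin_cases i
  · exact hE 0
  · exact hW.continuousAt.mul continuousAt_const
  · exact hW.continuousAt.mul continuousAt_const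
  · exact hΘ.continuousAt.neg
  · exact (continuousAt_const.mul hA).add (continuousAt_const.mul (hZ 2))
  · exact (continuousAt_const.mul hA).sub (continuousAt_const.mul (hZ 2))
  · exact continuousAt_const
  · exact continuousAt_apply _ _
  · exact (continuousAt_const.mul (hE 1)).sub (continuousAt_const.mul (hE 2))
  · exact ((hE 0).mul continuousAt_const).sub (continuousAt_const.mul
      ((continuousAt_const.mul (hE 1)).add (continuousAt_const.mul (hE 2))))
  · exact continuousAt_const
  · exact continuousAt_apply _ _
  · exact continuousAt_const
  · exact continuousAt_const

end Section

end Lift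

/-! ### Invariance of the Tulczyjew set in the reduced space -/

section ReducedInvariance

variable {x : Full} {m μ ℰ : ℝ}

/-- The transition from the coordinate basis to the rotated tetrad. -/
def toRotated (μ : ℝ) (x : Full) : Matrix (Fin 4) (Fin 4) ℝ :=
  !![1 / tetradDiag μ (pos x) 0, 0, 0, 0; 0, 1 / tetradDiag μ (pos x) 1, 0, 0;
    0, 0, dirU x / tetradDiag μ (pos x) 2, dirV x / tetradDiag μ (pos x) 3;
    0, 0, dirV x / tetradDiag μ (pos x) 2, -(dirU x / tetradDiag μ (pos x) 3)]

/-- The transition from the rotated tetrad to the coordinate basis. -/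
def ofRotated (μ : ℝ) (x : Full) : Matrix (Fin 4) (Fin 4) ℝ :=
  !![tetradDiag μ (pos x) 0, 0, 0, 0; 0, tetradDiag μ (pos x) 1, 0, 0;
    0, 0, tetradDiag μ (pos x) 2 * dirU x, tetradDiag μ (pos x) 2 * dirV x;
    0, 0, tetradDiag μ (pos x) 3 * dirV x, -(tetradDiag μ (pos x) 3 * dirU x)]

theorem redTul_redMap (hμ : 0 < μ) (hx : x ∈ exterior μ) (h : 0 < perpL x) (hC : casStar x = 0)
    (i : Fin 4) :
    redTul μ (energy x) (redMap x) i = ∑ α, toRotated μ x i α * tulczyjew μ α x := by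
  have he := fun α => (tetradDiag_pos hμ hx α).ne'
  have h0 := he 0
  have h1 := he 1
  have h2 := he 2
  have h3 := he 3
  simp only [tulczyjew_frame, Fin.sum_univ_four]
  fin_cases i
  · simp [toRotated, ← frameTul_zero hμ hx h hC]
    field_simp
  · simp [toRotated, ← frameTul_one hμ hx h]
    field_simp
  · simp [toRotated, ← frameTul_parallel hμ hx h hC]
    field_simp
  · simp [toRotated, ← frameTul_orthogonal hμ hx h hC]
    field_simp
    ring

theorem tulczyjew_eq_redTul (hμ : 0 < μ) (hx : x ∈ exterior μ) (h : 0 < perpL x)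
    (hC : casStar x = 0) (α : Fin 4) :
    tulczyjew μ α x = ∑ i, ofRotated μ x α i * redTul μ (energy x) (redMap x) i := by
  have hV := sq_dirV h
  rw [Fin.sum_univ_four, ← frameTul_zero hμ hx h hC, ← frameTul_one hμ hx h,
    ← frameTul_parallel hμ hx h hC, ← frameTul_orthogonal hμ hx h hC, tulczyjew_frame]
  fin_cases α
  · simp [ofRotated]
  · simp [ofRotated]
  · simp [ofRotated]
    linear_combination -tetradDiag μ (pos x) 2 * frameTul μ 2 x * hV
  · simp [ofRotated]
    linear_combination -tetradDiag μ (pos x) 3 * frameTul μ 3 x * hV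

theorem contDiffAt_dir (h : 0 < perpL x) : ContDiffAt ℝ ∞ dirU x ∧ ContDiffAt ℝ ∞ dirV x := by
  have h0 : vecL x 1 ^ 2 + vecL x 2 ^ 2 ≠ 0 := (Real.sqrt_pos.1 h).ne'
  have hL : ∀ i, ContDiffAt ℝ ∞ (fun z => vecL z i) x := fun i => contDiffAt_coord _
  have hρ : ContDiffAt ℝ ∞ perpL x := ContDiffAt.sqrt (((hL 1).pow 2).add ((hL 2).pow 2)) h0
  exact ⟨(hL 1).div hρ h.ne', (hL 2).div hρ h.ne'⟩

theorem contDiffAt_toRotated (hμ : 0 < μ) (hx : x ∈ exterior μ) (h : 0 < perpL x) (i α : Fin 4) :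
    ContDiffAt ℝ ∞ (fun z => toRotated μ z i α) x := by
  have he := contDiffAt_tetradDiag hμ hx
  have he0 := fun α => (tetradDiag_pos hμ hx α).ne'
  obtain ⟨hu, hv⟩ := contDiffAt_dir h
  fin_cases i <;> fin_cases α <;>
    first
    | exact contDiffAt_const
    | exact contDiffAt_const.div (he _) (he0 _)
    | exact hu.div (he _) (he0 _)
    | exact hv.div (he _) (he0 _)
    | exact (hu.div (he _) (he0 _)).neg

theorem continuousAt_ofRotated (hμ : 0 < μ) (hx : x ∈ exterior μ) (h : 0 < perpL x) (i α : Fin 4) :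
    ContinuousAt (fun z => ofRotated μ z i α) x := by
  have he := fun α => (contDiffAt_tetradDiag hμ hx α).continuousAt
  obtain ⟨hu, hv⟩ := contDiffAt_dir h
  have hu := hu.continuousAt
  have hv := hv.continuousAt
  have h22 : ContinuousAt (fun z => tetradDiag μ (pos z) 2 * dirU z) x := (he 2).mul hu
  have h23 : ContinuousAt (fun z => tetradDiag μ (pos z) 2 * dirV z) x := (he 2).mul hv
  have h32 : ContinuousAt (fun z => tetradDiag μ (pos z) 3 * dirV z) x := (he 3).mul hv
  have h33 : ContinuousAt (fun z => -(tetradDiag μ (pos z) 3 * dirU z)) x := ((he 3).mul hu).neg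
  have h0 : ContinuousAt (fun _ : Full => (0 : ℝ)) x := continuousAt_const
  fin_cases i <;> fin_cases α
  exacts [he 0, h0, h0, h0, h0, he 1, h0, h0, h0, h0, h22, h23, h0, h0, h32, h33]

/-- The coefficients of the linear differential equation satisfied by the Tulczyjew vector in the
reduced variables. -/
def redTulCoeff (m μ : ℝ) (x : Full) : Matrix (Fin 4) (Fin 4) ℝ := fun i j =>
  ∑ α, (bracket fullTensor (fun z => toRotated μ z i α) (ham m μ) x
    + ∑ β, toRotated μ x i β * tulczyjewCoeff m μ x β α) * ofRotated μ x α j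

theorem continuousAt_redTulCoeff (hm : m ≠ 0) (hμ : 0 < μ) (hx : x ∈ regular μ)
    (h : 0 < perpL x) (i j : Fin 4) : ContinuousAt (fun z => redTulCoeff m μ z i j) x :=
  tendsto_finsetSum _ fun α _ => ContinuousAt.mul (ContinuousAt.add
    (continuousAt_bracket isPoissonTensor_fullTensor (contDiffAt_toRotated hμ hx.1 h i α)
      (contDiffAt_ham hm hμ hx))
    (tendsto_finsetSum _ fun β _ => ((contDiffAt_toRotated hμ hx.1 h i β).continuousAt).mul
      (continuousAt_tulczyjewCoeff hm hμ hx β α))) (continuousAt_ofRotated hμ hx.1 h α j)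

/-- Change of basis in a linear system: if f' = A f and T goes over to the rotated tetrad, then T f
has the coefficient matrix (T' + T A) T⁻¹, with `ofRotated` as T⁻¹. -/
theorem bracket_rotated_ham (hm : m ≠ 0) (hμ : 0 < μ) (hx : x ∈ regular μ) (h : 0 < perpL x)
    (hC : casStar x = 0) (i : Fin 4) :
    bracket fullTensor (fun z => ∑ α, toRotated μ z i α * tulczyjew μ α z) (ham m μ) x
      = ∑ j, redTulCoeff m μ x i j * redTul μ (energy x) (redMap x) j := by
  have h1 : ∀ α, DifferentiableAt ℝ (fun z => toRotated μ z i α) x := fun α =>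
    (contDiffAt_toRotated hμ hx.1 h i α).diff
  have h2 := differentiableAt_tulczyjew hμ hx.1
  have hd : ∀ α ∈ Finset.univ,
      DifferentiableAt ℝ (fun z => toRotated μ z i α * tulczyjew μ α z) x := fun α _ =>
    (h1 α).mul (h2 α)
  rw [bracket_antisymm (fullTensor_skew x), bracket_sum_right _ hd]
  have e : ∀ α, bracket fullTensor (ham m μ) (fun z => toRotated μ z i α * tulczyjew μ α z) x
      = -(bracket fullTensor (fun z => toRotated μ z i α) (ham m μ) x * tulczyjew μ α x
        + toRotated μ x i α * ∑ l, tulczyjewCoeff m μ x α l * tulczyjew μ l x) := fun α => by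
    rw [bracket_mul_right (h1 α) (h2 α), bracket_antisymm (fullTensor_skew x) (ham m μ),
      bracket_antisymm (fullTensor_skew x) (ham m μ), bracket_tulczyjew_ham hm hμ hx hC]
    ring
  have e2 : ∑ j, redTulCoeff m μ x i j * redTul μ (energy x) (redMap x) j
      = ∑ α, (bracket fullTensor (fun z => toRotated μ z i α) (ham m μ) x
        + ∑ β, toRotated μ x i β * tulczyjewCoeff m μ x β α) * tulczyjew μ α x := by
    simp only [redTulCoeff, Finset.sum_mul, tulczyjew_eq_redTul hμ hx.1 h hC, Finset.mul_sum]
    rw [Finset.sum_comm]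
    exact Finset.sum_congr rfl fun α _ => Finset.sum_congr rfl fun j _ => by ring
  simp only [e, e2, Fin.sum_univ_four]
  ring

variable {I : Set ℝ} {z : ℝ → Red}

/-- The point x only has to lie above z τ at the one time τ; no trajectory through it is used. Both
derivatives are those of K along the reduced field, since x has energy ℰ and its Hamiltonian field
projects to the reduced one. -/
theorem hasDerivAt_of_redMap (hm : m ≠ 0) (hμ : 0 < μ)
    (hz : IsTrajectory redTensor (redHam m μ ℰ) I z) {τ : ℝ} (hτ : τ ∈ I)
    (hx : x ∈ regular μ) (h : 0 < perpL x) (hC : casStar x = 0) (he : energy x = ℰ)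
    (hr : redMap x = z τ) {K : ℝ → Red → ℝ} {G : Full → ℝ} (hG : DifferentiableAt ℝ G x)
    (hK : DifferentiableAt ℝ (fun q : ℝ × Red => K q.1 q.2) (ℰ, z τ))
    (h0 : ∀ᶠ w in 𝓝 x, casStar w = 0 → G w = K (energy w) (redMap w)) :
    HasDerivAt (fun s => K ℰ (z s)) (bracket fullTensor G (ham m μ) x) τ := by
  have hK' : DifferentiableAt ℝ (fun q : ℝ × Red => K q.1 q.2) (energy x, redMap x) := by
    rwa [he, hr]
  have hd := hasDiff_comp_param (K := K) (e := energy) (f := redMap) hK'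
    hasDiff_energy.differentiableAt fun a => (hasDiff_redMap hμ hx.1 h a).differentiableAt
  have e1 : bracket fullTensor G (ham m μ) x
      = bracket fullTensor (fun w => K (energy w) (redMap w)) (ham m μ) x := by
    have h1 : bracket fullTensor (ham m μ)
        (fun w => G w + -1 * K (energy w) (redMap w)) x = 0 := by
      refine bracket_eq_zero_of_casStar h hC _ (hG.add (hd.differentiableAt.const_mul _)) ?_
      filter_upwards [h0] with w hw hw'
      rw [hw hw']
      ring
    rw [bracket_add_right hG (hd.differentiableAt.const_mul _),
      bracket_const_mul_right _ hd.differentiableAt] at h1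
    rw [bracket_antisymm (fullTensor_skew x) G, bracket_antisymm (fullTensor_skew x) _ (ham m μ)]
    linarith
  have e2 : ∀ a, fderiv ℝ (fun w => redMap w a) x (hamField fullTensor (ham m μ) x)
      = hamField redTensor (redHam m μ ℰ) (z τ) a := fun a => by
    rw [← (HasDiff.of_differentiableAt (hasDiff_redMap hμ hx.1 h a).differentiableAt).bracket_eq,
      bracket_redMap_ham hm hμ hx h hC, he, hr]
  have e3 : fderiv ℝ energy x (hamField fullTensor (ham m μ) x) = 0 := by
    rw [← (HasDiff.of_differentiableAt hasDiff_energy.differentiableAt).bracket_eq,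
      bracket_energy_ham hm hμ hx]
  have hK2 : DifferentiableAt ℝ (K ℰ) (z τ) :=
    hK.comp (z τ) ((differentiableAt_const ℰ).prodMk differentiableAt_id)
  rw [e1, hd.bracket_eq]
  simp only [e2, e3, mul_zero, zero_add, he, hr]
  exact (hasDiff_pd hK2).hasDerivAt (hz τ hτ) rfl

theorem redTulczyjew_invariant (hm : m ≠ 0) (hμ : 0 < μ) (hI : IsOpenInterval I)
    (hz : IsTrajectory redTensor (redHam m μ ℰ) I z)
    (hr : ∀ τ ∈ I, z τ ∈ redDomain μ ∧ redV μ ℰ (z τ) ≠ 0) {τ₀ : ℝ} (hτ₀ : τ₀ ∈ I)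
    (h0 : z τ₀ ∈ redTulczyjew μ ℰ) {τ : ℝ} (hτ : τ ∈ I) :
    z τ ∈ redTulczyjew μ ℰ ∧ redMassSq μ ℰ (z τ) = redMassSq μ ℰ (z τ₀) := by
  have hx : ∀ τ ∈ I, redSection ℰ (z τ) ∈ regular μ := fun τ hτ =>
    redSection_mem_regular ℰ hμ (hr τ hτ).1 (hr τ hτ).2
  have hρ : ∀ τ ∈ I, 0 < perpL (redSection ℰ (z τ)) := fun τ hτ => perpL_redSection ℰ (hr τ hτ).1
  have hC : ∀ τ ∈ I, casStar (redSection ℰ (z τ)) = 0 := fun τ hτ =>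
    casStar_redSection ℰ (hr τ hτ).1
  have hm' : ∀ τ ∈ I, redMap (redSection ℰ (z τ)) = z τ := fun τ hτ =>
    redMap_redSection ℰ (hr τ hτ).1
  have hρ' : ∀ τ ∈ I, ∀ᶠ w in 𝓝 (redSection ℰ (z τ)), 0 < perpL w ∧ w ∈ exterior μ :=
    fun τ hτ => ((hasDiff_perpL (hρ τ hτ)).differentiableAt.continuousAt.eventually
      (lt_mem_nhds (hρ τ hτ))).and ((isOpen_exterior μ).mem_nhds (hx τ hτ).1)
  have hcf : ∀ q : ℝ × Red, ContDiffAt ℝ ∞ (fun q : ℝ × Red => q.2) q := fun q => contDiffAt_snd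
  have hcg : ∀ q : ℝ × Red, ContDiffAt ℝ ∞ (fun q : ℝ × Red => q.1) q := fun q => contDiffAt_fst
  have key : ∀ τ ∈ I, z τ ∈ redTulczyjew μ ℰ := fun τ hτ => by
    rw [mem_redTulczyjew_iff hμ (hr τ₀ hτ₀).1] at h0
    rw [mem_redTulczyjew_iff hμ (hr τ hτ).1]
    -- The coefficients are taken at `redSection`, which is not itself a solution; only its
    -- continuity in time matters.
    refine fun i => congr_fun (linear_ode_eq_zero hI
      (A := fun τ => redTulCoeff m μ (redSection ℰ (z τ)))
      (y := fun τ i => redTul μ ℰ (z τ) i) (fun i j τ hτ => ?_) (fun τ hτ => ?_) hτ₀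
      (funext h0) hτ) i
    · refine (ContinuousAt.comp (g := fun x => redTulCoeff m μ x i j)
        (f := fun τ => redSection ℰ (z τ)) (continuousAt_redTulCoeff hm hμ (hx τ hτ) (hρ τ hτ) i j)
        ?_).continuousWithinAt
      exact ContinuousAt.comp (g := redSection ℰ) (continuousAt_redSection ℰ hμ (hr τ hτ).1)
        (hz τ hτ).continuousAt
    · refine hasDerivAt_pi.2 fun i => ?_
      have hd := hasDerivAt_of_redMap (K := fun e w => redTul μ e w i)
        (G := fun w => ∑ α, toRotated μ w i α * tulczyjew μ α w) hm hμ hz hτ (hx τ hτ) (hρ τ hτ)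
        (hC τ hτ) (energy_redSection ℰ) (hm' τ hτ) ?_ ?_ ?_
      · rw [bracket_rotated_ham hm hμ (hx τ hτ) (hρ τ hτ) (hC τ hτ), energy_redSection,
          hm' τ hτ] at hd
        exact hd
      · exact DifferentiableAt.fun_sum fun α _ =>
          ((contDiffAt_toRotated hμ (hx τ hτ).1 (hρ τ hτ) i α).diff).mul
            (differentiableAt_tulczyjew hμ (hx τ hτ).1 α)
      · exact (contDiffAt_redTul hμ (hcf _) (hcg _) (hr τ hτ).1 i).1.differentiableAt (by simp)
      · filter_upwards [hρ' τ hτ] with w hw hw'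
        exact (redTul_redMap hμ hw.2 hw.1 hw' i).symm
  refine ⟨key τ hτ, eq_of_hasDerivAt_zero hI (f := fun τ => redMassSq μ ℰ (z τ))
    (fun τ hτ => ?_) hτ hτ₀⟩
  -- Invariance has been shown for all times, so f vanishes at the chosen point and p² commutes
  -- there with H.
  have hf : ∀ α, tulczyjew μ α (redSection ℰ (z τ)) = 0 := by
    rw [(tulczyjew_redMap hμ (hx τ hτ).1 (hρ τ hτ) (hC τ hτ)).2.2.2, energy_redSection, hm' τ hτ]
    exact key τ hτ
  have hd := hasDerivAt_of_redMap (K := fun e w => -redMassSq μ e w) (G := momSq μ) hm hμ hz hτ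
    (hx τ hτ) (hρ τ hτ) (hC τ hτ) (energy_redSection ℰ) (hm' τ hτ)
    (contDiffAt_momSq hμ (hx τ hτ).1).diff ?_ ?_
  · rw [bracket_momSq_ham hm hμ (hx τ hτ) hf] at hd
    have hn := hd.neg
    rw [neg_zero] at hn
    exact hn.congr_of_eventuallyEq (Eventually.of_forall fun s => (neg_neg _).symm)
  · exact ((contDiffAt_redV hμ (hcf _) (hcg _) (hr τ hτ).1).2.2.2.1.neg).differentiableAt (by simp)
  · filter_upwards [hρ' τ hτ] with w hw hw'
    rw [redMassSq_redMap hμ hw.2 hw.1, neg_neg]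

end ReducedInvariance

/-! ### Recovery of trajectories from reduced solutions -/

section Recovery

variable {m μ ℰ : ℝ} {x : Full}

/-- The fifteen differentials of the energy, Q, the reduced variables, C⋆, t and φ, subject to the
relation F = (Q, Q), span the fourteen-dimensional cotangent space when `angX` is nonzero. Otherwise
the displacement of θ and the turning of (L₂, L₃) are not seen and are assumed to vanish. -/
theorem eq_zero_of_reduced (hμ : 0 < μ) (hx : x ∈ exterior μ) (h : 0 < perpL x) {v : Full}
    (hX : angX x ≠ 0 ∨ pos v 2 = 0 ∧ dirV x * vecL v 1 - dirU x * vecL v 2 = 0) (he : fderiv ℝ energy x v = 0) (hQ : ∀ i, fderiv ℝ (fun z => vecQ z i) x v = 0)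
    (hr : ∀ a, fderiv ℝ (fun z => redMap z a) x v = 0) (hC : fderiv ℝ casStar x v = 0)
    (ht : pos v 0 = 0) (hφ : pos v 3 = 0) : v = 0 := by
  have h3 : Real.sin (pos x 2) ≠ 0 := sin_ne hμ hx
  have hρ := h.ne'
  have hn := (normL_pos h).ne'
  have hV := sq_dirV h
  have hcp := Real.cos_sq_add_sin_sq (pos x 3)
  rw [hasDiff_energy.fderiv_eq, neg_eq_zero] at he
  simp only [fun i => (hasDiff_vecQ hμ hx i).fderiv_eq v] at hQ
  simp only [fun a => (hasDiff_redMap hμ hx h a).fderiv_eq v] at hr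
  have hC' : HasDiff casStar (fun v => ∑ i, (vecL v i * vecM x i + vecL x i * vecM v i)) x := by
    refine (HasDiff.sum Finset.univ fun i _ => (hasDiff_vecL i).mul (hasDiff_vecM i)).congr
      fun v => Finset.sum_congr rfl fun i _ => ?_
    ring
  rw [hC'.fderiv_eq] at hC
  have hP3 : vecP v 3 = 0 := hQ 2
  have hL0 : vecL v 0 = 0 := by
    simpa [redGradL, redGradM, redGradP, redGradY, Fin.sum_univ_succ] using hr (.inl (.inl 0))
  have hr1 : pos v 1 = 0 := by
    simpa [redGradL, redGradM, redGradP, redGradY, Fin.sum_univ_succ] using hr (.inr 0)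
  have hP1 : vecP v 1 = 0 := by
    simpa [redGradL, redGradM, redGradP, redGradY, Fin.sum_univ_succ] using hr (.inr 1)
  have q0 := hQ 0
  have q1 := hQ 1
  simp [hL0, hP3, hφ] at q0 q1
  have hP2 : vecP v 2 = 0 := by
    linear_combination -Real.sin (pos x 3) * q0 + Real.cos (pos x 3) * q1 - vecP v 2 * hcp
  -- After undoing the rotation by φ, the equations for Q₁ and Q₂ separate into the vanishing of the
  -- P_θ-component and of `angX` times the θ-component.
  have hY2 : pos v 2 = 0 := by
    refine hX.elim (fun hX => ?_) fun h0 => h0.1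
    have hX' : vecL x 0 * Real.cos (pos x 2) - vecP x 3 ≠ 0 := fun h0 =>
      hX (by rw [angX, h0, zero_div])
    have h4 : (vecL x 0 * Real.cos (pos x 2) - vecP x 3) / Real.sin (pos x 2) ^ 2 * pos v 2 = 0 := by
      linear_combination -Real.cos (pos x 3) * q0 - Real.sin (pos x 3) * q1
        - (vecL x 0 * Real.cos (pos x 2) - vecP x 3) / Real.sin (pos x 2) ^ 2 * pos v 2 * hcp
    exact (mul_eq_zero.1 h4).resolve_left (div_ne_zero hX' (pow_ne_zero 2 h3))
  have e1 := hr (.inl (.inl 1))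
  have e2 := hr (.inl (.inl 2))
  have z0 := hr (.inl (.inr 0))
  have z1 := hr (.inl (.inr 1))
  have z2 := hr (.inl (.inr 2))
  simp [redGradL, redGradM, redGradP, redGradY, Fin.sum_univ_succ, hL0, hP2, hY2, hP3,
    -mul_eq_zero] at e1 e2 z0 z1 z2
  -- Turning (L₂, L₃) turns (E₂, E₃); projecting onto the direction (u, v) produces the factor
  -- `angX`.
  have hk : dirV x * vecL v 1 - dirU x * vecL v 2 = 0 := by
    refine hX.elim (fun hX => (mul_eq_zero.1 ?_).resolve_left hX) fun h0 => h0.2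
    rw [angX_eq h]
    field_simp at e1 e2
    linear_combination dirV x * e1 - dirU x * e2
  have hl : dirU x * vecL v 1 + dirV x * vecL v 2 = 0 := by
    field_simp at z1
    rw [mul_zero, mul_eq_zero, or_iff_right hρ] at z1
    exact z1
  have hL1 : vecL v 1 = 0 := by
    linear_combination dirV x * hk + dirU x * hl - vecL v 1 * hV
  have hL2 : vecL v 2 = 0 := by
    linear_combination -dirU x * hk + dirV x * hl - vecL v 2 * hV
  simp [hL1, hL2, -mul_eq_zero] at z0 z2
  have hM0 : vecM v 0 = 0 := by
    field_simp at z0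
    rw [mul_zero, mul_eq_zero, or_iff_right hn] at z0
    exact z0
  simp only [Fin.sum_univ_three, hL0, hL1, hL2, hM0, vecL_one h, vecL_two h] at hC
  have hs : dirU x * vecM v 1 + dirV x * vecM v 2 = 0 := by
    refine (mul_eq_zero.1 ?_).resolve_left hρ
    linear_combination hC
  have hM1 : vecM v 1 = 0 := by
    linear_combination dirV x * z2 + dirU x * hs - vecM v 1 * hV
  have hM2 : vecM v 2 = 0 := by
    linear_combination -dirU x * z2 + dirV x * hs - vecM v 2 * hV
  ext a
  rcases a with (i | i) | (i | i) <;> fin_cases i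
  exacts [hL0, hL1, hL2, hM0, hM1, hM2, he, hP1, hP2, hP3, ht, hr1, hY2, hφ]

/-- φ is conjugate to P_φ, which enters the reduced variables only through E₂ and E₃. -/
theorem bracket_azimuth_ham (hm : m ≠ 0) (hμ : 0 < μ) (hx : x ∈ regular μ) (h : 0 < perpL x)
    (hC : casStar x = 0) : bracket fullTensor (fun z => pos z 3) (ham m μ) x
      = -(dirU x * pd (redHam m μ (energy x)) (.inl (.inl 1)) (redMap x)
        + dirV x * pd (redHam m μ (energy x)) (.inl (.inl 2)) (redMap x)) / Real.sin (pos x 2) := by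
  rw [bracket_ham_redHam hm hμ hx h hC]
  have h1 : bracket fullTensor (fun z => pos z 3) energy x = 0 := by
    rw [(hasDiff_pos 3).bracket_eq, hamField_energy, pos_hamVec]
    rfl
  have h2 : ∀ a, bracket fullTensor (fun z => pos z 3) (fun z => redMap z a) x
      = redGradP x a 3 := fun a => by
    rw [(hasDiff_pos 3).bracket_eq, hamField_redMap hμ hx.1 h, pos_hamVec]
  simp [h1, h2, redGradP, Fintype.sum_sum_type, Fin.sum_univ_succ]
  ring

/-- A curve on which the reduced variables, the integrals and the cyclic coordinates evolve as
on the trajectories is a trajectory. -/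
theorem hasDerivAt_of_reduced (hm : m ≠ 0) (hμ : 0 < μ) {γ : ℝ → Full} {τ : ℝ} {z : ℝ → Red}
    {t φ : ℝ → ℝ} {q : Fin 3 → ℝ} (hγ : DifferentiableAt ℝ γ τ)
    (hX : angX (γ τ) ≠ 0 ∨ (HasDerivAt (fun s => pos (γ s) 2)
        (bracket fullTensor (fun z => pos z 2) (ham m μ) (γ τ)) τ ∧
      dirV (γ τ) * (deriv γ τ - hamField fullTensor (ham m μ) (γ τ)) (.inl (.inl 1))
        - dirU (γ τ) * (deriv γ τ - hamField fullTensor (ham m μ) (γ τ)) (.inl (.inl 2)) = 0))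
    (hz : HasDerivAt z (hamField redTensor (redHam m μ ℰ) (z τ)) τ)
    (ht : HasDerivAt t (-deriv (fun e => redHam m μ e (z τ)) ℰ) τ)
    (hφ : HasDerivAt φ (bracket fullTensor (fun z => pos z 3) (ham m μ) (γ τ)) τ)
    (h : ∀ᶠ s in 𝓝 τ, γ s ∈ regular μ ∧ 0 < perpL (γ s) ∧ casStar (γ s) = 0 ∧ energy (γ s) = ℰ ∧
      vecQ (γ s) = q ∧ redMap (γ s) = z s ∧ pos (γ s) 0 = t s ∧ pos (γ s) 3 = φ s) :
    HasDerivAt γ (hamField fullTensor (ham m μ) (γ τ)) τ := by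
  obtain ⟨hx, hρ, hC, he, -, hr, -, -⟩ := h.self_of_nhds
  -- If F along the curve has the derivative {F, H}, its differential kills the difference of γ' and
  -- the Hamiltonian field. The listed functions then force this difference to be zero.
  have key : ∀ {F : Full → ℝ} {f : ℝ → ℝ} {f' : ℝ}, DifferentiableAt ℝ F (γ τ) →
      (∀ᶠ s in 𝓝 τ, F (γ s) = f s) → HasDerivAt f f' τ → bracket fullTensor F (ham m μ) (γ τ) = f' →
      fderiv ℝ F (γ τ) (deriv γ τ - hamField fullTensor (ham m μ) (γ τ)) = 0 := by
    intro F f f' hF hf hf' hb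
    have hd := HasDiff.of_differentiableAt hF
    rw [map_sub, ← hd.bracket_eq, hb, sub_eq_zero]
    exact (hd.hasDerivAt hγ.hasDerivAt rfl).unique (hf'.congr_of_eventuallyEq hf)
  have h0 := eq_zero_of_reduced hμ hx.1 hρ
    (hX.imp_right fun hX => ⟨by
      have := key (hasDiff_pos 2).differentiableAt (Eventually.of_forall fun s => rfl) hX.1 rfl
      rwa [(hasDiff_pos 2).fderiv_eq] at this, hX.2⟩)
    (key hasDiff_energy.differentiableAt (h.mono fun s hs => hs.2.2.2.1) (hasDerivAt_const τ ℰ)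
      (bracket_energy_ham hm hμ hx))
    (fun i => key (hasDiff_vecQ hμ hx.1 i).differentiableAt
      (h.mono fun s hs => congr_fun hs.2.2.2.2.1 i) (hasDerivAt_const τ (q i))
      (bracket_vecQ_ham hm hμ hx i))
    (fun a => key (hasDiff_redMap hμ hx.1 hρ a).differentiableAt
      (h.mono fun s hs => congr_fun hs.2.2.2.2.2.1 a) (hasDerivAt_pi.1 hz a)
      (by rw [bracket_redMap_ham hm hμ hx hρ hC, he, hr]))
    (key (isCasimir_casStar.1.differentiable (by simp) _) (h.mono fun s hs => hs.2.2.1)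
      (hasDerivAt_const τ 0) (isCasimir_casStar.bracket_eq_zero _ _))
    (by
      have := key (hasDiff_pos 0).differentiableAt (h.mono fun s hs => hs.2.2.2.2.2.2.1) ht
        (by rw [bracket_time_ham hm hμ hx hρ hC, he, hr])
      rwa [(hasDiff_pos 0).fderiv_eq] at this)
    (by
      have := key (hasDiff_pos 3).differentiableAt (h.mono fun s hs => hs.2.2.2.2.2.2.2) hφ rfl
      rwa [(hasDiff_pos 3).fderiv_eq] at this)
  rw [sub_eq_zero] at h0
  rw [← h0]
  exact hγ.hasDerivAt

theorem vecQ_redLift_polar {u v t θ φ : ℝ} {z : Red} {q : ℝ}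
    (h1 : v * vecE z 1 - u * vecE z 2 = 0) (h2 : u * vecE z 1 + v * vecE z 2 = -q * Real.sin θ)
    (h3 : vecE z 0 = q * Real.cos θ) : vecQ (redLift ℰ u v t θ φ z) = ![0, 0, q] := by
  have hP : vecP (redLift ℰ u v t θ φ z) 3 = q := by
    change vecE z 0 * Real.cos θ - Real.sin θ * (u * vecE z 1 + v * vecE z 2) = q
    rw [h2, h3]
    linear_combination q * Real.sin_sq_add_cos_sq θ
  have hP2 : vecP (redLift ℰ u v t θ φ z) 2 = 0 := h1
  have hL : vecL (redLift ℰ u v t θ φ z) 0 = q * Real.cos θ := h3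
  have hθ' : pos (redLift ℰ u v t θ φ z) 2 = θ := rfl
  simp only [vecQ, hP, hP2, hL, hθ', sub_self, mul_zero, zero_mul, add_zero]

theorem exists_trajectory_polar (hm : m ≠ 0) (hμ : 0 < μ) {q : ℝ} {I : Set ℝ} {z : ℝ → Red}
    {t φ : ℝ → ℝ} (hq : q ≠ 0) (hI : IsOpenInterval I)
    (hz : IsTrajectory redTensor (redHam m μ ℰ) I z)
    (hd : ∀ τ ∈ I, z τ ∈ redDomain μ ∧ redV μ ℰ (z τ) ≠ 0 ∧ redF (z τ) = q ^ 2 ∧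
      0 < vecE (z τ) 1 ^ 2 + vecE (z τ) 2 ^ 2)
    (h : ∀ τ ∈ I, HasDerivAt φ (q / (vecE (z τ) 1 ^ 2 + vecE (z τ) 2 ^ 2) *
        (vecE (z τ) 1 * pd (redHam m μ ℰ) (.inl (.inl 1)) (z τ)
          + vecE (z τ) 2 * pd (redHam m μ ℰ) (.inl (.inl 2)) (z τ))) τ ∧
      HasDerivAt t (-deriv (fun e => redHam m μ e (z τ)) ℰ) τ) :
    ∃ γ : ℝ → Full, IsTrajectory fullTensor (ham m μ) I γ ∧
      ∀ τ ∈ I, γ τ ∈ regular μ ∧ 0 < perpL (γ τ) ∧ casStar (γ τ) = 0 ∧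
        energy (γ τ) = ℰ ∧ vecQ (γ τ) = ![0, 0, q] ∧ redMap (γ τ) = z τ ∧
        pos (γ τ) 0 = t τ ∧ pos (γ τ) 3 = φ τ ∧
        pos (γ τ) 2 = Real.arccos (vecE (z τ) 0 / q) ∧ vecP (γ τ) 2 = 0 := by
  set c : ℝ → ℝ := fun τ => vecE (z τ) 0 / q with hc
  -- With P_φ = q and L₁ = q cos θ the quantity `angX` is forced to be -q sin θ. P_θ = 0 makes (u,
  -- v) parallel to (E₂, E₃), hence the quotients by X in the lift.
  set X : ℝ → ℝ := fun τ => -q * √(1 - c τ ^ 2) with hXd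
  set γ : ℝ → Full := fun τ => redLift ℰ (vecE (z τ) 1 / X τ) (vecE (z τ) 2 / X τ) (t τ)
    (Real.arccos (c τ)) (φ τ) (z τ) with hγd
  have hc1 : ∀ τ ∈ I, q ^ 2 * (1 - c τ ^ 2) = vecE (z τ) 1 ^ 2 + vecE (z τ) 2 ^ 2 := fun τ hτ => by
    have := (hd τ hτ).2.2.1
    rw [redF] at this
    simp only [hc]
    field_simp
    linarith
  have hc2 : ∀ τ ∈ I, 0 < 1 - c τ ^ 2 := fun τ hτ =>
    pos_of_mul_pos_right (by rw [hc1 τ hτ]; exact (hd τ hτ).2.2.2) (sq_nonneg q)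
  have hX2 : ∀ τ ∈ I, X τ ^ 2 = vecE (z τ) 1 ^ 2 + vecE (z τ) 2 ^ 2 := fun τ hτ => by
    rw [← hc1 τ hτ]
    simp only [hXd]
    rw [mul_pow, Real.sq_sqrt (hc2 τ hτ).le, neg_sq]
  have hX0 : ∀ τ ∈ I, X τ ≠ 0 := fun τ hτ =>
    mul_ne_zero (neg_ne_zero.2 hq) (Real.sqrt_pos.2 (hc2 τ hτ)).ne'
  have hs : ∀ τ, Real.sin (Real.arccos (c τ)) = √(1 - c τ ^ 2) := fun τ => Real.sin_arccos _
  have hab : ∀ τ ∈ I, -1 < c τ ∧ c τ < 1 := fun τ hτ => by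
    have := hc2 τ hτ
    constructor <;> nlinarith
  have hcos : ∀ τ ∈ I, Real.cos (Real.arccos (c τ)) = c τ := fun τ hτ =>
    Real.cos_arccos (hab τ hτ).1.le (hab τ hτ).2.le
  have hsin : ∀ τ ∈ I, Real.sin (Real.arccos (c τ)) ≠ 0 := fun τ hτ => by
    rw [hs]
    exact (Real.sqrt_pos.2 (hc2 τ hτ)).ne'
  have huv : ∀ τ ∈ I, (vecE (z τ) 1 / X τ) ^ 2 + (vecE (z τ) 2 / X τ) ^ 2 = 1 := fun τ hτ => by
    rw [div_pow, div_pow, ← add_div, ← hX2 τ hτ, div_self (pow_ne_zero 2 (hX0 τ hτ))]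
  have hXe : ∀ τ ∈ I, vecE (z τ) 1 / X τ * vecE (z τ) 1 + vecE (z τ) 2 / X τ * vecE (z τ) 2
      = X τ := fun τ hτ => by
    have := hX0 τ hτ
    field_simp
    linarith [hX2 τ hτ]
  have hprop : ∀ τ ∈ I, γ τ ∈ regular μ ∧ 0 < perpL (γ τ) ∧ casStar (γ τ) = 0 ∧
      energy (γ τ) = ℰ ∧ vecQ (γ τ) = ![0, 0, q] ∧ redMap (γ τ) = z τ ∧
      pos (γ τ) 0 = t τ ∧ pos (γ τ) 3 = φ τ := fun τ hτ => by
    have hD := (hd τ hτ).1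
    have hρ : 0 < perpL (γ τ) := by
      rw [hγd, perpL_redLift hD (huv τ hτ)]
      exact redW_pos hD
    have hC : casStar (γ τ) = 0 := casStar_redLift hD (huv τ hτ)
    have hr : redMap (γ τ) = z τ := redMap_redLift hD (huv τ hτ) (hsin τ hτ)
    have hx : γ τ ∈ exterior μ := redLift_mem_exterior hD (Real.arccos_pos.2 (hab τ hτ).2)
      ((Real.arccos_lt_pi).2 (hab τ hτ).1)
    refine ⟨mem_regular hμ hx hρ hC ?_, hρ, hC, energy_redLift,
      vecQ_redLift_polar ?_ ?_ ?_, hr, rfl, rfl⟩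
    · rw [hr, hγd, energy_redLift]
      exact (hd τ hτ).2.1
    · ring
    · rw [hXe τ hτ, hs]
    · rw [hcos τ hτ]
      simp only [hc]
      field_simp
  refine ⟨γ, fun τ hτ => ?_, fun τ hτ => ?_⟩
  · obtain ⟨hx, hρ, hC, he, -, hr, -, -⟩ := hprop τ hτ
    have hD := (hd τ hτ).1
    have hu : dirU (γ τ) = vecE (z τ) 1 / X τ := dirU_redLift hD (huv τ hτ)
    have hv : dirV (γ τ) = vecE (z τ) 2 / X τ := dirV_redLift hD (huv τ hτ)
    refine hasDerivAt_of_reduced hm hμ (z := z) (t := t) (φ := φ) (q := ![0, 0, q]) ?_ ?_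
      (hz τ hτ) (h τ hτ).2 ?_
      (Filter.eventually_of_mem (hI.1.mem_nhds hτ) hprop)
    · have hdz : DifferentiableAt ℝ z τ := (hz τ hτ).differentiableAt
      have hcomp : ∀ a, DifferentiableAt ℝ (fun s => z s a) τ := differentiableAt_pi.1 hdz
      have hf : ContDiffAt ℝ ∞ (fun w : Red => w) (z τ) := contDiffAt_id
      have hg : ContDiffAt ℝ ∞ (fun _ : Red => ℰ) (z τ) := contDiffAt_const
      obtain ⟨hW, -, hΘ, -, -⟩ := contDiffAt_redV hμ hf hg hD
      have hW' : DifferentiableAt ℝ (fun s => redW (z s)) τ :=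
        DifferentiableAt.comp (g := redW) τ (hW.differentiableAt (by simp)) hdz
      have hΘ' : DifferentiableAt ℝ (fun s => redTheta (z s)) τ :=
        DifferentiableAt.comp (g := redTheta) τ (hΘ.differentiableAt (by simp)) hdz
      have hE : ∀ i, DifferentiableAt ℝ (fun s => vecE (z s) i) τ := fun i => hcomp _
      have hZ : ∀ i, DifferentiableAt ℝ (fun s => vecZ (z s) i) τ := fun i => hcomp _
      have hA : DifferentiableAt ℝ (fun s => redA (z s)) τ :=
        ((hE 0).mul (hZ 0)).div (hZ 1) (redDomain_pos hD).ne'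
      have hcd : DifferentiableAt ℝ c τ := (hE 0).div_const q
      have hXdd : DifferentiableAt ℝ X τ :=
        (DifferentiableAt.sqrt ((hcd.pow 2).const_sub 1) (hc2 τ hτ).ne').const_mul (-q)
      have hud : DifferentiableAt ℝ (fun s => vecE (z s) 1 / X s) τ := (hE 1).div hXdd (hX0 τ hτ)
      have hvd : DifferentiableAt ℝ (fun s => vecE (z s) 2 / X s) τ := (hE 2).div hXdd (hX0 τ hτ)
      have hθd : DifferentiableAt ℝ (fun s => Real.arccos (c s)) τ :=
        DifferentiableAt.comp (g := Real.arccos) τ (Real.differentiableAt_arccos.2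
          ⟨(hab τ hτ).1.ne', (hab τ hτ).2.ne⟩) hcd
      refine differentiableAt_pi.2 fun a => ?_
      rcases a with (i | i) | (i | i) <;> fin_cases i
      · exact hE 0
      · exact hW'.mul hud
      · exact hW'.mul hvd
      · exact hΘ'.neg
      · exact (hud.mul hA).add (hvd.mul (hZ 2))
      · exact (hvd.mul hA).sub (hud.mul (hZ 2))
      · exact differentiableAt_const _
      · exact hcomp _
      · exact (hvd.mul (hE 1)).sub (hud.mul (hE 2))
      · exact ((hE 0).mul hθd.cos).sub (hθd.sin.mul ((hud.mul (hE 1)).add (hvd.mul (hE 2))))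
      · exact (h τ hτ).2.differentiableAt
      · exact hcomp _
      · exact hθd
      · exact (h τ hτ).1.differentiableAt
    -- Here `angX` equals X, which is nonzero because E₂² + E₃² > 0.
    · refine Or.inl ?_
      rw [angX_eq hρ, hu, hv, hr, hXe τ hτ]
      exact hX0 τ hτ
    · rw [bracket_azimuth_ham hm hμ hx hρ hC, he, hr, hu, hv]
      convert (h τ hτ).1 using 1
      change _ / Real.sin (Real.arccos (c τ)) = _
      have h0 := (Real.sqrt_pos.2 (hc2 τ hτ)).ne'
      have h1 : X τ = -q * √(1 - c τ ^ 2) := rfl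
      rw [hs, ← hX2 τ hτ, h1]
      field_simp
      ring
  · obtain ⟨hx, hρ, hC, he, hQ, hr, ht, hφ⟩ := hprop τ hτ
    refine ⟨hx, hρ, hC, he, hQ, hr, ht, hφ, rfl, ?_⟩
    change vecE (z τ) 2 / X τ * vecE (z τ) 1 - vecE (z τ) 1 / X τ * vecE (z τ) 2 = 0
    ring

end Recovery

/-! ### The case of zero angular momentum -/

section ZeroAngularMomentum

variable {m μ ℰ : ℝ} {x : Full} {w : Red₀}

theorem vecQ_eq_zero_iff (hμ : 0 < μ) (hx : x ∈ exterior μ) :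
    vecQ x = 0 ↔ vecP x 2 = 0 ∧ vecL x 0 = 0 ∧ vecP x 3 = 0 := by
  have h3 : Real.sin (pos x 2) ≠ 0 := sin_ne hμ hx
  have hcp := Real.cos_sq_add_sin_sq (pos x 3)
  constructor
  · intro h
    have hP : vecP x 3 = 0 := congr_fun h 2
    have q0 : Real.cos (pos x 3) / Real.sin (pos x 2) * (vecL x 0 - vecP x 3 * Real.cos (pos x 2))
      - vecP x 2 * Real.sin (pos x 3) = 0 := congr_fun h 0
    have q1 : Real.sin (pos x 3) / Real.sin (pos x 2) * (vecL x 0 - vecP x 3 * Real.cos (pos x 2))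
      + vecP x 2 * Real.cos (pos x 3) = 0 := congr_fun h 1
    rw [hP] at q0 q1
    refine ⟨?_, ?_, hP⟩
    · linear_combination -Real.sin (pos x 3) * q0 + Real.cos (pos x 3) * q1 - vecP x 2 * hcp
    · field_simp at q0 q1
      linear_combination Real.cos (pos x 3) * q0 + Real.sin (pos x 3) * q1 - vecL x 0 * hcp
  · rintro ⟨h1, h2, h4⟩
    simp only [vecQ, h1, h2, h4, zero_mul, mul_zero, sub_self, add_zero]
    ext i
    fin_cases i <;> rfl

/-- Q = 0 gives L₁ = 0, while C∘ > 0 gives L ≠ 0. -/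
theorem perpL_pos_of_vecQ_eq_zero (hμ : 0 < μ) (hx : x ∈ exterior μ) (hc : 0 < casCirc x)
    (hQ : vecQ x = 0) : 0 < perpL x := by
  have h0 := ((vecQ_eq_zero_iff hμ hx).1 hQ).2.1
  refine Real.sqrt_pos.2 ?_
  simp only [casCirc, Fin.sum_univ_three, h0] at hc
  nlinarith [sq_nonneg (vecM x 0), sq_nonneg (vecM x 1), sq_nonneg (vecM x 2)]

theorem redMap_eq_incl₀ (hμ : 0 < μ) (hx : x ∈ exterior μ) (hQ : vecQ x = 0) :
    redMap x = incl₀ (redMap₀ x) := by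
  obtain ⟨h1, h2, h3⟩ := (vecQ_eq_zero_iff hμ hx).1 hQ
  ext a
  rcases a with (i | i) | i
  · fin_cases i
    · exact h2
    · simp [redMap, incl₀, h1, h2, h3]
    · simp [redMap, incl₀, h1, h2, h3]
  · rfl
  · rfl

theorem incl₀_mem_redDomain : incl₀ w ∈ redDomain μ ↔ w ∈ redDomain₀ μ := by
  change _ ∧ |(0 : ℝ)| < _ ↔ _
  rw [abs_zero]
  rfl

theorem redMap₀_mem_redDomain₀ (hμ : 0 < μ) (hx : x ∈ exterior μ) (h : 0 < perpL x)
    (hQ : vecQ x = 0) : redMap₀ x ∈ redDomain₀ μ := by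
  rw [← incl₀_mem_redDomain, ← redMap_eq_incl₀ hμ hx hQ]
  exact redMap_mem_redDomain hx h

/-- The labels of `Z`, `r`, `P_r` among those of the reduced variables. -/
def inclIdx : RedIdx₀ → RedIdx := Sum.map Sum.inr id

theorem redMap₀_apply (x : Full) (a : RedIdx₀) : redMap₀ x a = redMap x (inclIdx a) := by
  rcases a with i | i <;> rfl

theorem redTensor_inclIdx (z : Red) (w : Red₀) (h : ∀ a, z (inclIdx a) = w a) (a b : RedIdx₀) :
    redTensor z (inclIdx a) (inclIdx b) = redTensor₀ w a b := by
  have e : vecZ z = fun i => w (.inl i) := funext fun i => h (.inl i)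
  rcases a with i | i <;> rcases b with j | j <;> simp [redTensor, redTensor₀, inclIdx, e]

theorem redW_incl₀ (hw : w ∈ redDomain₀ μ) : redW (incl₀ w) = w (.inl 1) := by
  change √(w (.inl 1) ^ 2 - 0 ^ 2) = _
  rw [zero_pow two_ne_zero, sub_zero, Real.sqrt_sq hw.2.le]

theorem redTheta_incl₀ (hw : w ∈ redDomain₀ μ) : redTheta (incl₀ w) = w (.inl 0) := by
  rw [redTheta, redW_incl₀ hw]
  exact div_mul_cancel₀ _ hw.2.ne'

theorem redTulczyjew_incl₀ (hμ : 0 < μ) (hw : w ∈ redDomain₀ μ) :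
    incl₀ w ∈ redTulczyjew μ ℰ ↔ w ∈ redTulczyjew₀ μ ℰ := by
  have hz := incl₀_mem_redDomain.2 hw
  have hr : w (.inr 0) ≠ 0 := (redDomain_radius_pos hμ hz).ne'
  have ha : 0 < lapse μ (w (.inr 0)) := redDomain_lapse_pos hμ hz
  have hT : redTulT μ (incl₀ w)
      = -(w (.inl 0) * w (.inr 1) + w (.inl 1) * w (.inl 2) / w (.inr 0)) := by
    rw [redTulT, redTheta_incl₀ hw, redW_incl₀ hw]
    simp [incl₀, vecE, vecZ, radius, radMom]
    ring
  have hG : redGamma μ (incl₀ w) ^ 2 = lapse μ (w (.inr 0)) * w (.inl 1) ^ 2 := by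
    rw [redGamma]
    change (√(lapse μ (w (.inr 0)) * (w (.inl 1) ^ 2 - 0 ^ 2)) - 0) ^ 2 = _
    rw [sub_zero, zero_pow two_ne_zero, sub_zero, Real.sq_sqrt (by positivity)]
  have hR : redTulR μ ℰ (incl₀ w) = -ℰ * w (.inl 0) + μ * w (.inl 0) ^ 2 / w (.inr 0) ^ 2
      - lapse μ (w (.inr 0)) / w (.inr 0) * w (.inl 1) ^ 2 := by
    rw [redTulR, redTheta_incl₀ hw]
    change _ - (redGamma μ (incl₀ w) + 0) * redGamma μ (incl₀ w) / w (.inr 0) = _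
    rw [add_zero, ← sq, hG]
    change _ + μ * w (.inl 0) ^ 2 / w (.inr 0) ^ 2 - _ = _
    ring
  constructor
  · rintro ⟨h1, h2, -⟩
    exact ⟨by rwa [hT, neg_eq_zero] at h1, by rwa [hR] at h2⟩
  · rintro ⟨h1, h2⟩
    -- For Z₁ = 0 the second equation would leave a Z₂²/r = 0, impossible in the domain. Hence the
    -- third equation is a consequence of the other two.
    have h0 : vecZ (incl₀ w) 0 ≠ 0 := by
      change w (.inl 0) ≠ 0
      intro h0
      rw [h0] at h2
      have : 0 < lapse μ (w (.inr 0)) / w (.inr 0) * w (.inl 1) ^ 2 :=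
        mul_pos (div_pos ha (redDomain_radius_pos hμ hz)) (pow_pos hw.2 2)
      simp at h2
      rcases h2 with (h2 | h2) | h2
      · exact ha.ne' h2
      · exact hr h2
      · exact hw.2.ne' h2
    exact (redTulczyjew_of_redTulT_redTulR hμ hz h0).2 ⟨by rw [hT, h1, neg_zero], by rw [hR, h2]⟩

theorem hasDiff_redHam₀ (hm : m ≠ 0) (hμ : 0 < μ) (hw : w ∈ redDomain₀ μ)
    (hV : redV μ ℰ (incl₀ w) ≠ 0) : HasDiff (redHam₀ m μ ℰ)
      (fun v => fderiv ℝ (redHam m μ ℰ) (incl₀ w) (incl₀ v)) w := by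
  have hz := incl₀_mem_redDomain.2 hw
  have hH : DifferentiableAt ℝ (redHam m μ ℰ) (incl₀ w) :=
    (contDiffAt_redHam (f := fun z => z) (g := fun _ => ℰ) hm hμ contDiffAt_id contDiffAt_const hz
      hV).differentiableAt (by simp)
  have hi : ∀ a, HasDiff (fun w => incl₀ w a) (fun v => incl₀ v a) w := fun a => by
    rcases a with (i | i) | i
    · exact HasDiff.const 0
    · exact HasDiff.coord _
    · exact HasDiff.coord _
  exact HasDiff.comp (H := redHam m μ ℰ) (Φ := incl₀) hi (HasDiff.of_differentiableAt hH)

theorem incl₀_single (a : RedIdx₀) : incl₀ (Pi.single a 1) = Pi.single (inclIdx a) 1 := by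
  ext b
  rcases a with i | i <;> rcases b with (j | j) | j <;>
    simp [incl₀, inclIdx, Pi.single_apply]

theorem pd_redHam₀ (hm : m ≠ 0) (hμ : 0 < μ) (hw : w ∈ redDomain₀ μ)
    (hV : redV μ ℰ (incl₀ w) ≠ 0) (a : RedIdx₀) :
    pd (redHam₀ m μ ℰ) a w = pd (redHam m μ ℰ) (inclIdx a) (incl₀ w) := by
  rw [(hasDiff_redHam₀ hm hμ hw hV).pd_eq, incl₀_single]
  rfl

/-- The E-bracket vanishes at E = 0, so the subspace is invariant whatever the E-derivatives of the
Hamiltonian are. -/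
theorem hamField_redHam₀ (hm : m ≠ 0) (hμ : 0 < μ) (hw : w ∈ redDomain₀ μ)
    (hV : redV μ ℰ (incl₀ w) ≠ 0) : hamField redTensor (redHam m μ ℰ) (incl₀ w)
      = incl₀ (hamField redTensor₀ (redHam₀ m μ ℰ) w) := by
  have hp := pd_redHam₀ hm hμ hw hV
  have hE : vecE (incl₀ w) = 0 := rfl
  rw [hamField_redTensor, hamField_redTensor₀]
  ext a
  rcases a with (i | i) | i
  · simp only [redEqs, hE, Sum.elim_inl, map_zero]
    rfl
  · simp only [redEqs₀, hp]
    rfl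
  · simp only [redEqs₀, hp]
    rfl

theorem incl₀_trajectory (hm : m ≠ 0) (hμ : 0 < μ) {I : Set ℝ} {w : ℝ → Red₀}
    (hw : IsTrajectory redTensor₀ (redHam₀ m μ ℰ) I w)
    (hd : ∀ τ ∈ I, w τ ∈ redDomain₀ μ ∧ redV μ ℰ (incl₀ (w τ)) ≠ 0) :
    IsTrajectory redTensor (redHam m μ ℰ) I fun τ => incl₀ (w τ) := fun τ hτ => by
  rw [hamField_redHam₀ hm hμ (hd τ hτ).1 (hd τ hτ).2]
  have h := hasDerivAt_pi.1 (hw τ hτ)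
  refine hasDerivAt_pi.2 fun a => ?_
  rcases a with (i | i) | i
  · exact hasDerivAt_const τ 0
  · exact h _
  · exact h _

theorem redMap₀_trajectory (hm : m ≠ 0) (hμ : 0 < μ) {I : Set ℝ} {γ : ℝ → Full}
    (hI : IsOpenInterval I) (hγ : IsTrajectory fullTensor (ham m μ) I γ)
    (hr : ∀ τ ∈ I, γ τ ∈ regular μ) {τ₀ : ℝ} (hτ₀ : τ₀ ∈ I) (hC : casStar (γ τ₀) = 0)
    (hc : 0 < casCirc (γ τ₀)) (hQ : vecQ (γ τ₀) = 0) :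
    IsTrajectory redTensor₀ (redHam₀ m μ (energy (γ τ₀))) I (fun τ => redMap₀ (γ τ)) ∧
      ∀ τ ∈ I, vecQ (γ τ) = 0 ∧ redCirc₀ (redMap₀ (γ τ)) = casCirc (γ τ₀) ∧
        HasDerivAt (fun s => pos (γ s) 0)
          (-deriv (fun e => redHam₀ m μ e (redMap₀ (γ τ))) (energy (γ τ₀))) τ := by
  have hQ' : ∀ τ ∈ I, energy (γ τ) = energy (γ τ₀) ∧ vecQ (γ τ) = 0 := fun τ hτ =>
    ⟨(integrals_conserved hm hμ hI hγ hr hτ₀ hτ).1,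
      (integrals_conserved hm hμ hI hγ hr hτ₀ hτ).2.trans hQ⟩
  have hc' : ∀ τ ∈ I, 0 < casCirc (γ τ) := fun τ hτ => by
    rwa [hγ.casimir_eq isCasimir_casCirc hI hτ hτ₀]
  have hρ : ∀ τ ∈ I, 0 < perpL (γ τ) := fun τ hτ =>
    perpL_pos_of_vecQ_eq_zero hμ (hr τ hτ).1 (hc' τ hτ) (hQ' τ hτ).2
  have he : ∀ τ ∈ I, redMap (γ τ) = incl₀ (redMap₀ (γ τ)) := fun τ hτ =>
    redMap_eq_incl₀ hμ (hr τ hτ).1 (hQ' τ hτ).2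
  obtain ⟨h1, h2⟩ := redMap_trajectory hm hμ hI hγ (fun τ hτ => ⟨hr τ hτ, hρ τ hτ⟩) hτ₀ hC
  refine ⟨fun τ hτ => ?_, fun τ hτ => ⟨(hQ' τ hτ).2, ?_, ?_⟩⟩
  · have hV := redV_ne hμ (hr τ hτ) (hρ τ hτ)
      (by rw [hγ.casimir_eq isCasimir_casStar hI hτ hτ₀, hC])
    rw [(hQ' τ hτ).1, he τ hτ] at hV
    have h3 := h1 τ hτ
    simp only [he τ hτ] at h3
    rw [hamField_redHam₀ hm hμ (redMap₀_mem_redDomain₀ hμ (hr τ hτ).1 (hρ τ hτ) (hQ' τ hτ).2) hV]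
      at h3
    refine hasDerivAt_pi.2 fun a => ?_
    rcases a with i | i
    · exact hasDerivAt_pi.1 h3 (.inl (.inr i))
    · exact hasDerivAt_pi.1 h3 (.inr i)
  · rw [redCirc₀, ← he τ hτ]
    exact (h2 τ hτ).1
  · have h3 := (h2 τ hτ).2.2
    rw [he τ hτ] at h3
    exact h3

/-- The sign change of `E₁` and `E₃`. -/
def flip : Red → Red := fun z =>
  Sum.elim (Sum.elim ![-vecE z 0, vecE z 1, -vecE z 2] (vecZ z)) fun i => z (.inr i)

theorem redHam_flip (z : Red) : redHam m μ ℰ (flip z) = redHam m μ ℰ z := by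
  have h0 : vecE (flip z) 0 = -vecE z 0 := rfl
  have h1 : vecE (flip z) 1 = vecE z 1 := rfl
  have h2 : vecE (flip z) 2 = -vecE z 2 := rfl
  have hZ : vecZ (flip z) = vecZ z := rfl
  have hr : radius (flip z) = radius z := rfl
  have hP : radMom (flip z) = radMom z := rfl
  have hW : redW (flip z) = redW z := by rw [redW, redW, h0, neg_sq, hZ]
  have hG : redGamma μ (flip z) = redGamma μ z := by
    rw [redGamma, redGamma, h0, neg_sq, hZ, h1, hr]
  have hΘ : redTheta (flip z) = redTheta z := by rw [redTheta, redTheta, hZ, hW]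
  have hM : redMassSq μ ℰ (flip z) = redMassSq μ ℰ z := by
    rw [redMassSq, redMassSq, h2, neg_sq, hΘ, hG, hr, hP]
  have hV : redV μ ℰ (flip z) = redV μ ℰ z := by
    rw [redV, redV, h0, neg_sq, hM, hZ, hr]
  simp only [redHam, h0, h1, h2, hZ, hr, hP, hG, hΘ, hV, neg_sq, neg_mul_neg, mul_assoc,
    neg_mul, mul_neg, neg_neg]

/-- The reduced Hamiltonian is even under `flip`, which fixes the points with E = 0 and reverses the
directions of E₁ and E₃. -/
theorem pd_redHam_incl₀ (hm : m ≠ 0) (hμ : 0 < μ) (hw : w ∈ redDomain₀ μ)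
    (hV : redV μ ℰ (incl₀ w) ≠ 0) : pd (redHam m μ ℰ) (.inl (.inl 0)) (incl₀ w) = 0 ∧
      pd (redHam m μ ℰ) (.inl (.inl 2)) (incl₀ w) = 0 := by
  have hz := incl₀_mem_redDomain.2 hw
  have hf : flip (incl₀ w) = incl₀ w := by
    ext a
    rcases a with (i | i) | i
    · fin_cases i <;> simp [flip, incl₀, vecE]
    · rfl
    · rfl
  have hH : DifferentiableAt ℝ (redHam m μ ℰ) (incl₀ w) :=
    (contDiffAt_redHam (f := fun z => z) (g := fun _ => ℰ) hm hμ contDiffAt_id contDiffAt_const hz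
      hV).differentiableAt (by simp)
  have hi : ∀ a, HasDiff (fun z => flip z a) (fun v => flip v a) (incl₀ w) := fun a => by
    rcases a with (i | i) | i
    · fin_cases i
      · exact (HasDiff.coord _).neg
      · exact HasDiff.coord _
      · exact (HasDiff.coord _).neg
    · exact HasDiff.coord _
    · exact HasDiff.coord _
  have hc := HasDiff.comp (H := redHam m μ ℰ) (Φ := flip) hi
    (HasDiff.of_differentiableAt (by rwa [hf]))
  rw [hf] at hc
  have hu := (hc.congr_fun (G := redHam m μ ℰ)
    (Eventually.of_forall fun z => (redHam_flip z).symm)).unique (HasDiff.of_differentiableAt hH)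
  have key : ∀ i : Fin 3, flip (Pi.single (.inl (.inl i)) 1) = -Pi.single (.inl (.inl i)) 1 →
      pd (redHam m μ ℰ) (.inl (.inl i)) (incl₀ w) = 0 := fun i hi => by
    have h1 := hu (Pi.single (.inl (.inl i)) 1)
    change fderiv ℝ (redHam m μ ℰ) (incl₀ w) (flip (Pi.single (.inl (.inl i)) 1)) = _ at h1
    rw [hi, map_neg] at h1
    exact self_eq_neg.1 h1.symm
  refine ⟨key 0 ?_, key 2 ?_⟩
  all_goals
    ext a
    rcases a with (i | i) | i
    · fin_cases i <;> simp [flip, vecE]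
    · simp [flip, vecZ]
    · simp [flip]

section Equatorial

variable {t φ : ℝ}

theorem dir_equatorial (hw : w ∈ redDomain₀ μ) :
    dirU (redLift ℰ (-1) 0 t (Real.pi / 2) φ (incl₀ w)) = -1 ∧
      dirV (redLift ℰ (-1) 0 t (Real.pi / 2) φ (incl₀ w)) = 0 :=
  ⟨dirU_redLift (incl₀_mem_redDomain.2 hw) (by norm_num),
    dirV_redLift (incl₀_mem_redDomain.2 hw) (by norm_num)⟩

theorem equatorial_mem (hw : w ∈ redDomain₀ μ) :
    redLift ℰ (-1) 0 t (Real.pi / 2) φ (incl₀ w) ∈ exterior μ ∧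
      0 < perpL (redLift ℰ (-1) 0 t (Real.pi / 2) φ (incl₀ w)) ∧
      casStar (redLift ℰ (-1) 0 t (Real.pi / 2) φ (incl₀ w)) = 0 ∧
      vecQ (redLift ℰ (-1) 0 t (Real.pi / 2) φ (incl₀ w)) = 0 ∧
      redMap (redLift ℰ (-1) 0 t (Real.pi / 2) φ (incl₀ w)) = incl₀ w := by
  have hz := incl₀_mem_redDomain.2 hw
  refine ⟨redLift_mem_exterior hz (by positivity) (by linarith [Real.pi_pos]), ?_,
    casStar_redLift hz (by norm_num), ?_, redMap_redLift hz (by norm_num) (by simp)⟩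
  · rw [perpL_redLift hz (by norm_num)]
    exact redW_pos hz
  · rw [vecQ_redLift_polar (q := 0)]
    · ext i
      fin_cases i <;> rfl
    · simp [incl₀, vecE]
    · simp [incl₀, vecE]
    · simp [incl₀, vecE]

theorem exists_equatorial (hw : w ∈ redDomain₀ μ) (hc : 0 < redCirc₀ w) : ∃ x ∈ exterior μ,
    casStar x = 0 ∧ 0 < casCirc x ∧ vecQ x = 0 ∧ energy x = ℰ ∧ redMap₀ x = w := by
  obtain ⟨h1, h2, h3, h4, h5⟩ := equatorial_mem (ℰ := ℰ) (t := 0) (φ := 0) hw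
  refine ⟨_, h1, h3, ?_, h4, energy_redLift, ?_⟩
  · rwa [← redCirc_redMap h2 h3, h5]
  · ext a
    rw [redMap₀_apply, h5]
    rcases a with i | i <;> rfl

/-- At E = 0 the quantity `angX` vanishes, so `hasDerivAt_of_reduced` is used with its second
alternative: the curve has constant θ and L₃ = 0, and the brackets of θ and L₃ with H are shown to
vanish. -/
theorem exists_trajectory_equatorial (hm : m ≠ 0) (hμ : 0 < μ) {I : Set ℝ} {w : ℝ → Red₀}
    {t φ : ℝ → ℝ} (hI : IsOpenInterval I) (hw : IsTrajectory redTensor₀ (redHam₀ m μ ℰ) I w)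
    (hd : ∀ τ ∈ I, w τ ∈ redDomain₀ μ ∧ redV μ ℰ (incl₀ (w τ)) ≠ 0)
    (h : ∀ τ ∈ I, HasDerivAt φ (pd (redHam m μ ℰ) (.inl (.inl 1)) (incl₀ (w τ))) τ ∧
      HasDerivAt t (-deriv (fun e => redHam₀ m μ e (w τ)) ℰ) τ) :
    ∃ γ : ℝ → Full, IsTrajectory fullTensor (ham m μ) I γ ∧
      ∀ τ ∈ I, γ τ ∈ regular μ ∧ casStar (γ τ) = 0 ∧ energy (γ τ) = ℰ ∧ vecQ (γ τ) = 0 ∧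
        redMap₀ (γ τ) = w τ ∧ pos (γ τ) 0 = t τ ∧ pos (γ τ) 2 = Real.pi / 2 ∧
        pos (γ τ) 3 = φ τ := by
  -- The direction (u, v) = (-1, 0), that is L₂ = -Z₂, makes the azimuth evolve with ∂H/∂E₂ with the
  -- plus sign.
  set γ : ℝ → Full := fun τ => redLift ℰ (-1) 0 (t τ) (Real.pi / 2) (φ τ) (incl₀ (w τ)) with hγd
  have hprop : ∀ τ ∈ I, γ τ ∈ regular μ ∧ 0 < perpL (γ τ) ∧ casStar (γ τ) = 0 ∧
      energy (γ τ) = ℰ ∧ vecQ (γ τ) = 0 ∧ redMap (γ τ) = incl₀ (w τ) ∧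
      pos (γ τ) 0 = t τ ∧ pos (γ τ) 3 = φ τ := fun τ hτ => by
    obtain ⟨h1, h2, h3, h4, h5⟩ := equatorial_mem (ℰ := ℰ) (t := t τ) (φ := φ τ) (hd τ hτ).1
    refine ⟨mem_regular hμ h1 h2 h3 ?_, h2, h3, energy_redLift, h4, h5, rfl, rfl⟩
    rw [h5, energy_redLift]
    exact (hd τ hτ).2
  refine ⟨γ, fun τ hτ => ?_, fun τ hτ => ?_⟩
  · obtain ⟨hx, hρ, hC, he, hQ, hr, -, -⟩ := hprop τ hτ
    have hz := (incl₀_trajectory hm hμ hw hd) τ hτ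
    obtain ⟨hu, hv⟩ : dirU (γ τ) = -1 ∧ dirV (γ τ) = 0 := dir_equatorial (hd τ hτ).1
    obtain ⟨p0, p2⟩ := pd_redHam_incl₀ hm hμ (hd τ hτ).1 (hd τ hτ).2
    have hθ : Real.sin (pos (γ τ) 2) = 1 := Real.sin_pi_div_two
    have hθ' : Real.cos (pos (γ τ) 2) = 0 := Real.cos_pi_div_two
    have hE : vecE (redMap (γ τ)) = 0 := by
      rw [hr]
      rfl
    have hL0 : vecL (γ τ) 0 = 0 := rfl
    have hw' := hasDerivAt_pi.1 (hw τ hτ)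
    have hγ : ∀ᶠ s in 𝓝 τ, γ s = Sum.elim (Sum.elim ![0, -(w s (.inl 1)), 0]
        ![-(w s (.inl 0)), 0, w s (.inl 2)])
        (Sum.elim ![-ℰ, w s (.inr 1), 0, 0] ![t s, w s (.inr 0), Real.pi / 2, φ s]) := by
      refine Filter.eventually_of_mem (hI.1.mem_nhds hτ) fun s hs => ?_
      simp only [hγd, redLift, redTheta_incl₀ (hd s hs).1, redW_incl₀ (hd s hs).1]
      ext a
      rcases a with (i | i) | (i | i) <;> fin_cases i <;>
        simp [incl₀, vecE, vecZ, redA, radMom, radius]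
    have hγτ := hγ.self_of_nhds
    have hM1 : vecM (γ τ) 1 = 0 := by
      rw [hγτ]
      rfl
    have hdγ : DifferentiableAt ℝ γ τ := by
      refine DifferentiableAt.congr_of_eventuallyEq (differentiableAt_pi.2 fun a => ?_) hγ
      rcases a with (i | i) | (i | i) <;> fin_cases i
      exacts [differentiableAt_const _, (hw' _).differentiableAt.neg, differentiableAt_const _,
        (hw' _).differentiableAt.neg, differentiableAt_const _, (hw' _).differentiableAt,
        differentiableAt_const _, (hw' _).differentiableAt, differentiableAt_const _,
        differentiableAt_const _, (h τ hτ).2.differentiableAt, (hw' _).differentiableAt,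
        differentiableAt_const _, (h τ hτ).1.differentiableAt]
    -- θ is conjugate to P_θ, so its rate is v ∂H/∂E₂ - u ∂H/∂E₃: the first term vanishes with v,
    -- the second by evenness.
    have b2 : bracket fullTensor (fun z => pos z 2) (ham m μ) (γ τ) = 0 := by
      have h1 : bracket fullTensor (fun z => pos z 2) energy (γ τ) = 0 := by
        rw [(hasDiff_pos 2).bracket_eq, hamField_energy, pos_hamVec]
        rfl
      have h2 : ∀ a, bracket fullTensor (fun z => pos z 2) (fun z => redMap z a) (γ τ)
          = redGradP (γ τ) a 2 := fun a => by
        rw [(hasDiff_pos 2).bracket_eq, hamField_redMap hμ hx.1 hρ, pos_hamVec]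
      rw [bracket_ham_redHam hm hμ hx hρ hC]
      simp [h1, h2, redGradP, Fintype.sum_sum_type, Fin.sum_univ_succ, he, hr, p2, hv]
    -- Besides evenness in (E₁, E₃) this uses the equatorial position, cos θ = 0, and the vanishing
    -- of L₁ and M₂ on the lift.
    have bL : bracket fullTensor (fun z => vecL z 2) (ham m μ) (γ τ) = 0 := by
      have h1 : bracket fullTensor (fun z => vecL z 2) energy (γ τ) = 0 := by
        rw [(hasDiff_vecL 2).bracket_eq, hamField_energy, vecL_hamVec]
        simp
      rw [bracket_ham_redHam hm hμ hx hρ hC, h1]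
      simp only [fun a => (hasDiff_vecL (x := γ τ) 2).bracket_eq fullTensor (fun z => redMap z a),
        hamField_redMap hμ hx.1 hρ, vecL_hamVec]
      simp [redGradL, redGradM, Fintype.sum_sum_type, Fin.sum_univ_succ, cross_apply, he, hr, p0,
        p2, hv, hE, hL0, hM1, hθ']
    refine hasDerivAt_of_reduced hm hμ (z := fun s => incl₀ (w s)) (t := t) (φ := φ) (q := 0) hdγ
      (Or.inr ⟨?_, ?_⟩) hz (h τ hτ).2 ?_ (Filter.eventually_of_mem (hI.1.mem_nhds hτ) hprop)
    · rw [b2]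
      exact hasDerivAt_const τ _
    · have h1 : HasDerivAt (fun s => γ s (.inl (.inl 2))) 0 τ := by
        refine (hasDerivAt_const τ (0 : ℝ)).congr_of_eventuallyEq (hγ.mono fun s hs => ?_)
        change γ s (.inl (.inl 2)) = 0
        rw [hs]
        rfl
      have h2 : deriv γ τ (.inl (.inl 2)) = 0 :=
        (hasDerivAt_pi.1 hdγ.hasDerivAt _).unique h1
      have h3 : hamField fullTensor (ham m μ) (γ τ) (.inl (.inl 2)) = 0 := by
        rw [← bL, (hasDiff_vecL 2).bracket_eq]
        rfl
      rw [hv, Pi.sub_apply, Pi.sub_apply, h2, h3]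
      ring
    · rw [bracket_azimuth_ham hm hμ hx hρ hC, he, hr, hu, hv, hθ]
      convert (h τ hτ).1 using 1
      ring
  · obtain ⟨hx, hρ, hC, he, hQ, hr, ht, hφ⟩ := hprop τ hτ
    refine ⟨hx, hC, he, hQ, ?_, ht, rfl, hφ⟩
    ext a
    rw [redMap₀_apply, hr]
    rcases a with i | i <;> rfl

end Equatorial

end ZeroAngularMomentum

end

end SpinningBody

/-! ### Assembly of the four parts -/

theorem mainTheorem1 (m μ : ℝ) (hm : 0 < m) (hμ : 0 < μ) :
    -- A. The full system: a Hamiltonian system with six degrees of freedom.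
    (IsPoissonTensor fullTensor ∧ IsCasimir fullTensor casStar ∧ IsCasimir fullTensor casCirc ∧
      (∀ x, 0 < casCirc x → (fullTensor x).rank = 2 * 6) ∧
      (∀ H x, hamField fullTensor H x = fullEqs H x) ∧
      (∀ x ∈ regular μ, ContDiffAt ℝ ∞ (ham m μ) x) ∧
      -- the Souriau bracket of the spin tensor, the momentum and the coordinates
      (∀ x ∈ exterior μ, ∀ α β κ ν : Fin 4,
        bracket fullTensor (spin μ α β) (spin μ κ ν) x
            = (schw μ (pos x))⁻¹ α κ * spin μ β ν x - (schw μ (pos x))⁻¹ α ν * spin μ β κ x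
              + (schw μ (pos x))⁻¹ β ν * spin μ α κ x - (schw μ (pos x))⁻¹ β κ * spin μ α ν x ∧
        bracket fullTensor (spin μ α β) (mom μ κ) x
            = -(∑ l, christoffel (schw μ) α l κ (pos x) * spin μ l β x)
              - ∑ l, christoffel (schw μ) β l κ (pos x) * spin μ α l x ∧
        bracket fullTensor (mom μ α) (mom μ β) x
            = -(1 / 2) * ∑ c, ∑ l, riemannDown (schw μ) α β c l (pos x) * spin μ c l x ∧
        bracket fullTensor (fun z => pos z α) (mom μ β) x = (if α = β then 1 else 0) ∧
        bracket fullTensor (fun z => pos z α) (spin μ κ ν) x = 0 ∧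
        bracket fullTensor (fun z => pos z α) (fun z => pos z β) x = 0) ∧
      -- on the Tulczyjew manifold the trajectories satisfy the Mathisson-Papapetrou equations
      (∀ (I : Set ℝ) (γ : ℝ → Full) (u : ℝ → Fin 4 → ℝ),
        IsTrajectory fullTensor (ham m μ) I γ →
        (∀ τ ∈ I, ∀ α, HasDerivAt (fun s => pos (γ s) α) (u τ α) τ) →
        ∀ τ ∈ I, γ τ ∈ regular μ → (∀ α, tulczyjew μ α (γ τ) = 0) →
          (∀ α, HasDerivAt (fun s => momUp μ α (γ s))
            (-(∑ κ, ∑ ν, christoffel (schw μ) α κ ν (pos (γ τ)) * momUp μ κ (γ τ) * u τ ν)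
              - (1 / 2) * ∑ l, ∑ κ, ∑ ν,
                riemann (schw μ) α l κ ν (pos (γ τ)) * u τ l * spin μ κ ν (γ τ)) τ) ∧
          (∀ α β, HasDerivAt (fun s => spin μ α β (γ s))
            (-(∑ κ, ∑ ν, christoffel (schw μ) α κ ν (pos (γ τ)) * spin μ κ β (γ τ) * u τ ν)
              - (∑ κ, ∑ ν, christoffel (schw μ) β κ ν (pos (γ τ)) * spin μ α κ (γ τ) * u τ ν)
              + (momUp μ α (γ τ) * u τ β - u τ α * momUp μ β (γ τ))) τ) ∧
          -(∑ α, mom μ α (γ τ) * u τ α) = -momSq μ (γ τ) / m) ∧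
      -- the Tulczyjew manifold is invariant and the mass is conserved on it
      (∀ (I : Set ℝ) (γ : ℝ → Full), IsOpenInterval I →
        IsTrajectory fullTensor (ham m μ) I γ → (∀ τ ∈ I, γ τ ∈ regular μ) →
        ∀ τ₀ ∈ I, momSq μ (γ τ₀) < 0 → (∀ α, tulczyjew μ α (γ τ₀) = 0) →
          ∀ τ ∈ I, (∀ α, tulczyjew μ α (γ τ) = 0) ∧ momSq μ (γ τ) = momSq μ (γ τ₀))) ∧
    -- B. The four first integrals.
    ((∀ x ∈ exterior μ, LinearIndependent ℝ
        ![fun i => pd energy i x, fun i => pd (fun z => vecQ z 0) i x,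
          fun i => pd (fun z => vecQ z 1) i x, fun i => pd (fun z => vecQ z 2) i x]) ∧
      (∀ x ∈ exterior μ, ∀ i j, bracket fullTensor energy (fun z => vecQ z i) x = 0 ∧
        bracket fullTensor (fun z => vecQ z i) (fun z => vecQ z j) x = hat (vecQ x) i j) ∧
      (∀ x ∈ regular μ, bracket fullTensor energy (ham m μ) x = 0 ∧
        ∀ i, bracket fullTensor (fun z => vecQ z i) (ham m μ) x = 0) ∧
      (∀ (I : Set ℝ) (γ : ℝ → Full), IsOpenInterval I →
        IsTrajectory fullTensor (ham m μ) I γ → (∀ τ ∈ I, γ τ ∈ regular μ) →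
        ∀ τ₀ ∈ I, ∀ τ ∈ I, energy (γ τ) = energy (γ τ₀) ∧ vecQ (γ τ) = vecQ (γ τ₀))) ∧
    -- C. The reduction by three degrees of freedom for `Q ≠ 0`.
    (IsPoissonTensor redTensor ∧ IsCasimir redTensor redCirc ∧ IsCasimir redTensor redF ∧
      (∀ z, vecE z ≠ 0 → vecZ z ≠ 0 → (redTensor z).rank = 2 * (6 - 3)) ∧
      (∀ H z, hamField redTensor H z = redEqs H z) ∧
      (∀ ℰ, ∀ z ∈ redDomain μ, redV μ ℰ z ≠ 0 → ContDiffAt ℝ ∞ (redHam m μ ℰ) z) ∧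
      -- the reduced variables are smooth and in involution with the four integrals
      (∀ x ∈ exterior μ, 0 < perpL x → ContDiffAt ℝ ∞ redMap x ∧
        ∀ a, bracket fullTensor (fun z => redMap z a) energy x = 0 ∧
          ∀ i, bracket fullTensor (fun z => redMap z a) (fun z => vecQ z i) x = 0) ∧
      -- their brackets, the Casimir functions and the Hamiltonian on the level `C⋆ = 0`
      (∀ x ∈ exterior μ, 0 < perpL x → casStar x = 0 →
        redMap x ∈ redDomain μ ∧
        (∀ a b, bracket fullTensor (fun z => redMap z a) (fun z => redMap z b) x
          = redTensor (redMap x) a b) ∧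
        redCirc (redMap x) = casCirc x ∧
        redF (redMap x) = ∑ i, vecQ x i ^ 2 ∧
        redMassSq μ (energy x) (redMap x) = -momSq μ x ∧
        curvScalar μ x + 2 * momSq μ x = -2 * μ / pos x 1 ^ 3 * redV μ (energy x) (redMap x) ∧
        (x ∈ regular μ → ham m μ x = redHam m μ (energy x) (redMap x))) ∧
      -- all values of the reduced variables occur
      (∀ ℰ, ∀ z ∈ redDomain μ, ∃ x ∈ exterior μ,
        0 < perpL x ∧ casStar x = 0 ∧ energy x = ℰ ∧ redMap x = z) ∧
      -- the trajectories of the full system project to trajectories of the reduced system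
      (∀ (I : Set ℝ) (γ : ℝ → Full), IsOpenInterval I →
        IsTrajectory fullTensor (ham m μ) I γ → (∀ τ ∈ I, γ τ ∈ regular μ ∧ 0 < perpL (γ τ)) →
        ∀ τ₀ ∈ I, casStar (γ τ₀) = 0 → vecQ (γ τ₀) ≠ 0 →
          IsTrajectory redTensor (redHam m μ (energy (γ τ₀))) I (fun τ => redMap (γ τ)) ∧
          ∀ τ ∈ I, redCirc (redMap (γ τ)) = casCirc (γ τ₀) ∧
            redF (redMap (γ τ)) = ∑ i, vecQ (γ τ₀) i ^ 2 ∧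
            HasDerivAt (fun s => pos (γ s) 0)
              (-deriv (fun e => redHam m μ e (redMap (γ τ))) (energy (γ τ₀))) τ) ∧
      -- the Tulczyjew manifold in the reduced variables, and its invariance
      (∀ x ∈ exterior μ, 0 < perpL x → casStar x = 0 →
        tulczyjew μ 0 x = redTulT μ (redMap x) ∧
        tulczyjew μ 1 x = redTulR μ (energy x) (redMap x) ∧
        (vecL x 1 * (pos x 1 * Real.sin (pos x 2) * tulczyjew μ 3 x)
          - vecL x 2 * (pos x 1 * tulczyjew μ 2 x)) / perpL x
            = redTulN μ (energy x) (redMap x) ∧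
        ((∀ α, tulczyjew μ α x = 0) ↔ redMap x ∈ redTulczyjew μ (energy x))) ∧
      (∀ ℰ, ∀ z ∈ redDomain μ, vecZ z 0 ≠ 0 →
        (z ∈ redTulczyjew μ ℰ ↔ redTulT μ z = 0 ∧ redTulR μ ℰ z = 0)) ∧
      (∀ (ℰ : ℝ) (I : Set ℝ) (z : ℝ → Red), IsOpenInterval I →
        IsTrajectory redTensor (redHam m μ ℰ) I z →
        (∀ τ ∈ I, z τ ∈ redDomain μ ∧ redV μ ℰ (z τ) ≠ 0) →
        ∀ τ₀ ∈ I, 0 < redMassSq μ ℰ (z τ₀) → z τ₀ ∈ redTulczyjew μ ℰ →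
          ∀ τ ∈ I, z τ ∈ redTulczyjew μ ℰ ∧ redMassSq μ ℰ (z τ) = redMassSq μ ℰ (z τ₀)) ∧
      -- the trajectories with `Q = (0, 0, P_φ)` are recovered from those of the reduced system
      (∀ (ℰ Pφ : ℝ) (I : Set ℝ) (z : ℝ → Red) (t φ : ℝ → ℝ), Pφ ≠ 0 → IsOpenInterval I →
        IsTrajectory redTensor (redHam m μ ℰ) I z →
        (∀ τ ∈ I, z τ ∈ redDomain μ ∧ redV μ ℰ (z τ) ≠ 0 ∧ redF (z τ) = Pφ ^ 2 ∧
          0 < vecE (z τ) 1 ^ 2 + vecE (z τ) 2 ^ 2) →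
        (∀ τ ∈ I,
          HasDerivAt φ (Pφ / (vecE (z τ) 1 ^ 2 + vecE (z τ) 2 ^ 2) *
            (vecE (z τ) 1 * pd (redHam m μ ℰ) (.inl (.inl 1)) (z τ)
              + vecE (z τ) 2 * pd (redHam m μ ℰ) (.inl (.inl 2)) (z τ))) τ ∧
          HasDerivAt t (-deriv (fun e => redHam m μ e (z τ)) ℰ) τ) →
        ∃ γ : ℝ → Full, IsTrajectory fullTensor (ham m μ) I γ ∧
          ∀ τ ∈ I, γ τ ∈ regular μ ∧ 0 < perpL (γ τ) ∧ casStar (γ τ) = 0 ∧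
            energy (γ τ) = ℰ ∧ vecQ (γ τ) = ![0, 0, Pφ] ∧ redMap (γ τ) = z τ ∧
            pos (γ τ) 0 = t τ ∧ pos (γ τ) 3 = φ τ ∧
            pos (γ τ) 2 = Real.arccos (vecE (z τ) 0 / Pφ) ∧ vecP (γ τ) 2 = 0)) ∧
    -- D. The reduction by four degrees of freedom for `Q = 0`.
    (IsPoissonTensor redTensor₀ ∧ IsCasimir redTensor₀ redCirc₀ ∧
      (∀ w : Red₀, (fun i => w (.inl i)) ≠ 0 → (redTensor₀ w).rank = 2 * (6 - 4)) ∧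
      (∀ H w, hamField redTensor₀ H w = redEqs₀ H w) ∧
      (∀ x ∈ exterior μ, vecQ x = 0 ↔ vecP x 2 = 0 ∧ vecL x 0 = 0 ∧ vecP x 3 = 0) ∧
      -- brackets and Hamiltonian on the invariant manifold `Q = 0`, `C⋆ = 0`
      (∀ x ∈ exterior μ, casStar x = 0 → 0 < casCirc x → vecQ x = 0 →
        0 < perpL x ∧ redMap x = incl₀ (redMap₀ x) ∧ redMap₀ x ∈ redDomain₀ μ ∧
        (∀ a, bracket fullTensor (fun z => redMap₀ z a) energy x = 0 ∧
          ∀ i, bracket fullTensor (fun z => redMap₀ z a) (fun z => vecQ z i) x = 0) ∧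
        (∀ a b, bracket fullTensor (fun z => redMap₀ z a) (fun z => redMap₀ z b) x
          = redTensor₀ (redMap₀ x) a b) ∧
        redCirc₀ (redMap₀ x) = casCirc x ∧
        (x ∈ regular μ → ham m μ x = redHam₀ m μ (energy x) (redMap₀ x)) ∧
        ((∀ α, tulczyjew μ α x = 0) ↔ redMap₀ x ∈ redTulczyjew₀ μ (energy x))) ∧
      -- all values of the reduced variables with `C∘ > 0` occur
      (∀ ℰ, ∀ w ∈ redDomain₀ μ, 0 < redCirc₀ w → ∃ x ∈ exterior μ,
        casStar x = 0 ∧ 0 < casCirc x ∧ vecQ x = 0 ∧ energy x = ℰ ∧ redMap₀ x = w) ∧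
      -- projection of the trajectories
      (∀ (I : Set ℝ) (γ : ℝ → Full), IsOpenInterval I →
        IsTrajectory fullTensor (ham m μ) I γ → (∀ τ ∈ I, γ τ ∈ regular μ) →
        ∀ τ₀ ∈ I, casStar (γ τ₀) = 0 → 0 < casCirc (γ τ₀) → vecQ (γ τ₀) = 0 →
          IsTrajectory redTensor₀ (redHam₀ m μ (energy (γ τ₀))) I (fun τ => redMap₀ (γ τ)) ∧
          ∀ τ ∈ I, vecQ (γ τ) = 0 ∧ redCirc₀ (redMap₀ (γ τ)) = casCirc (γ τ₀) ∧
            HasDerivAt (fun s => pos (γ s) 0)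
              (-deriv (fun e => redHam₀ m μ e (redMap₀ (γ τ))) (energy (γ τ₀))) τ) ∧
      -- invariance of the Tulczyjew manifold
      (∀ (ℰ : ℝ) (I : Set ℝ) (w : ℝ → Red₀), IsOpenInterval I →
        IsTrajectory redTensor₀ (redHam₀ m μ ℰ) I w →
        (∀ τ ∈ I, w τ ∈ redDomain₀ μ ∧ redV μ ℰ (incl₀ (w τ)) ≠ 0) →
        ∀ τ₀ ∈ I, 0 < redMassSq μ ℰ (incl₀ (w τ₀)) → w τ₀ ∈ redTulczyjew₀ μ ℰ →
          ∀ τ ∈ I, w τ ∈ redTulczyjew₀ μ ℰ) ∧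
      -- recovery of the trajectories that lie in the equatorial plane
      (∀ (ℰ : ℝ) (I : Set ℝ) (w : ℝ → Red₀) (t φ : ℝ → ℝ), IsOpenInterval I →
        IsTrajectory redTensor₀ (redHam₀ m μ ℰ) I w →
        (∀ τ ∈ I, w τ ∈ redDomain₀ μ ∧ redV μ ℰ (incl₀ (w τ)) ≠ 0 ∧ 0 < redCirc₀ (w τ)) →
        (∀ τ ∈ I, HasDerivAt φ (pd (redHam m μ ℰ) (.inl (.inl 1)) (incl₀ (w τ))) τ ∧
          HasDerivAt t (-deriv (fun e => redHam₀ m μ e (w τ)) ℰ) τ) →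
        ∃ γ : ℝ → Full, IsTrajectory fullTensor (ham m μ) I γ ∧
          ∀ τ ∈ I, γ τ ∈ regular μ ∧ casStar (γ τ) = 0 ∧ energy (γ τ) = ℰ ∧ vecQ (γ τ) = 0 ∧
            redMap₀ (γ τ) = w τ ∧ pos (γ τ) 0 = t τ ∧ pos (γ τ) 2 = Real.pi / 2 ∧
            pos (γ τ) 3 = φ τ)) := by
  have hm' := hm.ne'
  have hH : ∀ ℰ, ∀ z ∈ redDomain μ, redV μ ℰ z ≠ 0 → ContDiffAt ℝ ∞ (redHam m μ ℰ) z :=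
    fun ℰ z hz hV => contDiffAt_redHam (f := fun z => z) (g := fun _ => ℰ) hm' hμ contDiffAt_id
      contDiffAt_const hz hV
  refine ⟨⟨isPoissonTensor_fullTensor, isCasimir_casStar, isCasimir_casCirc, rank_fullTensor,
    hamField_fullTensor, fun x hx => contDiffAt_ham hm' hμ hx, fun x hx α β κ ν =>
      ⟨bracket_spin_spin hμ hx α β κ ν, bracket_spin_mom hμ hx α β κ, bracket_mom_mom hμ hx α β,
        bracket_pos_mom hμ hx α β, bracket_pos_spin hμ hx α κ ν, bracket_pos_pos x α β⟩,
    fun I γ u hγ hu τ hτ hx hf => mathisson_papapetrou hm' hμ hγ hu hτ hx hf,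
    fun I γ hI hγ hr τ₀ hτ₀ hp hf τ hτ => tulczyjew_invariant hm' hμ hI hγ hr hτ₀ hp hf hτ⟩,
    ⟨fun x hx => linearIndependent_integrals hμ hx,
      fun x hx i j => ⟨bracket_energy_vecQ hμ hx i, bracket_vecQ_vecQ hμ hx i j⟩,
      fun x hx => ⟨bracket_energy_ham hm' hμ hx, bracket_vecQ_ham hm' hμ hx⟩,
      fun I γ hI hγ hr τ₀ hτ₀ τ hτ => integrals_conserved hm' hμ hI hγ hr hτ₀ hτ⟩,
    ⟨isPoissonTensor_redTensor, isCasimir_redCirc, isCasimir_redF, rank_redTensor,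
      hamField_redTensor, hH, fun x hx h => ⟨contDiffAt_redMap hμ hx h, fun a =>
        ⟨bracket_redMap_energy hμ hx h a, bracket_redMap_vecQ hμ hx h a⟩⟩,
      fun x hx h hC => ⟨redMap_mem_redDomain hx h, bracket_redMap_redMap hμ hx h hC,
        redCirc_redMap h hC, redF_redMap hμ hx h, ?_, denom_redMap hμ hx h hC,
        fun hr => ham_redMap hm' hμ hr h hC⟩,
      fun ℰ z hz => ⟨redSection ℰ z, redSection_mem_exterior ℰ hz, perpL_redSection ℰ hz,
        casStar_redSection ℰ hz, energy_redSection ℰ, redMap_redSection ℰ hz⟩,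
      fun I γ hI hγ hr τ₀ hτ₀ hC _ => redMap_trajectory hm' hμ hI hγ hr hτ₀ hC,
      fun x hx h hC => tulczyjew_redMap hμ hx h hC,
      fun ℰ z hz h0 => redTulczyjew_of_redTulT_redTulR hμ hz h0,
      fun ℰ I z hI hz hr τ₀ hτ₀ _ h0 τ hτ => redTulczyjew_invariant hm' hμ hI hz hr hτ₀ h0 hτ,
      fun ℰ q I z t φ hq hI hz hd h => exists_trajectory_polar hm' hμ hq hI hz hd h⟩,
    ⟨isPoissonTensor_redTensor₀, isCasimir_redCirc₀, rank_redTensor₀, hamField_redTensor₀,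
      fun x hx => vecQ_eq_zero_iff hμ hx, fun x hx hC hc hQ => ?_,
      fun ℰ w hw hc => exists_equatorial hw hc,
      fun I γ hI hγ hr τ₀ hτ₀ hC hc hQ => redMap₀_trajectory hm' hμ hI hγ hr hτ₀ hC hc hQ,
      fun ℰ I w hI hw hd τ₀ hτ₀ _ h0 τ hτ => ?_,
      fun ℰ I w t φ hI hw hd h => exists_trajectory_equatorial hm' hμ hI hw
        (fun τ hτ => ⟨(hd τ hτ).1, (hd τ hτ).2.1⟩) h⟩⟩
  · rw [← redMassSq_redMap hμ hx h]
  · have h := perpL_pos_of_vecQ_eq_zero hμ hx hc hQ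
    have he := redMap_eq_incl₀ hμ hx hQ
    have hw := redMap₀_mem_redDomain₀ hμ hx h hQ
    refine ⟨h, he, hw, fun a => ?_, fun a b => ?_, ?_, fun hr => ?_, ?_⟩
    · simp only [redMap₀_apply]
      exact ⟨bracket_redMap_energy hμ hx h _, bracket_redMap_vecQ hμ hx h _⟩
    · simp only [redMap₀_apply]
      rw [bracket_redMap_redMap hμ hx h hC]
      exact redTensor_inclIdx _ _ (fun a => (redMap₀_apply x a).symm) a b
    · rw [redCirc₀, ← he, redCirc_redMap h hC]
    · rw [redHam₀, ← he, ham_redMap hm' hμ hr h hC]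
    · rw [(tulczyjew_redMap hμ hx h hC).2.2.2, he, redTulczyjew_incl₀ hμ hw]
  -- A solution with Q = 0, included as E = 0, solves the larger reduced system, so invariance is
  -- inherited from there.
  · rw [← redTulczyjew_incl₀ hμ (hd τ hτ).1]
    rw [← redTulczyjew_incl₀ hμ (hd τ₀ hτ₀).1] at h0
    exact (redTulczyjew_invariant hm' hμ hI (incl₀_trajectory hm' hμ hw hd)
      (fun τ hτ => ⟨incl₀_mem_redDomain.2 (hd τ hτ).1, (hd τ hτ).2⟩) hτ₀ h0 hτ).1
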